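/- Let $X$ be a compact smooth manifold (without boundary) of dimension $2n$ and let $Z \subset X$ be a smooth embedded hypersurface (possibly empty). A *log-symplectic structure* on $(X,Z)$ is a Poisson bivector $\pi$ on $X$ such that the section $\wedge^n\pi$ of $\wedge^{2n}TX$ is transverse to the zero section and $(\wedge^n\pi)^{-1}(0) = Z$. A *folded-symplectic form* on $(X,Z)$ is a closed two-form $\omega$ on $X$ such that the section $\wedge^n\omega$ of $\wedge^{2n}T^*X$ is transverse to the zero section, $(\wedge^n\omega)^{-1}(0) = Z$, and the restriction $\omega^{n-1}|_Z$ (pullback to $Z$) is nowhere vanishing. At points where both are nondegenerate, $\pi = \omega^{-1}$ (equivalently $\omega = \pi^{-1}$) means $\pi^\sharp = (\omega^\flat)^{-1}$, where $\omega^\flat(v) = \omega(v,\cdot)$ and $\pi^\sharp(\alpha) = \pi(\alpha,\cdot)$. 1. If $\pi$ is a log-symplectic structure on $(X,Z)$, then for every neighbourhood $U$ of $Z$ there is a folded-symplectic form $\omega$ on $(X,Z)$ such that $\omega = \pi^{-1}$ on $X \setminus U$. 2. Conversely, if $\omega$ is a folded-symplectic form on $(X,Z)$ and there is a closed one-form $\theta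 \in \Omega^1(Z)$ such that $\theta \wedge \omega^{n-1}|_Z$ is nowhere vanishing on $Z$, then for every neighbourhood $U$ of $Z$ there is a log-symplectic structure $\pi$ on $(X,Z)$ such that $\pi = \omega^{-1}$ on $X \setminus U$. -/

import Mathlib

open scoped Manifold ContDiff Topology

noncomputable section

namespace LogFolded

/-! ### Exterior algebra of a real vector space -/

section Wedge

variable {V : Type*} [AddCommGroup V] [Module ℝ V]

/-- The wedge product of alternating forms (the signed sum over shuffles). -/
def wedge {k l : ℕ} (a : V [⋀^Fin k]→ₗ[ℝ] ℝ) (b : V [⋀^Fin l]→ₗ[ℝ] ℝ) :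
    V [⋀^Fin (k + l)]→ₗ[ℝ] ℝ :=
  ((LinearMap.mul' ℝ ℝ).compAlternatingMap (a.domCoprod b)).domDomCongr finSumFinEquiv

/-- The `n`-fold wedge power `a ∧ ⋯ ∧ a` of an alternating two-form. -/
def wedgePow (a : V [⋀^Fin 2]→ₗ[ℝ] ℝ) : (n : ℕ) → V [⋀^Fin (2 * n)]→ₗ[ℝ] ℝ
  | 0 => AlternatingMap.constOfIsEmpty ℝ V (Fin 0) 1
  | n + 1 => wedge (wedgePow a n) a

end Wedge

/-! ### Differential forms and bivector fields on a manifold without boundary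

`M` is a manifold of dimension `m`, modelled on `ℝᵐ`. -/

section Fields

variable {m : ℕ} (M : Type*) [TopologicalSpace M] [ChartedSpace (EuclideanSpace ℝ (Fin m)) M]

/-- A (not necessarily smooth) differential `k`-form on the `m`-dimensional manifold `M`. -/
abbrev DiffForm (m : ℕ) (M : Type*) [TopologicalSpace M]
    [ChartedSpace (EuclideanSpace ℝ (Fin m)) M] (k : ℕ) : Type _ :=
  ∀ x : M, TangentSpace (𝓡 m) x [⋀^Fin k]→L[ℝ] ℝ

/-- A (not necessarily smooth) bivector field on the `m`-dimensional manifold `M`; an element of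
`⋀² T_x M` is regarded as an alternating bilinear form on the cotangent space `T_x^* M`. -/
abbrev BivectorField (m : ℕ) (M : Type*) [TopologicalSpace M]
    [ChartedSpace (EuclideanSpace ℝ (Fin m)) M] : Type _ :=
  ∀ x : M, (TangentSpace (𝓡 m) x →L[ℝ] ℝ) [⋀^Fin 2]→L[ℝ] ℝ

variable {M}

/-- The expression of a form in the preferred chart at `x₀`, i.e. its pullback under the inverse
of that chart. It is meaningful on the target of the chart, an open subset of `ℝᵐ`. -/
def DiffForm.inChart {k : ℕ} (σ : DiffForm m M k) (x₀ : M) (y : EuclideanSpace ℝ (Fin m)) :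
    EuclideanSpace ℝ (Fin m) [⋀^Fin k]→L[ℝ] ℝ :=
  (σ ((extChartAt (𝓡 m) x₀).symm y)).compContinuousLinearMap
    (mfderiv 𝓘(ℝ, EuclideanSpace ℝ (Fin m)) (𝓡 m) (extChartAt (𝓡 m) x₀).symm y)

/-- The expression of a bivector field in the preferred chart at `x₀`, i.e. its pushforward under
that chart. It is meaningful on the target of the chart, an open subset of `ℝᵐ`. -/
def BivectorField.inChart (π : BivectorField m M) (x₀ : M) (y : EuclideanSpace ℝ (Fin m)) :
    (EuclideanSpace ℝ (Fin m) →L[ℝ] ℝ) [⋀^Fin 2]→L[ℝ] ℝ :=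
  (π ((extChartAt (𝓡 m) x₀).symm y)).compContinuousLinearMap
    (ContinuousLinearMap.precomp ℝ
      (mfderiv (𝓡 m) 𝓘(ℝ, EuclideanSpace ℝ (Fin m)) (extChartAt (𝓡 m) x₀)
        ((extChartAt (𝓡 m) x₀).symm y)))

/-- Smoothness of a differential form. -/
def DiffForm.IsSmooth {k : ℕ} (σ : DiffForm m M k) : Prop :=
  ∀ x₀ : M, ContDiffOn ℝ ∞ (σ.inChart x₀) (extChartAt (𝓡 m) x₀).target

/-- `dσ = 0`, where the exterior derivative is computed in charts. -/
def DiffForm.IsClosed {k : ℕ} (σ : DiffForm m M k) : Prop :=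
  ∀ x₀ : M, ∀ y ∈ (extChartAt (𝓡 m) x₀).target, extDeriv (σ.inChart x₀) y = 0

/-- Smoothness of a bivector field. -/
def BivectorField.IsSmooth (π : BivectorField m M) : Prop :=
  ∀ x₀ : M, ContDiffOn ℝ ∞ (π.inChart x₀) (extChartAt (𝓡 m) x₀).target

/-- The bracket `{f, g} = π(df, dg)`. -/
def BivectorField.bracket (π : BivectorField m M) (f g : M → ℝ) (x : M) : ℝ :=
  π x ![mvfderiv (𝓡 m) f x, mvfderiv (𝓡 m) g x]

/-- A smooth bivector field is Poisson if its bracket satisfies the Jacobi identity. -/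
structure BivectorField.IsPoisson (π : BivectorField m M) : Prop where
  smooth : π.IsSmooth
  jacobi : ∀ f g h : M → ℝ,
    ContMDiff (𝓡 m) 𝓘(ℝ, ℝ) ∞ f → ContMDiff (𝓡 m) 𝓘(ℝ, ℝ) ∞ g →
    ContMDiff (𝓡 m) 𝓘(ℝ, ℝ) ∞ h → ∀ x : M,
      π.bracket f (π.bracket g h) x + π.bracket g (π.bracket h f) x
        + π.bracket h (π.bracket f g) x = 0

/-- The pullback of a form under a map, here used for restriction to a submanifold. -/
def DiffForm.pullback {m' : ℕ} {N : Type*} [TopologicalSpace N]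
    [ChartedSpace (EuclideanSpace ℝ (Fin m')) N] {k : ℕ} (σ : DiffForm m M k) (ι : N → M) :
    DiffForm m' N k :=
  fun z => (σ (ι z)).compContinuousLinearMap (mfderiv (𝓡 m') (𝓡 m) ι z)

end Fields

/-! ### Log-symplectic and folded-symplectic structures

`X` is a manifold of dimension `2 * n`. -/

section Structures

variable {n : ℕ} {X : Type*} [TopologicalSpace X]
  [ChartedSpace (EuclideanSpace ℝ (Fin (2 * n))) X]

/-- The zero locus of `σⁿ`. -/
def DiffForm.degeneracyLocus (σ : DiffForm (2 * n) X 2) : Set X :=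
  {x | wedgePow (σ x).toAlternatingMap n = 0}

/-- The zero locus of `πⁿ`. -/
def BivectorField.degeneracyLocus (π : BivectorField (2 * n) X) : Set X :=
  {x | wedgePow (π x).toAlternatingMap n = 0}

/-- The section `σⁿ` of the line bundle `⋀²ⁿ T^*X` is transverse to the zero section: at each of
its zeros, the derivative of its local expression is non-zero. -/
def DiffForm.TopPowerTransverse (σ : DiffForm (2 * n) X 2) : Prop :=
  ∀ x ∈ σ.degeneracyLocus, ∃ v : Fin (2 * n) → EuclideanSpace ℝ (Fin (2 * n)),
    fderiv ℝ (fun y => wedgePow (σ.inChart x y).toAlternatingMap n v)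
      (extChartAt (𝓡 (2 * n)) x x) ≠ 0

/-- The section `πⁿ` of the line bundle `⋀²ⁿ TX` is transverse to the zero section: at each of
its zeros, the derivative of its local expression is non-zero. -/
def BivectorField.TopPowerTransverse (π : BivectorField (2 * n) X) : Prop :=
  ∀ x ∈ π.degeneracyLocus, ∃ α : Fin (2 * n) → (EuclideanSpace ℝ (Fin (2 * n)) →L[ℝ] ℝ),
    fderiv ℝ (fun y => wedgePow (π.inChart x y).toAlternatingMap n α)
      (extChartAt (𝓡 (2 * n)) x x) ≠ 0

/-- `π_x = σ_x⁻¹`, i.e. `π^♯ ∘ σ^♭ = id` on `T_x X`, where `σ^♭ v = σ(v, ·)` and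
`π^♯ α = π(α, ·)`. In particular both are nondegenerate at `x`. -/
def IsInverseAt (σ : DiffForm (2 * n) X 2) (π : BivectorField (2 * n) X) (x : X) : Prop :=
  ∀ (v : TangentSpace (𝓡 (2 * n)) x) (α β : TangentSpace (𝓡 (2 * n)) x →L[ℝ] ℝ),
    (∀ w, α w = σ x ![v, w]) → π x ![α, β] = β v

variable {Z : Type*} [TopologicalSpace Z] [ChartedSpace (EuclideanSpace ℝ (Fin (2 * n - 1))) Z]

/-- `π` is a log-symplectic structure on the pair consisting of `X` and the hypersurface `ι(Z)`:
a Poisson structure for which `πⁿ` is transverse to zero with zero locus `ι(Z)`. -/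
structure IsLogSymplectic (ι : Z → X) (π : BivectorField (2 * n) X) : Prop where
  poisson : π.IsPoisson
  transverse : π.TopPowerTransverse
  locus : π.degeneracyLocus = Set.range ι

/-- `σ` is a folded-symplectic form on the pair consisting of `X` and the hypersurface `ι(Z)`:
a closed two-form for which `σⁿ` is transverse to zero with zero locus `ι(Z)`, and for which the
restriction of `σⁿ⁻¹` to the hypersurface vanishes nowhere. -/
structure IsFoldedSymplectic (ι : Z → X) (σ : DiffForm (2 * n) X 2) : Prop where
  smooth : σ.IsSmooth
  closed : σ.IsClosed
  transverse : σ.TopPowerTransverse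
  locus : σ.degeneracyLocus = Set.range ι
  restrict_ne_zero : ∀ z : Z,
    wedgePow ((σ.pullback ι : DiffForm (2 * n - 1) Z 2) z).toAlternatingMap (n - 1) ≠ 0

end Structures

end LogFolded

end

/-!
# Log-symplectic and folded-symplectic structures on a pair `(X, Z)`

Both directions modify a two-form near the hypersurface `Z` by a multiple of `dh ∧ Θ`. Here `h` is
the square of the top power of the given structure, made into a function by means of a density
(`exists_squareDefining_biv`, `exists_squareDefining_form`), so near `Z` it is a positive multiple of
the square `s²` of a regular defining function, and `Θ` is a one-form which is locally exact near
`Z`. Adding `f(h) dh ∧ Θ` does not affect closedness (`d3_add_smul_wed`). The Pfaffian, that is the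
coefficient `pf` of the top power, depends affinely on the factor in front of a decomposable form
`φ ∧ θ` (`wedgePow_affine`), so its zeros can be controlled explicitly.

*From log-symplectic to folded-symplectic.* The inverse of `π` has a simple pole along `Z`. As it is
closed (`jacobiAt_iff_closed`), its residue is a closed one-form on `Z`
(`exists_residue_primitive`), which extends to a locally exact `Θ` near `Z`
(`LogData.exists_residue`, by `exists_extension_of_primitives`). Thus `π⁻¹ = β + dh ∧ Θ / (2h)` with
`β` smooth. Multiplying `h` by `exp (2k)` changes `β` by `-dk ∧ Θ`, and `k` can be chosen such that
the Pfaffian of `β` vanishes on `Z` (`SquareDefining.exists_normalization`). Then `1 / (2h)` is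
replaced by a function of `h` which equals `1 / (2h)` for `h ≥ ε` and is constant near `h = 0`. For
small `ε` the ratio of the Pfaffian of the new form to that of `π⁻¹` is positive off `Z` and bounded
below by a multiple of `h` (`le_smoothing_ratio`). Since the Pfaffian of `π⁻¹` is a constant divided
by `s`, this makes the new Pfaffian transverse to zero along `Z`
(`SquareDefining.smoothing_transverse`). The new form has maximal rank on `Z` because adding
`ds ∧ Θ` to it changes the Pfaffian (`wedgePow_hyperplane_ne_zero`).

*From folded-symplectic to log-symplectic.* A primitive of `θ` is extended from `Z` locally, which
again gives a locally exact `Θ`. By the hypothesis on `θ`, adding `ds ∧ Θ` to `ω` makes it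
non-degenerate along `Z` (`nondeg_add_of_hyperplane`). The form `ω ± χ(h) dh ∧ Θ / (2h)`, where `χ`
is a cutoff function and the sign is that of the change of the Pfaffian caused by `dh ∧ Θ` relative
to the Pfaffian of `ω`, is closed and non-degenerate off `Z`. Its inverse is a quotient of polynomial
expressions in the form which, after multiplication by `s`, are smooth with invertible denominator.
So it extends smoothly across `Z`, and its Pfaffian has a transverse zero there
(`SquareDefining.exists_inverse_extension`). By density of the complement of `Z`
(`jacobiAt_of_dense`), the extension is Poisson.

Several proofs use that the inverse of a non-degenerate form can be read off from the change of its
Pfaffian under decomposable perturbations (`Inv.biv_eq`), which yields the polynomial adjugates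
`adjB` and `adjF`.
-/

noncomputable section

namespace LogFolded

/-! ### Wedge powers of alternating two-forms -/

section Algebra

variable {V : Type*} [AddCommGroup V] [Module ℝ V]

/-- The multilinear map `v ↦ a(v₀, v₁) a(v₂, v₃) ⋯`, whose alternatization is `2ⁿ aⁿ`. -/
def pairProd (a : V [⋀^Fin 2]→ₗ[ℝ] ℝ) : (n : ℕ) → MultilinearMap ℝ (fun _ : Fin (2 * n) => V) ℝ
  | 0 => (MultilinearMap.constOfIsEmpty ℝ (fun _ : Fin 0 => V) (1 : ℝ) :)
  | n + 1 => ((LinearMap.mul' ℝ ℝ).compMultilinearMap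
      (MultilinearMap.domCoprod (pairProd a n)
        (a : MultilinearMap ℝ (fun _ : Fin 2 => V) ℝ))).domDomCongr finSumFinEquiv

theorem alternatization_domDomCongr {ι κ : Type*} [Fintype ι] [DecidableEq ι] [Fintype κ]
    [DecidableEq κ] (e : ι ≃ κ) (m : MultilinearMap ℝ (fun _ : ι => V) ℝ) :
    MultilinearMap.alternatization (m.domDomCongr e) =
      (MultilinearMap.alternatization m).domDomCongr e := by
  ext v
  simp only [MultilinearMap.alternatization_apply, MultilinearMap.domDomCongr_apply,
    AlternatingMap.domDomCongr_apply]
  refine Fintype.sum_equiv (e.permCongr).symm _ _ fun σ => ?_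
  congr 1
  · simp [Equiv.Perm.sign_permCongr, Equiv.permCongr_symm]
  · congr 1
    funext i
    simp

theorem two_pow_smul_wedgePow (a : V [⋀^Fin 2]→ₗ[ℝ] ℝ) (n : ℕ) :
    (2 : ℝ) ^ n • wedgePow a n = MultilinearMap.alternatization (pairProd a n) := by
  induction n with
  | zero =>
    ext v
    simp [wedgePow, pairProd, MultilinearMap.alternatization_apply]
  | succ n ih =>
    have h2 : MultilinearMap.alternatization (a : MultilinearMap ℝ (fun _ : Fin 2 => V) ℝ)
        = (2 : ℝ) • a := by
      rw [AlternatingMap.coe_alternatization]; ext; simp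
    rw [wedgePow, pairProd, alternatization_domDomCongr,
      LinearMap.compMultilinearMap_alternatization, MultilinearMap.domCoprod_alternization,
      ← ih, h2, wedge]
    rw [← AlternatingMap.domCoprod'_apply, ← AlternatingMap.domCoprod'_apply,
      TensorProduct.smul_tmul_smul, map_smul]
    ext v
    simp [pow_succ]

theorem pairProd_apply (a : V [⋀^Fin 2]→ₗ[ℝ] ℝ) (n : ℕ) (v : Fin (2 * n) → V) :
    pairProd a n v = ∏ i : Fin n, a ![v ⟨2 * i, by omega⟩, v ⟨2 * i + 1, by omega⟩] := by
  induction n with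
  | zero => simp [pairProd]
  | succ n ih =>
    rw [pairProd, Fin.prod_univ_castSucc]
    simp only [MultilinearMap.domDomCongr_apply, LinearMap.compMultilinearMap_apply,
      MultilinearMap.domCoprod_apply, LinearMap.mul'_apply, ih]
    refine congrArg₂ _ rfl (congrArg a ?_)
    funext i
    fin_cases i <;> rfl

theorem wedgePow_apply (a : V [⋀^Fin 2]→ₗ[ℝ] ℝ) (n : ℕ) (v : Fin (2 * n) → V) :
    wedgePow a n v = ((2 : ℝ) ^ n)⁻¹ * ∑ σ : Equiv.Perm (Fin (2 * n)),
      (Equiv.Perm.sign σ : ℝ) *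
        ∏ i : Fin n, a ![v (σ ⟨2 * i, by omega⟩), v (σ ⟨2 * i + 1, by omega⟩)] := by
  have h := congrArg (fun f => f v) (two_pow_smul_wedgePow a n)
  simp only [AlternatingMap.smul_apply, MultilinearMap.alternatization_apply] at h
  rw [eq_inv_mul_iff_mul_eq₀ (by positivity), ← smul_eq_mul, h]
  refine Finset.sum_congr rfl fun σ _ => ?_
  rw [MultilinearMap.domDomCongr_apply, pairProd_apply]
  simp [Units.smul_def]

theorem wedgePow_comp {W : Type*} [AddCommGroup W] [Module ℝ W] (a : V [⋀^Fin 2]→ₗ[ℝ] ℝ)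
    (b : W [⋀^Fin 2]→ₗ[ℝ] ℝ) (f : W → V) (hb : ∀ x y, b ![x, y] = a ![f x, f y]) (n : ℕ)
    (v : Fin (2 * n) → W) : wedgePow b n v = wedgePow a n (f ∘ v) := by
  simp [wedgePow_apply, hb]

/-- If `a` vanishes as soon as one of its arguments is some `w j`, then only the trivial shuffle
contributes to the value of `a ∧ b` on the concatenation of `u` and `w`. -/
theorem wedge_append {k l : ℕ} (a : V [⋀^Fin k]→ₗ[ℝ] ℝ) (b : V [⋀^Fin l]→ₗ[ℝ] ℝ)
    (u : Fin k → V) (w : Fin l → V)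
    (h : ∀ x : Fin k → V, (∃ i j, x i = w j) → a x = 0) :
    wedge a b (Fin.append u w) = a u * b w := by
  have key : ∀ σ : Equiv.Perm.ModSumCongr (Fin k) (Fin l), σ ≠ Quotient.mk'' 1 →
      AlternatingMap.domCoprod.summand a b σ (Sum.elim u w) = 0 := by
    intro σ
    induction σ using Quotient.inductionOn' with | _ σ
    intro hσ
    rw [AlternatingMap.domCoprod.summand_mk'']
    -- a non-trivial shuffle moves some `w j` into an argument of `a`
    have : ∃ i : Fin k, ∃ j : Fin l, σ (Sum.inl i) = Sum.inr j := by
      by_contra hcon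
      push Not at hcon
      apply hσ
      rw [Quotient.eq'', QuotientGroup.leftRel_apply]
      have : σ ∈ (Equiv.Perm.sumCongrHom (Fin k) (Fin l)).range := by
        apply Equiv.Perm.mem_sumCongrHom_range_of_perm_mapsTo_inl
        rintro _ ⟨i, rfl⟩
        rcases hs : σ (Sum.inl i) with j | j
        · exact ⟨j, rfl⟩
        · exact absurd hs (hcon i j)
      simpa using this
    obtain ⟨i, j, hij⟩ := this
    have h0 : a (fun i => Sum.elim u w (σ (Sum.inl i))) = 0 := h _ ⟨i, j, by simp [hij]⟩
    simp [MultilinearMap.domCoprod_apply, h0]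
  have hv : Fin.append u w ∘ finSumFinEquiv = Sum.elim u w := by
    funext i; rcases i with i | i <;> simp
  have hw : wedge a b (Fin.append u w) = LinearMap.mul' ℝ ℝ ((a.domCoprod b) (Sum.elim u w)) := by
    rw [← hv]; rfl
  have hsum : (a.domCoprod b) (Sum.elim u w) =
      ∑ σ : Equiv.Perm.ModSumCongr (Fin k) (Fin l),
        AlternatingMap.domCoprod.summand a b σ (Sum.elim u w) := by
    have h := congrArg (fun m => m (Sum.elim u w)) (AlternatingMap.domCoprod_coe a b)
    simp only [sum_apply] at h
    exact h
  rw [hw, hsum]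
  refine (congrArg _ (Finset.sum_eq_single
    (Quotient.mk'' 1 : Equiv.Perm.ModSumCongr (Fin k) (Fin l))
    (fun σ _ hσ => key σ hσ) (fun h => absurd (Finset.mem_univ _) h))).trans ?_
  rw [AlternatingMap.domCoprod.summand_mk'']
  simp [MultilinearMap.domCoprod_apply]

end Algebra

/-! ### Non-degenerate two-forms -/

section Symplectic

variable {V : Type*} [AddCommGroup V] [Module ℝ V]

theorem two_form_swap (a : V [⋀^Fin 2]→ₗ[ℝ] ℝ) (x y : V) : a ![x, y] = -a ![y, x] := by
  have h := a.map_swap ![y, x] (show (0 : Fin 2) ≠ 1 by decide)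
  rw [← h]
  congr 1
  funext i
  fin_cases i <;> simp

theorem two_form_self (a : V [⋀^Fin 2]→ₗ[ℝ] ℝ) (x : V) : a ![x, x] = 0 :=
  a.map_eq_zero_of_eq _ (i := 0) (j := 1) (by simp) (by decide)

theorem two_form_add_left (a : V [⋀^Fin 2]→ₗ[ℝ] ℝ) (x y z : V) :
    a ![x + y, z] = a ![x, z] + a ![y, z] := a.map_vecCons_add _ _ _

theorem two_form_smul_left (a : V [⋀^Fin 2]→ₗ[ℝ] ℝ) (c : ℝ) (x z : V) :
    a ![c • x, z] = c * a ![x, z] := a.map_vecCons_smul _ _ _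

/-- The bilinear map of an alternating two-form. -/
def bil (a : V [⋀^Fin 2]→ₗ[ℝ] ℝ) : V →ₗ[ℝ] V →ₗ[ℝ] ℝ :=
  LinearMap.mk₂ ℝ (fun x y => a ![x, y]) (fun x y z => two_form_add_left a x y z)
    (fun c x z => two_form_smul_left a c x z)
    (fun x y z => by
      rw [two_form_swap, two_form_add_left, two_form_swap a x y, two_form_swap a x z]; ring)
    (fun c x z => by
      rw [two_form_swap, two_form_smul_left, two_form_swap a x z, smul_eq_mul]; ring)

@[simp] theorem bil_apply (a : V [⋀^Fin 2]→ₗ[ℝ] ℝ) (x y : V) : bil a x y = a ![x, y] := rfl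

/-- The alternating two-form of an alternating bilinear map. -/
def ofBil (B : V →ₗ[ℝ] V →ₗ[ℝ] ℝ) (hB : ∀ x, B x x = 0) : V [⋀^Fin 2]→ₗ[ℝ] ℝ where
  toFun v := B (v 0) (v 1)
  map_update_add' v i x y := by
    fin_cases i <;> simp
  map_update_smul' v i c x := by
    fin_cases i <;> simp
  map_eq_zero_of_eq' v i j h hij := by
    fin_cases i <;> fin_cases j <;> simp_all

/-- Non-degeneracy of an alternating two-form. -/
def Nondeg (a : V [⋀^Fin 2]→ₗ[ℝ] ℝ) : Prop := ∀ v, (∀ w, a ![v, w] = 0) → v = 0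

/-- The standard symplectic pairing of the index set `Fin n × Fin 2`. -/
def stdPairing {n : ℕ} (p q : Fin n × Fin 2) : ℝ :=
  if p.1 = q.1 then (if p.2 = 0 ∧ q.2 = 1 then 1 else if p.2 = 1 ∧ q.2 = 0 then -1 else 0) else 0

/-- The bijection `2 * i + b ↦ (i, b)`. -/
def pairEquiv (n : ℕ) : Fin (2 * n) ≃ Fin n × Fin 2 where
  toFun k := (⟨k / 2, by omega⟩, ⟨k % 2, by omega⟩)
  invFun p := ⟨2 * p.1 + p.2, by omega⟩
  left_inv k := by ext; simp; omega
  right_inv p := by ext <;> simp <;> omega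

/-- The value of `ωⁿ` on a symplectic basis of `ω`. -/
def stdPf (n : ℕ) : ℝ :=
  ((2 : ℝ) ^ n)⁻¹ * ∑ τ : Equiv.Perm (Fin n × Fin 2),
    (Equiv.Perm.sign τ : ℝ) * ∏ i : Fin n, stdPairing (τ (i, 0)) (τ (i, 1))

/-- If the values of `a` on the family `v` are `c` times the standard ones, then the value of `aⁿ`
is `cⁿ` times the standard one. -/
theorem wedgePow_of_pairing (a : V [⋀^Fin 2]→ₗ[ℝ] ℝ) (n : ℕ) (v : Fin n × Fin 2 → V)
    (c : ℝ) (h : ∀ p q, a ![v p, v q] = c * stdPairing p q) :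
    wedgePow a n (v ∘ pairEquiv n) = c ^ n * stdPf n := by
  rw [wedgePow_apply, stdPf, mul_left_comm]
  refine congrArg (fun s => ((2 : ℝ) ^ n)⁻¹ * s) ?_
  rw [Finset.mul_sum]
  refine Fintype.sum_equiv ((pairEquiv n).permCongr) _ _ fun σ => ?_
  rw [Equiv.Perm.sign_permCongr, mul_left_comm]
  congr 1
  simp only [Function.comp_apply, h, Finset.prod_mul_distrib]
  simp only [Finset.prod_const, Finset.card_univ, Fintype.card_fin]
  congr 1

/-- A permutation contributing to the Pfaffian of the standard symplectic form permutes the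
hyperbolic pairs and possibly exchanges the members of each; its sign is the product of the signs
of these exchanges, so its contribution is `1`. -/
theorem sign_mul_prod_stdPairing_nonneg {n : ℕ} (τ : Equiv.Perm (Fin n × Fin 2)) :
    0 ≤ (Equiv.Perm.sign τ : ℝ) * ∏ i : Fin n, stdPairing (τ (i, 0)) (τ (i, 1)) := by
  by_cases h0 : ∏ i : Fin n, stdPairing (τ (i, 0)) (τ (i, 1)) = 0
  · rw [h0, mul_zero]
  have hne : ∀ i, stdPairing (τ (i, 0)) (τ (i, 1)) ≠ 0 := fun i hi =>
    h0 (Finset.prod_eq_zero (Finset.mem_univ i) hi)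
  have hfst : ∀ i, (τ (i, 0)).1 = (τ (i, 1)).1 := fun i => by
    by_contra hc; exact hne i (by simp [stdPairing, hc])
  have hsnd : ∀ i, (τ (i, 0)).2 ≠ (τ (i, 1)).2 := fun i hc => by
    apply hne i
    unfold stdPairing
    rw [hc, if_pos (hfst i), if_neg, if_neg] <;> omega
  let t : Fin n → Fin n := fun i => (τ (i, 0)).1
  have ht : Function.Injective t := by
    intro i j hij
    have h1 : τ (i, 0) = τ (j, 0) ∨ τ (i, 0) = τ (j, 1) := by
      have hs := hsnd j
      rcases (show (τ (i, 0)).2 = (τ (j, 0)).2 ∨ (τ (i, 0)).2 = (τ (j, 1)).2 by omega) with h | h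
      · exact Or.inl (Prod.ext hij h)
      · exact Or.inr (Prod.ext (hij.trans (hfst j)) h)
    rcases h1 with h | h
    · exact congrArg Prod.fst (τ.injective h)
    · exact congrArg Prod.fst (τ.injective h)
  let T : Equiv.Perm (Fin n) := Equiv.ofBijective t (Finite.injective_iff_bijective.1 ht)
  let ρ : Fin n → Equiv.Perm (Fin 2) := fun i =>
    if (τ (i, 0)).2 = 0 then 1 else Equiv.swap 0 1
  have hτ : τ = Equiv.prodCongrLeft (fun _ : Fin 2 => T) * Equiv.prodCongrRight ρ := by
    ext ⟨i, b⟩ : 1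
    have hs := hsnd i
    have hf := hfst i
    refine Prod.ext ?_ ?_
    · fin_cases b
      · simp [T, t]
      · simp [T, t, hf]
    · by_cases h : (τ (i, 0)).2 = 0
      · have : (τ (i, 1)).2 = 1 := by omega
        fin_cases b <;> simp [ρ, h, this]
      · have h' : (τ (i, 0)).2 = 1 := by omega
        have : (τ (i, 1)).2 = 0 := by omega
        fin_cases b <;> simp [ρ, h', this]
  have hsign : (Equiv.Perm.sign τ : ℤˣ) = ∏ i, Equiv.Perm.sign (ρ i) := by
    rw [hτ, Equiv.Perm.sign_mul, Equiv.Perm.sign_prodCongrLeft, Equiv.Perm.sign_prodCongrRight]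
    simp
  have hterm : ∀ i, stdPairing (τ (i, 0)) (τ (i, 1)) = ((Equiv.Perm.sign (ρ i) : ℤ) : ℝ) := by
    intro i
    have hs := hsnd i
    unfold stdPairing
    rw [if_pos (hfst i)]
    by_cases h : (τ (i, 0)).2 = 0
    · have : (τ (i, 1)).2 = 1 := by omega
      simp [ρ, h, this]
    · have h' : (τ (i, 0)).2 = 1 := by omega
      have : (τ (i, 1)).2 = 0 := by omega
      simp [ρ, h', this]
  rw [hsign]
  simp only [hterm]
  push_cast
  exact mul_self_nonneg _

theorem stdPf_pos (n : ℕ) : 0 < stdPf n := by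
  refine mul_pos (by positivity) ?_
  refine Finset.sum_pos' (fun τ _ => sign_mul_prod_stdPairing_nonneg τ) ⟨1, Finset.mem_univ _, ?_⟩
  simp [stdPairing]

/-- A non-degenerate two-form has a symplectic basis. The induction splits off a hyperbolic plane,
spanned by `e` and `f`, and passes to its orthogonal complement. -/
theorem exists_symplectic_family (n : ℕ) : ∀ {V : Type _} [AddCommGroup V] [Module ℝ V]
    [FiniteDimensional ℝ V] (a : V [⋀^Fin 2]→ₗ[ℝ] ℝ), Nondeg a → Module.finrank ℝ V = 2 * n →
    ∃ v : Fin n × Fin 2 → V, ∀ p q, a ![v p, v q] = stdPairing p q := by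
  induction n with
  | zero => intro V _ _ _ a _ _; exact ⟨fun p => p.1.elim0, fun p => p.1.elim0⟩
  | succ n ih =>
    intro V _ _ _ a ha hV
    have : Nontrivial V := Module.nontrivial_of_finrank_pos (R := ℝ) (by omega)
    obtain ⟨e, he⟩ := exists_ne (0 : V)
    obtain ⟨f', hf'⟩ : ∃ f, a ![e, f] ≠ 0 := by
      by_contra hc; push Not at hc; exact he (ha e hc)
    obtain ⟨f, hf⟩ : ∃ f, a ![e, f] = 1 :=
      ⟨(a ![e, f'])⁻¹ • f', by rw [← bil_apply, map_smul, bil_apply, smul_eq_mul,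
        inv_mul_cancel₀ hf']⟩
    have hfe : a ![f, e] = -1 := by rw [two_form_swap, hf]
    let L : V →ₗ[ℝ] ℝ × ℝ := (bil a e).prod (bil a f)
    have hLs : Function.Surjective L := fun ⟨s, t⟩ => ⟨s • f - t • e, by
      simp [L, -bil_apply, map_sub, map_smul]
      simp [hf, hfe, two_form_self]⟩
    let U := LinearMap.ker L
    have hU : ∀ w ∈ U, a ![e, w] = 0 ∧ a ![f, w] = 0 := fun w hw => by
      simpa [U, L] using hw
    have hdim : Module.finrank ℝ U = 2 * n := by
      have h1 := LinearMap.finrank_range_add_finrank_ker L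
      rw [LinearMap.range_eq_top.2 hLs, finrank_top, hV] at h1
      simp at h1
      change Module.finrank ℝ (LinearMap.ker L) = _
      omega
    have hnd : Nondeg (a.compLinearMap U.subtype) := by
      rintro ⟨w, hw⟩ hw0
      obtain ⟨hew, hfw⟩ := hU w hw
      have : w = 0 := by
        refine ha w fun x => ?_
        -- the component of `x` orthogonal to `e` and `f`
        let x' : V := x - a ![e, x] • f + a ![f, x] • e
        have hx' : x' ∈ U := by
          have h1 : bil a e x' = 0 := by
            simp only [x', map_add, map_sub, map_smul, bil_apply, hf, two_form_self]; simp
          have h2 : bil a f x' = 0 := by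
            simp only [x', map_add, map_sub, map_smul, bil_apply, hfe, two_form_self]; simp
          simpa [U, L] using And.intro h1 h2
        have h3 : bil a w x' = 0 := by
          have := hw0 ⟨x', hx'⟩
          rw [AlternatingMap.compLinearMap_apply] at this
          rw [bil_apply, ← this]
          congr 1
          funext i; fin_cases i <;> rfl
        simp only [x', map_add, map_sub, map_smul, bil_apply] at h3
        rw [two_form_swap a w f, two_form_swap a w e, hew, hfw] at h3
        simpa using h3
      exact Subtype.ext this
    obtain ⟨v, hv⟩ := ih (a.compLinearMap U.subtype) hnd hdim
    have hv' : ∀ p q, a ![(v p : V), v q] = stdPairing p q := fun p q => by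
      rw [← hv, AlternatingMap.compLinearMap_apply]
      congr 1
      funext i; fin_cases i <;> rfl
    refine ⟨fun p => Fin.cases (if p.2 = 0 then e else f) (fun i => (v (i, p.2) : V)) p.1, ?_⟩
    rintro ⟨i, b⟩ ⟨j, c⟩
    have hvU : ∀ p, a ![e, v p] = 0 ∧ a ![f, v p] = 0 := fun p => hU _ (v p).2
    have hvU' : ∀ p, a ![(v p : V), e] = 0 ∧ a ![(v p : V), f] = 0 := fun p => by
      rw [two_form_swap, (hvU p).1, two_form_swap, (hvU p).2]; simp
    refine Fin.cases ?_ (fun i => ?_) i <;> refine Fin.cases ?_ (fun j => ?_) j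
    · fin_cases b <;> fin_cases c <;> simp [stdPairing, hf, hfe, two_form_self]
    · fin_cases b <;> fin_cases c <;> simp [stdPairing, hvU, (Fin.succ_ne_zero j).symm]
    · fin_cases b <;> fin_cases c <;> simp [stdPairing, hvU', Fin.succ_ne_zero i]
    · simp [hv', stdPairing]

theorem wedgePow_ne_zero_of_nondeg [FiniteDimensional ℝ V] {n : ℕ} (a : V [⋀^Fin 2]→ₗ[ℝ] ℝ)
    (ha : Nondeg a) (hV : Module.finrank ℝ V = 2 * n) : wedgePow a n ≠ 0 := by
  obtain ⟨v, hv⟩ := exists_symplectic_family n a ha hV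
  intro h
  have := wedgePow_of_pairing a n v 1 (by simpa using hv)
  rw [h] at this
  simp [(stdPf_pos n).ne] at this

/-- If `v` lies in the kernel of `a`, then `a` is its own pullback under a projection along `v`,
and the image of a basis under this projection is linearly dependent. -/
theorem nondeg_of_wedgePow_ne_zero [FiniteDimensional ℝ V] {n : ℕ} (a : V [⋀^Fin 2]→ₗ[ℝ] ℝ)
    (ha : wedgePow a n ≠ 0) (hV : Module.finrank ℝ V = 2 * n) : Nondeg a := by
  intro v hv
  by_contra hv0
  apply ha
  obtain ⟨φ, hφ⟩ : ∃ φ : V →ₗ[ℝ] ℝ, φ v = 1 := Module.Projective.exists_dual_eq_one ℝ hv0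
  ext w
  let f : V →ₗ[ℝ] V := LinearMap.id - φ.smulRight v
  have hf : f v = 0 := by simp [f, hφ]
  rw [wedgePow_comp a a f (fun x y => ?_) n w]
  · apply AlternatingMap.map_linearDependent
    intro hli
    have hcard : Module.finrank ℝ V = Fintype.card (Fin (2 * n)) := by simpa using hV
    have h2 : LinearIndependent ℝ w := LinearIndependent.of_comp f hli
    have hspan : Submodule.span ℝ (Set.range (f ∘ w)) = ⊤ :=
      hli.span_eq_top_of_card_eq_finrank' hcard.symm
    have hsurj : Function.Surjective f := by
      rw [← LinearMap.range_eq_top, eq_top_iff, ← hspan, Submodule.span_le]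
      rintro _ ⟨i, rfl⟩
      exact ⟨w i, rfl⟩
    exact hv0 (LinearMap.injective_iff_surjective.2 hsurj (by rw [hf, map_zero]))
  · have h1 : ∀ x, bil a x v = 0 := fun x => by rw [bil_apply, two_form_swap, hv, neg_zero]
    have h2 : bil a v = 0 := LinearMap.ext fun x => hv x
    rw [← bil_apply, ← bil_apply]
    simp only [f, LinearMap.sub_apply, LinearMap.id_apply, LinearMap.smulRight_apply, map_sub,
      map_smul, h2, h1]
    simp

end Symplectic

/-! ### Rank-one changes of the Pfaffian -/

section RankOne

variable {V : Type*} [AddCommGroup V] [Module ℝ V] {n : ℕ}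

theorem wedgePow_basis_eq_zero_iff (b : Module.Basis (Fin (2 * n)) ℝ V)
    (a : V [⋀^Fin 2]→ₗ[ℝ] ℝ) : wedgePow a n b = 0 ↔ wedgePow a n = 0 := by
  refine ⟨fun h => ?_, fun h => by rw [h]; rfl⟩
  rw [(wedgePow a n).eq_smul_basis_det b, h, zero_smul]

theorem wedgePow_basis_ne_zero_iff (b : Module.Basis (Fin (2 * n)) ℝ V)
    (a : V [⋀^Fin 2]→ₗ[ℝ] ℝ) : wedgePow a n b ≠ 0 ↔ Nondeg a := by
  have : FiniteDimensional ℝ V := b.finiteDimensional_of_finite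
  have hV : Module.finrank ℝ V = 2 * n := by simpa using Module.finrank_eq_card_basis b
  rw [Ne, wedgePow_basis_eq_zero_iff]
  exact ⟨fun h => nondeg_of_wedgePow_ne_zero a h hV, fun h => wedgePow_ne_zero_of_nondeg a h hV⟩

theorem wedgePow_comp_basis (b : Module.Basis (Fin (2 * n)) ℝ V) (a a' : V [⋀^Fin 2]→ₗ[ℝ] ℝ)
    (f : V →ₗ[ℝ] V) (h : ∀ x y, a' ![x, y] = a ![f x, f y]) :
    wedgePow a' n b = LinearMap.det f * wedgePow a n b := by
  have hb := congrArg (fun F => F (f ∘ b)) ((wedgePow a n).eq_smul_basis_det b)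
  rw [wedgePow_comp a a' f h n b, hb, AlternatingMap.smul_apply, Module.Basis.det_comp,
    Module.Basis.det_self, smul_eq_mul]
  ring

theorem det_id_add_smulRight (b : Module.Basis (Fin (2 * n)) ℝ V) (φ : V →ₗ[ℝ] ℝ) (v : V) :
    LinearMap.det (LinearMap.id + φ.smulRight v) = 1 + φ v := by
  have : FiniteDimensional ℝ V := b.finiteDimensional_of_finite
  rw [← LinearMap.transvection.det φ v]
  congr 1

/-- The form `a + φ ∧ a(v, ·)` is the pullback of `a` under `x ↦ x + φ(x) v`. -/
theorem wedgePow_rank_one (b : Module.Basis (Fin (2 * n)) ℝ V) (a a' : V [⋀^Fin 2]→ₗ[ℝ] ℝ)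
    (φ : V →ₗ[ℝ] ℝ) (v : V)
    (h : ∀ x y, a' ![x, y] = a ![x, y] + φ x * a ![v, y] - φ y * a ![v, x]) :
    wedgePow a' n b = (1 + φ v) * wedgePow a n b := by
  rw [← det_id_add_smulRight b φ v]
  refine wedgePow_comp_basis b a a' _ fun x y => ?_
  change _ = bil a (x + φ x • v) (y + φ y • v)
  rw [h]
  simp only [LinearMap.add_apply, LinearMap.smul_apply, map_add, map_smul,
    bil_apply, two_form_self, smul_eq_mul]
  rw [two_form_swap a x v]
  ring

/-- A covector is of the form `a(v, ·)` for a non-degenerate form `a`. -/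
theorem exists_bil_eq [FiniteDimensional ℝ V] (a : V [⋀^Fin 2]→ₗ[ℝ] ℝ) (ha : Nondeg a)
    (θ : V →ₗ[ℝ] ℝ) : ∃ v, ∀ w, a ![v, w] = θ w := by
  have hinj : Function.Injective (bil a) := by
    rw [injective_iff_map_eq_zero]
    exact fun v hv => ha v fun w => LinearMap.congr_fun hv w
  have hsurj := (LinearMap.injective_iff_surjective_of_finrank_eq_finrank
    (f := (bil a : V →ₗ[ℝ] Module.Dual ℝ V)) Subspace.dual_finrank_eq.symm).1 hinj
  obtain ⟨v, hv⟩ := hsurj θ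
  exact ⟨v, fun w => LinearMap.congr_fun hv w⟩

/-- If `σ` has a kernel vector `v` with `θ(v) ≠ 0`, then scaling along `v` fixes `σ` and
multiplies `φ ∧ θ` by an arbitrary factor. -/
theorem wedgePow_affine_aux (b : Module.Basis (Fin (2 * n)) ℝ V) (σ τ : V [⋀^Fin 2]→ₗ[ℝ] ℝ)
    (φ θ : V →ₗ[ℝ] ℝ) (hτ : ∀ x y, τ ![x, y] = φ x * θ y - φ y * θ x) (v : V)
    (hv : ∀ w, σ ![v, w] = 0) (hθ : θ v ≠ 0) (t : ℝ) :
    wedgePow (σ + t • τ) n b = t * wedgePow (σ + τ) n b := by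
  let c := (t - 1) / θ v
  have ht : t = 1 + (c • θ) v := by simp [c, hθ]
  have hv' : ∀ x, σ ![x, v] = 0 := fun x => by rw [two_form_swap, hv, neg_zero]
  rw [show t * wedgePow (σ + τ) n b = (1 + (c • θ) v) * wedgePow (σ + τ) n b by rw [← ht]]
  refine wedgePow_rank_one b (σ + τ) _ (c • θ) v fun x y => ?_
  have hc : t = 1 + c * θ v := ht
  simp only [AlternatingMap.add_apply, AlternatingMap.smul_apply, hτ, hv, LinearMap.smul_apply,
    smul_eq_mul]
  rw [hc]
  ring

/-- The Pfaffian is affine along a rank-two direction `φ ∧ θ`. -/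
theorem wedgePow_affine (b : Module.Basis (Fin (2 * n)) ℝ V) (σ τ : V [⋀^Fin 2]→ₗ[ℝ] ℝ)
    (φ θ : V →ₗ[ℝ] ℝ) (hτ : ∀ x y, τ ![x, y] = φ x * θ y - φ y * θ x) (t : ℝ) :
    wedgePow (σ + t • τ) n b =
      wedgePow σ n b + t * (wedgePow (σ + τ) n b - wedgePow σ n b) := by
  have : FiniteDimensional ℝ V := b.finiteDimensional_of_finite
  by_cases hσ : Nondeg σ
  -- for non-degenerate `σ`, write `θ = σ(v, ·)` and use the determinant of a transvection
  · obtain ⟨v, hv⟩ := exists_bil_eq σ hσ θ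
    have h1 := wedgePow_rank_one b σ (σ + t • τ) (t • φ) v fun x y => by
      simp only [AlternatingMap.add_apply, AlternatingMap.smul_apply, hτ, hv,
        LinearMap.smul_apply, smul_eq_mul]
      ring
    have h2 := wedgePow_rank_one b σ (σ + τ) φ v fun x y => by
      simp only [AlternatingMap.add_apply, hτ, hv]
      ring
    rw [h1, h2, LinearMap.smul_apply, smul_eq_mul]
    ring
  · have h0 : wedgePow σ n b = 0 := by
      by_contra h; exact hσ ((wedgePow_basis_ne_zero_iff b σ).1 h)
    simp only [Nondeg, not_forall] at hσ
    obtain ⟨v, hv, hv0⟩ := hσ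
    rw [h0]
    -- for degenerate `σ` with kernel vector `v`, either `v` is in the kernel of all `σ + t τ`, or
    -- one of `θ` and `φ` does not vanish on it
    by_cases hθ : θ v = 0
    · by_cases hφ : φ v = 0
      · have hz : ∀ t : ℝ, wedgePow (σ + t • τ) n b = 0 := fun t => by
          by_contra h
          refine hv0 ((wedgePow_basis_ne_zero_iff b _).1 h v fun w => ?_)
          simp [hv, hτ, hθ, hφ]
        have h1 := hz 1
        rw [one_smul] at h1
        rw [hz, h1]; ring
      · rw [wedgePow_affine_aux b σ τ θ (-φ) (fun x y => by rw [hτ]; simp; ring) v hv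
          (by simpa using hφ)]
        ring
    · rw [wedgePow_affine_aux b σ τ φ θ hτ v hv hθ]
      ring

/-- If `θ ∧ aᵐ ≠ 0` on a space of dimension `2m + 1`, then `θ ≠ 0` and `a` is non-degenerate on
`ker θ`. -/
theorem wedge_one_wedgePow_ne_zero {m : ℕ} [FiniteDimensional ℝ V]
    (hV : Module.finrank ℝ V = 1 + 2 * m) (θ : V [⋀^Fin 1]→ₗ[ℝ] ℝ) (a : V [⋀^Fin 2]→ₗ[ℝ] ℝ)
    (h : wedge θ (wedgePow a m) ≠ 0) :
    (∃ w, θ ![w] ≠ 0) ∧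
      ∀ w, θ ![w] = 0 → (∀ w', θ ![w'] = 0 → a ![w, w'] = 0) → w = 0 := by
  have hθ : ∃ w, θ ![w] ≠ 0 := by
    by_contra hc
    push Not at hc
    apply h
    have : θ = 0 := by
      ext v
      rw [show v = ![v 0] by ext i; fin_cases i; rfl, hc]; rfl
    rw [this, wedge, ← AlternatingMap.domCoprod'_apply, TensorProduct.zero_tmul, map_zero]
    ext; simp
  refine ⟨hθ, ?_⟩
  by_contra hdeg
  apply h
  obtain ⟨e, he⟩ := hθ
  let L : V →ₗ[ℝ] ℝ := (AlternatingMap.ofSubsingleton ℝ V ℝ (0 : Fin 1)).symm θ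
  have hL : ∀ w, L w = θ ![w] := fun w => by
    simp only [L, AlternatingMap.ofSubsingleton_symm_apply_apply]
    congr 1
    ext i; fin_cases i; rfl
  let K := LinearMap.ker L
  have hKdim : Module.finrank ℝ K = 2 * m := by
    have h1 := LinearMap.finrank_range_add_finrank_ker L
    have h2 : Function.Surjective L := LinearMap.surjective (by
      intro h0; apply he; rw [← hL, h0]; rfl)
    rw [LinearMap.range_eq_top.2 h2, finrank_top, hV] at h1
    simp at h1
    change Module.finrank ℝ (LinearMap.ker L) = _
    omega
  have hzero : wedgePow (a.compLinearMap K.subtype) m = 0 := by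
    by_contra hne
    apply hdeg
    intro w hw hw'
    have := nondeg_of_wedgePow_ne_zero _ hne hKdim ⟨w, (hL w).trans hw⟩ fun w' => by
      rw [AlternatingMap.compLinearMap_apply]
      refine Eq.trans ?_ (hw' w' ((hL _).symm.trans w'.2))
      congr 1
      funext i; fin_cases i <;> rfl
    exact congrArg Subtype.val this
  -- in a basis consisting of `e` and a basis of `ker θ`, the form `θ ∧ aᵐ` is
  -- `θ(e) aᵐ|_{ker θ} = 0`
  let bK := Module.finBasisOfFinrankEq ℝ K hKdim
  let u : Fin (1 + 2 * m) → V := Fin.append ![e] fun i => (bK i : V)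
  have hspan : ⊤ ≤ Submodule.span ℝ (Set.range u) := by
    intro x _
    have hLe : L e ≠ 0 := by rwa [hL]
    have hx : x - (L x / L e) • e ∈ K := by simp [K, hLe]
    have hK : ∀ k : K, (k : V) ∈ Submodule.span ℝ (Set.range u) := by
      intro k
      rw [← bK.sum_repr k]
      push_cast
      refine Submodule.sum_mem _ fun i _ => Submodule.smul_mem _ _ (Submodule.subset_span ?_)
      exact ⟨Fin.natAdd 1 i, by simp [u]⟩
    have he' : e ∈ Submodule.span ℝ (Set.range u) :=
      Submodule.subset_span ⟨Fin.castAdd _ 0, by simp only [u, Fin.append_left]; rfl⟩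
    rw [show x = (x - (L x / L e) • e) + (L x / L e) • e by abel]
    exact Submodule.add_mem _ (hK ⟨_, hx⟩) (Submodule.smul_mem _ _ he')
  let B := basisOfTopLeSpanOfCardEqFinrank u hspan (by rw [hV]; simp)
  rw [(wedge θ (wedgePow a m)).eq_smul_basis_det B]
  have hB : (wedge θ (wedgePow a m)) B = 0 := by
    have : (B : Fin (1 + 2 * m) → V) = u := coe_basisOfTopLeSpanOfCardEqFinrank _ _ _
    rw [this]
    simp only [u]
    rw [wedge_append]
    · have hz := congrArg (fun F => F bK) hzero
      have hc := wedgePow_comp a (a.compLinearMap K.subtype) K.subtype (fun x y => by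
        rw [AlternatingMap.compLinearMap_apply]; congr 1; funext i; fin_cases i <;> rfl) m bK
      have : wedgePow a m (fun i => (bK i : V)) = 0 := hc.symm.trans hz
      rw [this, mul_zero]
    · rintro x ⟨i, j, hij⟩
      have hx : x = ![(bK j : V)] := by ext k; fin_cases k; fin_cases i; exact hij
      rw [hx, ← hL]
      exact (bK j).2
  rw [hB, zero_smul]

/-- If `σ` is degenerate on `V` and its restriction to the hyperplane `ker α` is as
non-degenerate as possible, transversally to `θ`, then `σ + α ∧ θ` is non-degenerate. -/
theorem nondeg_add_of_hyperplane {W : Type*} [AddCommGroup W] [Module ℝ W]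
    (σ τ : V [⋀^Fin 2]→ₗ[ℝ] ℝ) (α θ : V →ₗ[ℝ] ℝ)
    (hτ : ∀ x y, τ ![x, y] = α x * θ y - α y * θ x) (j : W → V)
    (hα : ∃ v, α v ≠ 0) (hj : ∀ v, α v = 0 → ∃ w, j w = v) (hj0 : j 0 = 0) (hαj : ∀ w, α (j w) = 0)
    (hθ : ∃ w, θ (j w) ≠ 0)
    (hK : ∀ w, θ (j w) = 0 → (∀ w', θ (j w') = 0 → σ ![j w, j w'] = 0) → w = 0)
    (hσ : ¬ Nondeg σ) : Nondeg (σ + τ) := by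
  simp only [Nondeg, not_forall] at hσ
  obtain ⟨r, hr, hr0⟩ := hσ
  have hK' : ∀ x, α x = 0 → θ x = 0 → (∀ y, α y = 0 → θ y = 0 → σ ![x, y] = 0) → x = 0 := by
    intro x hx hx' hxy
    obtain ⟨w, rfl⟩ := hj x hx
    rw [hK w hx' fun w' hw' => hxy _ (hαj w') hw', hj0]
  intro v hv
  by_contra hv0
  have hv1 : ∀ y, σ ![v, y] + (α v * θ y - α y * θ v) = 0 := fun y => by
    rw [← hτ]; exact hv y
  have hvr : α v * θ r - α r * θ v = 0 := by
    have := hv1 r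
    rwa [two_form_swap, hr, neg_zero, zero_add] at this
  have hvK : ∀ y, α y = 0 → θ y = 0 → σ ![v, y] = 0 := fun y h1 h2 => by
    have := hv1 y
    rw [h1, h2] at this
    simpa using this
  -- a combination of `v` and the kernel vector `r` lies in `ker α ∩ ker θ`, hence vanishes
  have hcomb : ∀ s t : ℝ, s * α v = t * α r → s * θ v = t * θ r → s • v = t • r := by
    intro s t h1 h2
    rw [← sub_eq_zero]
    refine hK' _ (by simp [h1]) (by simp [h2]) fun y hy hy' => ?_
    rw [← bil_apply]
    simp [hvK y hy hy', hr]
  have hrne : α r ≠ 0 ∨ θ r ≠ 0 := by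
    by_contra hc
    push Not at hc
    exact hr0 (hK' r hc.1 hc.2 fun y _ _ => hr y)
  have hvker : ∀ y, σ ![v, y] = 0 := by
    have : ∃ c : ℝ, v = c • r := by
      rcases hrne with h | h
      · have h1 := hcomb (α r) (α v) (by ring) (by linarith)
        exact ⟨(α r)⁻¹ * α v, by rw [mul_smul, ← h1, smul_smul, inv_mul_cancel₀ h, one_smul]⟩
      · have h1 := hcomb (θ r) (θ v) (by linarith) (by ring)
        exact ⟨(θ r)⁻¹ * θ v, by rw [mul_smul, ← h1, smul_smul, inv_mul_cancel₀ h, one_smul]⟩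
    obtain ⟨c, rfl⟩ := this
    intro y
    rw [two_form_smul_left, hr, mul_zero]
  have hprop : ∀ y, α v * θ y = α y * θ v := fun y => by
    have := hv1 y
    rw [hvker] at this
    linarith
  obtain ⟨w, hw⟩ := hθ
  obtain ⟨x, hx⟩ := hα
  have h1 : α v = 0 := by
    have := hprop (j w)
    rw [hαj, zero_mul] at this
    exact (mul_eq_zero.1 this).resolve_right hw
  have h2 : θ v = 0 := by
    have := hprop x
    rw [h1, zero_mul] at this
    exact (mul_eq_zero.1 this.symm).resolve_left hx
  exact hv0 (hK' v h1 h2 fun y _ _ => hvker y)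

/-- If adding `α ∧ θ` changes the Pfaffian of `σ`, then `σ` has rank `2n - 2` on `ker α`. -/
theorem wedgePow_hyperplane_ne_zero {W : Type*} [AddCommGroup W] [Module ℝ W]
    (b : Module.Basis (Fin (2 * n)) ℝ V)
    (σ τ : V [⋀^Fin 2]→ₗ[ℝ] ℝ) (α θ : V →ₗ[ℝ] ℝ)
    (hτ : ∀ x y, τ ![x, y] = α x * θ y - α y * θ x) (j : W → V)
    (hj : ∀ v, α v = 0 → ∃ w, j w = v) (a : W [⋀^Fin 2]→ₗ[ℝ] ℝ)
    (ha : ∀ x y, a ![x, y] = σ ![j x, j y])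
    (hne : wedgePow (σ + τ) n b ≠ wedgePow σ n b) : wedgePow a (n - 1) ≠ 0 := by
  have : FiniteDimensional ℝ V := b.finiteDimensional_of_finite
  have hV : Module.finrank ℝ V = 2 * n := by simpa using Module.finrank_eq_card_basis b
  obtain ⟨x, y, hxy⟩ : ∃ x y, α x * θ y - α y * θ x ≠ 0 := by
    by_contra hc
    push Not at hc
    apply hne
    have : τ = 0 := by
      ext v
      rw [show v = ![v 0, v 1] by ext i; fin_cases i <;> rfl, hτ, hc]; rfl
    rw [this, add_zero]
  let L : V →ₗ[ℝ] ℝ × ℝ := α.prod θ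
  have hL : ∀ z, L z = (α z, θ z) := fun _ => rfl
  have hLs : Function.Surjective L := by
    rintro ⟨s, t⟩
    set D := α x * θ y - α y * θ x with hD
    refine ⟨((s * θ y - t * α y) / D) • x + ((t * α x - s * θ x) / D) • y, ?_⟩
    simp only [hL, map_add, map_smul, smul_eq_mul, Prod.mk.injEq]
    constructor <;> field_simp <;> rw [hD] <;> ring
  let K := LinearMap.ker L
  have hKm : ∀ w ∈ K, α w = 0 ∧ θ w = 0 := fun w hw => by simpa [K, hL] using hw
  have hdim : Module.finrank ℝ K = 2 * (n - 1) := by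
    have h1 := LinearMap.finrank_range_add_finrank_ker L
    rw [LinearMap.range_eq_top.2 hLs, finrank_top, hV] at h1
    simp at h1
    change Module.finrank ℝ (LinearMap.ker L) = _
    omega
  -- it suffices that `σ` is non-degenerate on the codimension-two subspace `ker α ∩ ker θ`
  have hnd : Nondeg (σ.compLinearMap K.subtype) := by
    rintro ⟨w, hw⟩ hw0
    obtain ⟨hαw, hθw⟩ := hKm w hw
    have hw1 : ∀ z, α z = 0 → θ z = 0 → σ ![w, z] = 0 := fun z h1 h2 => by
      have := hw0 ⟨z, by simp [K, hL, h1, h2]⟩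
      rw [AlternatingMap.compLinearMap_apply] at this
      rw [← this]
      congr 1
      funext i; fin_cases i <;> rfl
    -- `σ(w, ·)` is a combination `p α + q θ`
    obtain ⟨p, q, hpq⟩ : ∃ p q : ℝ, ∀ z, σ ![w, z] = p * α z + q * θ z := by
      obtain ⟨e, he⟩ := hLs (1, 0)
      obtain ⟨f, hf⟩ := hLs (0, 1)
      simp only [hL, Prod.mk.injEq] at he hf
      refine ⟨σ ![w, e], σ ![w, f], fun z => ?_⟩
      have := hw1 (z - α z • e - θ z • f) (by simp [he, hf]) (by simp [he, hf])
      rw [← bil_apply] at this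
      simp only [map_sub, map_smul, bil_apply, smul_eq_mul] at this
      linarith
    -- if `q ≠ 0`, then `σ + q τ` is the pullback of `σ` under a transvection of determinant one, so
    -- the Pfaffian does not change in the direction `τ`; likewise for `p`
    have hq : q = 0 := by
      by_contra hq
      have h1 := wedgePow_rank_one b σ (σ + q • τ) α w fun x y => by
        simp only [AlternatingMap.add_apply, AlternatingMap.smul_apply, hτ, hpq, smul_eq_mul]
        ring
      rw [wedgePow_affine b σ τ α θ hτ, hαw] at h1
      have : q * (wedgePow (σ + τ) n b - wedgePow σ n b) = 0 := by linarith
      exact hne (sub_eq_zero.1 ((mul_eq_zero.1 this).resolve_left hq))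
    have hp : p = 0 := by
      by_contra hp
      have h1 := wedgePow_rank_one b σ (σ + (-p) • τ) θ w fun x y => by
        simp only [AlternatingMap.add_apply, AlternatingMap.smul_apply, hτ, hpq, smul_eq_mul]
        ring
      rw [wedgePow_affine b σ τ α θ hτ, hθw] at h1
      have : p * (wedgePow (σ + τ) n b - wedgePow σ n b) = 0 := by linarith
      exact hne (sub_eq_zero.1 ((mul_eq_zero.1 this).resolve_left hp))
    have hker : ∀ z, σ ![w, z] = 0 := fun z => by rw [hpq, hp, hq]; ring
    by_contra hw0'
    have hw0'' : w ≠ 0 := fun h => hw0' (Subtype.ext h)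
    apply hne
    have e1 : wedgePow σ n b = 0 := by
      by_contra h; exact hw0'' ((wedgePow_basis_ne_zero_iff b _).1 h w hker)
    have e2 : wedgePow (σ + τ) n b = 0 := by
      by_contra h
      refine hw0'' ((wedgePow_basis_ne_zero_iff b _).1 h w fun z => ?_)
      rw [AlternatingMap.add_apply, hker, hτ, hαw, hθw]; ring
    rw [e1, e2]
  have hne' := wedgePow_ne_zero_of_nondeg _ hnd hdim
  intro h0
  apply hne'
  ext v
  choose g hg using fun z : K => hj z (hKm z z.2).1
  have h1 := wedgePow_comp σ (σ.compLinearMap K.subtype) K.subtype (fun x y => by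
    rw [AlternatingMap.compLinearMap_apply]; congr 1; funext i; fin_cases i <;> rfl) (n - 1) v
  have h2 := wedgePow_comp σ a j ha (n - 1) (g ∘ v)
  rw [h0] at h2
  rw [h1, AlternatingMap.zero_apply]
  rw [AlternatingMap.zero_apply] at h2
  rw [h2]
  congr 1
  funext i
  exact (hg (v i)).symm

end RankOne

/-! ### Continuous two-forms, their Pfaffians and inverses -/

set_option linter.unusedSectionVars false

section Wed

variable {V : Type*} [AddCommGroup V] [Module ℝ V] [TopologicalSpace V]

/-- The wedge product `φ ∧ θ` of two covectors. -/
def wed (φ θ : V →L[ℝ] ℝ) : V [⋀^Fin 2]→L[ℝ] ℝ :=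
  { ofBil (((φ : V →ₗ[ℝ] ℝ).smulRight (θ : V →ₗ[ℝ] ℝ)) -
      ((θ : V →ₗ[ℝ] ℝ).smulRight (φ : V →ₗ[ℝ] ℝ))) (fun x => by simp; ring) with
    cont := by
      change Continuous fun v : Fin 2 → V => φ (v 0) • θ (v 1) - θ (v 0) • φ (v 1)
      fun_prop }

@[simp] theorem wed_apply (φ θ : V →L[ℝ] ℝ) (v : Fin 2 → V) :
    wed φ θ v = φ (v 0) * θ (v 1) - φ (v 1) * θ (v 0) := by
  change φ (v 0) • θ (v 1) - θ (v 0) • φ (v 1) = _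
  simp only [smul_eq_mul]; ring

end Wed

section Pfaffian

variable {V : Type*} [NormedAddCommGroup V] [NormedSpace ℝ V] [FiniteDimensional ℝ V] {n m : ℕ}

theorem vec2 {α : Type*} (v : Fin 2 → α) : v = ![v 0, v 1] := by
  ext i; fin_cases i <;> rfl

/-- The coefficient of `aⁿ` in the basis `b`; up to the factor `n!`, the Pfaffian. -/
def pf (b : Module.Basis (Fin (2 * n)) ℝ V) (a : V [⋀^Fin 2]→L[ℝ] ℝ) : ℝ :=
  wedgePow a.toAlternatingMap n b

theorem contDiff_form_apply {W : Type*} [NormedAddCommGroup W] [NormedSpace ℝ W]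
    {k : WithTop ℕ∞} (v : Fin 2 → W) :
    ContDiff ℝ k fun a : W [⋀^Fin 2]→L[ℝ] ℝ => a v :=
  (ContinuousAlternatingMap.apply ℝ W ℝ v).contDiff

theorem contDiff_wedgePow (v : Fin (2 * n) → V) :
    ContDiff ℝ ∞ fun a : V [⋀^Fin 2]→L[ℝ] ℝ => wedgePow a.toAlternatingMap n v := by
  simp only [wedgePow_apply]
  refine contDiff_const.mul
    (ContDiff.sum fun σ _ => contDiff_const.mul (contDiff_prod fun i _ => ?_))
  exact contDiff_form_apply _

theorem contDiff_pf (b : Module.Basis (Fin (2 * n)) ℝ V) : ContDiff ℝ ∞ (pf b) :=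
  contDiff_wedgePow b

theorem pf_ne_zero_iff (b : Module.Basis (Fin (2 * n)) ℝ V) (a : V [⋀^Fin 2]→L[ℝ] ℝ) :
    pf b a ≠ 0 ↔ Nondeg a.toAlternatingMap := wedgePow_basis_ne_zero_iff b _

theorem pf_eq_zero_iff (b : Module.Basis (Fin (2 * n)) ℝ V) (a : V [⋀^Fin 2]→L[ℝ] ℝ) :
    pf b a = 0 ↔ wedgePow a.toAlternatingMap n = 0 := wedgePow_basis_eq_zero_iff b _

theorem pf_affine (b : Module.Basis (Fin (2 * n)) ℝ V) (σ : V [⋀^Fin 2]→L[ℝ] ℝ)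
    (φ θ : V →L[ℝ] ℝ) (t : ℝ) :
    pf b (σ + t • wed φ θ) = pf b σ + t * (pf b (σ + wed φ θ) - pf b σ) :=
  wedgePow_affine b σ.toAlternatingMap (wed φ θ).toAlternatingMap φ θ
    (fun x y => wed_apply φ θ ![x, y]) t

theorem pf_comp (b : Module.Basis (Fin (2 * n)) ℝ V) (σ : V [⋀^Fin 2]→L[ℝ] ℝ) (A : V →L[ℝ] V) :
    pf b (σ.compContinuousLinearMap A) = LinearMap.det (A : V →ₗ[ℝ] V) * pf b σ := by
  refine wedgePow_comp_basis b σ.toAlternatingMap _ (A : V →ₗ[ℝ] V) fun x y => ?_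
  change σ (A ∘ ![x, y]) = σ ![A x, A y]
  congr 1
  funext i; fin_cases i <;> rfl

/-- The coordinate covectors of a basis. -/
def coordL (b : Module.Basis (Fin m) ℝ V) (i : Fin m) : V →L[ℝ] ℝ :=
  LinearMap.toContinuousLinearMap (b.coord i)

@[simp] theorem coordL_apply (b : Module.Basis (Fin m) ℝ V) (i : Fin m) (v : V) :
    coordL b i v = b.repr v i := rfl

/-- The basis of the topological dual which is dual to `b`. -/
def dualB (b : Module.Basis (Fin m) ℝ V) : Module.Basis (Fin m) ℝ (V →L[ℝ] ℝ) :=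
  b.dualBasis.map LinearMap.toContinuousLinearMap

theorem dualB_apply (b : Module.Basis (Fin m) ℝ V) (i : Fin m) : dualB b i = coordL b i := by
  ext v
  simp [dualB]

theorem dualB_repr (b : Module.Basis (Fin m) ℝ V) (α : V →L[ℝ] ℝ) (i : Fin m) :
    (dualB b).repr α i = α (b i) := by
  simp [dualB]

/-- Evaluation at a vector, as a covector on the dual space. -/
def evL (v : V) : (V →L[ℝ] ℝ) →L[ℝ] ℝ := ContinuousLinearMap.apply ℝ ℝ v

@[simp] theorem evL_apply (v : V) (α : V →L[ℝ] ℝ) : evL v α = α v := rfl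

theorem form_expand (b : Module.Basis (Fin m) ℝ V) (a : V [⋀^Fin 2]→L[ℝ] ℝ) (x y : V) :
    a ![x, y] = ∑ i, ∑ j, b.repr x i * b.repr y j * a ![b i, b j] := by
  change bil a.toAlternatingMap x y = _
  conv_lhs => rw [← b.sum_repr x, ← b.sum_repr y]
  rw [map_sum, Finset.sum_comm]
  refine Finset.sum_congr rfl fun j _ => ?_
  rw [map_sum, LinearMap.sum_apply]
  refine Finset.sum_congr rfl fun i _ => ?_
  rw [map_smul, map_smul, LinearMap.smul_apply, smul_eq_mul, smul_eq_mul]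
  change _ * (_ * a ![b i, b j]) = _
  ring

theorem form_ext {a a' : V [⋀^Fin 2]→L[ℝ] ℝ} (h : ∀ x y, a ![x, y] = a' ![x, y]) : a = a' := by
  ext v
  rw [vec2 v, h]

/-- The two-form with given values on pairs of basis vectors (antisymmetrized). -/
def formOf (b : Module.Basis (Fin m) ℝ V) (c : Fin m → Fin m → ℝ) : V [⋀^Fin 2]→L[ℝ] ℝ :=
  ∑ i, ∑ j, (c i j / 2) • wed (coordL b i) (coordL b j)

theorem formOf_eq (b : Module.Basis (Fin m) ℝ V) (a : V [⋀^Fin 2]→L[ℝ] ℝ) :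
    formOf b (fun i j => a ![b i, b j]) = a := by
  refine form_ext fun x y => ?_
  simp only [formOf, ContinuousAlternatingMap.sum_apply, ContinuousAlternatingMap.smul_apply,
    wed_apply, coordL_apply, smul_eq_mul, Matrix.cons_val_zero, Matrix.cons_val_one]
  have h1 := form_expand b a x y
  have h2 := form_expand b a y x
  have h3 : a ![y, x] = -a ![x, y] := two_form_swap a.toAlternatingMap y x
  have h4 : a ![x, y] = (a ![x, y] - a ![y, x]) / 2 := by rw [h3]; ring
  rw [h4, h1, h2, ← Finset.sum_sub_distrib, Finset.sum_div]
  refine Finset.sum_congr rfl fun i _ => ?_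
  rw [← Finset.sum_sub_distrib, Finset.sum_div]
  refine Finset.sum_congr rfl fun j _ => ?_
  ring

theorem formOf_add (b : Module.Basis (Fin m) ℝ V) (c c' : Fin m → Fin m → ℝ) :
    formOf b c + formOf b c' = formOf b (c + c') := by
  simp only [formOf, ← Finset.sum_add_distrib, ← add_smul, Pi.add_apply, add_div]

theorem formOf_smul (b : Module.Basis (Fin m) ℝ V) (t : ℝ) (c : Fin m → Fin m → ℝ) :
    t • formOf b c = formOf b (t • c) := by
  simp only [formOf, Finset.smul_sum, smul_smul, Pi.smul_apply, smul_eq_mul, mul_div_assoc]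

theorem formOf_sub (b : Module.Basis (Fin m) ℝ V) (c c' : Fin m → Fin m → ℝ) :
    formOf b c - formOf b c' = formOf b (c - c') := by
  rw [sub_eq_iff_eq_add, formOf_add, sub_add_cancel]

variable {F : Type*} [NormedAddCommGroup F] [NormedSpace ℝ F] {k : WithTop ℕ∞}

theorem contDiffAt_formOf (b : Module.Basis (Fin m) ℝ V) {c : F → Fin m → Fin m → ℝ} {p : F}
    (hc : ∀ i j, ContDiffAt ℝ k (fun y => c y i j) p) :
    ContDiffAt ℝ k (fun y => formOf b (c y)) p := by
  unfold formOf
  refine ContDiffAt.sum fun i _ => ContDiffAt.sum fun j _ => ?_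
  exact ((hc i j).div_const 2).smul contDiffAt_const

theorem contDiffAt_form_iff (b : Module.Basis (Fin m) ℝ V) {a : F → V [⋀^Fin 2]→L[ℝ] ℝ} {p : F} :
    ContDiffAt ℝ k a p ↔ ∀ i j, ContDiffAt ℝ k (fun y => a y ![b i, b j]) p := by
  refine ⟨fun h i j => (contDiff_form_apply ![b i, b j]).contDiffAt.comp p h,
    fun h => ?_⟩
  have := contDiffAt_formOf b h
  simpa only [formOf_eq] using this

theorem ContDiffAt.form_apply {a : F → V [⋀^Fin 2]→L[ℝ] ℝ} {v w : F → V} {p : F}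
    (ha : ContDiffAt ℝ k a p) (hv : ContDiffAt ℝ k v p) (hw : ContDiffAt ℝ k w p) :
    ContDiffAt ℝ k (fun y => a y ![v y, w y]) p := by
  let b := Module.finBasis ℝ V
  have : (fun y => a y ![v y, w y]) = fun y =>
      ∑ i, ∑ j, coordL b i (v y) * coordL b j (w y) * a y ![b i, b j] := by
    funext y
    simpa using form_expand b (a y) (v y) (w y)
  rw [this]
  refine ContDiffAt.sum fun i _ => ContDiffAt.sum fun j _ => ?_
  exact (((coordL b i).contDiff.contDiffAt.comp p hv).mul
    ((coordL b j).contDiff.contDiffAt.comp p hw)).mul ((contDiffAt_form_iff b).1 ha i j)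

theorem ContDiffAt.wed {φ θ : F → V →L[ℝ] ℝ} {p : F} (hφ : ContDiffAt ℝ k φ p)
    (hθ : ContDiffAt ℝ k θ p) : ContDiffAt ℝ k (fun y => wed (φ y) (θ y)) p := by
  let b := Module.finBasis ℝ V
  rw [contDiffAt_form_iff b]
  intro i j
  simp only [wed_apply, Matrix.cons_val_zero, Matrix.cons_val_one]
  exact ((hφ.clm_apply contDiffAt_const).mul (hθ.clm_apply contDiffAt_const)).sub
    ((hφ.clm_apply contDiffAt_const).mul (hθ.clm_apply contDiffAt_const))

theorem ContDiffAt.form_comp {W : Type*} [NormedAddCommGroup W] [NormedSpace ℝ W]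
    [FiniteDimensional ℝ W] {a : F → V [⋀^Fin 2]→L[ℝ] ℝ} {A : F → W →L[ℝ] V} {p : F}
    (ha : ContDiffAt ℝ k a p) (hA : ContDiffAt ℝ k A p) :
    ContDiffAt ℝ k (fun y => (a y).compContinuousLinearMap (A y)) p := by
  let b := Module.finBasis ℝ W
  rw [contDiffAt_form_iff b]
  intro i j
  have : (fun y => (a y).compContinuousLinearMap (A y) ![b i, b j]) =
      fun y => a y ![A y (b i), A y (b j)] := by
    funext y
    rw [ContinuousAlternatingMap.compContinuousLinearMap_apply]
    congr 1
    funext l; fin_cases l <;> rfl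
  rw [this]
  exact ContDiffAt.form_apply ha (hA.clm_apply contDiffAt_const) (hA.clm_apply contDiffAt_const)

theorem form_comp_apply {V W : Type*} [AddCommGroup V] [Module ℝ V] [TopologicalSpace V]
    [AddCommGroup W] [Module ℝ W] [TopologicalSpace W]
    (a : V [⋀^Fin 2]→L[ℝ] ℝ) (A : W →L[ℝ] V) (x y : W) :
    a.compContinuousLinearMap A ![x, y] = a ![A x, A y] := by
  rw [ContinuousAlternatingMap.compContinuousLinearMap_apply]
  congr 1
  funext l; fin_cases l <;> rfl

/-! ### Inverse forms and bivectors -/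

theorem eq_zero_of_dual {v : V} (h : ∀ β : V →L[ℝ] ℝ, β v = 0) : v = 0 :=
  (Module.forall_dual_apply_eq_zero_iff ℝ v).1 fun β => h (LinearMap.toContinuousLinearMap β)

/-- `π` is the inverse of `σ`, i.e. `π(σ(v, ·), β) = β(v)`. At a point of a manifold, this is
`IsInverseAt`. -/
def Inv (σ : V [⋀^Fin 2]→L[ℝ] ℝ) (π : (V →L[ℝ] ℝ) [⋀^Fin 2]→L[ℝ] ℝ) : Prop :=
  ∀ (v : V) (α β : V →L[ℝ] ℝ), (∀ w, α w = σ ![v, w]) → π ![α, β] = β v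

theorem Inv.nondeg_form {σ : V [⋀^Fin 2]→L[ℝ] ℝ} {π : (V →L[ℝ] ℝ) [⋀^Fin 2]→L[ℝ] ℝ}
    (h : Inv σ π) : Nondeg σ.toAlternatingMap := by
  intro v hv
  refine eq_zero_of_dual fun β => ?_
  rw [← h v 0 β (fun w => (hv w).symm)]
  change bil π.toAlternatingMap 0 β = 0
  simp

theorem exists_form_eq {σ : V [⋀^Fin 2]→L[ℝ] ℝ} (hσ : Nondeg σ.toAlternatingMap)
    (α : V →L[ℝ] ℝ) : ∃ v, ∀ w, α w = σ ![v, w] := by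
  obtain ⟨v, hv⟩ := exists_bil_eq σ.toAlternatingMap hσ (α : V →ₗ[ℝ] ℝ)
  exact ⟨v, fun w => (hv w).symm⟩

theorem Inv.nondeg_biv {σ : V [⋀^Fin 2]→L[ℝ] ℝ} {π : (V →L[ℝ] ℝ) [⋀^Fin 2]→L[ℝ] ℝ}
    (h : Inv σ π) : Nondeg π.toAlternatingMap := by
  intro α hα
  obtain ⟨v, hv⟩ := exists_form_eq h.nondeg_form α
  have hv0 : v = 0 := by
    refine eq_zero_of_dual fun β => ?_
    rw [← h v α β hv]
    exact hα β
  ext w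
  rw [hv, hv0]
  change bil σ.toAlternatingMap 0 w = 0
  simp

theorem exists_inv_of_form {σ : V [⋀^Fin 2]→L[ℝ] ℝ} (hσ : Nondeg σ.toAlternatingMap) :
    ∃ π, Inv σ π := by
  let Φ : V →ₗ[ℝ] (V →L[ℝ] ℝ) :=
    (LinearMap.toContinuousLinearMap : (V →ₗ[ℝ] ℝ) ≃ₗ[ℝ] (V →L[ℝ] ℝ)).toLinearMap ∘ₗ
      bil σ.toAlternatingMap
  have hΦ : ∀ v w, Φ v w = σ ![v, w] := fun v w => rfl
  have hbij : Function.Bijective Φ := by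
    constructor
    · rw [injective_iff_map_eq_zero]
      exact fun v hv => hσ v fun w => (hΦ v w).symm.trans (by rw [hv]; rfl)
    · intro α
      obtain ⟨v, hv⟩ := exists_form_eq hσ α
      exact ⟨v, by ext w; rw [hΦ, hv]⟩
  let e := LinearEquiv.ofBijective Φ hbij
  have he : ∀ α w, α w = σ ![e.symm α, w] := fun α w => by
    rw [← hΦ]; exact congrArg (fun f => f w) (e.apply_symm_apply α).symm
  let B : (V →L[ℝ] ℝ) →ₗ[ℝ] (V →L[ℝ] ℝ) →ₗ[ℝ] ℝ :=
    LinearMap.mk₂ ℝ (fun α β => β (e.symm α)) (by simp) (by simp) (by simp) (by simp)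
  have hB : ∀ α, B α α = 0 := fun α => by
    change α (e.symm α) = 0
    rw [he]
    exact two_form_self σ.toAlternatingMap _
  refine ⟨formOf (dualB (Module.finBasis ℝ V)) fun i j =>
    ofBil B hB ![dualB (Module.finBasis ℝ V) i, dualB (Module.finBasis ℝ V) j], ?_⟩
  let π : (V →L[ℝ] ℝ) [⋀^Fin 2]→L[ℝ] ℝ :=
    { ofBil B hB with
      cont := by
        let S : (V →L[ℝ] ℝ) →L[ℝ] V := LinearMap.toContinuousLinearMap e.symm.toLinearMap
        change Continuous fun v : Fin 2 → (V →L[ℝ] ℝ) => (v 1) (S (v 0))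
        fun_prop }
  have hπ : ∀ v, π v = ofBil B hB v := fun v => rfl
  simp only [← hπ, formOf_eq]
  intro v α β hα
  have : e.symm α = v := by
    rw [LinearEquiv.symm_apply_eq]; ext w; rw [hα]; rfl
  rw [hπ, ← this]
  rfl

theorem exists_inv_of_biv {π : (V →L[ℝ] ℝ) [⋀^Fin 2]→L[ℝ] ℝ} (hπ : Nondeg π.toAlternatingMap) :
    ∃ σ, Inv σ π := by
  obtain ⟨ρ, hρ⟩ := exists_inv_of_form hπ
  refine ⟨ρ.compContinuousLinearMap (ContinuousLinearMap.apply ℝ ℝ), fun v α β hα => ?_⟩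
  obtain ⟨α', hα'⟩ := exists_form_eq hπ (evL v)
  have : α = α' := by
    ext w
    rw [hα, form_comp_apply]
    exact hρ α' (evL v) (evL w) hα'
  rw [this, ← hα']
  rfl

/-- The polynomial expression in `σ` which equals `pf σ • σ⁻¹` for non-degenerate `σ`. -/
def adjB (b : Module.Basis (Fin (2 * n)) ℝ V) (σ : V [⋀^Fin 2]→L[ℝ] ℝ) :
    (V →L[ℝ] ℝ) [⋀^Fin 2]→L[ℝ] ℝ :=
  formOf (dualB b) fun i j => pf b (σ + wed (coordL b j) (coordL b i)) - pf b σ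

/-- The polynomial expression in `π` which equals `pf π • π⁻¹` for non-degenerate `π`. -/
def adjF (b : Module.Basis (Fin (2 * n)) ℝ V) (π : (V →L[ℝ] ℝ) [⋀^Fin 2]→L[ℝ] ℝ) :
    V [⋀^Fin 2]→L[ℝ] ℝ :=
  formOf b fun i j => pf (dualB b) (π + wed (evL (b j)) (evL (b i))) - pf (dualB b) π

/-- The inverse of a non-degenerate two-form. -/
def invB (b : Module.Basis (Fin (2 * n)) ℝ V) (σ : V [⋀^Fin 2]→L[ℝ] ℝ) :
    (V →L[ℝ] ℝ) [⋀^Fin 2]→L[ℝ] ℝ := (pf b σ)⁻¹ • adjB b σ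

/-- The inverse of a non-degenerate bivector. -/
def invF (b : Module.Basis (Fin (2 * n)) ℝ V) (π : (V →L[ℝ] ℝ) [⋀^Fin 2]→L[ℝ] ℝ) :
    V [⋀^Fin 2]→L[ℝ] ℝ := (pf (dualB b) π)⁻¹ • adjF b π

theorem contDiff_adjB (b : Module.Basis (Fin (2 * n)) ℝ V) : ContDiff ℝ ∞ (adjB b) := by
  rw [contDiff_iff_contDiffAt]
  intro σ
  refine contDiffAt_formOf _ fun i j => ContDiff.contDiffAt ?_
  exact ((contDiff_pf b).comp (contDiff_id.add contDiff_const)).sub (contDiff_pf b)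

theorem contDiff_adjF (b : Module.Basis (Fin (2 * n)) ℝ V) : ContDiff ℝ ∞ (adjF b) := by
  rw [contDiff_iff_contDiffAt]
  intro σ
  refine contDiffAt_formOf _ fun i j => ContDiff.contDiffAt ?_
  exact ((contDiff_pf _).comp (contDiff_id.add contDiff_const)).sub (contDiff_pf _)

/-- Like the Pfaffian, the adjugate is affine along a rank-two direction. -/
theorem adjB_affine (b : Module.Basis (Fin (2 * n)) ℝ V) (σ : V [⋀^Fin 2]→L[ℝ] ℝ)
    (φ θ : V →L[ℝ] ℝ) (t : ℝ) :
    adjB b (σ + t • wed φ θ) = adjB b σ + t • (adjB b (σ + wed φ θ) - adjB b σ) := by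
  simp only [adjB, formOf_sub, formOf_smul, formOf_add]
  congr 1
  funext i j
  simp only [Pi.add_apply, Pi.smul_apply, Pi.sub_apply, smul_eq_mul]
  set ψ := wed (coordL b j) (coordL b i)
  rw [show σ + t • wed φ θ + ψ = (σ + ψ) + t • wed φ θ by abel, pf_affine b (σ + ψ),
    pf_affine b σ, show σ + wed φ θ + ψ = (σ + ψ) + wed φ θ by abel]
  ring

/-- The inverse is determined by the change of the Pfaffian under rank-two perturbations:
`pf (σ + β ∧ α) - pf σ = pf σ * σ⁻¹(α, β)`. -/
theorem Inv.biv_eq {σ : V [⋀^Fin 2]→L[ℝ] ℝ} {π : (V →L[ℝ] ℝ) [⋀^Fin 2]→L[ℝ] ℝ}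
    (h : Inv σ π) (b : Module.Basis (Fin (2 * n)) ℝ V) : π = invB b σ := by
  have hpf := (pf_ne_zero_iff b σ).2 h.nondeg_form
  have key : ∀ α β, pf b (σ + wed β α) - pf b σ = pf b σ * π ![α, β] := by
    intro α β
    obtain ⟨v, hv⟩ := exists_form_eq h.nondeg_form α
    have h1 : pf b (σ + wed β α) = (1 + β v) * pf b σ :=
      wedgePow_rank_one b σ.toAlternatingMap _ (β : V →ₗ[ℝ] ℝ) v fun x y => by
        change σ ![x, y] + wed β α ![x, y] = σ ![x, y] + β x * σ ![v, y] - β y * σ ![v, x]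
        rw [← hv, ← hv, wed_apply]
        simp only [Matrix.cons_val_zero, Matrix.cons_val_one]
        ring
    rw [h1, h v α β hv]
    ring
  have h2 : adjB b σ = pf b σ • π := by
    have h3 := formOf_eq (dualB b) (pf b σ • π)
    rw [← h3]
    unfold adjB
    congr 1
    funext i j
    rw [key, dualB_apply, dualB_apply]
    rfl
  rw [invB, h2, smul_smul, inv_mul_cancel₀ hpf, one_smul]

theorem Inv.form_eq {σ : V [⋀^Fin 2]→L[ℝ] ℝ} {π : (V →L[ℝ] ℝ) [⋀^Fin 2]→L[ℝ] ℝ}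
    (h : Inv σ π) (b : Module.Basis (Fin (2 * n)) ℝ V) : σ = invF b π := by
  have hpf := (pf_ne_zero_iff (dualB b) π).2 h.nondeg_biv
  have key : ∀ v w, pf (dualB b) (π + wed (evL w) (evL v)) - pf (dualB b) π =
      pf (dualB b) π * σ ![v, w] := by
    intro v w
    let α : V →L[ℝ] ℝ := LinearMap.toContinuousLinearMap (bil σ.toAlternatingMap v)
    have hα : ∀ β, π ![α, β] = β v := fun β => h v α β fun w => rfl
    have h1 : pf (dualB b) (π + wed (evL w) (evL v)) = (1 + evL w α) * pf (dualB b) π :=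
      wedgePow_rank_one (dualB b) π.toAlternatingMap _ (evL w : (V →L[ℝ] ℝ) →ₗ[ℝ] ℝ) α
        fun x y => by
          change π ![x, y] + wed (evL w) (evL v) ![x, y] =
            π ![x, y] + x w * π ![α, y] - y w * π ![α, x]
          rw [hα, hα, wed_apply]
          simp only [Matrix.cons_val_zero, Matrix.cons_val_one, evL_apply]
          ring
    have h2 : evL w α = σ ![v, w] := rfl
    rw [h1, h2]
    ring
  have h2 : adjF b π = pf (dualB b) π • σ := by
    have h3 := formOf_eq b (pf (dualB b) π • σ)
    rw [← h3]
    unfold adjF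
    congr 1
    funext i j
    rw [key]
    rfl
  rw [invF, h2, smul_smul, inv_mul_cancel₀ hpf, one_smul]

theorem inv_invB (b : Module.Basis (Fin (2 * n)) ℝ V) {σ : V [⋀^Fin 2]→L[ℝ] ℝ}
    (hσ : pf b σ ≠ 0) : Inv σ (invB b σ) := by
  obtain ⟨π, hπ⟩ := exists_inv_of_form ((pf_ne_zero_iff b σ).1 hσ)
  exact hπ.biv_eq b ▸ hπ

theorem inv_invF (b : Module.Basis (Fin (2 * n)) ℝ V) {π : (V →L[ℝ] ℝ) [⋀^Fin 2]→L[ℝ] ℝ}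
    (hπ : pf (dualB b) π ≠ 0) : Inv (invF b π) π := by
  obtain ⟨σ, hσ⟩ := exists_inv_of_biv ((pf_ne_zero_iff (dualB b) π).1 hπ)
  exact hσ.form_eq b ▸ hσ

/-- The product of the Pfaffians of a form and of its inverse is a universal constant. -/
theorem Inv.pf_mul_pf {σ : V [⋀^Fin 2]→L[ℝ] ℝ} {π : (V →L[ℝ] ℝ) [⋀^Fin 2]→L[ℝ] ℝ}
    (h : Inv σ π) (b : Module.Basis (Fin (2 * n)) ℝ V) :
    pf b σ * pf (dualB b) π = (-1) ^ n * stdPf n ^ 2 := by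
  have hV : Module.finrank ℝ V = 2 * n := by simpa using Module.finrank_eq_card_basis b
  obtain ⟨v, hv⟩ := exists_symplectic_family n σ.toAlternatingMap h.nondeg_form hV
  have hv' : ∀ p q, σ ![v p, v q] = stdPairing p q := hv
  -- the covectors dual to the symplectic family
  let u : Fin n × Fin 2 → V := fun p => if p.2 = 0 then -v (p.1, 1) else v (p.1, 0)
  let α : Fin n × Fin 2 → V →L[ℝ] ℝ := fun p =>
    LinearMap.toContinuousLinearMap (bil σ.toAlternatingMap (u p))
  have hα : ∀ p w, α p w = σ ![u p, w] := fun p w => rfl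
  have hneg : ∀ x y : V, σ ![-x, y] = -σ ![x, y] := fun x y => by
    change bil σ.toAlternatingMap (-x) y = - bil σ.toAlternatingMap x y
    simp only [map_neg, LinearMap.neg_apply]
  have hαv : ∀ p q, α p (v q) = if p = q then 1 else 0 := by
    rintro ⟨i, a⟩ ⟨j, c⟩
    rw [hα]
    fin_cases a <;> fin_cases c <;> simp [u, hneg, hv', stdPairing, neg_ite, eq_comm]
  have hπα : ∀ p q, π ![α p, α q] = (-1) * stdPairing p q := by
    rintro ⟨i, a⟩ ⟨j, c⟩
    rw [h (u (i, a)) (α (i, a)) (α (j, c)) (hα _)]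
    fin_cases a <;> fin_cases c <;> simp [u, hαv, stdPairing, eq_comm]
    split_ifs <;> simp
  have hli : LinearIndependent ℝ v := by
    rw [Fintype.linearIndependent_iff]
    intro g hg p
    have := congrArg (α p) hg
    simpa [map_sum, hαv] using this
  let B' : Module.Basis (Fin n × Fin 2) ℝ V :=
    basisOfLinearIndependentOfCardEqFinrank' v hli (by rw [hV]; simp; ring)
  let B : Module.Basis (Fin (2 * n)) ℝ V := B'.reindex (pairEquiv n).symm
  have hB : (B : Fin (2 * n) → V) = v ∘ pairEquiv n := by
    funext i; simp [B, B']
  have hBd : (dualB B : Fin (2 * n) → V →L[ℝ] ℝ) = α ∘ pairEquiv n := by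
    funext i
    refine (dualB B).ext_elem fun j => ?_
    rw [dualB_repr, dualB_repr, dualB_apply, coordL_apply, Module.Basis.repr_self, hB,
      Function.comp_apply, Function.comp_apply, hαv]
    simp [Finsupp.single_apply, eq_comm]
  have h1 : pf B σ = stdPf n := by
    rw [pf, hB, wedgePow_of_pairing _ n v 1 (by simpa using hv)]; simp
  have h2 : pf (dualB B) π = (-1) ^ n * stdPf n := by
    rw [pf, hBd, wedgePow_of_pairing _ n α (-1) hπα]
  have h3 : pf b σ = B.det b * pf B σ := by
    have := congrArg (fun f => f b) ((wedgePow σ.toAlternatingMap n).eq_smul_basis_det B)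
    simp only [AlternatingMap.smul_apply, smul_eq_mul] at this
    rw [pf, this, pf]; ring
  have h4 : pf (dualB b) π = (dualB B).det (dualB b) * pf (dualB B) π := by
    have := congrArg (fun f => f (dualB b))
      ((wedgePow π.toAlternatingMap n).eq_smul_basis_det (dualB B))
    simp only [AlternatingMap.smul_apply, smul_eq_mul] at this
    rw [pf, this, pf]; ring
  -- the base changes of a basis and of its dual basis are contragredient
  have h5 : B.det b * (dualB B).det (dualB b) = 1 := by
    have : (dualB B).toMatrix (dualB b) = (b.toMatrix B).transpose := by
      ext i j
      rw [Module.Basis.toMatrix_apply, dualB_repr, dualB_apply, coordL_apply,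
        Matrix.transpose_apply, Module.Basis.toMatrix_apply]
    rw [Module.Basis.det_apply, Module.Basis.det_apply, this, Matrix.det_transpose,
      ← Matrix.det_mul, Module.Basis.toMatrix_mul_toMatrix_flip, Matrix.det_one]
  rw [h3, h4, h1, h2]
  linear_combination ((-1) ^ n * stdPf n ^ 2) * h5

/-- Inverses are preserved by linear isomorphisms. -/
theorem Inv.comp {σ : V [⋀^Fin 2]→L[ℝ] ℝ} {π : (V →L[ℝ] ℝ) [⋀^Fin 2]→L[ℝ] ℝ}
    (h : Inv σ π) (A B : V →L[ℝ] V) (hAB : ∀ v, A (B v) = v) (hBA : ∀ v, B (A v) = v) :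
    Inv (σ.compContinuousLinearMap B)
      (π.compContinuousLinearMap (ContinuousLinearMap.precomp ℝ A)) := by
  intro v α β hα
  rw [form_comp_apply, h (B v) _ _ fun w => ?_]
  · change β (A (B v)) = β v
    rw [hAB]
  · change α (A w) = _
    rw [hα, form_comp_apply, hBA]

end Pfaffian

/-! ### Calculus near a point of a regular hypersurface -/

section SmoothNear

variable {V : Type*} [NormedAddCommGroup V] [NormedSpace ℝ V]
  {F : Type*} [NormedAddCommGroup F] [NormedSpace ℝ F]
  {F' : Type*} [NormedAddCommGroup F'] [NormedSpace ℝ F']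

/-- `f` is smooth on a neighbourhood of `p`. -/
def SmoothNear (f : V → F) (p : V) : Prop := ∀ᶠ y in 𝓝 p, ContDiffAt ℝ ∞ f y

theorem SmoothNear.contDiffAt {f : V → F} {p : V} (hf : SmoothNear f p) : ContDiffAt ℝ ∞ f p :=
  hf.self_of_nhds

theorem SmoothNear.continuousAt {f : V → F} {p : V} (hf : SmoothNear f p) : ContinuousAt f p :=
  hf.contDiffAt.continuousAt

theorem SmoothNear.eventually {f : V → F} {p : V} (hf : SmoothNear f p) :
    ∀ᶠ y in 𝓝 p, SmoothNear f y := eventually_eventually_nhds.2 hf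

protected theorem SmoothNear.congr {f g : V → F} {p : V} (hf : SmoothNear f p)
    (h : ∀ᶠ y in 𝓝 p, g y = f y) : SmoothNear g p := by
  filter_upwards [hf, eventually_eventually_nhds.2 h] with y h1 h2
  exact h1.congr_of_eventuallyEq h2

theorem ContDiff.smoothNear {f : V → F} (hf : ContDiff ℝ ∞ f) (p : V) : SmoothNear f p :=
  .of_forall fun _ => hf.contDiffAt

theorem smoothNear_const (c : F) (p : V) : SmoothNear (fun _ => c) p :=
  .of_forall fun _ => contDiffAt_const

protected theorem SmoothNear.comp {g : F → F'} {f : V → F} {p : V} (hg : SmoothNear g (f p))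
    (hf : SmoothNear f p) : SmoothNear (fun y => g (f y)) p := by
  filter_upwards [hf, hf.continuousAt.eventually hg] with y h1 h2
  exact h2.comp y h1

protected theorem SmoothNear.fderiv {f : V → F} {p : V} (hf : SmoothNear f p) :
    SmoothNear (fderiv ℝ f) p := by
  filter_upwards [hf] with y h using h.fderiv_right (by simp)

protected theorem SmoothNear.add {f g : V → F} {p : V} (hf : SmoothNear f p) (hg : SmoothNear g p) :
    SmoothNear (fun y => f y + g y) p := by
  filter_upwards [hf, hg] with y h1 h2 using h1.add h2

protected theorem SmoothNear.sub {f g : V → F} {p : V} (hf : SmoothNear f p) (hg : SmoothNear g p) :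
    SmoothNear (fun y => f y - g y) p := by
  filter_upwards [hf, hg] with y h1 h2 using h1.sub h2

protected theorem SmoothNear.smul {f : V → ℝ} {g : V → F} {p : V} (hf : SmoothNear f p)
    (hg : SmoothNear g p) : SmoothNear (fun y => f y • g y) p := by
  filter_upwards [hf, hg] with y h1 h2 using h1.smul h2

protected theorem SmoothNear.mul {f g : V → ℝ} {p : V} (hf : SmoothNear f p)
    (hg : SmoothNear g p) : SmoothNear (fun y => f y * g y) p := by
  filter_upwards [hf, hg] with y h1 h2 using h1.mul h2

protected theorem SmoothNear.pow {f : V → ℝ} {p : V} (hf : SmoothNear f p) (k : ℕ) :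
    SmoothNear (fun y => f y ^ k) p := by
  filter_upwards [hf] with y h1 using h1.pow k

protected theorem SmoothNear.inv {f : V → ℝ} {p : V} (hf : SmoothNear f p) (h0 : f p ≠ 0) :
    SmoothNear (fun y => (f y)⁻¹) p := by
  filter_upwards [hf, hf.continuousAt.eventually_ne h0] with y h1 h2 using h1.inv h2

protected theorem SmoothNear.clm_apply {f : V → F →L[ℝ] F'} {g : V → F} {p : V}
    (hf : SmoothNear f p) (hg : SmoothNear g p) : SmoothNear (fun y => f y (g y)) p := by
  filter_upwards [hf, hg] with y h1 h2 using h1.clm_apply h2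

protected theorem SmoothNear.clm_comp {G : Type*} [NormedAddCommGroup G] [NormedSpace ℝ G]
    {f : V → F →L[ℝ] F'} {g : V → G →L[ℝ] F} {p : V} (hf : SmoothNear f p)
    (hg : SmoothNear g p) : SmoothNear (fun y => (f y).comp (g y)) p := by
  filter_upwards [hf, hg] with y h1 h2 using h1.clm_comp h2

/-- If `|f| ≥ δ |g|` near a common zero of `f` and `g`, and the derivative of `g` there is
non-zero, then so is the derivative of `f`. -/
theorem fderiv_ne_zero_of_le {f g : V → ℝ} {p : V} {δ : ℝ} (hδ : 0 < δ)
    (h : ∀ᶠ y in 𝓝 p, δ * |g y| ≤ |f y|) (hf0 : f p = 0) (hg0 : g p = 0)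
    (hf : DifferentiableAt ℝ f p) (hg : fderiv ℝ g p ≠ 0) : fderiv ℝ f p ≠ 0 := by
  intro hf'
  apply hg
  have h1 := hf.hasFDerivAt
  rw [hf', hasFDerivAt_iff_isLittleO] at h1
  have h2 : HasFDerivAt g (0 : V →L[ℝ] ℝ) p := by
    rw [hasFDerivAt_iff_isLittleO]
    simp only [hf0, hg0, sub_zero, zero_apply] at h1 ⊢
    refine Asymptotics.IsBigO.trans_isLittleO ?_ h1
    refine Asymptotics.IsBigO.of_bound δ⁻¹ ?_
    filter_upwards [h] with y hy
    rw [Real.norm_eq_abs, Real.norm_eq_abs, inv_mul_eq_div, le_div_iff₀ hδ]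
    linarith
  exact h2.fderiv

/-- The complement of a regular hypersurface `s = 0` accumulates at each of its points. -/
theorem neBot_nhdsWithin_ne_zero {s : V → ℝ} {p : V} (hs : fderiv ℝ s p ≠ 0) :
    (𝓝[{y | s y ≠ 0}] p).NeBot := by
  rw [← mem_closure_iff_nhdsWithin_neBot, mem_closure_iff_frequently]
  intro h
  apply hs
  have h' : ∀ᶠ y in 𝓝 p, s y = 0 := by
    filter_upwards [h] with y hy
    simpa using hy
  have h2 : s =ᶠ[𝓝 p] fun _ => (0 : ℝ) := h'
  rw [h2.fderiv_eq]
  simp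

/-- Two maps which are continuous at a point of a regular hypersurface and agree off the
hypersurface agree at that point. -/
theorem eq_of_eq_off {Y : Type*} [TopologicalSpace Y] [T2Space Y] {s : V → ℝ} {p : V}
    (hs : fderiv ℝ s p ≠ 0) {f g : V → Y} (hf : ContinuousAt f p) (hg : ContinuousAt g p)
    (h : ∀ᶠ y in 𝓝 p, s y ≠ 0 → f y = g y) : f p = g p := by
  have := neBot_nhdsWithin_ne_zero hs
  refine tendsto_nhds_unique_of_eventuallyEq (l := 𝓝[{y | s y ≠ 0}] p)
    (hf.mono_left nhdsWithin_le_nhds) (hg.mono_left nhdsWithin_le_nhds) ?_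
  exact eventually_nhdsWithin_iff.2 h

theorem eventually_eq_of_eq_off {Y : Type*} [TopologicalSpace Y] [T2Space Y] {s : V → ℝ} {p : V}
    (hs : ∀ᶠ y in 𝓝 p, fderiv ℝ s y ≠ 0) {f g : V → Y} (hf : ∀ᶠ y in 𝓝 p, ContinuousAt f y)
    (hg : ∀ᶠ y in 𝓝 p, ContinuousAt g y) (h : ∀ᶠ y in 𝓝 p, s y ≠ 0 → f y = g y) :
    ∀ᶠ y in 𝓝 p, f y = g y := by
  filter_upwards [hs, hf, hg, eventually_eventually_nhds.2 h] with y h1 h2 h3 h4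
  exact eq_of_eq_off h1 h2 h3 h4

theorem SmoothNear.eventually_continuousAt {f : V → F} {p : V} (hf : SmoothNear f p) :
    ∀ᶠ y in 𝓝 p, ContinuousAt f y := by
  filter_upwards [hf] with y h using h.continuousAt

theorem SmoothNear.eventually_fderiv_ne_zero {s : V → ℝ} {p : V} (hs : SmoothNear s p)
    (h : fderiv ℝ s p ≠ 0) : ∀ᶠ y in 𝓝 p, fderiv ℝ s y ≠ 0 :=
  hs.fderiv.continuousAt.eventually_ne h

end SmoothNear

section Parametric

set_option linter.unusedSectionVars false

universe u

variable {W : Type u} [NormedAddCommGroup W] [NormedSpace ℝ W] [FiniteDimensional ℝ W]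

/-- Differentiation under the integral sign. -/
theorem hasFDerivAt_integral_param {G : Type u} [NormedAddCommGroup G] [NormedSpace ℝ G]
    [CompleteSpace G] {f : W × ℝ → G} (hf : ContDiff ℝ ∞ f) (w : W) :
    HasFDerivAt (fun w => ∫ t in (0 : ℝ)..1, f (w, t))
      (∫ t in (0 : ℝ)..1, (fderiv ℝ f (w, t)).comp (ContinuousLinearMap.inl ℝ W ℝ)) w := by
  have hf' : ContDiff ℝ ∞ fun q : W × ℝ => (fderiv ℝ f q).comp (ContinuousLinearMap.inl ℝ W ℝ) :=
    (hf.fderiv_right (by simp)).clm_comp contDiff_const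
  have hK : IsCompact (Metric.closedBall w 1 ×ˢ Set.Icc (0 : ℝ) 1) :=
    (isCompact_closedBall w 1).prod isCompact_Icc
  obtain ⟨C, hC⟩ := hK.exists_bound_of_continuousOn hf'.continuous.continuousOn
  refine intervalIntegral.hasFDerivAt_integral_of_dominated_of_fderiv_le
    (F := fun w t => f (w, t))
    (F' := fun w t => (fderiv ℝ f (w, t)).comp (ContinuousLinearMap.inl ℝ W ℝ))
    (bound := fun _ => C) (Metric.closedBall_mem_nhds w one_pos) ?_ ?_ ?_ ?_ ?_ ?_
  · refine .of_forall fun x => Continuous.aestronglyMeasurable ?_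
    exact hf.continuous.comp (by fun_prop)
  · exact (hf.continuous.comp (by fun_prop : Continuous fun t : ℝ => (w, t))).intervalIntegrable _ _
  · exact (hf'.continuous.comp
      (by fun_prop : Continuous fun t : ℝ => (w, t))).aestronglyMeasurable
  · refine .of_forall fun t ht x hx => hC (x, t) ⟨hx, ?_⟩
    rw [Set.uIoc_of_le zero_le_one] at ht
    exact ⟨ht.1.le, ht.2⟩
  · exact intervalIntegrable_const
  · refine .of_forall fun t _ x _ => ?_
    have h1 : HasFDerivAt f (fderiv ℝ f (x, t)) (x, t) :=
      (hf.differentiable (by simp) (x, t)).hasFDerivAt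
    exact h1.comp x (hasFDerivAt_prodMk_left x t)

theorem contDiff_integral_param_nat (n : ℕ) : ∀ {G : Type u} [NormedAddCommGroup G]
    [NormedSpace ℝ G] [CompleteSpace G] {f : W × ℝ → G}, ContDiff ℝ ∞ f →
    ContDiff ℝ n (fun w => ∫ t in (0 : ℝ)..1, f (w, t)) := by
  induction n with
  | zero =>
    intro G _ _ _ f hf
    rw [Nat.cast_zero, contDiff_zero]
    exact intervalIntegral.continuous_parametric_intervalIntegral_of_continuous'
      (f := fun w t => f (w, t)) hf.continuous 0 1
  | succ n ih =>
    intro G _ _ _ f hf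
    rw [Nat.cast_succ, contDiff_succ_iff_hasFDerivAt]
    refine ⟨_, ?_, fun w => hasFDerivAt_integral_param hf w⟩
    exact ih (f := fun q : W × ℝ => (fderiv ℝ f q).comp (ContinuousLinearMap.inl ℝ W ℝ))
      ((hf.fderiv_right (by simp)).clm_comp contDiff_const)

theorem contDiff_integral_param {G : Type u} [NormedAddCommGroup G]
    [NormedSpace ℝ G] [CompleteSpace G] {f : W × ℝ → G} (hf : ContDiff ℝ ∞ f) :
    ContDiff ℝ ∞ (fun w => ∫ t in (0 : ℝ)..1, f (w, t)) :=
  contDiff_infty.2 fun n => contDiff_integral_param_nat n hf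

/-- Hadamard's lemma for a hyperplane. -/
theorem exists_eq_linear_smul {G : Type u} [NormedAddCommGroup G] [NormedSpace ℝ G]
    [CompleteSpace G] {f : W → G} {q : W} (hf : SmoothNear f q) {ℓ : W →L[ℝ] ℝ} {u : W}
    (hu : ℓ u = 1) (h0 : ∀ᶠ y in 𝓝 q, ℓ y = 0 → f y = 0) :
    ∃ g : W → G, SmoothNear g q ∧ ∀ᶠ y in 𝓝 q, f y = ℓ y • g y := by
  obtain ⟨ε, hε, hB⟩ := Metric.eventually_nhds_iff_ball.1 (hf.and h0)
  -- cut off so that `f` becomes globally smooth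
  let χ : ContDiffBump q := ⟨ε / 4, ε / 2, by positivity, by linarith⟩
  let f₁ : W → G := fun y => χ y • f y
  have hf₁ : ContDiff ℝ ∞ f₁ := by
    rw [contDiff_iff_contDiffAt]
    intro y
    by_cases hy : y ∈ Metric.ball q ε
    · exact χ.contDiffAt.smul (hB y hy).1
    · have : f₁ =ᶠ[𝓝 y] fun _ => 0 := by
        have h1 : y ∉ tsupport χ := by
          rw [χ.tsupport_eq]
          simp only [Metric.mem_ball, not_lt, Metric.mem_closedBall, not_le] at hy ⊢
          change ε / 2 < dist y q
          linarith
        filter_upwards [notMem_tsupport_iff_eventuallyEq.1 h1] with z hz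
        simp only [f₁, hz, Pi.zero_apply, zero_smul]
      exact contDiffAt_const.congr_of_eventuallyEq this
  have hf₁0 : ∀ y, ℓ y = 0 → f₁ y = 0 := by
    intro y hy
    by_cases hy' : y ∈ Metric.ball q ε
    · simp only [f₁, (hB y hy').2 hy, smul_zero]
    · have : χ y = 0 := by
        refine χ.zero_of_le_dist ?_
        simp only [Metric.mem_ball, not_lt] at hy'
        change ε / 2 ≤ dist y q
        linarith
      simp only [f₁, this, zero_smul]
  -- integrate the derivative of `f₁` in the direction `u`, from the hyperplane `ℓ = 0` up to `y`
  let γ : W × ℝ → W := fun z => z.1 + ((z.2 - 1) * ℓ z.1) • u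
  have hγ : ContDiff ℝ ∞ γ := by
    refine contDiff_fst.add (ContDiff.smul ?_ contDiff_const)
    exact (contDiff_snd.sub contDiff_const).mul (ℓ.contDiff.comp contDiff_fst)
  have hF : ContDiff ℝ ∞ fun z => fderiv ℝ f₁ (γ z) u :=
    ((hf₁.fderiv_right (by simp)).comp hγ).clm_apply contDiff_const
  refine ⟨_, (ContDiff.smoothNear (contDiff_integral_param hF) q), ?_⟩
  have h1 : ∀ᶠ y in 𝓝 q, χ y = 1 := χ.eventuallyEq_one
  filter_upwards [h1] with y hy
  have h2 : f y = f₁ y := by simp only [f₁, hy, one_smul]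
  have h3 : ∀ t : ℝ, HasDerivAt (fun t => f₁ (γ (y, t))) (ℓ y • fderiv ℝ f₁ (γ (y, t)) u) t := by
    intro t
    have h4 : HasDerivAt (fun t => γ (y, t)) (ℓ y • u) t := by
      have : HasDerivAt (fun t : ℝ => (t - 1) * ℓ y) (ℓ y) t := by
        simpa using ((hasDerivAt_id t).sub_const 1).mul_const (ℓ y)
      exact (this.smul_const u).const_add y
    have h5 := ((hf₁.differentiable (by simp)) (γ (y, t))).hasFDerivAt.comp_hasDerivAt t h4
    rwa [map_smul] at h5
  have h6 := intervalIntegral.integral_eq_sub_of_hasDerivAt (a := 0) (b := 1)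
    (fun t _ => h3 t) (Continuous.intervalIntegrable
      ((hF.continuous.comp (by fun_prop : Continuous fun t : ℝ => (y, t))).const_smul (ℓ y)) _ _)
  rw [intervalIntegral.integral_smul] at h6
  rw [h6, h2, hf₁0 (γ (y, 0))]
  · simp [γ]
  · simp [γ, hu]

/-- A regular hypersurface is straightened by a local diffeomorphism. -/
theorem exists_straightening {s : W → ℝ} {p : W} (hs : SmoothNear s p)
    (hds : fderiv ℝ s p ≠ 0) : ∃ (Φ Ψ : W → W) (ℓ : W →L[ℝ] ℝ) (u : W), ℓ u = 1 ∧
      SmoothNear Φ p ∧ SmoothNear Ψ (Φ p) ∧ Ψ (Φ p) = p ∧ (∀ᶠ y in 𝓝 p, Ψ (Φ y) = y) ∧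
      (∀ᶠ w in 𝓝 (Φ p), Φ (Ψ w) = w) ∧ ∀ y, ℓ (Φ y) = s y := by
  set ℓ := fderiv ℝ s p with hℓ
  obtain ⟨v, hv⟩ : ∃ v, ℓ v ≠ 0 := by
    by_contra! h
    exact hds (ContinuousLinearMap.ext h)
  let u := (ℓ v)⁻¹ • v
  have hu : ℓ u = 1 := by simp [u, hv]
  -- `Φ` exchanges `s` for its linear part, so its derivative at `p` is the identity
  let Φ : W → W := fun y => y + (s y - ℓ y) • u
  have hΦ : SmoothNear Φ p :=
    (ContDiff.smoothNear contDiff_id p).add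
      ((hs.sub (ContDiff.smoothNear ℓ.contDiff p)).smul (smoothNear_const u p))
  have hdΦ : HasFDerivAt Φ ((ContinuousLinearEquiv.refl ℝ W : W ≃L[ℝ] W) : W →L[ℝ] W) p := by
    have h1 : HasFDerivAt s ℓ p := (hs.contDiffAt.differentiableAt (by simp)).hasFDerivAt
    have h2 := (hasFDerivAt_id p).add ((h1.sub ℓ.hasFDerivAt).smul_const u)
    rw [sub_self, ContinuousLinearMap.zero_smulRight, add_zero] at h2
    exact h2
  let e := hΦ.contDiffAt.toOpenPartialHomeomorph Φ hdΦ (by simp)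
  have he : ∀ y, e y = Φ y := fun y => rfl
  have hp : p ∈ e.source := hΦ.contDiffAt.mem_toOpenPartialHomeomorph_source hdΦ (by simp)
  have hΦp : Φ p ∈ e.target := e.map_source hp
  have hsymm : e.symm (Φ p) = p := e.left_inv hp
  refine ⟨Φ, e.symm, ℓ, u, hu, hΦ, ?_, hsymm, ?_, ?_, ?_⟩
  · have h1 : ∀ᶠ y in 𝓝 p, fderiv ℝ Φ y ∈ Set.range ((↑) : (W ≃L[ℝ] W) → W →L[ℝ] W) := by
      refine hΦ.fderiv.continuousAt.eventually ?_
      rw [hdΦ.fderiv]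
      exact ContinuousLinearEquiv.nhds _
    have h2 : ContinuousAt e.symm (Φ p) := e.continuousAt_symm hΦp
    have h3 : Filter.Tendsto e.symm (𝓝 (Φ p)) (𝓝 p) := by
      rw [ContinuousAt, hsymm] at h2; exact h2
    filter_upwards [h3.eventually (h1.and hΦ), e.open_target.mem_nhds hΦp] with w hw hwt
    obtain ⟨⟨A, hA⟩, hw2⟩ := hw
    refine e.contDiffAt_symm (f₀' := A) hwt ?_ hw2
    rw [hA]
    exact (hw2.differentiableAt (by simp)).hasFDerivAt
  · filter_upwards [e.open_source.mem_nhds hp] with y hy using e.left_inv hy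
  · filter_upwards [e.open_target.mem_nhds hΦp] with w hw using e.right_inv hw
  · intro y
    simp only [Φ, map_add, map_smul, hu, smul_eq_mul]
    ring

/-- Hadamard's lemma: a smooth map which vanishes on the regular hypersurface `s = 0` is divisible
by `s`. -/
theorem exists_eq_smul_of_eq_zero {G : Type u} [NormedAddCommGroup G] [NormedSpace ℝ G]
    [CompleteSpace G] {f : W → G} {s : W → ℝ} {p : W} (hf : SmoothNear f p) (hs : SmoothNear s p)
    (hds : fderiv ℝ s p ≠ 0) (h0 : ∀ᶠ y in 𝓝 p, s y = 0 → f y = 0) :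
    ∃ g : W → G, SmoothNear g p ∧ ∀ᶠ y in 𝓝 p, f y = s y • g y := by
  obtain ⟨Φ, Ψ, ℓ, u, hu, hΦ, hΨ, hp, h1, h2, h3⟩ := exists_straightening hs hds
  have hΨt : Filter.Tendsto Ψ (𝓝 (Φ p)) (𝓝 p) := by
    have := hΨ.continuousAt; rwa [ContinuousAt, hp] at this
  have hf' : SmoothNear (fun w => f (Ψ w)) (Φ p) := SmoothNear.comp (by rwa [hp]) hΨ
  obtain ⟨g, hg, hfg⟩ := exists_eq_linear_smul hf' hu (by
    filter_upwards [hΨt.eventually h0, h2] with w hw hw2 hw3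
    exact hw (by rw [← h3, hw2, hw3]))
  refine ⟨fun y => g (Φ y), hg.comp hΦ, ?_⟩
  filter_upwards [h1, hΦ.continuousAt.eventually hfg] with y hy1 hy2
  rw [hy1, h3] at hy2
  exact hy2

/-- A local retraction onto a regular hypersurface. -/
theorem exists_retraction {s : W → ℝ} {p : W} (hs : SmoothNear s p)
    (hds : fderiv ℝ s p ≠ 0) (hp0 : s p = 0) : ∃ r : W → W, SmoothNear r p ∧ r p = p ∧
      (∀ᶠ y in 𝓝 p, s (r y) = 0) ∧ ∀ᶠ y in 𝓝 p, s y = 0 → r y = y := by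
  obtain ⟨Φ, Ψ, ℓ, u, hu, hΦ, hΨ, hp, h1, h2, h3⟩ := exists_straightening hs hds
  let ρ : W → W := fun y => Φ y - s y • u
  have hρp : ρ p = Φ p := by simp [ρ, hp0]
  have hρ : SmoothNear ρ p := hΦ.sub (hs.smul (smoothNear_const u p))
  refine ⟨fun y => Ψ (ρ y), SmoothNear.comp (by rwa [hρp]) hρ, ?_, ?_, ?_⟩
  · change Ψ (ρ p) = p
    rw [hρp, hp]
  · have hc : Filter.Tendsto ρ (𝓝 p) (𝓝 (Φ p)) := by
      have := hρ.continuousAt; rwa [ContinuousAt, hρp] at this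
    filter_upwards [hc.eventually h2] with y hy
    rw [← h3, hy]
    simp [ρ, h3, hu]
  · filter_upwards [h1] with y hy h0
    simp only [ρ, h0, zero_smul, sub_zero, hy]

/-- The Poincaré lemma for one-forms near a point. -/
theorem exists_primitive {η : W → W →L[ℝ] ℝ} {p : W} (hη : SmoothNear η p)
    (hd : ∀ᶠ y in 𝓝 p, ∀ v w, fderiv ℝ η y v w = fderiv ℝ η y w v) :
    ∃ G : W → ℝ, SmoothNear G p ∧ ∀ᶠ y in 𝓝 p, HasFDerivAt G (η y) y := by
  obtain ⟨ε, hε, hB⟩ := Metric.eventually_nhds_iff_ball.1 (hη.and hd)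
  obtain ⟨G, hG⟩ := (convex_ball p ε).exists_forall_hasFDerivAt_of_fderiv_symmetric
    Metric.isOpen_ball
    (fun y hy => ((hB y hy).1.differentiableAt (by simp)).differentiableWithinAt)
    (fun y hy => (hB y hy).2)
  have h1 : ∀ᶠ y in 𝓝 p, y ∈ Metric.ball p ε := Metric.ball_mem_nhds p hε
  refine ⟨G, ?_, h1.mono fun y hy => hG y hy⟩
  have h2 : ContDiffOn ℝ (∞ + 1) G (Metric.ball p ε) := by
    rw [contDiffOn_succ_iff_hasFDerivWithinAt_of_uniqueDiffOn Metric.isOpen_ball.uniqueDiffOn]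
    refine ⟨by simp, η, fun y hy => (hB y hy).1.contDiffWithinAt,
      fun y hy => (hG y hy).hasFDerivWithinAt⟩
  filter_upwards [h1] with y hy
  exact (h2.of_le (by simp)).contDiffAt (Metric.isOpen_ball.mem_nhds hy)

end Parametric

/-! ### The exterior derivative of two-forms and the Jacobi identity -/

section FormCalculus

set_option linter.unusedSectionVars false

variable {V : Type*} [NormedAddCommGroup V] [NormedSpace ℝ V] [FiniteDimensional ℝ V] {n : ℕ}
  {F : Type*} [NormedAddCommGroup F] [NormedSpace ℝ F]

theorem form_congr {V : Type*} [AddCommGroup V] [Module ℝ V] [TopologicalSpace V]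
    (a : V [⋀^Fin 2]→L[ℝ] ℝ) (v : Fin 2 → V) : a v = a ![v 0, v 1] := by
  rw [← vec2 v]

theorem form_swap {V : Type*} [AddCommGroup V] [Module ℝ V] [TopologicalSpace V]
    (a : V [⋀^Fin 2]→L[ℝ] ℝ) (x y : V) : a ![x, y] = -a ![y, x] :=
  two_form_swap a.toAlternatingMap x y

/-- The covector `a(u, ·)`. -/
def contract (a : V [⋀^Fin 2]→L[ℝ] ℝ) (u : V) : V →L[ℝ] ℝ :=
  LinearMap.toContinuousLinearMap (bil a.toAlternatingMap u)

@[simp] theorem contract_apply (a : V [⋀^Fin 2]→L[ℝ] ℝ) (u w : V) :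
    contract a u w = a ![u, w] := rfl

theorem contDiffAt_covector {k : WithTop ℕ∞} {f : F → V →L[ℝ] ℝ} {p : F}
    (h : ∀ v, ContDiffAt ℝ k (fun y => f y v) p) : ContDiffAt ℝ k f p := by
  let b := Module.finBasis ℝ V
  have : f = fun y => ∑ i, f y (b i) • coordL b i := by
    funext y
    refine ContinuousLinearMap.ext fun v => ?_
    conv_lhs => rw [← b.sum_repr v]
    simp only [map_sum, map_smul, sum_apply, smul_apply,
      coordL_apply, smul_eq_mul]
    exact Finset.sum_congr rfl fun i _ => mul_comm _ _
  rw [this]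
  exact ContDiffAt.sum fun i _ => (h (b i)).smul contDiffAt_const

theorem fderiv_form_apply {a : F → V [⋀^Fin 2]→L[ℝ] ℝ} {v w : F → V} {p : F}
    (ha : DifferentiableAt ℝ a p) (hv : DifferentiableAt ℝ v p) (hw : DifferentiableAt ℝ w p)
    (d : F) : fderiv ℝ (fun y => a y ![v y, w y]) p d =
      fderiv ℝ a p d ![v p, w p] + a p ![fderiv ℝ v p d, w p] + a p ![v p, fderiv ℝ w p d] := by
  have h := fderiv_continuousAlternatingMap_apply_apply (f := a) (g := ![v, w]) ha
    (fun i => by fin_cases i <;> assumption) d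
  have h1 : (fun y => a y ![v y, w y]) = fun y => a y (![v, w] · y) := by
    funext y; congr 1; funext i; fin_cases i <;> rfl
  rw [h1, h, Fin.sum_univ_two, form_congr (fderiv ℝ a p d), form_congr (a p), add_assoc]
  congr 2
  rw [form_congr (a p)]
  rfl

theorem fderiv_form_const {a : F → V [⋀^Fin 2]→L[ℝ] ℝ} {p : F}
    (ha : DifferentiableAt ℝ a p) (v w : V) (d : F) :
    fderiv ℝ (fun y => a y ![v, w]) p d = fderiv ℝ a p d ![v, w] := by
  rw [fderiv_continuousAlternatingMap_apply_const ha]; rfl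

/-- The value of the exterior derivative of a two-form on three vectors. -/
def d3 (R : V → V [⋀^Fin 2]→L[ℝ] ℝ) (y a b c : V) : ℝ :=
  fderiv ℝ R y a ![b, c] - fderiv ℝ R y b ![a, c] + fderiv ℝ R y c ![a, b]

theorem extDeriv_apply_three (R : V → V [⋀^Fin 2]→L[ℝ] ℝ) (y a b c : V) :
    extDeriv R y ![a, b, c] = d3 R y a b c := by
  rw [extDeriv, ContinuousAlternatingMap.alternatizeUncurryFin_apply, Fin.sum_univ_three, d3]
  have h0 : (0 : Fin 3).removeNth ![a, b, c] = ![b, c] := by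
    funext i; fin_cases i <;> rfl
  have h1 : (1 : Fin 3).removeNth ![a, b, c] = ![a, c] := by
    funext i; fin_cases i <;> rfl
  have h2 : (2 : Fin 3).removeNth ![a, b, c] = ![a, b] := by
    funext i; fin_cases i <;> rfl
  rw [h0, h1, h2]
  simp
  ring

theorem extDeriv_eq_zero_iff (R : V → V [⋀^Fin 2]→L[ℝ] ℝ) (y : V) :
    extDeriv R y = 0 ↔ ∀ a b c, d3 R y a b c = 0 := by
  refine ⟨fun h a b c => by rw [← extDeriv_apply_three, h]; rfl, fun h => ?_⟩
  ext v
  have : v = ![v 0, v 1, v 2] := by funext i; fin_cases i <;> rfl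
  rw [this, extDeriv_apply_three, h]
  rfl

/-- The value of `φ ∧ R` on three vectors. -/
def wed3 (φ : V →L[ℝ] ℝ) (R : V [⋀^Fin 2]→L[ℝ] ℝ) (a b c : V) : ℝ :=
  φ a * R ![b, c] - φ b * R ![a, c] + φ c * R ![a, b]

theorem d3_congr {R R' : V → V [⋀^Fin 2]→L[ℝ] ℝ} {y : V} (h : ∀ᶠ z in 𝓝 y, R z = R' z)
    (a b c : V) : d3 R y a b c = d3 R' y a b c := by
  have : R =ᶠ[𝓝 y] R' := h
  simp only [d3, this.fderiv_eq]

theorem d3_add {R R' : V → V [⋀^Fin 2]→L[ℝ] ℝ} {y : V} (hR : DifferentiableAt ℝ R y)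
    (hR' : DifferentiableAt ℝ R' y) (a b c : V) :
    d3 (fun z => R z + R' z) y a b c = d3 R y a b c + d3 R' y a b c := by
  simp only [d3, fderiv_fun_add hR hR', add_apply,
    ContinuousAlternatingMap.add_apply]
  ring

theorem d3_smul {f : V → ℝ} {R : V → V [⋀^Fin 2]→L[ℝ] ℝ} {y : V} (hf : DifferentiableAt ℝ f y)
    (hR : DifferentiableAt ℝ R y) (a b c : V) :
    d3 (fun z => f z • R z) y a b c = f y * d3 R y a b c + wed3 (fderiv ℝ f y) (R y) a b c := by
  simp only [d3, wed3, fderiv_fun_smul hf hR, add_apply,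
    ContinuousAlternatingMap.add_apply, smul_apply,
    ContinuousAlternatingMap.smul_apply, ContinuousLinearMap.smulRight_apply, smul_eq_mul]
  ring

/-- The value of the exterior derivative of a one-form on two vectors. -/
def d2 (θ : V → V →L[ℝ] ℝ) (y a b : V) : ℝ := fderiv ℝ θ y a b - fderiv ℝ θ y b a

theorem differentiableAt_wed {φ θ : F → V →L[ℝ] ℝ} {y : F} (hφ : DifferentiableAt ℝ φ y)
    (hθ : DifferentiableAt ℝ θ y) : DifferentiableAt ℝ (fun z => wed (φ z) (θ z)) y := by
  let b := Module.finBasis ℝ V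
  have : (fun z => wed (φ z) (θ z)) = fun z => ∑ i, ∑ j,
      ((φ z (b i) * θ z (b j) - φ z (b j) * θ z (b i)) / 2) • wed (coordL b i) (coordL b j) := by
    funext z
    conv_lhs => rw [← formOf_eq b (wed (φ z) (θ z))]
    simp [formOf]
  rw [this]
  fun_prop

theorem fderiv_wed {φ θ : F → V →L[ℝ] ℝ} {y : F} (hφ : DifferentiableAt ℝ φ y)
    (hθ : DifferentiableAt ℝ θ y) (d : F) (a b : V) :
    fderiv ℝ (fun z => wed (φ z) (θ z)) y d ![a, b] =
      fderiv ℝ φ y d a * θ y b + φ y a * fderiv ℝ θ y d b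
        - fderiv ℝ φ y d b * θ y a - φ y b * fderiv ℝ θ y d a := by
  rw [← fderiv_form_const (differentiableAt_wed hφ hθ)]
  simp only [wed_apply, Matrix.cons_val_zero, Matrix.cons_val_one]
  have e : ∀ (ψ : F → V →L[ℝ] ℝ) (v : V), DifferentiableAt ℝ ψ y →
      HasFDerivAt (fun z => ψ z v) ((fderiv ℝ ψ y).flip v) y := fun ψ v hψ => by
    simpa using hψ.hasFDerivAt.clm_apply (hasFDerivAt_const v y)
  have h := (((e φ a hφ).mul (e θ b hθ)).sub ((e φ b hφ).mul (e θ a hθ))).fderiv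
  rw [show (fun z => φ z a * θ z b - φ z b * θ z a) =
    ((fun z => φ z a) * (fun z => θ z b) - (fun z => φ z b) * fun z => θ z a) from rfl, h]
  simp
  ring

theorem d3_wed {φ θ : V → V →L[ℝ] ℝ} {y : V} (hφ : DifferentiableAt ℝ φ y)
    (hθ : DifferentiableAt ℝ θ y) (a b c : V) :
    d3 (fun z => wed (φ z) (θ z)) y a b c =
      d2 φ y a b * θ y c - d2 φ y a c * θ y b + d2 φ y b c * θ y a
        - (φ y a * d2 θ y b c - φ y b * d2 θ y a c + φ y c * d2 θ y a b) := by
  simp only [d3, d2, fderiv_wed hφ hθ]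
  ring

theorem fderiv_fderiv_symm {f : V → F} {y : V} (hf : ContDiffAt ℝ ∞ f y) (a b : V) :
    fderiv ℝ (fderiv ℝ f) y a b = fderiv ℝ (fderiv ℝ f) y b a := by
  refine (hf.isSymmSndFDerivAt ?_).eq a b
  rw [minSmoothness_of_isRCLikeNormedField]
  exact WithTop.coe_le_coe.2 le_top

theorem d2_fderiv {f : V → ℝ} {y : V} (hf : ContDiffAt ℝ ∞ f y) (a b : V) :
    d2 (fderiv ℝ f) y a b = 0 :=
  sub_eq_zero.2 (fderiv_fderiv_symm hf a b)

/-- Adding `f dh ∧ dG` with `df` proportional to `dh` does not change the exterior derivative. -/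
theorem d3_add_smul_wed {σ : V → V [⋀^Fin 2]→L[ℝ] ℝ} {f h G : V → ℝ} {y : V}
    (hσ : DifferentiableAt ℝ σ y) (hf : DifferentiableAt ℝ f y) (hh : ContDiffAt ℝ ∞ h y)
    (hG : ContDiffAt ℝ ∞ G y) {t : ℝ} (hfh : fderiv ℝ f y = t • fderiv ℝ h y) (a b c : V) :
    d3 (fun z => σ z + f z • wed (fderiv ℝ h z) (fderiv ℝ G z)) y a b c = d3 σ y a b c := by
  have hh' : DifferentiableAt ℝ (fderiv ℝ h) y :=
    (hh.fderiv_right (m := ∞) (by simp)).differentiableAt (by simp)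
  have hG' : DifferentiableAt ℝ (fderiv ℝ G) y :=
    (hG.fderiv_right (m := ∞) (by simp)).differentiableAt (by simp)
  rw [d3_add hσ (hf.fun_smul (differentiableAt_wed hh' hG')),
    d3_smul hf (differentiableAt_wed hh' hG'), d3_wed hh' hG']
  simp only [d2_fderiv hh, d2_fderiv hG, wed3, hfh, wed_apply, smul_apply,
    smul_eq_mul, Matrix.cons_val_zero, Matrix.cons_val_one]
  ring

/-- The pullback of a one-form has the pulled back exterior derivative. -/
theorem d2_pullback {W : Type*} [NormedAddCommGroup W] [NormedSpace ℝ W] [FiniteDimensional ℝ W]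
    {θ : V → V →L[ℝ] ℝ} {r : W → V} {y : W} (hθ : DifferentiableAt ℝ θ (r y))
    (hr : ContDiffAt ℝ ∞ r y) (a b : W) :
    d2 (fun z => (θ (r z)).comp (fderiv ℝ r z)) y a b =
      d2 θ (r y) (fderiv ℝ r y a) (fderiv ℝ r y b) := by
  have hr' : DifferentiableAt ℝ (fderiv ℝ r) y :=
    (hr.fderiv_right (m := ∞) (by simp)).differentiableAt (by simp)
  have h1 : HasFDerivAt (fun z => θ (r z)) ((fderiv ℝ θ (r y)).comp (fderiv ℝ r y)) y :=
    hθ.hasFDerivAt.comp y (hr.differentiableAt (by simp)).hasFDerivAt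
  have h2 := (h1.clm_comp hr'.hasFDerivAt).fderiv
  have hs := fderiv_fderiv_symm hr a b
  simp only [d2, h2, add_apply, ContinuousLinearMap.comp_apply,
    ContinuousLinearMap.compL_apply, ContinuousLinearMap.flip_apply, hs]
  ring

/-- A linear form on the dual space is the evaluation at a vector. -/
theorem exists_dual_eval (Λ : (V →L[ℝ] ℝ) →ₗ[ℝ] ℝ) : ∃ X : V, ∀ β, Λ β = β X := by
  let b := Module.finBasis ℝ V
  refine ⟨∑ i, Λ (dualB b i) • b i, fun β => ?_⟩
  conv_lhs => rw [← (dualB b).sum_repr β]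
  simp only [map_sum, map_smul, dualB_repr, smul_eq_mul]
  exact Finset.sum_congr rfl fun i _ => mul_comm _ _

/-- The Jacobi identity at `y` for the brackets of functions with constant differentials. -/
def JacobiAt (π : V → (V →L[ℝ] ℝ) [⋀^Fin 2]→L[ℝ] ℝ) (y : V) : Prop :=
  ∀ α β γ : V →L[ℝ] ℝ, π y ![α, fderiv ℝ (fun z => π z ![β, γ]) y]
    + π y ![β, fderiv ℝ (fun z => π z ![γ, α]) y]
    + π y ![γ, fderiv ℝ (fun z => π z ![α, β]) y] = 0

/-- The terms with second derivatives in the Jacobi identity cancel. -/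
theorem JacobiAt.bracket {π : V → (V →L[ℝ] ℝ) [⋀^Fin 2]→L[ℝ] ℝ} {y : V} (hJ : JacobiAt π y)
    (hπ : DifferentiableAt ℝ π y) {f g h : V → ℝ} (hf : ContDiffAt ℝ ∞ f y)
    (hg : ContDiffAt ℝ ∞ g y) (hh : ContDiffAt ℝ ∞ h y) :
    π y ![fderiv ℝ f y, fderiv ℝ (fun z => π z ![fderiv ℝ g z, fderiv ℝ h z]) y]
    + π y ![fderiv ℝ g y, fderiv ℝ (fun z => π z ![fderiv ℝ h z, fderiv ℝ f z]) y]
    + π y ![fderiv ℝ h y, fderiv ℝ (fun z => π z ![fderiv ℝ f z, fderiv ℝ g z]) y] = 0 := by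
  have hX : ∀ α : V →L[ℝ] ℝ, ∃ X : V, ∀ β, π y ![α, β] = β X := fun α =>
    exists_dual_eval (bil (π y).toAlternatingMap α)
  have hd : ∀ {k : V → ℝ}, ContDiffAt ℝ ∞ k y → DifferentiableAt ℝ (fderiv ℝ k) y := fun hk =>
    (hk.fderiv_right (m := ∞) (by simp)).differentiableAt (by simp)
  have hs : ∀ {k : V → ℝ}, ContDiffAt ℝ ∞ k y → ∀ a b, fderiv ℝ (fderiv ℝ k) y a b =
      fderiv ℝ (fderiv ℝ k) y b a := fun hk a b => fderiv_fderiv_symm hk a b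
  obtain ⟨X, hX1⟩ := hX (fderiv ℝ f y)
  obtain ⟨Y, hY1⟩ := hX (fderiv ℝ g y)
  obtain ⟨T, hT1⟩ := hX (fderiv ℝ h y)
  have h0 := hJ (fderiv ℝ f y) (fderiv ℝ g y) (fderiv ℝ h y)
  rw [hX1, hY1, hT1, fderiv_form_const hπ, fderiv_form_const hπ, fderiv_form_const hπ] at h0
  rw [hX1, hY1, hT1, fderiv_form_apply hπ (hd hg) (hd hh), fderiv_form_apply hπ (hd hh) (hd hf),
    fderiv_form_apply hπ (hd hf) (hd hg), form_swap (π y) _ (fderiv ℝ h y),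
    form_swap (π y) _ (fderiv ℝ f y), form_swap (π y) _ (fderiv ℝ g y)]
  simp only [hX1, hY1, hT1]
  rw [hs hf T Y, hs hg X T, hs hh Y X]
  linarith

/-- For inverse fields, the Jacobi expression is the exterior derivative of the form. -/
theorem jacobi_eq_d3 {σ : V → V [⋀^Fin 2]→L[ℝ] ℝ} {π : V → (V →L[ℝ] ℝ) [⋀^Fin 2]→L[ℝ] ℝ} {y : V}
    (hσ : DifferentiableAt ℝ σ y) (hπ : DifferentiableAt ℝ π y)
    (hinv : ∀ᶠ z in 𝓝 y, Inv (σ z) (π z)) (a b c : V) :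
    π y ![contract (σ y) a, fderiv ℝ (fun z => π z ![contract (σ y) b, contract (σ y) c]) y]
    + π y ![contract (σ y) b, fderiv ℝ (fun z => π z ![contract (σ y) c, contract (σ y) a]) y]
    + π y ![contract (σ y) c, fderiv ℝ (fun z => π z ![contract (σ y) a, contract (σ y) b]) y]
      = d3 σ y a b c := by
  have hi : Inv (σ y) (π y) := hinv.self_of_nhds
  have hc : ∀ v, DifferentiableAt ℝ (fun z => contract (σ z) v) y := by
    intro v
    let B := Module.finBasis ℝ V
    have : (fun z => contract (σ z) v) = fun z => ∑ i, σ z ![v, B i] • coordL B i := by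
      funext z
      refine ContinuousLinearMap.ext fun w => ?_
      conv_lhs => rw [← B.sum_repr w]
      simp only [map_sum, map_smul, sum_apply, smul_apply,
        coordL_apply, smul_eq_mul, contract_apply]
      exact Finset.sum_congr rfl fun i _ => mul_comm _ _
    rw [this]
    fun_prop
  have hcd : ∀ v w d, fderiv ℝ (fun z => contract (σ z) v) y d w = fderiv ℝ σ y d ![v, w] := by
    intro v w d
    rw [← fderiv_form_const hσ]
    have := (hc v).hasFDerivAt.clm_apply (hasFDerivAt_const w y)
    have h2 := this.fderiv
    simp only [contract_apply] at h2
    rw [h2]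
    simp
  -- differentiate the identity `π(σ(v, ·), α) = α(v)`, with `α = σ(y)(w, ·)` held constant
  have key : ∀ v w d, fderiv ℝ π y d ![contract (σ y) v, contract (σ y) w] =
      fderiv ℝ σ y d ![v, w] := by
    intro v w d
    have h1 : (fun z => π z ![contract (σ z) v, contract (σ y) w]) =ᶠ[𝓝 y]
        fun _ => contract (σ y) w v := by
      filter_upwards [hinv] with z hz
      exact hz v _ _ fun u => rfl
    have h2 := fderiv_form_apply hπ (hc v) (differentiableAt_const (contract (σ y) w)) d
    rw [h1.fderiv_eq] at h2
    simp only [fderiv_fun_const, Pi.zero_apply, zero_apply] at h2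
    have h3 : π y ![contract (σ y) v, 0] = 0 := by
      rw [form_swap]
      exact neg_eq_zero.2 ((π y).map_coord_zero 0 rfl)
    rw [h3, form_swap (π y), hi w _ _ fun u => rfl, hcd] at h2
    linarith
  rw [hi a _ _ fun u => rfl, hi b _ _ fun u => rfl, hi c _ _ fun u => rfl, fderiv_form_const hπ,
    fderiv_form_const hπ, fderiv_form_const hπ, key, key, key, d3,
    form_swap (fderiv ℝ σ y b) c a]
  ring

/-- A non-degenerate bivector field is Poisson if and only if the inverse two-form is closed. -/
theorem jacobiAt_iff_closed {σ : V → V [⋀^Fin 2]→L[ℝ] ℝ}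
    {π : V → (V →L[ℝ] ℝ) [⋀^Fin 2]→L[ℝ] ℝ} {y : V}
    (hσ : DifferentiableAt ℝ σ y) (hπ : DifferentiableAt ℝ π y)
    (hinv : ∀ᶠ z in 𝓝 y, Inv (σ z) (π z)) : JacobiAt π y ↔ ∀ a b c, d3 σ y a b c = 0 := by
  have hi : Inv (σ y) (π y) := hinv.self_of_nhds
  constructor
  · intro h a b c
    rw [← jacobi_eq_d3 hσ hπ hinv]
    exact h _ _ _
  · intro h α β γ
    have e : ∀ α : V →L[ℝ] ℝ, ∃ v, α = contract (σ y) v := fun α => by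
      obtain ⟨v, hv⟩ := exists_form_eq hi.nondeg_form α
      exact ⟨v, ContinuousLinearMap.ext hv⟩
    obtain ⟨a, rfl⟩ := e α
    obtain ⟨b, rfl⟩ := e β
    obtain ⟨c, rfl⟩ := e γ
    rw [jacobi_eq_d3 hσ hπ hinv]
    exact h _ _ _

end FormCalculus

/-! ### Two-forms with a simple pole along a regular hypersurface -/

section Residue

set_option linter.unusedSectionVars false

variable {V : Type} [NormedAddCommGroup V] [NormedSpace ℝ V] [FiniteDimensional ℝ V] {n : ℕ}
  {W : Type*} [NormedAddCommGroup W] [NormedSpace ℝ W] {p : W}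

theorem SmoothNear.wedge {φ θ : W → V →L[ℝ] ℝ} (hφ : SmoothNear φ p)
    (hθ : SmoothNear θ p) : SmoothNear (fun y => wed (φ y) (θ y)) p := by
  filter_upwards [hφ, hθ] with y h1 h2 using ContDiffAt.wed h1 h2

theorem SmoothNear.pfaffian {a : W → V [⋀^Fin 2]→L[ℝ] ℝ} (b : Module.Basis (Fin (2 * n)) ℝ V)
    (ha : SmoothNear a p) : SmoothNear (fun y => pf b (a y)) p := by
  filter_upwards [ha] with y h1 using (contDiff_pf b).contDiffAt.comp y h1

theorem SmoothNear.adj {a : W → V [⋀^Fin 2]→L[ℝ] ℝ} (b : Module.Basis (Fin (2 * n)) ℝ V)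
    (ha : SmoothNear a p) : SmoothNear (fun y => adjB b (a y)) p := by
  filter_upwards [ha] with y h1 using (contDiff_adjB b).contDiffAt.comp y h1

theorem SmoothNear.form_apply {a : W → V [⋀^Fin 2]→L[ℝ] ℝ} (ha : SmoothNear a p) (v w : V) :
    SmoothNear (fun y => a y ![v, w]) p := by
  filter_upwards [ha] with y h1 using ContDiffAt.form_apply h1 contDiffAt_const contDiffAt_const

theorem SmoothNear.contract {a : W → V [⋀^Fin 2]→L[ℝ] ℝ} (ha : SmoothNear a p) (v : V) :
    SmoothNear (fun y => LogFolded.contract (a y) v) p := by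
  filter_upwards [ha] with y h1
  exact contDiffAt_covector fun w => ContDiffAt.form_apply h1 contDiffAt_const contDiffAt_const

theorem SmoothNear.differentiableAt {F : Type*} [NormedAddCommGroup F] [NormedSpace ℝ F]
    {f : W → F} (hf : SmoothNear f p) : DifferentiableAt ℝ f p :=
  hf.contDiffAt.differentiableAt (by simp)

theorem wed_add_left {V : Type*} [AddCommGroup V] [Module ℝ V] [TopologicalSpace V]
    [IsTopologicalAddGroup V] (φ φ' θ : V →L[ℝ] ℝ) : wed (φ + φ') θ = wed φ θ + wed φ' θ := by
  ext v; simp; ring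

theorem wed_smul_left {V : Type*} [AddCommGroup V] [Module ℝ V] [TopologicalSpace V]
    [IsTopologicalAddGroup V] [ContinuousSMul ℝ V] (t : ℝ) (φ θ : V →L[ℝ] ℝ) :
    wed (t • φ) θ = t • wed φ θ := by
  ext v; simp; ring

theorem wed_add_right {V : Type*} [AddCommGroup V] [Module ℝ V] [TopologicalSpace V]
    [IsTopologicalAddGroup V] (φ θ θ' : V →L[ℝ] ℝ) : wed φ (θ + θ') = wed φ θ + wed φ θ' := by
  ext v; simp; ring

theorem wed_smul_right {V : Type*} [AddCommGroup V] [Module ℝ V] [TopologicalSpace V]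
    [IsTopologicalAddGroup V] [ContinuousSMul ℝ V] (t : ℝ) (φ θ : V →L[ℝ] ℝ) :
    wed φ (t • θ) = t • wed φ θ := by
  ext v; simp; ring

theorem wed_self {V : Type*} [AddCommGroup V] [Module ℝ V] [TopologicalSpace V]
    (φ : V →L[ℝ] ℝ) : wed φ φ = 0 := by
  ext v; simp; ring

theorem wed_zero_left {V : Type*} [AddCommGroup V] [Module ℝ V] [TopologicalSpace V]
    [IsTopologicalAddGroup V] (θ : V →L[ℝ] ℝ) : wed 0 θ = 0 := by
  ext v; simp

/-- The exterior derivative of a smooth two-form, contracted with `u`, is smooth. -/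
theorem exists_d3_form {R : V → V [⋀^Fin 2]→L[ℝ] ℝ} {p : V} (hR : SmoothNear R p) (u : V) :
    ∃ D : V → V [⋀^Fin 2]→L[ℝ] ℝ, SmoothNear D p ∧ ∀ y a b, D y ![a, b] = d3 R y u a b := by
  let L : (V →L[ℝ] V [⋀^Fin 2]→L[ℝ] ℝ) →L[ℝ] V [⋀^Fin 2]→L[ℝ] ℝ :=
    (ContinuousLinearMap.apply ℝ (V [⋀^Fin 2]→L[ℝ] ℝ) u).comp
      ((ContinuousAlternatingMap.curryLeftLI (𝕜 := ℝ) (E := V) (F := ℝ)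
        (n := 2)).toContinuousLinearMap.comp
          (ContinuousAlternatingMap.alternatizeUncurryFinCLM ℝ V ℝ))
  refine ⟨fun y => L (fderiv ℝ R y), ?_, fun y a b => ?_⟩
  · filter_upwards [hR.fderiv] with y h using L.contDiff.contDiffAt.comp y h
  · rw [← extDeriv_apply_three]
    rfl

theorem continuousAt_d3 {R : V → V [⋀^Fin 2]→L[ℝ] ℝ} {p : V} (hR : SmoothNear R p) (a b c : V) :
    ContinuousAt (fun y => d3 R y a b c) p := by
  obtain ⟨D, hD, hD'⟩ := exists_d3_form hR a
  simp only [← hD']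
  exact (hD.form_apply b c).continuousAt

theorem SmoothNear.d2_continuousAt {θ : V → V →L[ℝ] ℝ} {p : V} (hθ : SmoothNear θ p) (a b : V) :
    ContinuousAt (fun y => d2 θ y a b) p := by
  have h := hθ.fderiv
  exact (((h.clm_apply (smoothNear_const a p)).clm_apply (smoothNear_const b p)).sub
    ((h.clm_apply (smoothNear_const b p)).clm_apply (smoothNear_const a p))).continuousAt

theorem exists_apply_ne_zero {s : V → ℝ} {p : V} (hds : fderiv ℝ s p ≠ 0) :
    ∃ u, fderiv ℝ s p u ≠ 0 := by
  by_contra! h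
  exact hds (ContinuousLinearMap.ext h)

variable {R : V → V [⋀^Fin 2]→L[ℝ] ℝ} {s : V → ℝ} {p : V}

/-- If `s⁻¹ R` is closed off `s = 0`, then `s dR = ds ∧ R`. -/
theorem smul_d3_of_closed (hR : SmoothNear R p) (hs : SmoothNear s p) (hds : fderiv ℝ s p ≠ 0)
    (hcl : ∀ᶠ y in 𝓝 p, s y ≠ 0 → ∀ a b c, d3 (fun z => (s z)⁻¹ • R z) y a b c = 0) :
    ∀ᶠ y in 𝓝 p, ∀ a b c, s y * d3 R y a b c = wed3 (fderiv ℝ s y) (R y) a b c := by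
  have off : ∀ᶠ y in 𝓝 p, s y ≠ 0 →
      ∀ a b c, s y * d3 R y a b c = wed3 (fderiv ℝ s y) (R y) a b c := by
    filter_upwards [hR, hs.eventually, hcl] with y h1 h2 h3 h0 a b c
    have h4 : ∀ᶠ z in 𝓝 y, R z = s z • ((s z)⁻¹ • R z) := by
      filter_upwards [h2.continuousAt.eventually_ne h0] with z hz
      rw [smul_smul, mul_inv_cancel₀ hz, one_smul]
    have h5 := h2.differentiableAt
    have h6 : DifferentiableAt ℝ (fun z => (s z)⁻¹ • R z) y :=
      (h5.fun_inv h0).fun_smul (h1.differentiableAt (by simp))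
    rw [d3_congr h4, d3_smul h5 h6, h3 h0, mul_zero, zero_add]
    simp only [wed3, ContinuousAlternatingMap.smul_apply, smul_eq_mul]
    field_simp
  filter_upwards [hR.eventually, hs.eventually, hs.eventually_fderiv_ne_zero hds,
    eventually_eventually_nhds.2 off] with y h1 h2 h3 h4 a b c
  refine eq_of_eq_off (f := fun y => s y * d3 R y a b c)
    (g := fun y => wed3 (fderiv ℝ s y) (R y) a b c) h3
    (h2.continuousAt.mul (continuousAt_d3 h1 a b c)) ?_
    (h4.mono fun z hz h0 => hz h0 a b c)
  have e : ∀ v, SmoothNear (fun y => fderiv ℝ s y v) y := fun v =>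
    h2.fderiv.clm_apply (smoothNear_const v y)
  exact ((((e a).mul (h1.form_apply b c)).sub ((e b).mul (h1.form_apply a c))).add
    ((e c).mul (h1.form_apply a b))).continuousAt

/-- A closed two-form `s⁻¹ R` with a simple pole along `s = 0` is, up to a smooth form, equal to
`s⁻¹ ds ∧ dG` for a smooth function `G`: its residue is closed along the hypersurface. -/
theorem exists_residue_primitive (hR : SmoothNear R p) (hs : SmoothNear s p) (hp : s p = 0)
    (hds : fderiv ℝ s p ≠ 0)
    (hcl : ∀ᶠ y in 𝓝 p, s y ≠ 0 → ∀ a b c, d3 (fun z => (s z)⁻¹ • R z) y a b c = 0) :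
    ∃ (G : V → ℝ) (β : V → V [⋀^Fin 2]→L[ℝ] ℝ), SmoothNear G p ∧ SmoothNear β p ∧
      ∀ᶠ y in 𝓝 p, R y = wed (fderiv ℝ s y) (fderiv ℝ G y) + s y • β y := by
  have h1 := smul_d3_of_closed hR hs hds hcl
  obtain ⟨u, hu⟩ := exists_apply_ne_zero hds
  obtain ⟨D, hD, hD'⟩ := exists_d3_form hR u
  have hsu : SmoothNear (fun y => fderiv ℝ s y u) p := hs.fderiv.clm_apply (smoothNear_const u p)
  have hsu0 : ∀ᶠ y in 𝓝 p, fderiv ℝ s y u ≠ 0 := hsu.continuousAt.eventually_ne hu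
  let N : V → ℝ := fun y => (fderiv ℝ s y u)⁻¹
  have hN : SmoothNear N p := hsu.inv hu
  -- contracting `s dR = ds ∧ R` with `u` splits off the residue `θ₀`
  let θ₀ : V → V →L[ℝ] ℝ := fun y => N y • contract (R y) u
  have hθ₀ : SmoothNear θ₀ p := hN.smul (hR.contract u)
  let β₀ : V → V [⋀^Fin 2]→L[ℝ] ℝ := fun y => N y • D y
  have hβ₀ : SmoothNear β₀ p := hN.smul hD
  have hsplit : ∀ᶠ y in 𝓝 p, R y = wed (fderiv ℝ s y) (θ₀ y) + s y • β₀ y := by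
    filter_upwards [h1, hsu0] with y h2 h3
    refine form_ext fun a b => ?_
    have h4 := h2 u a b
    simp only [ContinuousAlternatingMap.add_apply, ContinuousAlternatingMap.smul_apply, wed_apply,
      θ₀, β₀, hD', smul_eq_mul, smul_apply, contract_apply, Matrix.cons_val_zero,
      Matrix.cons_val_one]
    rw [wed3] at h4
    have h5 : N y * fderiv ℝ s y u = 1 := inv_mul_cancel₀ h3
    linear_combination (-N y) * h4 - R y ![a, b] * h5
  -- the residue is closed along the hypersurface
  have hres : ∀ᶠ y in 𝓝 p, ∀ a b c, fderiv ℝ s y a * d2 θ₀ y b c - fderiv ℝ s y b * d2 θ₀ y a c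
      + fderiv ℝ s y c * d2 θ₀ y a b = s y * d3 β₀ y a b c := by
    have off : ∀ᶠ y in 𝓝 p, s y ≠ 0 → ∀ a b c,
        fderiv ℝ s y a * d2 θ₀ y b c - fderiv ℝ s y b * d2 θ₀ y a c
          + fderiv ℝ s y c * d2 θ₀ y a b = s y * d3 β₀ y a b c := by
      filter_upwards [h1, hs.eventually, hθ₀.eventually, hβ₀.eventually,
        eventually_eventually_nhds.2 hsplit] with y h2 h3 h4 h5 h6 h0 a b c
      have h7 := h2 a b c
      have h8 := d2_fderiv h3.contDiffAt
      rw [d3_congr h6, d3_add (differentiableAt_wed h3.fderiv.differentiableAt h4.differentiableAt)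
        (h3.differentiableAt.fun_smul h5.differentiableAt),
        d3_wed h3.fderiv.differentiableAt h4.differentiableAt,
        d3_smul h3.differentiableAt h5.differentiableAt, h6.self_of_nhds, h8, h8, h8] at h7
      simp only [wed3, ContinuousAlternatingMap.add_apply, ContinuousAlternatingMap.smul_apply,
        wed_apply, smul_eq_mul, Matrix.cons_val_zero, Matrix.cons_val_one] at h7
      have h9 : s y * (fderiv ℝ s y a * d2 θ₀ y b c - fderiv ℝ s y b * d2 θ₀ y a c
          + fderiv ℝ s y c * d2 θ₀ y a b) = s y * (s y * d3 β₀ y a b c) := by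
        linear_combination -h7
      exact mul_left_cancel₀ h0 h9
    filter_upwards [hs.eventually, hs.eventually_fderiv_ne_zero hds, hθ₀.eventually,
      hβ₀.eventually, eventually_eventually_nhds.2 off] with y h2 h3 h4 h5 h6 a b c
    have e : ∀ v, ContinuousAt (fun y => fderiv ℝ s y v) y := fun v =>
      (h2.fderiv.clm_apply (smoothNear_const v y)).continuousAt
    exact eq_of_eq_off (f := fun y => fderiv ℝ s y a * d2 θ₀ y b c - fderiv ℝ s y b * d2 θ₀ y a c
      + fderiv ℝ s y c * d2 θ₀ y a b) (g := fun y => s y * d3 β₀ y a b c) h3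
      ((((e a).mul (h4.d2_continuousAt b c)).sub ((e b).mul (h4.d2_continuousAt a c))).add
        ((e c).mul (h4.d2_continuousAt a b)))
      (h2.continuousAt.mul (continuousAt_d3 h5 a b c)) (h6.mono fun z hz h0 => hz h0 a b c)
  -- its pullback under a retraction is closed
  obtain ⟨r, hr, hrp, hr0, hrid⟩ := exists_retraction hs hds hp
  have hrt : Filter.Tendsto r (𝓝 p) (𝓝 p) := by
    have := hr.continuousAt; rwa [ContinuousAt, hrp] at this
  let η : V → V →L[ℝ] ℝ := fun y => (θ₀ (r y)).comp (fderiv ℝ r y)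
  have hη : SmoothNear η p :=
    (SmoothNear.comp (g := θ₀) (f := r) (by rwa [hrp]) hr).clm_comp hr.fderiv
  have hηcl : ∀ᶠ y in 𝓝 p, ∀ v w, fderiv ℝ η y v w = fderiv ℝ η y w v := by
    filter_upwards [hr, eventually_eventually_nhds.2 hr0, hrt.eventually hres,
      hrt.eventually hsu0, hrt.eventually hs, hrt.eventually hθ₀] with y h2 h3 h4 h5 h6 h7 v w
    have hker : ∀ v, fderiv ℝ s (r y) (fderiv ℝ r y v) = 0 := by
      intro v
      have e1 : (fun z => s (r z)) =ᶠ[𝓝 y] fun _ => 0 := h3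
      have e2 := ((h6.differentiableAt (by simp)).hasFDerivAt.comp y
        (h2.differentiableAt (by simp)).hasFDerivAt).fderiv
      have e3 : fderiv ℝ (s ∘ r) y = 0 := by
        rw [show s ∘ r = fun z => s (r z) from rfl, e1.fderiv_eq]; simp
      rw [e3] at e2
      exact (congrArg (fun L => L v) e2).symm
    have h8 := d2_pullback (h7.differentiableAt (by simp)) h2 v w
    have h9 := h4 u (fderiv ℝ r y v) (fderiv ℝ r y w)
    rw [hker, hker, h3.self_of_nhds, zero_mul, zero_mul, zero_mul, sub_zero, add_zero] at h9
    rw [(mul_eq_zero.1 h9).resolve_left h5] at h8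
    exact sub_eq_zero.1 h8
  obtain ⟨G, hG, hGη⟩ := exists_primitive hη hηcl
  have hGη' : ∀ᶠ y in 𝓝 p, fderiv ℝ G y = η y := hGη.mono fun y h => h.fderiv
  -- along the hypersurface the residue and its pullback agree on tangent vectors
  have hδ : ∀ᶠ y in 𝓝 p, s y = 0 → ∀ v, fderiv ℝ s y v = 0 → θ₀ y v = η y v := by
    obtain ⟨g, hg, hrg⟩ := exists_eq_smul_of_eq_zero (f := fun y => r y - y)
      (hr.sub (ContDiff.smoothNear contDiff_id p)) hs hds (by
        filter_upwards [hrid] with y hy h0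
        rw [hy h0, sub_self])
    filter_upwards [hs.eventually, hg.eventually, eventually_eventually_nhds.2 hrg, hrid]
      with y h2 h3 h4 h5 h0 v hv
    have e1 : r =ᶠ[𝓝 y] fun z => z + s z • g z := by
      filter_upwards [h4] with z hz
      rw [← hz]; abel
    have e2 : fderiv ℝ r y v = v := by
      rw [e1.fderiv_eq, fderiv_fun_add differentiableAt_fun_id
        (h2.differentiableAt.fun_smul h3.differentiableAt),
        fderiv_fun_smul h2.differentiableAt h3.differentiableAt]
      simp [h0, hv]
    simp only [η, h5 h0, ContinuousLinearMap.comp_apply, e2]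
  -- hence their difference is a multiple `t` of `ds` there; the term `ds ∧ (t ds)` vanishes
  let δ : V → V →L[ℝ] ℝ := fun y => θ₀ y - η y
  have hδs : SmoothNear δ p := hθ₀.sub hη
  let t : V → ℝ := fun y => N y * δ y u
  have ht : SmoothNear t p := hN.mul (hδs.clm_apply (smoothNear_const u p))
  obtain ⟨γ, hγ, hγ'⟩ := exists_eq_smul_of_eq_zero (f := fun y => δ y - t y • fderiv ℝ s y)
    (hδs.sub (ht.smul hs.fderiv)) hs hds (by
      filter_upwards [hδ, hsu0] with y h2 h3 h0
      refine ContinuousLinearMap.ext fun v => ?_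
      have h4 := h2 h0 (v - (fderiv ℝ s y v * N y) • u) (by
        simp only [map_sub, map_smul, smul_eq_mul, N]
        field_simp
        ring)
      simp only [map_sub, map_smul, smul_eq_mul] at h4
      simp only [sub_apply, smul_apply, smul_eq_mul, t, δ, zero_apply]
      linear_combination h4)
  refine ⟨G, fun y => β₀ y + wed (fderiv ℝ s y) (γ y), hG, hβ₀.add (hs.fderiv.wedge hγ), ?_⟩
  filter_upwards [hsplit, hGη', hγ'] with y h2 h3 h4
  have h5 : θ₀ y = η y + t y • fderiv ℝ s y + s y • γ y := by
    rw [← h4]; simp only [δ]; abel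
  rw [h2, h3, h5, wed_add_right, wed_add_right, wed_smul_right, wed_smul_right, wed_self,
    smul_zero, add_zero, smul_add]
  abel

/-- The function `G` may be replaced by one with the same restriction to the hypersurface, up to
a constant. -/
theorem residue_primitive_congr (hs : SmoothNear s p) (hds : fderiv ℝ s p ≠ 0) {G G' : V → ℝ}
    {β : V → V [⋀^Fin 2]→L[ℝ] ℝ} (hG : SmoothNear G p) (hG' : SmoothNear G' p)
    (hβ : SmoothNear β p)
    (hR : ∀ᶠ y in 𝓝 p, R y = wed (fderiv ℝ s y) (fderiv ℝ G y) + s y • β y) {c : ℝ}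
    (hc : ∀ᶠ y in 𝓝 p, s y = 0 → G' y = G y + c) :
    ∃ β' : V → V [⋀^Fin 2]→L[ℝ] ℝ, SmoothNear β' p ∧
      ∀ᶠ y in 𝓝 p, R y = wed (fderiv ℝ s y) (fderiv ℝ G' y) + s y • β' y := by
  obtain ⟨m, hm, hm'⟩ := exists_eq_smul_of_eq_zero (f := fun y => G y - G' y + c)
    ((hG.sub hG').add (smoothNear_const c p)) hs hds (by
      filter_upwards [hc] with y hy h0
      rw [hy h0]; ring)
  refine ⟨fun y => β y + wed (fderiv ℝ s y) (fderiv ℝ m y), hβ.add (hs.fderiv.wedge hm.fderiv), ?_⟩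
  filter_upwards [hR, hs.eventually, hG'.eventually, hm.eventually,
    eventually_eventually_nhds.2 hm'] with y h1 h2 h4 h5 h6
  have e : G =ᶠ[𝓝 y] fun z => G' z - c + s z • m z := by
    filter_upwards [h6] with z hz
    rw [← hz]; ring
  have e2 : fderiv ℝ G y = fderiv ℝ G' y + (s y • fderiv ℝ m y + m y • fderiv ℝ s y) := by
    rw [e.fderiv_eq, fderiv_fun_add (h4.differentiableAt.sub_const c)
      (h2.differentiableAt.fun_smul h5.differentiableAt), fderiv_sub_const]
    congr 1
    exact fderiv_fun_mul h2.differentiableAt h5.differentiableAt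
  rw [h1, e2, wed_add_right, wed_add_right, wed_smul_right, wed_smul_right, wed_self, smul_zero,
    add_zero, smul_add]
  abel

/-- The restriction of the residue to the hypersurface is unique. -/
theorem residue_unique (hs : SmoothNear s p) (hds : fderiv ℝ s p ≠ 0) {G G' : V → ℝ}
    {β β' : V → V [⋀^Fin 2]→L[ℝ] ℝ}
    (hR : ∀ᶠ y in 𝓝 p, R y = wed (fderiv ℝ s y) (fderiv ℝ G y) + s y • β y)
    (hR' : ∀ᶠ y in 𝓝 p, R y = wed (fderiv ℝ s y) (fderiv ℝ G' y) + s y • β' y) :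
    ∀ᶠ y in 𝓝 p, s y = 0 → ∀ v, fderiv ℝ s y v = 0 → fderiv ℝ G y v = fderiv ℝ G' y v := by
  filter_upwards [hR, hR', hs.eventually_fderiv_ne_zero hds] with y h1 h2 h3 h0 v hv
  obtain ⟨u, hu⟩ := exists_apply_ne_zero h3
  rw [h1, h0, zero_smul, zero_smul, add_zero, add_zero] at h2
  have := congrArg (fun a => a ![u, v]) h2
  simp only [wed_apply, Matrix.cons_val_zero, Matrix.cons_val_one, hv, zero_mul, sub_zero] at this
  exact mul_left_cancel₀ hu this

end Residue

/-! ### Local models near the hypersurface -/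

section LocalModels

set_option linter.unusedSectionVars false

variable {V : Type} [NormedAddCommGroup V] [NormedSpace ℝ V] [FiniteDimensional ℝ V] {n : ℕ}

/-- Near `p`, the function `h` is a positive multiple `u s²` of the square of a regular defining
function `s` of a hypersurface through `p`. -/
structure SquareDefining (s u h : V → ℝ) (p : V) : Prop where
  smooth : SmoothNear s p
  zero : s p = 0
  regular : fderiv ℝ s p ≠ 0
  smooth_factor : SmoothNear u p
  pos : 0 < u p
  eq : ∀ᶠ y in 𝓝 p, h y = u y * s y ^ 2

namespace SquareDefining

variable {s u h : V → ℝ} {p : V}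

theorem smooth_h (H : SquareDefining s u h p) : SmoothNear h p :=
  SmoothNear.congr (H.smooth_factor.mul (H.smooth.pow 2)) H.eq

theorem eventually_pos (H : SquareDefining s u h p) : ∀ᶠ y in 𝓝 p, 0 < u y :=
  H.smooth_factor.continuousAt.eventually_const_lt H.pos

theorem eventually_h_pos (H : SquareDefining s u h p) : ∀ᶠ y in 𝓝 p, s y ≠ 0 → 0 < h y := by
  filter_upwards [H.eventually_pos, H.eq] with y h1 h2 h0
  rw [h2]; positivity

theorem h_zero (H : SquareDefining s u h p) : h p = 0 := by
  rw [H.eq.self_of_nhds, H.zero]; ring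

end SquareDefining

/-- For `h = u s²`, this is the smooth form `s dh / (2h)`. -/
def conormal (s u : V → ℝ) (y : V) : V →L[ℝ] ℝ :=
  fderiv ℝ s y + (s y / (2 * u y)) • fderiv ℝ u y

namespace SquareDefining

variable {s u h : V → ℝ} {p : V}

theorem smooth_conormal (H : SquareDefining s u h p) : SmoothNear (conormal s u) p := by
  refine H.smooth.fderiv.add (SmoothNear.smul ?_ H.smooth_factor.fderiv)
  have : SmoothNear (fun y => (2 * u y)⁻¹) p :=
    SmoothNear.inv ((smoothNear_const 2 p).mul H.smooth_factor) (by have := H.pos; positivity)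
  exact H.smooth.mul this

/-- The differential of `h = u s²` is `2 u s` times the smooth form `conormal s u`. -/
theorem fderiv_h (H : SquareDefining s u h p) :
    ∀ᶠ y in 𝓝 p, fderiv ℝ h y = (2 * u y * s y) • conormal s u y := by
  filter_upwards [H.smooth.eventually, H.smooth_factor.eventually,
    eventually_eventually_nhds.2 H.eq, H.eventually_pos] with y h1 h2 h3 h4
  have e : h =ᶠ[𝓝 y] fun z => u z * s z ^ 2 := h3
  have e2 : HasFDerivAt (fun z => u z * s z ^ 2)
      (u y • ((2 * s y) • fderiv ℝ s y) + (s y ^ 2) • fderiv ℝ u y) y := by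
    have := h1.differentiableAt.hasFDerivAt.pow 2
    simp only [Nat.add_one_sub_one, pow_one, nsmul_eq_mul, Nat.cast_ofNat] at this
    exact h2.differentiableAt.hasFDerivAt.mul this
  rw [e.fderiv_eq, e2.fderiv, conormal, smul_add, smul_smul, smul_smul]
  congr 2
  · ring
  · field_simp

theorem fderiv_h_zero (H : SquareDefining s u h p) : fderiv ℝ h p = 0 := by
  rw [H.fderiv_h.self_of_nhds, H.zero, mul_zero, zero_smul]

/-- The form `dh / (2h)` has a simple pole along the hypersurface. -/
theorem wed_fderiv_h (H : SquareDefining s u h p) :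
    ∀ᶠ y in 𝓝 p, s y ≠ 0 → ∀ θ : V →L[ℝ] ℝ,
      (2 * h y)⁻¹ • wed (fderiv ℝ h y) θ = (s y)⁻¹ • wed (conormal s u y) θ := by
  filter_upwards [H.fderiv_h, H.eq, H.eventually_pos] with y h1 h2 h3 h0 θ
  rw [h1, h2, wed_smul_left, smul_smul]
  congr 1
  field_simp

/-- A smooth positive factor changes only the regular part. -/
theorem exists_regular_part (H : SquareDefining s u h p) {R β : V → V [⋀^Fin 2]→L[ℝ] ℝ}
    {G : V → ℝ} (hβ : SmoothNear β p) (hG : SmoothNear G p)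
    (hR : ∀ᶠ y in 𝓝 p, R y = wed (fderiv ℝ s y) (fderiv ℝ G y) + s y • β y) :
    ∃ β' : V → V [⋀^Fin 2]→L[ℝ] ℝ, SmoothNear β' p ∧ ∀ᶠ y in 𝓝 p, s y ≠ 0 →
      (s y)⁻¹ • R y = β' y + (2 * h y)⁻¹ • wed (fderiv ℝ h y) (fderiv ℝ G y) := by
  have hu : SmoothNear (fun y => (2 * u y)⁻¹) p :=
    SmoothNear.inv ((smoothNear_const 2 p).mul H.smooth_factor) (by have := H.pos; positivity)
  refine ⟨fun y => β y - (2 * u y)⁻¹ • wed (fderiv ℝ u y) (fderiv ℝ G y),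
    hβ.sub (hu.smul (H.smooth_factor.fderiv.wedge hG.fderiv)), ?_⟩
  filter_upwards [hR, H.wed_fderiv_h] with y h1 h2 h0
  rw [h1, h2 h0, conormal, wed_add_left, wed_smul_left, smul_add, smul_add, smul_smul, smul_smul,
    inv_mul_cancel₀ h0, one_smul, show (s y)⁻¹ * (s y / (2 * u y)) = (2 * u y)⁻¹ by field_simp]
  abel

/-- If `β + dh/(2h) ∧ dG` has Pfaffian `c / s`, then `ds ∧ dG` adds `c` to the Pfaffian of `β` along
the hypersurface. -/
theorem pf_residue (H : SquareDefining s u h p) (b : Module.Basis (Fin (2 * n)) ℝ V)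
    {β : V → V [⋀^Fin 2]→L[ℝ] ℝ} {G : V → ℝ} {c : ℝ} (hβ : SmoothNear β p) (hG : SmoothNear G p)
    (hc : ∀ᶠ y in 𝓝 p, s y ≠ 0 →
      s y * pf b (β y + (2 * h y)⁻¹ • wed (fderiv ℝ h y) (fderiv ℝ G y)) = c) :
    ∀ᶠ y in 𝓝 p, s y = 0 → pf b (β y + wed (fderiv ℝ s y) (fderiv ℝ G y)) - pf b (β y) = c := by
  have hA : SmoothNear (fun y => s y * pf b (β y) +
      (pf b (β y + wed (conormal s u y) (fderiv ℝ G y)) - pf b (β y))) p :=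
    (H.smooth.mul (hβ.pfaffian b)).add
      (((hβ.add (H.smooth_conormal.wedge hG.fderiv)).pfaffian b).sub (hβ.pfaffian b))
  have h1 := eventually_eq_of_eq_off (H.smooth.eventually_fderiv_ne_zero H.regular)
    hA.eventually_continuousAt (g := fun _ => c) (.of_forall fun _ => continuousAt_const) (by
      filter_upwards [hc, H.wed_fderiv_h] with y h1 h2 h0
      rw [← h1 h0, h2 h0, pf_affine]
      field_simp)
  filter_upwards [h1] with y h1 h0
  have e : conormal s u y = fderiv ℝ s y := by simp [conormal, h0]
  rw [e, h0, zero_mul, zero_add] at h1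
  exact h1

/-- The data of a form `η = β + dh/(2h) ∧ dG` with Pfaffian `c / s` near the hypersurface, where
`h` has been normalized so that `β` is degenerate along the hypersurface. -/
theorem exists_normalization (H : SquareDefining s u h p) (b : Module.Basis (Fin (2 * n)) ℝ V)
    {η β : V → V [⋀^Fin 2]→L[ℝ] ℝ} {G k : V → ℝ} {c : ℝ} (hc : c ≠ 0) (hβ : SmoothNear β p)
    (hG : SmoothNear G p)
    (hη : ∀ᶠ y in 𝓝 p, s y ≠ 0 →
      η y = β y + (2 * h y)⁻¹ • wed (fderiv ℝ h y) (fderiv ℝ G y))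
    (hpf : ∀ᶠ y in 𝓝 p, s y ≠ 0 → s y * pf b (η y) = c)
    (hk : ∀ᶠ y in 𝓝 p, k y = s y * (pf b (β y) / c))
    {h₁ : V → ℝ} (hh₁ : ∀ᶠ y in 𝓝 p, h₁ y = h y * Real.exp (2 * k y)) :
    ∃ (u₁ : V → ℝ) (β₁ : V → V [⋀^Fin 2]→L[ℝ] ℝ), SquareDefining s u₁ h₁ p ∧ SmoothNear β₁ p ∧
      (∀ᶠ y in 𝓝 p, s y ≠ 0 →
        η y = β₁ y + (2 * h₁ y)⁻¹ • wed (fderiv ℝ h₁ y) (fderiv ℝ G y)) ∧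
      (∀ᶠ y in 𝓝 p, s y = 0 → pf b (β₁ y) = 0) ∧
      (pf b (β₁ p + wed (fderiv ℝ s p) (fderiv ℝ G p)) - pf b (β₁ p) = c) ∧
      ∃ C, ∀ᶠ y in 𝓝 p, s y ≠ 0 → |pf b (β₁ y) / pf b (η y)| ≤ C * h₁ y := by
  have hq : SmoothNear (fun y => pf b (β y) / c) p := by
    simpa only [div_eq_mul_inv] using (hβ.pfaffian b).mul (smoothNear_const c⁻¹ p)
  have hks : SmoothNear k p := SmoothNear.congr (H.smooth.mul hq) hk
  have hexp : SmoothNear (fun y => Real.exp (2 * k y)) p :=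
    SmoothNear.comp (ContDiff.smoothNear Real.contDiff_exp _) ((smoothNear_const 2 p).mul hks)
  have H₁ : SquareDefining s (fun y => u y * Real.exp (2 * k y)) h₁ p :=
    { H with
      smooth_factor := H.smooth_factor.mul hexp
      pos := mul_pos H.pos (Real.exp_pos _)
      eq := by
        filter_upwards [H.eq, hh₁] with y h1 h2
        rw [h2, h1]; ring }
  -- since `dh₁ / (2h₁) = dh / (2h) + dk`, the regular part changes by `-dk ∧ dG`
  let β₁ : V → V [⋀^Fin 2]→L[ℝ] ℝ := fun y => β y - wed (fderiv ℝ k y) (fderiv ℝ G y)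
  have hβ₁ : SmoothNear β₁ p := hβ.sub (hks.fderiv.wedge hG.fderiv)
  have hη₁ : ∀ᶠ y in 𝓝 p, s y ≠ 0 →
      η y = β₁ y + (2 * h₁ y)⁻¹ • wed (fderiv ℝ h₁ y) (fderiv ℝ G y) := by
    filter_upwards [hη, H.smooth_h.eventually, hks.eventually, H.eventually_h_pos,
      eventually_eventually_nhds.2 hh₁] with y h1 h2 h3 h4 h5 h0
    have e : h₁ =ᶠ[𝓝 y] fun z => h z * Real.exp (2 * k z) := h5
    have e2 : fderiv ℝ h₁ y = Real.exp (2 * k y) • fderiv ℝ h y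
        + (2 * h y * Real.exp (2 * k y)) • fderiv ℝ k y := by
      have e3 := h2.differentiableAt.hasFDerivAt.mul
        (h3.differentiableAt.hasFDerivAt.const_mul 2).exp
      rw [e.fderiv_eq]
      rw [show (fun z => h z * Real.exp (2 * k z)) = h * fun z => Real.exp (2 * k z) from rfl,
        e3.fderiv, smul_smul, smul_smul, add_comm]
      congr 2
      ring
    have hpos := h4 h0
    have hexp0 := Real.exp_pos (2 * k y)
    rw [h1 h0, e2, h5.self_of_nhds, wed_add_left, wed_smul_left, wed_smul_left, smul_add,
      smul_smul, smul_smul,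
      show (2 * (h y * Real.exp (2 * k y)))⁻¹ * Real.exp (2 * k y) = (2 * h y)⁻¹ by field_simp,
      show (2 * (h y * Real.exp (2 * k y)))⁻¹ * (2 * h y * Real.exp (2 * k y)) = 1 by field_simp,
      one_smul]
    simp only [β₁]
    abel
  have hc0 := H.pf_residue b hβ hG (c := c) (by
    filter_upwards [hη, hpf] with y h1 h2 h0
    rw [← h1 h0, h2 h0])
  have hc1 := H₁.pf_residue b hβ₁ hG (c := c) (by
    filter_upwards [hη₁, hpf] with y h1 h2 h0
    rw [← h1 h0, h2 h0])
  -- on `s = 0`, `dk = (pf β / c) ds`, and adding `-(pf β / c) ds ∧ dG` to `β` cancels `pf β`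
  have hz : ∀ᶠ y in 𝓝 p, s y = 0 → pf b (β₁ y) = 0 := by
    filter_upwards [hc0, H.smooth.eventually, hq.eventually, eventually_eventually_nhds.2 hk]
      with y h1 h2 h3 h4 h0
    have e : k =ᶠ[𝓝 y] fun z => s z * (pf b (β z) / c) := h4
    have e2 : fderiv ℝ k y = (pf b (β y) / c) • fderiv ℝ s y := by
      rw [e.fderiv_eq, fderiv_fun_mul h2.differentiableAt h3.differentiableAt, h0, zero_smul,
        zero_add]
    have e3 : β₁ y = β y + (-(pf b (β y) / c)) • wed (fderiv ℝ s y) (fderiv ℝ G y) := by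
      simp only [β₁]
      rw [e2, wed_smul_left]
      ext v
      simp only [ContinuousAlternatingMap.sub_apply, ContinuousAlternatingMap.add_apply,
        ContinuousAlternatingMap.smul_apply, smul_eq_mul]
      ring
    rw [e3, pf_affine, h1 h0]
    field_simp
    ring
  refine ⟨_, β₁, H₁, hβ₁, hη₁, hz, hc1.self_of_nhds H.zero, ?_⟩
  obtain ⟨m, hm, hm'⟩ := exists_eq_smul_of_eq_zero (hβ₁.pfaffian b) H.smooth H.regular hz
  -- `pf β₁ / pf η = s² m / c`
  let B := |m p| + 1
  have hB : ∀ᶠ y in 𝓝 p, |m y| < B :=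
    (hm.continuousAt.abs).eventually_lt_const (lt_add_one _)
  let w := u p * Real.exp (2 * k p) / 2
  have hw : 0 < w := by have := H₁.pos; simp only [w]; positivity
  have hu₁ : ∀ᶠ y in 𝓝 p, w < u y * Real.exp (2 * k y) :=
    H₁.smooth_factor.continuousAt.eventually_const_lt (half_lt_self H₁.pos)
  refine ⟨B / (|c| * w), ?_⟩
  filter_upwards [hm', hB, hu₁, hpf, H₁.eq] with y h1 h2 h3 h4 h5 h0
  have hc' : 0 < |c| := abs_pos.2 hc
  have hη0 : pf b (η y) = c / s y := by rw [← h4 h0]; field_simp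
  have hB0 : 0 ≤ B := by simp only [B]; positivity
  rw [h1, hη0, smul_eq_mul, h5, show s y * m y / (c / s y) = s y ^ 2 * m y / c by field_simp,
    abs_div, abs_mul, abs_of_nonneg (sq_nonneg (s y)), div_le_iff₀ hc']
  calc s y ^ 2 * |m y| ≤ s y ^ 2 * B := by gcongr
    _ = B / (|c| * w) * (w * s y ^ 2) * |c| := by field_simp
    _ ≤ B / (|c| * w) * (u y * Real.exp (2 * k y) * s y ^ 2) * |c| := by gcongr

end SquareDefining

/-- The effect on the Pfaffian of replacing `dh/(2h)` by `g dh`. -/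
theorem pf_smoothing (b : Module.Basis (Fin (2 * n)) ℝ V) {η β : V [⋀^Fin 2]→L[ℝ] ℝ}
    {φ θ : V →L[ℝ] ℝ} {h : ℝ} (hh : h ≠ 0) (hη : η = β + (2 * h)⁻¹ • wed φ θ) (g : ℝ) :
    pf b (β + g • wed φ θ) = pf b β * (1 - 2 * g * h) + 2 * g * h * pf b η := by
  rw [hη, pf_affine, pf_affine]
  field_simp
  ring

/-- The ratio of the Pfaffians after and before smoothing is bounded below. -/
theorem le_smoothing_ratio {κ h g C : ℝ} (h0 : 0 < h) (hκ : |κ| ≤ C * h) (hg : C ≤ g)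
    (hgh : 2 * g * h ≤ 1) (hg0 : 0 ≤ g) : g * h ≤ κ * (1 - 2 * g * h) + 2 * g * h := by
  have h1 : |κ * (1 - 2 * g * h)| ≤ g * h := by
    rw [abs_mul, abs_of_nonneg (by linarith : (0 : ℝ) ≤ 1 - 2 * g * h)]
    calc |κ| * (1 - 2 * g * h) ≤ |κ| * 1 := by
          gcongr
          have : 0 ≤ 2 * g * h := by positivity
          linarith
      _ ≤ C * h := by linarith
      _ ≤ g * h := by gcongr
  have := (abs_le.1 h1).1
  linarith

namespace SquareDefining

variable {s u h : V → ℝ} {p : V}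

/-- The smoothed form is transverse to zero, and folded, along the hypersurface. -/
theorem smoothing_transverse (H : SquareDefining s u h p) (b : Module.Basis (Fin (2 * n)) ℝ V)
    {η β : V → V [⋀^Fin 2]→L[ℝ] ℝ} {G : V → ℝ} {c : ℝ} (hc : c ≠ 0) (hβ : SmoothNear β p)
    (hG : SmoothNear G p)
    (hη : ∀ᶠ y in 𝓝 p, s y ≠ 0 →
      η y = β y + (2 * h y)⁻¹ • wed (fderiv ℝ h y) (fderiv ℝ G y))
    (hpf : ∀ᶠ y in 𝓝 p, s y ≠ 0 → s y * pf b (η y) = c)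
    (hβ0 : pf b (β p) = 0)
    (hβc : pf b (β p + wed (fderiv ℝ s p) (fderiv ℝ G p)) - pf b (β p) = c)
    {C g : ℝ} (hC : ∀ᶠ y in 𝓝 p, s y ≠ 0 → |pf b (β y) / pf b (η y)| ≤ C * h y)
    (hg : C ≤ g) (hg0 : 0 < g) :
    fderiv ℝ (fun y => pf b (β y + g • wed (fderiv ℝ h y) (fderiv ℝ G y))) p ≠ 0 ∧
    β p + g • wed (fderiv ℝ h p) (fderiv ℝ G p) = β p ∧
    pf b (β p + wed (fderiv ℝ s p) (fderiv ℝ G p)) ≠ pf b (β p) := by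
  have e : β p + g • wed (fderiv ℝ h p) (fderiv ℝ G p) = β p := by
    rw [H.fderiv_h_zero, wed_zero_left, smul_zero, add_zero]
  refine ⟨?_, e, fun h0 => hc (by rw [← hβc, h0, sub_self])⟩
  have hh := H.smooth_h
  have hsm : SmoothNear (fun y => pf b (β y + g • wed (fderiv ℝ h y) (fderiv ℝ G y))) p :=
    (hβ.add ((smoothNear_const g p).smul (hh.fderiv.wedge hG.fderiv))).pfaffian b
  have hu2 : ∀ᶠ y in 𝓝 p, u p / 2 < u y :=
    H.smooth_factor.continuousAt.eventually_const_lt (half_lt_self H.pos)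
  have hh1 : ∀ᶠ y in 𝓝 p, 2 * g * h y < 1 := by
    have : ContinuousAt (fun y => 2 * g * h y) p := hh.continuousAt.const_mul _
    exact this.eventually_lt_const (by change 2 * g * h p < 1; rw [H.h_zero]; norm_num)
  have hup := H.pos
  -- near `p`, the Pfaffian of the smoothed form is at least a positive multiple of `|s|`
  refine fderiv_ne_zero_of_le (g := s) (δ := g * (u p / 2) * |c|)
    (by have := abs_pos.2 hc; positivity) ?_ (by rw [e, hβ0]) H.zero hsm.differentiableAt H.regular
  filter_upwards [hη, hpf, hC, hu2, hh1, H.eq, H.eventually_h_pos] with y h1 h2 h3 h4 h5 h6 h7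
  by_cases h0 : s y = 0
  · rw [h0, abs_zero, mul_zero]; exact abs_nonneg _
  have hpos := h7 h0
  have hpf0 : pf b (η y) ≠ 0 := fun h' => hc (by rw [← h2 h0, h', mul_zero])
  have hr := le_smoothing_ratio hpos (h3 h0) hg h5.le hg0.le
  have e1 : pf b (β y + g • wed (fderiv ℝ h y) (fderiv ℝ G y)) =
      (pf b (β y) / pf b (η y) * (1 - 2 * g * h y) + 2 * g * h y) * pf b (η y) := by
    rw [pf_smoothing b hpos.ne' (h1 h0) g]
    field_simp
  have e2 : |pf b (η y)| = |c| / |s y| := by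
    rw [← h2 h0, abs_mul]
    have := abs_pos.2 h0
    field_simp
  have hs := abs_pos.2 h0
  have hcp := abs_pos.2 hc
  have hgh : 0 < g * h y := by positivity
  rw [e1, abs_mul, abs_of_pos (lt_of_lt_of_le hgh hr), e2]
  calc g * (u p / 2) * |c| * |s y| = g * (u p / 2 * s y ^ 2) * (|c| / |s y|) := by
        rw [← sq_abs (s y)]; field_simp
    _ ≤ g * (u y * s y ^ 2) * (|c| / |s y|) := by gcongr
    _ = g * h y * (|c| / |s y|) := by rw [h6]
    _ ≤ _ := by gcongr

/-- The inverse of `σ ± dh/(2h) ∧ dG` extends smoothly across the hypersurface `pf σ = 0`, with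
transverse zero there. -/
theorem exists_inverse_extension (b : Module.Basis (Fin (2 * n)) ℝ V)
    {σ : V → V [⋀^Fin 2]→L[ℝ] ℝ} {G : V → ℝ}
    (H : SquareDefining (fun y => pf b (σ y)) u h p) (hσ : SmoothNear σ p) (hG : SmoothNear G p)
    (h0 : pf b (σ p + wed (fderiv ℝ (fun y => pf b (σ y)) p) (fderiv ℝ G p)) ≠ 0) :
    ∃ e : ℝ, e ≠ 0 ∧ (∀ᶠ y in 𝓝 p, pf b (σ y) ≠ 0 → SignType.sign
        ((pf b (σ y + wed (fderiv ℝ h y) (fderiv ℝ G y)) - pf b (σ y)) / pf b (σ y)) = e) ∧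
      ∃ π : V → (V →L[ℝ] ℝ) [⋀^Fin 2]→L[ℝ] ℝ, SmoothNear π p ∧
        (∀ᶠ y in 𝓝 p, pf b (σ y) ≠ 0 →
          π y = invB b (σ y + (e * (2 * h y)⁻¹) • wed (fderiv ℝ h y) (fderiv ℝ G y))) ∧
        pf (dualB b) (π p) = 0 ∧ fderiv ℝ (fun y => pf (dualB b) (π y)) p ≠ 0 := by
  set s : V → ℝ := fun y => pf b (σ y) with hs
  let α := conormal s u
  have hα : SmoothNear α p := H.smooth_conormal
  let τ : V → V [⋀^Fin 2]→L[ℝ] ℝ := fun y => wed (α y) (fderiv ℝ G y)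
  have hτ : SmoothNear τ p := hα.wedge hG.fderiv
  -- `τ = s dh / (2h) ∧ dG`, so that `pf (σ + t s⁻¹ τ) = s + t Δ / s`
  let Δ : V → ℝ := fun y => pf b (σ y + τ y) - s y
  have hΔ : SmoothNear Δ p := ((hσ.add hτ).pfaffian b).sub H.smooth
  have hΔp : Δ p ≠ 0 := by
    have : α p = fderiv ℝ s p := by simp [α, conormal, H.zero]
    simp only [Δ, τ, this, H.zero, sub_zero]
    exact h0
  let e : ℝ := SignType.sign (Δ p)
  have he : e ≠ 0 := by
    rcases lt_or_gt_of_ne hΔp with h1 | h1 <;> simp [e, h1]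
  have hsign : ∀ᶠ y in 𝓝 p, SignType.sign (Δ y) = SignType.sign (Δ p) := by
    rcases lt_or_gt_of_ne hΔp with h1 | h1
    · filter_upwards [hΔ.continuousAt.eventually_lt_const h1] with y h2
      rw [sign_neg h1, sign_neg h2]
    · filter_upwards [hΔ.continuousAt.eventually_const_lt h1] with y h2
      rw [sign_pos h1, sign_pos h2]
  refine ⟨e, he, ?_, ?_⟩
  · filter_upwards [H.fderiv_h, H.eventually_pos, hsign] with y h1 h2 h3 h4
    have h4' : pf b (σ y) ≠ 0 := h4
    have e1 : (pf b (σ y + wed (fderiv ℝ h y) (fderiv ℝ G y)) - pf b (σ y)) / pf b (σ y) =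
        2 * u y * Δ y := by
      rw [h1, wed_smul_left, pf_affine, div_eq_iff h4']
      simp only [Δ, τ, hs, α]
      ring
    rw [e1, sign_mul, sign_pos (by positivity : 0 < 2 * u y), one_mul, h3]
  -- `N` is `s` times the Pfaffian of `σ + e dh / (2h) ∧ dG`, and `A` is `s` times its adjugate;
  -- the inverse is `A / N`, and `N = e Δ` is non-zero on the hypersurface
  let N : V → ℝ := fun y => s y ^ 2 + e * Δ y
  have hN : SmoothNear N p := (H.smooth.pow 2).add ((smoothNear_const e p).mul hΔ)
  have hNp : N p ≠ 0 := by
    simp only [N, H.zero]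
    simpa using ⟨he, hΔp⟩
  have hN0 := hN.continuousAt.eventually_ne hNp
  let A : V → (V →L[ℝ] ℝ) [⋀^Fin 2]→L[ℝ] ℝ := fun y =>
    s y • adjB b (σ y) + e • (adjB b (σ y + τ y) - adjB b (σ y))
  have hA : SmoothNear A p :=
    (H.smooth.smul (hσ.adj b)).add ((smoothNear_const e p).smul
      (((hσ.add hτ).adj b).sub (hσ.adj b)))
  let π : V → (V →L[ℝ] ℝ) [⋀^Fin 2]→L[ℝ] ℝ := fun y => (N y)⁻¹ • A y
  have hπ : SmoothNear π p := (hN.inv hNp).smul hA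
  have hoff : ∀ᶠ y in 𝓝 p, s y ≠ 0 →
      (π y = invB b (σ y + (e * (2 * h y)⁻¹) • wed (fderiv ℝ h y) (fderiv ℝ G y))) ∧
      pf b (σ y + (e * (2 * h y)⁻¹) • wed (fderiv ℝ h y) (fderiv ℝ G y)) = N y / s y := by
    filter_upwards [H.wed_fderiv_h, hN0] with y h1 h2 h3
    have e1 : (e * (2 * h y)⁻¹) • wed (fderiv ℝ h y) (fderiv ℝ G y) = (e * (s y)⁻¹) • τ y := by
      rw [mul_smul, h1 h3, smul_smul]
    have e2 : pf b (σ y + (e * (s y)⁻¹) • τ y) = N y / s y := by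
      simp only [τ, N, Δ]
      rw [pf_affine]
      change s y + _ * (_ - s y) = _
      field_simp
    refine ⟨?_, by rw [e1, e2]⟩
    rw [e1, invB, e2]
    simp only [π, A, τ]
    rw [adjB_affine, inv_div, div_eq_inv_mul, mul_smul]
    congr 1
    rw [smul_add, smul_smul]
    congr 2
    field_simp
  refine ⟨π, hπ, hoff.mono fun y h1 h2 => (h1 h2).1, ?_⟩
  -- the Pfaffians of a form and its inverse are inverse to each other up to a constant
  obtain ⟨c, hcn⟩ : ∃ c : ℝ, c = (-1) ^ n * stdPf n ^ 2 := ⟨_, rfl⟩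
  have hc : c ≠ 0 := by
    have := (stdPf_pos n).ne'
    rw [hcn]; positivity
  have hpf : ∀ᶠ y in 𝓝 p, pf (dualB b) (π y) = c * s y * (N y)⁻¹ := by
    refine eventually_eq_of_eq_off (H.smooth.eventually_fderiv_ne_zero H.regular)
      (hπ.pfaffian (dualB b)).eventually_continuousAt
      (((smoothNear_const c p).mul H.smooth).mul (hN.inv hNp)).eventually_continuousAt ?_
    filter_upwards [hoff, hN0] with y h1 h2 h3
    obtain ⟨h4, h5⟩ := h1 h3
    have h6 := (inv_invB b (by rw [h5]; exact div_ne_zero h2 h3)).pf_mul_pf b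
    rw [← h4, h5] at h6
    have h7 : N y / s y * pf (dualB b) (π y) = c := by rw [hcn]; exact h6
    rw [← h7]
    field_simp
  have hp0 : pf (dualB b) (π p) = 0 := by
    rw [hpf.self_of_nhds, H.zero, mul_zero, zero_mul]
  refine ⟨hp0, ?_⟩
  refine fderiv_ne_zero_of_le (g := s) (δ := |c| * (|N p| + 1)⁻¹)
    (by have := abs_pos.2 hc; positivity) ?_ hp0 H.zero
    (hπ.pfaffian (dualB b)).differentiableAt H.regular
  filter_upwards [hpf, hN0, hN.continuousAt.abs.eventually_lt_const (lt_add_one |N p|)]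
    with y h1 h2 h3
  have := abs_pos.2 h2
  have h4 : (|N p| + 1)⁻¹ ≤ |N y|⁻¹ := by gcongr
  rw [h1, abs_mul, abs_mul, abs_inv, mul_right_comm]
  exact mul_le_mul_of_nonneg_left h4 (mul_nonneg (abs_nonneg _) (abs_nonneg _))

end SquareDefining

end LocalModels

/-! ### Fields in charts -/

section Charts

set_option linter.unusedSectionVars false

/-- The model space. -/
abbrev Eu (m : ℕ) : Type := EuclideanSpace ℝ (Fin m)

variable {m : ℕ} {X : Type*} [TopologicalSpace X] [ChartedSpace (Eu m) X]

/-- The differential of the inverse chart at `x`, as an endomorphism of the model space. -/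
def chA (x : X) (y : Eu m) : Eu m →L[ℝ] Eu m :=
  mfderiv 𝓘(ℝ, Eu m) (𝓡 m) (extChartAt (𝓡 m) x).symm y

/-- The differential of the chart at `x`, as an endomorphism of the model space. -/
def chB (x : X) (y : Eu m) : Eu m →L[ℝ] Eu m :=
  mfderiv (𝓡 m) 𝓘(ℝ, Eu m) (extChartAt (𝓡 m) x) ((extChartAt (𝓡 m) x).symm y)

/-- The differential of a function, as a covector on the model space. -/
def dX (m : ℕ) {X : Type*} [TopologicalSpace X] [ChartedSpace (Eu m) X] (f : X → ℝ) (x : X) :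
    Eu m →L[ℝ] ℝ := mvfderiv (𝓡 m) f x

/-- A function on a manifold is smooth on a neighbourhood of `x`. -/
def SmoothNearX (m : ℕ) {X : Type*} [TopologicalSpace X] [ChartedSpace (Eu m) X]
    (f : X → ℝ) (x : X) : Prop :=
  ∀ᶠ x' in 𝓝 x, ContMDiffAt (𝓡 m) 𝓘(ℝ, ℝ) ∞ f x'

theorem target_mem_nhds {x : X} {y : Eu m} (hy : y ∈ (extChartAt (𝓡 m) x).target) :
    (extChartAt (𝓡 m) x).target ∈ 𝓝 y := (isOpen_extChartAt_target x).mem_nhds hy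

theorem source_mem_nhds {x x' : X} (hx : x' ∈ (extChartAt (𝓡 m) x).source) :
    (extChartAt (𝓡 m) x).source ∈ 𝓝 x' := (isOpen_extChartAt_source x).mem_nhds hx

theorem eventually_symm {x : X} {y : Eu m} (hy : y ∈ (extChartAt (𝓡 m) x).target) {P : X → Prop}
    (h : ∀ᶠ x' in 𝓝 ((extChartAt (𝓡 m) x).symm y), P x') :
    ∀ᶠ y' in 𝓝 y, P ((extChartAt (𝓡 m) x).symm y') :=
  (continuousAt_extChartAt_symm'' hy).eventually h

theorem eventually_chart {x x' : X} (hx : x' ∈ (extChartAt (𝓡 m) x).source) {P : Eu m → Prop}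
    (h : ∀ᶠ y in 𝓝 (extChartAt (𝓡 m) x x'), P y) :
    ∀ᶠ x'' in 𝓝 x', P (extChartAt (𝓡 m) x x'') :=
  (continuousAt_extChartAt' hx).eventually h

variable [IsManifold (𝓡 m) ∞ X]

theorem contMDiffAt_symm {x : X} {y : Eu m} (hy : y ∈ (extChartAt (𝓡 m) x).target) :
    ContMDiffAt 𝓘(ℝ, Eu m) (𝓡 m) ∞ (extChartAt (𝓡 m) x).symm y :=
  (contMDiffOn_extChartAt_symm x).contMDiffAt (target_mem_nhds hy)

theorem contMDiffAt_chart {x x' : X} (hx : x' ∈ (extChartAt (𝓡 m) x).source) :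
    ContMDiffAt (𝓡 m) 𝓘(ℝ, Eu m) ∞ (extChartAt (𝓡 m) x) x' :=
  contMDiffAt_extChartAt' (by rwa [extChartAt_source] at hx)

theorem chB_chA {x : X} {y : Eu m} (hy : y ∈ (extChartAt (𝓡 m) x).target) (v : Eu m) :
    chB x y (chA x y v) = v := by
  have hs := (extChartAt (𝓡 m) x).map_target hy
  have h := mfderiv_comp y ((contMDiffAt_chart hs).mdifferentiableAt (by simp))
    ((contMDiffAt_symm hy).mdifferentiableAt (by simp))
  have e : (extChartAt (𝓡 m) x ∘ (extChartAt (𝓡 m) x).symm) =ᶠ[𝓝 y] id := by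
    filter_upwards [target_mem_nhds hy] with z hz using (extChartAt (𝓡 m) x).right_inv hz
  rw [e.mfderiv_eq, mfderiv_id] at h
  exact (congrArg (fun L => L v) h).symm

theorem chA_chB {x : X} {y : Eu m} (hy : y ∈ (extChartAt (𝓡 m) x).target) (v : Eu m) :
    chA x y (chB x y v) = v := by
  have hinj : Function.Injective (chB x y) := by
    have hsurj : Function.Surjective (chB x y) := fun w => ⟨_, chB_chA hy w⟩
    exact (LinearMap.injective_iff_surjective (f := (chB x y : Eu m →ₗ[ℝ] Eu m))).2 hsurj
  exact hinj (chB_chA hy _)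

theorem smoothNear_comp_symm {f : X → ℝ} {x : X} {y : Eu m}
    (hy : y ∈ (extChartAt (𝓡 m) x).target)
    (hf : SmoothNearX m f ((extChartAt (𝓡 m) x).symm y)) :
    SmoothNear (fun z => f ((extChartAt (𝓡 m) x).symm z)) y := by
  filter_upwards [eventually_symm hy hf, target_mem_nhds hy] with z hz hz'
  exact contMDiffAt_iff_contDiffAt.1 (hz.comp z (contMDiffAt_symm hz'))

theorem smoothNearX_of_chart {f : X → ℝ} {x x' : X} (hx : x' ∈ (extChartAt (𝓡 m) x).source)
    (hf : SmoothNear (fun z => f ((extChartAt (𝓡 m) x).symm z)) (extChartAt (𝓡 m) x x')) :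
    SmoothNearX m f x' := by
  filter_upwards [eventually_chart hx hf, eventually_eventually_nhds.2 (source_mem_nhds hx)]
    with z hz hz'
  have h := (contMDiffAt_iff_contDiffAt.2 hz).comp z (contMDiffAt_chart (mem_of_mem_nhds hz'))
  refine h.congr_of_eventuallyEq ?_
  filter_upwards [hz'] with w hw
  exact congrArg f ((extChartAt (𝓡 m) x).left_inv hw).symm

theorem SmoothNearX.contMDiffAt {f : X → ℝ} {x : X} (hf : SmoothNearX m f x) :
    ContMDiffAt (𝓡 m) 𝓘(ℝ, ℝ) ∞ f x := hf.self_of_nhds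

theorem dX_comp_chA {f : X → ℝ} {x : X} {y : Eu m} (hy : y ∈ (extChartAt (𝓡 m) x).target)
    (hf : ContMDiffAt (𝓡 m) 𝓘(ℝ, ℝ) ∞ f ((extChartAt (𝓡 m) x).symm y)) :
    (dX m f ((extChartAt (𝓡 m) x).symm y)).comp (chA x y) =
      fderiv ℝ (fun z => f ((extChartAt (𝓡 m) x).symm z)) y := by
  have h := mfderiv_comp y (hf.mdifferentiableAt (by simp))
    ((contMDiffAt_symm hy).mdifferentiableAt (by simp))
  rw [mfderiv_eq_fderiv] at h
  exact h.symm

/-- The transition map between two charts. -/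
def trans (x₀ x₁ : X) (y : Eu m) : Eu m := extChartAt (𝓡 m) x₁ ((extChartAt (𝓡 m) x₀).symm y)

theorem smoothNear_trans {x₀ x₁ : X} {y : Eu m} (hy : y ∈ (extChartAt (𝓡 m) x₀).target)
    (hy' : (extChartAt (𝓡 m) x₀).symm y ∈ (extChartAt (𝓡 m) x₁).source) :
    SmoothNear (trans x₀ x₁) y := by
  filter_upwards [target_mem_nhds hy, eventually_symm hy (source_mem_nhds hy')] with z hz hz'
  exact contMDiffAt_iff_contDiffAt.1 ((contMDiffAt_chart hz').comp z (contMDiffAt_symm hz))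

theorem fderiv_trans {x₀ x₁ : X} {y : Eu m} (hy : y ∈ (extChartAt (𝓡 m) x₀).target)
    (hy' : (extChartAt (𝓡 m) x₀).symm y ∈ (extChartAt (𝓡 m) x₁).source) :
    fderiv ℝ (trans x₀ x₁) y = (chB x₁ (trans x₀ x₁ y)).comp (chA x₀ y) := by
  have h := mfderiv_comp y ((contMDiffAt_chart hy').mdifferentiableAt (by simp))
    ((contMDiffAt_symm hy).mdifferentiableAt (by simp))
  rw [mfderiv_eq_fderiv] at h
  have e : (extChartAt (𝓡 m) x₁).symm (trans x₀ x₁ y) = (extChartAt (𝓡 m) x₀).symm y :=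
    (extChartAt (𝓡 m) x₁).left_inv hy'
  rw [chB, e]
  exact h

/-- A kind of tensor field with fibres modelled on `W`: the expression in charts of the values, and
the fact that smoothness of this expression does not depend on the chart. -/
structure FieldKind (m : ℕ) (X : Type*) [TopologicalSpace X] [ChartedSpace (Eu m) X]
    (W : Type) [NormedAddCommGroup W] [NormedSpace ℝ W] where
  /-- `C x y v` is the expression in the chart at `x` of the value `v` at the point with
  coordinates `y`. -/
  C : X → Eu m → W → W
  /-- Every vector is the expression of some value. -/
  surj : ∀ x, ∀ y ∈ (extChartAt (𝓡 m) x).target, Function.Surjective (C x y)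
  /-- A smooth expression `q` in the chart at `x₁` corresponds to a smooth expression `q'` in the
  chart at `x₀`. -/
  change : ∀ x₀ x₁ : X, ∀ y ∈ (extChartAt (𝓡 m) x₀).target,
    (extChartAt (𝓡 m) x₀).symm y ∈ (extChartAt (𝓡 m) x₁).source → ∀ q : Eu m → W,
      SmoothNear q (trans x₀ x₁ y) → ∃ q' : Eu m → W, SmoothNear q' y ∧
        ∀ᶠ z in 𝓝 y, ∀ v, C x₁ (trans x₀ x₁ z) v = q (trans x₀ x₁ z) ↔ C x₀ z v = q' z

theorem trans_trans {x₀ x₁ : X} {y : Eu m} (hy : y ∈ (extChartAt (𝓡 m) x₀).target)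
    (hy' : (extChartAt (𝓡 m) x₀).symm y ∈ (extChartAt (𝓡 m) x₁).source) :
    trans x₁ x₀ (trans x₀ x₁ y) = y := by
  simp only [trans]
  rw [(extChartAt (𝓡 m) x₁).left_inv hy', (extChartAt (𝓡 m) x₀).right_inv hy]

theorem fderiv_trans_trans {x₀ x₁ : X} {y : Eu m} (hy : y ∈ (extChartAt (𝓡 m) x₀).target)
    (hy' : (extChartAt (𝓡 m) x₀).symm y ∈ (extChartAt (𝓡 m) x₁).source) :
    fderiv ℝ (trans x₁ x₀) (trans x₀ x₁ y) = (chB x₀ y).comp (chA x₁ (trans x₀ x₁ y)) := by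
  rw [fderiv_trans, trans_trans hy hy']
  · exact (extChartAt (𝓡 m) x₁).map_source hy'
  · rw [trans, (extChartAt (𝓡 m) x₁).left_inv hy']
    exact (extChartAt (𝓡 m) x₀).map_target hy

variable (m X) in
/-- Two-forms. -/
def formKind : FieldKind m X (Eu m [⋀^Fin 2]→L[ℝ] ℝ) where
  C x y v := v.compContinuousLinearMap (chA x y)
  surj x y hy w := by
    refine ⟨w.compContinuousLinearMap (chB x y), form_ext fun a b => ?_⟩
    rw [form_comp_apply, form_comp_apply, chB_chA hy, chB_chA hy]
  change x₀ x₁ y hy hy' q hq := by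
    refine ⟨fun z => (q (trans x₀ x₁ z)).compContinuousLinearMap (fderiv ℝ (trans x₀ x₁) z), ?_, ?_⟩
    · filter_upwards [hq.comp (smoothNear_trans hy hy'), (smoothNear_trans hy hy').fderiv]
        with z h1 h2 using ContDiffAt.form_comp h1 h2
    · filter_upwards [target_mem_nhds hy, eventually_symm hy (source_mem_nhds hy')] with z hz hz' v
      have ht : trans x₀ x₁ z ∈ (extChartAt (𝓡 m) x₁).target :=
        (extChartAt (𝓡 m) x₁).map_source hz'
      rw [fderiv_trans hz hz']
      constructor
      · intro h
        rw [← h]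
        refine form_ext fun a b => ?_
        simp only [form_comp_apply, ContinuousLinearMap.comp_apply, chA_chB ht]
      · intro h
        refine form_ext fun a b => ?_
        have h1 := congrArg (fun f => f ![chB x₀ z (chA x₁ (trans x₀ x₁ z) a),
          chB x₀ z (chA x₁ (trans x₀ x₁ z) b)]) h
        simpa only [form_comp_apply, ContinuousLinearMap.comp_apply, chA_chB hz, chB_chA ht]
          using h1

theorem precomp_apply' (A : Eu m →L[ℝ] Eu m) (α : Eu m →L[ℝ] ℝ) :
    ContinuousLinearMap.precomp ℝ A α = α.comp A := rfl

theorem comp_chB_chA {x : X} {y : Eu m} (hy : y ∈ (extChartAt (𝓡 m) x).target)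
    (α : Eu m →L[ℝ] ℝ) : (α.comp (chB x y)).comp (chA x y) = α :=
  ContinuousLinearMap.ext fun v => congrArg α (chB_chA hy v)

theorem comp_chA_chB {x : X} {y : Eu m} (hy : y ∈ (extChartAt (𝓡 m) x).target)
    (α : Eu m →L[ℝ] ℝ) : (α.comp (chA x y)).comp (chB x y) = α :=
  ContinuousLinearMap.ext fun v => congrArg α (chA_chB hy v)

theorem contDiff_precomp : ContDiff ℝ ∞ fun A : Eu m →L[ℝ] Eu m =>
    (ContinuousLinearMap.precomp ℝ A : (Eu m →L[ℝ] ℝ) →L[ℝ] Eu m →L[ℝ] ℝ) := by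
  rw [contDiff_clm_apply_iff]
  exact fun α => (contDiff_const (c := α)).clm_comp contDiff_id

variable (m X) in
/-- Bivector fields. -/
def bivectorKind : FieldKind m X ((Eu m →L[ℝ] ℝ) [⋀^Fin 2]→L[ℝ] ℝ) where
  C x y v := v.compContinuousLinearMap (ContinuousLinearMap.precomp ℝ (chB x y))
  surj x y hy w := by
    refine ⟨w.compContinuousLinearMap (ContinuousLinearMap.precomp ℝ (chA x y)),
      form_ext fun a b => ?_⟩
    simp only [form_comp_apply, precomp_apply', comp_chB_chA hy]
  change x₀ x₁ y hy hy' q hq := by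
    have ht : trans x₀ x₁ y ∈ (extChartAt (𝓡 m) x₁).target :=
      (extChartAt (𝓡 m) x₁).map_source hy'
    have ht' : (extChartAt (𝓡 m) x₁).symm (trans x₀ x₁ y) ∈ (extChartAt (𝓡 m) x₀).source := by
      rw [trans, (extChartAt (𝓡 m) x₁).left_inv hy']
      exact (extChartAt (𝓡 m) x₀).map_target hy
    refine ⟨fun z => (q (trans x₀ x₁ z)).compContinuousLinearMap
      (ContinuousLinearMap.precomp ℝ (fderiv ℝ (trans x₁ x₀) (trans x₀ x₁ z))), ?_, ?_⟩
    · have h3 : SmoothNear (fun z => fderiv ℝ (trans x₁ x₀) (trans x₀ x₁ z)) y :=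
        (smoothNear_trans ht ht').fderiv.comp (smoothNear_trans hy hy')
      filter_upwards [hq.comp (smoothNear_trans hy hy'), h3] with z h1 h2
      refine ContDiffAt.form_comp h1 ?_
      exact contDiff_precomp.contDiffAt.comp z h2
    · filter_upwards [target_mem_nhds hy, eventually_symm hy (source_mem_nhds hy')] with z hz hz' v
      have ht : trans x₀ x₁ z ∈ (extChartAt (𝓡 m) x₁).target :=
        (extChartAt (𝓡 m) x₁).map_source hz'
      rw [fderiv_trans_trans hz hz']
      constructor
      · intro h
        rw [← h]
        refine form_ext fun a b => ?_
        simp only [form_comp_apply, precomp_apply', ← ContinuousLinearMap.comp_assoc,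
          comp_chA_chB ht]
      · intro h
        refine form_ext fun a b => ?_
        have h1 := congrArg (fun f => f ![(a.comp (chB x₁ (trans x₀ x₁ z))).comp (chA x₀ z),
          (b.comp (chB x₁ (trans x₀ x₁ z))).comp (chA x₀ z)]) h
        simpa only [form_comp_apply, precomp_apply', ← ContinuousLinearMap.comp_assoc,
          comp_chA_chB hz, comp_chB_chA ht] using h1

namespace FieldKind

variable {W : Type} [NormedAddCommGroup W] [NormedSpace ℝ W] (K : FieldKind m X W)

/-- A field which is smooth near each point in the preferred chart is smooth in all charts. -/
theorem smoothNear_of_local {f : X → W}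
    (h : ∀ x, SmoothNear (fun y => K.C x y (f ((extChartAt (𝓡 m) x).symm y)))
      (extChartAt (𝓡 m) x x)) (x : X) {y : Eu m} (hy : y ∈ (extChartAt (𝓡 m) x).target) :
    SmoothNear (fun y => K.C x y (f ((extChartAt (𝓡 m) x).symm y))) y := by
  set x₁ := (extChartAt (𝓡 m) x).symm y with hx₁
  have hs : (extChartAt (𝓡 m) x).symm y ∈ (extChartAt (𝓡 m) x₁).source :=
    mem_extChartAt_source x₁
  obtain ⟨q', hq', h'⟩ := K.change x x₁ y hy hs
    (fun y => K.C x₁ y (f ((extChartAt (𝓡 m) x₁).symm y))) (h x₁)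
  refine hq'.congr ?_
  filter_upwards [h', target_mem_nhds hy, eventually_symm hy (source_mem_nhds hs)] with z h1 h2 h3
  rw [← h1, trans, (extChartAt (𝓡 m) x₁).left_inv h3]

theorem mem_closure_symm {Z : Set X} {x : X} {y : Eu m} (hy : y ∈ (extChartAt (𝓡 m) x).target)
    (hZ : (extChartAt (𝓡 m) x).symm y ∈ closure Zᶜ) :
    (𝓝[{z | (extChartAt (𝓡 m) x).symm z ∉ Z}] y).NeBot := by
  rw [← mem_closure_iff_nhdsWithin_neBot, mem_closure_iff_frequently]
  rw [mem_closure_iff_frequently] at hZ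
  intro h
  apply hZ
  have hs := (extChartAt (𝓡 m) x).map_target hy
  have h1 : ∀ᶠ z in 𝓝 (extChartAt (𝓡 m) x ((extChartAt (𝓡 m) x).symm y)),
      ¬ (extChartAt (𝓡 m) x).symm z ∉ Z := by
    rwa [(extChartAt (𝓡 m) x).right_inv hy]
  filter_upwards [eventually_chart hs h1, source_mem_nhds hs] with z hz hz'
  rw [(extChartAt (𝓡 m) x).left_inv hz'] at hz
  exact hz

/-- A field defined off a set with dense complement, whose expressions near every point in the
preferred chart agree off this set with smooth maps, extends to a smooth field. -/
theorem exists_extension {Z : Set X} (hZ : ∀ x ∈ Z, x ∈ closure Zᶜ) (f : X → W)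
    (q : X → Eu m → W) (hq : ∀ x, SmoothNear (q x) (extChartAt (𝓡 m) x x))
    (hf : ∀ x, ∀ᶠ y in 𝓝 (extChartAt (𝓡 m) x x), (extChartAt (𝓡 m) x).symm y ∉ Z →
      K.C x y (f ((extChartAt (𝓡 m) x).symm y)) = q x y) :
    ∃ F : X → W, (∀ x ∉ Z, F x = f x) ∧
      ∀ x, ∀ᶠ y in 𝓝 (extChartAt (𝓡 m) x x),
        K.C x y (F ((extChartAt (𝓡 m) x).symm y)) = q x y := by
  classical
  choose v hv using fun x : X => K.surj x _ (mem_extChartAt_target (I := 𝓡 m) x)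
    (q x (extChartAt (𝓡 m) x x))
  refine ⟨fun x => if x ∈ Z then v x else f x, fun x hx => if_neg hx, fun x₀ => ?_⟩
  filter_upwards [(hq x₀).eventually, eventually_eventually_nhds.2 (hf x₀),
    extChartAt_target_mem_nhds x₀] with y hqy hfy hy
  set x₁ := (extChartAt (𝓡 m) x₀).symm y with hx₁
  by_cases hx : x₁ ∈ Z
  swap
  · rw [if_neg hx]
    exact hfy.self_of_nhds hx
  rw [if_pos hx]
  have hs : (extChartAt (𝓡 m) x₀).symm y ∈ (extChartAt (𝓡 m) x₁).source :=
    mem_extChartAt_source x₁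
  obtain ⟨q', hq', h'⟩ := K.change x₀ x₁ y hy hs (q x₁) (hq x₁)
  have h1 : q' y = q x₀ y := by
    have := mem_closure_symm hy (hZ x₁ hx)
    refine tendsto_nhds_unique_of_eventuallyEq
      (l := 𝓝[{z | (extChartAt (𝓡 m) x₀).symm z ∉ Z}] y)
      (hq'.continuousAt.mono_left nhdsWithin_le_nhds)
      (hqy.continuousAt.mono_left nhdsWithin_le_nhds) (eventually_nhdsWithin_iff.2 ?_)
    have hτ : ∀ᶠ z in 𝓝 y, (extChartAt (𝓡 m) x₁).symm (trans x₀ x₁ z) ∉ Z →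
        K.C x₁ (trans x₀ x₁ z) (f ((extChartAt (𝓡 m) x₁).symm (trans x₀ x₁ z))) =
          q x₁ (trans x₀ x₁ z) :=
      (smoothNear_trans hy hs).continuousAt.eventually (hf x₁)
    filter_upwards [h', hτ, hfy, eventually_symm hy (source_mem_nhds hs)] with z h1 h2 h3 h4 h5
    have e : (extChartAt (𝓡 m) x₁).symm (trans x₀ x₁ z) = (extChartAt (𝓡 m) x₀).symm z :=
      (extChartAt (𝓡 m) x₁).left_inv h4
    rw [e] at h2
    rw [← (h1 _).1 (h2 h5), h3 h5]
  rw [← h1]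
  exact (h'.self_of_nhds _).1 (hv x₁)

end FieldKind

end Charts

/-! ### Smooth functions near a point of a manifold -/

section Functions

set_option linter.unusedSectionVars false

variable {m : ℕ} {X : Type*} [TopologicalSpace X] [ChartedSpace (Eu m) X]

namespace SmoothNearX

theorem congr {f g : X → ℝ} {x : X} (hf : SmoothNearX m f x) (h : ∀ᶠ x' in 𝓝 x, g x' = f x') :
    SmoothNearX m g x := by
  filter_upwards [hf, eventually_eventually_nhds.2 h] with y h1 h2
    using h1.congr_of_eventuallyEq h2

theorem const (c : ℝ) (x : X) : SmoothNearX m (fun _ => c) x :=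
  Filter.Eventually.of_forall fun _ => contMDiffAt_const

theorem eventually {f : X → ℝ} {x : X} (hf : SmoothNearX m f x) :
    ∀ᶠ x' in 𝓝 x, SmoothNearX m f x' := eventually_eventually_nhds.2 hf

theorem mul {f g : X → ℝ} {x : X} (hf : SmoothNearX m f x) (hg : SmoothNearX m g x) :
    SmoothNearX m (fun x => f x * g x) x := by
  filter_upwards [hf, hg] with y h1 h2 using h1.mul h2

theorem sum {ι : Type*} {s : Finset ι} {f : ι → X → ℝ} {x : X}
    (hf : ∀ i ∈ s, SmoothNearX m (f i) x) : SmoothNearX m (fun x => ∑ i ∈ s, f i x) x := by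
  filter_upwards [(Filter.eventually_all_finset s).2 hf] with y hy
  exact contMDiffAt_finsetSum hy

theorem comp_real {f : X → ℝ} {x : X} {F : ℝ → ℝ} (hF : ContDiff ℝ ∞ F) (hf : SmoothNearX m f x) :
    SmoothNearX m (fun x => F (f x)) x := by
  filter_upwards [hf] with y h1 using hF.contMDiff.contMDiffAt.comp y h1

end SmoothNearX

theorem dX_congr {f g : X → ℝ} {x : X} (h : ∀ᶠ x' in 𝓝 x, f x' = g x') : dX m f x = dX m g x := by
  have h' : f =ᶠ[𝓝 x] g := h
  have := h'.mfderiv_eq (I := 𝓡 m) (I' := 𝓘(ℝ, ℝ))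
  exact this

variable [IsManifold (𝓡 m) ∞ X]

theorem dX_eq_fderiv_comp {f : X → ℝ} {x x' : X} (hx : x' ∈ (extChartAt (𝓡 m) x).source)
    (hf : ContMDiffAt (𝓡 m) 𝓘(ℝ, ℝ) ∞ f x') :
    dX m f x' = (fderiv ℝ (fun z => f ((extChartAt (𝓡 m) x).symm z)) (extChartAt (𝓡 m) x x')).comp
      (chB x (extChartAt (𝓡 m) x x')) := by
  have ht := (extChartAt (𝓡 m) x).map_source hx
  have e := (extChartAt (𝓡 m) x).left_inv hx
  rw [← dX_comp_chA ht (by rwa [e]), comp_chA_chB ht, e]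

theorem dX_add_const {f : X → ℝ} {x : X} (hf : ContMDiffAt (𝓡 m) 𝓘(ℝ, ℝ) ∞ f x) (c : ℝ) :
    dX m (fun x => f x + c) x = dX m f x := by
  have hf' : ContMDiffAt (𝓡 m) 𝓘(ℝ, ℝ) ∞ (fun x => f x + c) x := hf.add contMDiffAt_const
  rw [dX_eq_fderiv_comp (mem_extChartAt_source (I := 𝓡 m) x) hf,
    dX_eq_fderiv_comp (mem_extChartAt_source (I := 𝓡 m) x) hf',
    fderiv_add_const]

/-- Two functions with the same differential differ by a local constant. -/
theorem eventually_sub_eq_of_dX_eq {f g : X → ℝ} {x : X} (hf : SmoothNearX m f x)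
    (hg : SmoothNearX m g x) (h : ∀ᶠ x' in 𝓝 x, dX m f x' = dX m g x') :
    ∀ᶠ x' in 𝓝 x, f x' - g x' = f x - g x := by
  have hx := mem_extChartAt_source (I := 𝓡 m) x
  have hy := mem_extChartAt_target (I := 𝓡 m) x
  have e := (extChartAt (𝓡 m) x).left_inv hx
  set φ := extChartAt (𝓡 m) x with hφ
  let F : Eu m → ℝ := fun y => f (φ.symm y) - g (φ.symm y)
  have h1 : ∀ᶠ y in 𝓝 (φ x), DifferentiableAt ℝ F y ∧ fderiv ℝ F y = 0 := by
    have hf' := smoothNear_comp_symm hy (f := f) (by rwa [e])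
    have hg' := smoothNear_comp_symm hy (f := g) (by rwa [e])
    have a1 := eventually_symm hy (P := fun x' => ContMDiffAt (𝓡 m) 𝓘(ℝ, ℝ) ∞ f x')
      (by rw [e]; exact hf)
    have a2 := eventually_symm hy (P := fun x' => ContMDiffAt (𝓡 m) 𝓘(ℝ, ℝ) ∞ g x')
      (by rw [e]; exact hg)
    have a3 := eventually_symm hy (P := fun x' => dX m f x' = dX m g x') (by rw [e]; exact h)
    filter_upwards [hf', hg', a1, a2, a3, target_mem_nhds hy] with y b1 b2 b3 b4 b5 b6
    have d1 := b1.differentiableAt (by simp)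
    have d2 := b2.differentiableAt (by simp)
    refine ⟨d1.sub d2, ?_⟩
    rw [fderiv_fun_sub d1 d2, ← dX_comp_chA b6 b3, ← dX_comp_chA b6 b4, b5, sub_self]
  obtain ⟨r, hr, hball⟩ := Metric.eventually_nhds_iff_ball.1 h1
  have h2 : ∀ᶠ y in 𝓝 (φ x), F y = F (φ x) := by
    filter_upwards [Metric.ball_mem_nhds _ hr] with y hy
    refine (convex_ball (φ x) r).is_const_of_fderivWithin_eq_zero (𝕜 := ℝ)
      (fun z hz => (hball z hz).1.differentiableWithinAt) (fun z hz => ?_) hy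
      (Metric.mem_ball_self hr)
    rw [fderivWithin_of_isOpen Metric.isOpen_ball hz, (hball z hz).2]
  filter_upwards [eventually_chart hx h2, source_mem_nhds hx] with x' h3 h4
  simp only [F] at h3
  rwa [φ.left_inv h4, φ.left_inv hx] at h3

end Functions

/-! ### Hypersurfaces -/

section Immersion

set_option linter.unusedSectionVars false

variable {m d : ℕ} {X : Type*} [TopologicalSpace X] [ChartedSpace (Eu m) X]
  [IsManifold (𝓡 m) ∞ X] {Z : Type*} [TopologicalSpace Z] [ChartedSpace (Eu d) Z]
  [IsManifold (𝓡 d) ∞ Z]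

/-- An immersion has local left inverses. -/
theorem exists_local_retraction {ι : Z → X} {z : Z}
    (h : Manifold.IsImmersionAt (𝓡 d) (𝓡 m) ∞ ι z) :
    ∃ ρ : X → Z, (∀ᶠ x in 𝓝 (ι z), ContMDiffAt (𝓡 m) (𝓡 d) ∞ ρ x) ∧
      ∀ᶠ z' in 𝓝 z, ρ (ι z') = z' := by
  let P : Eu m → Eu d := fun y => (h.equiv.symm y).1
  have hP : ContDiff ℝ ∞ P := contDiff_fst.comp h.equiv.symm.contDiff
  have key : ∀ z' ∈ h.domChart.source,
      P (h.codChart.extend (𝓡 m) (ι z')) = h.domChart.extend (𝓡 d) z' := by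
    intro z' hz'
    have hz'' : z' ∈ (h.domChart.extend (𝓡 d)).source := by
      rwa [OpenPartialHomeomorph.extend_source]
    have := h.writtenInCharts ((h.domChart.extend (𝓡 d)).map_source hz'')
    simp only [Function.comp_apply, (h.domChart.extend (𝓡 d)).left_inv hz''] at this
    simp only [P, this, ContinuousLinearEquiv.symm_apply_apply]
  refine ⟨fun x => (h.domChart.extend (𝓡 d)).symm (P (h.codChart.extend (𝓡 m) x)), ?_, ?_⟩
  · have hc : ∀ x ∈ h.codChart.source, ContMDiffAt (𝓡 m) 𝓘(ℝ, Eu m) ∞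
        (h.codChart.extend (𝓡 m)) x := fun x hx =>
      contMDiffAt_of_mem_maximalAtlas h.codChart_mem_maximalAtlas hx
    have hx0 := h.mem_codChart_source
    have h1 : ContMDiffAt (𝓡 m) 𝓘(ℝ, Eu d) ∞ (fun x => P (h.codChart.extend (𝓡 m) x)) (ι z) :=
      hP.contMDiff.contMDiffAt.comp _ (hc _ hx0)
    have h2 : (h.domChart.extend (𝓡 d)).target ∈ 𝓝 (P (h.codChart.extend (𝓡 m) (ι z))) := by
      rw [key z h.mem_domChart_source]
      refine h.domChart.isOpen_extend_target.mem_nhds ?_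
      refine (h.domChart.extend (𝓡 d)).map_source ?_
      rw [OpenPartialHomeomorph.extend_source]
      exact h.mem_domChart_source
    filter_upwards [h.codChart.open_source.mem_nhds hx0, h1.continuousAt.eventually h2]
      with x hx hx'
    have h3 : ContMDiffAt 𝓘(ℝ, Eu d) (𝓡 d) ∞ (h.domChart.extend (𝓡 d)).symm
        (P (h.codChart.extend (𝓡 m) x)) :=
      (contMDiffOn_extend_symm h.domChart_mem_maximalAtlas).contMDiffAt <| by
        rw [← OpenPartialHomeomorph.extend_target']
        exact h.domChart.isOpen_extend_target.mem_nhds hx'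
    exact h3.comp x (hP.contMDiff.contMDiffAt.comp _ (hc _ hx))
  · filter_upwards [h.domChart.open_source.mem_nhds h.mem_domChart_source] with z' hz'
    rw [key z' hz']
    exact (h.domChart.extend (𝓡 d)).left_inv (by rwa [OpenPartialHomeomorph.extend_source])

/-- Functions given locally on a compact hypersurface, whose differentials agree on overlaps, are
restrictions of local primitives of a single covector field of the ambient manifold. The primitive
extending `g` is `∑ χᵢ · g ∘ ρᵢ`, for a partition of unity `χᵢ` and local retractions `ρᵢ`: if `g`
is changed by a constant, so is this sum. -/
theorem exists_extension_of_primitives [T2Space X] [CompactSpace X] {ι : Z → X}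
    (hι : Topology.IsEmbedding ι) (hc : IsClosed (Set.range ι)) (ρ : Z → X → Z)
    (hρ : ∀ z, ∀ᶠ x in 𝓝 (ι z), ContMDiffAt (𝓡 m) (𝓡 d) ∞ (ρ z) x)
    (hρι : ∀ z, ∀ᶠ z' in 𝓝 z, ρ z (ι z') = z') (g : Z → Z → ℝ)
    (hg : ∀ z, SmoothNearX d (g z) z)
    (hd : ∀ z, ∀ᶠ z' in 𝓝 z, dX d (g z) z' = dX d (g z') z') :
    ∃ Θ : X → Eu m →L[ℝ] ℝ, ∀ z, ∃ G : X → ℝ, SmoothNearX m G (ι z) ∧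
      (∀ᶠ x in 𝓝 (ι z), Θ x = dX m G x) ∧ ∀ᶠ z' in 𝓝 z, G (ι z') = g z z' := by
  classical
  -- `Q a z`: the function `g a` is a valid primitive at `z`
  let Q : Z → Z → Prop := fun a z => SmoothNearX d (g a) z ∧
    ∀ᶠ z' in 𝓝 z, dX d (g a) z' = dX d (g z') z'
  -- `R a z`: the map `ρ a` is a retraction near `z`
  let R : Z → Z → Prop := fun a z => (∀ᶠ x in 𝓝 (ι z), ContMDiffAt (𝓡 m) (𝓡 d) ∞ (ρ a) x) ∧
    ∀ᶠ z' in 𝓝 z, ρ a (ι z') = z'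
  have hQR : ∀ a, ∀ᶠ z in 𝓝 a, Q a z ∧ R a z := by
    intro a
    have h1 := hι.continuous.continuousAt.eventually (eventually_eventually_nhds.2 (hρ a))
    filter_upwards [(hg a).eventually, eventually_eventually_nhds.2 (hd a), h1,
      eventually_eventually_nhds.2 (hρι a)] with z a1 a2 a3 a4 using ⟨⟨a1, a2⟩, a3, a4⟩
  have hU : ∀ a, ∃ U : Set X, IsOpen U ∧ ι a ∈ U ∧ ∀ z, ι z ∈ U → Q a z ∧ R a z := by
    intro a
    have h1 := hQR a
    rw [hι.nhds_eq_comap, Filter.eventually_comap] at h1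
    obtain ⟨U, hU, hUo, ha⟩ := eventually_nhds_iff.1 h1
    exact ⟨U, hUo, ha, fun z hz => hU _ hz z rfl⟩
  choose U hUo hUm hUQR using hU
  obtain ⟨t, ht⟩ := hc.isCompact.elim_finite_subcover U hUo
    (by rintro _ ⟨z, rfl⟩; exact Set.mem_iUnion.2 ⟨z, hUm z⟩)
  obtain ⟨v, hvo, hvZ, hvU⟩ := normal_exists_closure_subset hc
    (isOpen_biUnion fun i (_ : i ∈ t) => hUo i) ht
  obtain ⟨χ, hχ⟩ := SmoothPartitionOfUnity.exists_isSubordinate (𝓡 m) (isClosed_closure (s := v))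
    (fun i : t => U i) (fun i => hUo i) (by
      intro x hx
      obtain ⟨i, hi, hx'⟩ := Set.mem_iUnion₂.1 (hvU hx)
      exact Set.mem_iUnion.2 ⟨⟨i, hi⟩, hx'⟩)
  have hsum : ∀ x ∈ closure v, ∑ i : t, χ i x = 1 := fun x hx => by
    rw [← finsum_eq_sum_of_fintype]
    exact χ.sum_eq_one hx
  let G : Z → X → ℝ := fun a x => ∑ i : t, χ i x * g a (ρ i x)
  -- the retractions involved near `ι z` are retractions at `z`
  have hR : ∀ (i : t) z, ι z ∈ tsupport (χ i) → R i z := fun i z hz => (hUQR i z (hχ i hz)).2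
  have hoff : ∀ (i : t) x, x ∉ tsupport (χ i) → ∀ᶠ x' in 𝓝 x, χ i x' = 0 := fun i x hx =>
    notMem_tsupport_iff_eventuallyEq.1 hx
  have htend : ∀ (i : t) z, ι z ∈ tsupport (χ i) → Filter.Tendsto (ρ i) (𝓝 (ι z)) (𝓝 z) := by
    intro i z hz
    have h1 := (hR i z hz).1.self_of_nhds.continuousAt
    rwa [ContinuousAt, (hR i z hz).2.self_of_nhds] at h1
  have hGs : ∀ a z, Q a z → SmoothNearX m (G a) (ι z) := by
    intro a z hQ
    refine SmoothNearX.sum fun i _ => ?_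
    by_cases hz : ι z ∈ tsupport (χ i)
    · filter_upwards [(hR i z hz).1, (htend i z hz).eventually hQ.1] with x h1 h2
      exact (χ i).contMDiff.contMDiffAt.mul (h2.comp x h1)
    · refine (SmoothNearX.const 0 _).congr ?_
      filter_upwards [hoff i _ hz] with x hx
      rw [hx, zero_mul]
  have hGd : ∀ a b z, Q a z → Q b z → ∀ᶠ x in 𝓝 (ι z), dX m (G a) x = dX m (G b) x := by
    intro a b z ha hb
    have h1 := eventually_sub_eq_of_dX_eq ha.1 hb.1 (by
      filter_upwards [ha.2, hb.2] with z' h1 h2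
      rw [h1, h2])
    have h2 : ∀ᶠ x in 𝓝 (ι z), G a x = G b x + (g a z - g b z) := by
      have h3 : ∀ i : t, ∀ᶠ x in 𝓝 (ι z),
          χ i x * g a (ρ i x) = χ i x * g b (ρ i x) + χ i x * (g a z - g b z) := by
        intro i
        by_cases hz : ι z ∈ tsupport (χ i)
        · filter_upwards [(htend i z hz).eventually h1] with x hx
          rw [← hx]; ring
        · filter_upwards [hoff i _ hz] with x hx
          rw [hx]; ring
      filter_upwards [Filter.eventually_all.2 h3, hvo.mem_nhds (hvZ ⟨z, rfl⟩)] with x hx hxv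
      simp only [G]
      rw [Finset.sum_congr rfl fun i _ => hx i, Finset.sum_add_distrib, ← Finset.sum_mul,
        hsum x (subset_closure hxv), one_mul]
    filter_upwards [eventually_eventually_nhds.2 h2, hGs b z hb] with x hx hx'
    rw [dX_congr hx, dX_add_const hx']
  let Θ : X → Eu m →L[ℝ] ℝ := fun x => if h : ∃ i : t, χ i x ≠ 0 then dX m (G h.choose) x else 0
  refine ⟨Θ, fun z => ⟨G z, hGs z z (hUQR z z (hUm z)).1, ?_, ?_⟩⟩
  · have h1 : ∀ i : t, ∀ᶠ x in 𝓝 (ι z), χ i x ≠ 0 → dX m (G i) x = dX m (G z) x := by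
      intro i
      by_cases hz : ι z ∈ tsupport (χ i)
      · filter_upwards [hGd i z z (hUQR i z (hχ i hz)).1 (hUQR z z (hUm z)).1] with x hx _ using hx
      · filter_upwards [hoff i _ hz] with x hx h
        exact absurd hx h
    filter_upwards [Filter.eventually_all.2 h1, hvo.mem_nhds (hvZ ⟨z, rfl⟩)] with x hx hxv
    have h2 : ∃ i : t, χ i x ≠ 0 := by
      by_contra! h
      have := hsum x (subset_closure hxv)
      simp [h] at this
    simp only [Θ, dif_pos h2]
    exact hx _ h2.choose_spec
  · have h1 : ∀ i : t, ∀ᶠ z' in 𝓝 z, χ i (ι z') * g z (ρ i (ι z')) = χ i (ι z') * g z z' := by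
      intro i
      by_cases hz : ι z ∈ tsupport (χ i)
      · filter_upwards [(hR i z hz).2] with z' hz'
        rw [hz']
      · filter_upwards [hι.continuous.continuousAt.eventually (hoff i _ hz)] with z' hz'
        rw [hz', zero_mul, zero_mul]
    filter_upwards [Filter.eventually_all.2 h1] with z' hz'
    simp only [G]
    rw [Finset.sum_congr rfl fun i _ => hz' i, ← Finset.sum_mul,
      hsum _ (subset_closure (hvZ ⟨z', rfl⟩)), one_mul]

end Immersion

/-! ### Smooth fields -/

section Fields

set_option linter.unusedSectionVars false

variable {m : ℕ} {X : Type*} [TopologicalSpace X] [ChartedSpace (Eu m) X]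

namespace FieldKind

variable {W : Type} [NormedAddCommGroup W] [NormedSpace ℝ W] (K : FieldKind m X W)

/-- The expression of a field in the chart at `x`. -/
def loc (f : X → W) (x : X) (y : Eu m) : W := K.C x y (f ((extChartAt (𝓡 m) x).symm y))

/-- Smoothness of a field near each point, in the preferred chart. -/
def Smooth (f : X → W) : Prop := ∀ x, SmoothNear (K.loc f x) (extChartAt (𝓡 m) x x)

/-- The field `f` coincides off `Z` with a field which is smooth near `x`. -/
def Extends (Z : Set X) (f : X → W) (x : X) : Prop :=
  ∃ q : Eu m → W, SmoothNear q (extChartAt (𝓡 m) x x) ∧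
    ∀ᶠ y in 𝓝 (extChartAt (𝓡 m) x x), (extChartAt (𝓡 m) x).symm y ∉ Z → K.loc f x y = q y

variable {K}

variable [IsManifold (𝓡 m) ∞ X]

theorem Smooth.smoothNear {f : X → W} (h : K.Smooth f) (x : X) {y : Eu m}
    (hy : y ∈ (extChartAt (𝓡 m) x).target) : SmoothNear (K.loc f x) y :=
  K.smoothNear_of_local h x hy

theorem Extends.eventually {Z : Set X} {f : X → W} {x : X} (h : K.Extends Z f x) :
    ∀ᶠ x' in 𝓝 x, K.Extends Z f x' := by
  obtain ⟨q, hq, hf⟩ := h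
  have hx := mem_extChartAt_source (I := 𝓡 m) x
  filter_upwards [eventually_chart hx hq.eventually,
    eventually_chart hx (eventually_eventually_nhds.2 hf), source_mem_nhds hx] with x' h1 h2 h3
  have hs' := mem_extChartAt_source (I := 𝓡 m) x'
  have ht' := mem_extChartAt_target (I := 𝓡 m) x'
  have e := (extChartAt (𝓡 m) x').left_inv hs'
  have e' : trans x' x (extChartAt (𝓡 m) x' x') = extChartAt (𝓡 m) x x' := by rw [trans, e]
  have hsx : (extChartAt (𝓡 m) x').symm (extChartAt (𝓡 m) x' x') ∈ (extChartAt (𝓡 m) x).source := by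
    rwa [e]
  obtain ⟨q', hq', h'⟩ := K.change x' x _ ht' hsx q (by rwa [e'])
  refine ⟨q', hq', ?_⟩
  rw [← e'] at h2
  filter_upwards [h', (smoothNear_trans ht' hsx).continuousAt.eventually h2,
    eventually_symm ht' (source_mem_nhds hsx)] with z a1 a2 a3 a4
  have e2 : (extChartAt (𝓡 m) x).symm (trans x' x z) = (extChartAt (𝓡 m) x').symm z :=
    (extChartAt (𝓡 m) x).left_inv a3
  rw [loc, e2] at a2
  exact (a1 _).1 (a2 a4)

/-- A smooth field has the same expression near a point of `Z` as the local extensions, by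
density of the complement of `Z`. -/
theorem Smooth.eventually_loc_eq {Z : Set X} (hZ : ∀ x ∈ Z, x ∈ closure Zᶜ) {F f : X → W}
    (hF : K.Smooth F) (hFf : ∀ x ∉ Z, F x = f x) {x : X} {q : Eu m → W}
    (hq : SmoothNear q (extChartAt (𝓡 m) x x))
    (h : ∀ᶠ y in 𝓝 (extChartAt (𝓡 m) x x), (extChartAt (𝓡 m) x).symm y ∉ Z →
      K.loc f x y = q y) :
    ∀ᶠ y in 𝓝 (extChartAt (𝓡 m) x x), K.loc F x y = q y := by
  filter_upwards [(hF x).eventually, hq.eventually, eventually_eventually_nhds.2 h,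
    extChartAt_target_mem_nhds x] with y h1 h2 h3 hy
  by_cases hyZ : (extChartAt (𝓡 m) x).symm y ∈ Z
  · have := mem_closure_symm hy (hZ _ hyZ)
    refine tendsto_nhds_unique_of_eventuallyEq
      (l := 𝓝[{z | (extChartAt (𝓡 m) x).symm z ∉ Z}] y)
      (h1.continuousAt.mono_left nhdsWithin_le_nhds)
      (h2.continuousAt.mono_left nhdsWithin_le_nhds) (eventually_nhdsWithin_iff.2 ?_)
    filter_upwards [h3] with z hz hz'
    rw [← hz hz', loc, hFf _ hz', loc]
  · rw [← h3.self_of_nhds hyZ, loc, hFf _ hyZ, loc]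

variable (K) in
/-- Local smooth extensions across a set with dense complement glue to a global one. -/
theorem exists_smooth_of_extends {Z : Set X} (hZ : ∀ x ∈ Z, x ∈ closure Zᶜ) {f : X → W}
    (h : ∀ x, K.Extends Z f x) : ∃ F : X → W, K.Smooth F ∧ ∀ x ∉ Z, F x = f x := by
  choose q hq hf using h
  obtain ⟨F, hF, h⟩ := K.exists_extension hZ f q hq hf
  exact ⟨F, fun x => (hq x).congr (h x), hF⟩

end FieldKind

/-- A function which is smooth on an open set coincides near each of its points with a smooth
function on the whole manifold. -/
theorem exists_contMDiff_eventually_eq [IsManifold (𝓡 m) ∞ X] [T2Space X] [CompactSpace X]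
    {f : X → ℝ} {s : Set X} (hs : IsOpen s)
    (hf : ∀ x ∈ s, ContMDiffAt (𝓡 m) 𝓘(ℝ, ℝ) ∞ f x) {x : X} (hx : x ∈ s) :
    ∃ F : X → ℝ, ContMDiff (𝓡 m) 𝓘(ℝ, ℝ) ∞ F ∧ ∀ᶠ x' in 𝓝 x, F x' = f x' := by
  obtain ⟨χ, h0, h1, -⟩ := exists_contMDiffMap_zero_one_nhds_of_isClosed (n := ⊤) (𝓡 m)
    hs.isClosed_compl (isClosed_singleton (x := x)) (by simpa using hx)
  refine ⟨fun x => χ x * f x, fun x' => ?_, ?_⟩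
  · by_cases hx' : x' ∈ s
    · exact χ.contMDiff.contMDiffAt.mul (hf x' hx')
    · refine (contMDiffAt_const (c := (0 : ℝ))).congr_of_eventuallyEq ?_
      filter_upwards [h0.filter_mono (nhds_le_nhdsSet hx')] with y hy
      rw [hy, zero_mul]
  · rw [nhdsSet_singleton] at h1
    filter_upwards [h1] with y hy
    rw [hy, one_mul]

end Fields

/-! ### The square of the Pfaffian as a function -/

section Density

set_option linter.unusedSectionVars false

variable {m n : ℕ} {X : Type*} [TopologicalSpace X] [ChartedSpace (Eu m) X]
  [IsManifold (𝓡 m) ∞ X]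

/-- The Gram determinant of a linear map. -/
def gram {N : ℕ} (L : Eu m →L[ℝ] Eu N) : ℝ :=
  ((Matrix.of fun (i : Fin N) (j : Fin m) => L (EuclideanSpace.basisFun (Fin m) ℝ j) i).transpose *
    Matrix.of fun (i : Fin N) (j : Fin m) => L (EuclideanSpace.basisFun (Fin m) ℝ j) i).det

theorem contDiff_gram {N : ℕ} : ContDiff ℝ ∞ (gram : (Eu m →L[ℝ] Eu N) → ℝ) := by
  unfold gram
  simp only [Matrix.det_apply', Matrix.mul_apply, Matrix.transpose_apply, Matrix.of_apply]
  refine ContDiff.sum fun σ _ => contDiff_const.mul (contDiff_prod fun i _ =>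
    ContDiff.sum fun k _ => ?_)
  have h : ∀ j, ContDiff ℝ ∞ fun L : Eu m →L[ℝ] Eu N =>
      (L (EuclideanSpace.basisFun (Fin m) ℝ j)) k := fun j =>
    (EuclideanSpace.proj k : Eu N →L[ℝ] ℝ).contDiff.comp
      ((ContinuousLinearMap.apply ℝ (Eu N) (EuclideanSpace.basisFun (Fin m) ℝ j)).contDiff)
  exact (h _).mul (h _)

theorem matrix_of_eq_toMatrix {N : ℕ} (L : Eu m →L[ℝ] Eu N) :
    (Matrix.of fun (i : Fin N) (j : Fin m) => L (EuclideanSpace.basisFun (Fin m) ℝ j) i) =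
      LinearMap.toMatrix (EuclideanSpace.basisFun (Fin m) ℝ).toBasis
        (EuclideanSpace.basisFun (Fin N) ℝ).toBasis (L : Eu m →ₗ[ℝ] Eu N) := by
  ext i j
  simp [LinearMap.toMatrix_apply]

theorem gram_comp {N : ℕ} (L : Eu m →L[ℝ] Eu N) (A : Eu m →L[ℝ] Eu m) :
    gram (L.comp A) = LinearMap.det (A : Eu m →ₗ[ℝ] Eu m) ^ 2 * gram L := by
  rw [gram, gram, matrix_of_eq_toMatrix, matrix_of_eq_toMatrix,
    show ((L.comp A : Eu m →L[ℝ] Eu N) : Eu m →ₗ[ℝ] Eu N) = (L : Eu m →ₗ[ℝ] Eu N) ∘ₗ A from rfl,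
    LinearMap.toMatrix_comp _ (EuclideanSpace.basisFun (Fin m) ℝ).toBasis,
    ← LinearMap.det_toMatrix (EuclideanSpace.basisFun (Fin m) ℝ).toBasis (A : Eu m →ₗ[ℝ] Eu m)]
  set P := LinearMap.toMatrix (EuclideanSpace.basisFun (Fin m) ℝ).toBasis
        (EuclideanSpace.basisFun (Fin N) ℝ).toBasis (L : Eu m →ₗ[ℝ] Eu N)
  set Q := LinearMap.toMatrix (EuclideanSpace.basisFun (Fin m) ℝ).toBasis
        (EuclideanSpace.basisFun (Fin m) ℝ).toBasis (A : Eu m →ₗ[ℝ] Eu m)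
  rw [Matrix.transpose_mul, show Q.transpose * P.transpose * (P * Q) =
    Q.transpose * (P.transpose * P) * Q by simp only [Matrix.mul_assoc], Matrix.det_mul,
    Matrix.det_mul, Matrix.det_transpose]
  ring

theorem gram_pos {N : ℕ} {L : Eu m →L[ℝ] Eu N} (hL : Function.Injective L) : 0 < gram L := by
  rw [gram, matrix_of_eq_toMatrix]
  set P := LinearMap.toMatrix (EuclideanSpace.basisFun (Fin m) ℝ).toBasis
        (EuclideanSpace.basisFun (Fin N) ℝ).toBasis (L : Eu m →ₗ[ℝ] Eu N) with hP
  have h := Matrix.PosDef.conjTranspose_mul_self P (by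
    intro v w hvw
    have h1 := LinearMap.toMatrix_mulVec_repr (EuclideanSpace.basisFun (Fin m) ℝ).toBasis
      (EuclideanSpace.basisFun (Fin N) ℝ).toBasis (L : Eu m →ₗ[ℝ] Eu N)
    have h2 := h1 (WithLp.toLp 2 v)
    have h3 := h1 (WithLp.toLp 2 w)
    have h4 : L (WithLp.toLp 2 v) = L (WithLp.toLp 2 w) := by
      apply (EuclideanSpace.basisFun (Fin N) ℝ).toBasis.repr.injective
      apply DFunLike.coe_injective
      rw [← hP] at h2 h3
      refine h2.symm.trans (Eq.trans ?_ h3)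
      exact hvw
    exact congrArg WithLp.ofLp (hL h4))
  simpa using h.det_pos

/-- A positive density: in a chart it is multiplied by the square of the Jacobian determinant. It
is the Gram determinant of the differential of an embedding into Euclidean space. -/
theorem exists_density [T2Space X] [CompactSpace X] :
    ∃ D : X → ℝ, (∀ x, 0 < D x) ∧ ∀ x, ∀ y ∈ (extChartAt (𝓡 m) x).target,
      SmoothNear (fun z => LinearMap.det (chA x z : Eu m →ₗ[ℝ] Eu m) ^ 2 *
        D ((extChartAt (𝓡 m) x).symm z)) y := by
  obtain ⟨N, e, he, -, hinj⟩ := exists_embedding_euclidean_of_compact (I := 𝓡 m) (M := X)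
  let L : X → Eu m →L[ℝ] Eu N := fun x => mfderiv (𝓡 m) (𝓡 N) e x
  refine ⟨fun x => gram (L x), fun x => gram_pos (hinj x), fun x y hy => ?_⟩
  have h1 : SmoothNear (fun z => e ((extChartAt (𝓡 m) x).symm z)) y := by
    filter_upwards [target_mem_nhds hy] with z hz
    exact contMDiffAt_iff_contDiffAt.1 ((he _).comp z (contMDiffAt_symm hz))
  have h2 : SmoothNear (fun z => gram (fderiv ℝ (fun z => e ((extChartAt (𝓡 m) x).symm z)) z)) y :=
    by filter_upwards [h1.fderiv] with z hz using contDiff_gram.contDiffAt.comp z hz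
  refine h2.congr ?_
  filter_upwards [target_mem_nhds hy] with z hz
  have h := mfderiv_comp z ((he _).mdifferentiableAt (by simp))
    ((contMDiffAt_symm hz).mdifferentiableAt (by simp))
  rw [mfderiv_eq_fderiv] at h
  rw [← gram_comp]
  exact congrArg gram h.symm

end Density

/-! ### Two-forms and bivector fields in charts -/

section TwoForms

set_option linter.unusedSectionVars false

variable {n : ℕ} {X : Type*} [TopologicalSpace X] [ChartedSpace (Eu (2 * n)) X]
  [IsManifold (𝓡 (2 * n)) ∞ X]

/-- The standard basis of the model space. -/
abbrev bE (n : ℕ) : Module.Basis (Fin (2 * n)) ℝ (Eu (2 * n)) :=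
  (EuclideanSpace.basisFun (Fin (2 * n)) ℝ).toBasis

/-- Two-forms on the model space. -/
abbrev Form (n : ℕ) : Type := Eu (2 * n) [⋀^Fin 2]→L[ℝ] ℝ

/-- Bivectors on the model space. -/
abbrev Biv (n : ℕ) : Type := (Eu (2 * n) →L[ℝ] ℝ) [⋀^Fin 2]→L[ℝ] ℝ

variable (n X) in
/-- Two-forms on a `2n`-dimensional manifold. -/
abbrev FK : FieldKind (2 * n) X (Form n) := formKind (2 * n) X

variable (n X) in
/-- Bivector fields on a `2n`-dimensional manifold. -/
abbrev BK : FieldKind (2 * n) X (Biv n) := bivectorKind (2 * n) X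

theorem det_chB_mul_det_chA {x : X} {y : Eu (2 * n)}
    (hy : y ∈ (extChartAt (𝓡 (2 * n)) x).target) :
    LinearMap.det (chB x y : Eu (2 * n) →ₗ[ℝ] Eu (2 * n)) *
      LinearMap.det (chA x y : Eu (2 * n) →ₗ[ℝ] Eu (2 * n)) = 1 := by
  rw [← LinearMap.det_comp, show (chB x y : Eu (2 * n) →ₗ[ℝ] Eu (2 * n)) ∘ₗ chA x y = LinearMap.id
    from LinearMap.ext fun v => chB_chA hy v, LinearMap.det_id]

theorem det_chA_ne_zero {x : X} {y : Eu (2 * n)} (hy : y ∈ (extChartAt (𝓡 (2 * n)) x).target) :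
    LinearMap.det (chA x y : Eu (2 * n) →ₗ[ℝ] Eu (2 * n)) ≠ 0 := fun h => by
  have := det_chB_mul_det_chA hy
  rw [h, mul_zero] at this
  exact zero_ne_one this

theorem pf_loc_form (σ : X → Form n) (x : X) (y : Eu (2 * n)) :
    pf (bE n) ((FK n X).loc σ x y) = LinearMap.det (chA x y : Eu (2 * n) →ₗ[ℝ] Eu (2 * n)) *
      pf (bE n) (σ ((extChartAt (𝓡 (2 * n)) x).symm y)) :=
  pf_comp _ _ _

theorem det_precomp (A : Eu (2 * n) →L[ℝ] Eu (2 * n)) :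
    LinearMap.det ((ContinuousLinearMap.precomp ℝ A :
      (Eu (2 * n) →L[ℝ] ℝ) →L[ℝ] Eu (2 * n) →L[ℝ] ℝ) :
        (Eu (2 * n) →L[ℝ] ℝ) →ₗ[ℝ] Eu (2 * n) →L[ℝ] ℝ) =
      LinearMap.det (A : Eu (2 * n) →ₗ[ℝ] Eu (2 * n)) := by
  rw [← LinearMap.det_toMatrix (dualB (bE n)), ← LinearMap.det_toMatrix (bE n),
    ← Matrix.det_transpose]
  congr 1
  ext i j
  rw [Matrix.transpose_apply, LinearMap.toMatrix_apply, LinearMap.toMatrix_apply, dualB_repr,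
    dualB_apply]
  rfl

theorem pf_loc_biv (π : X → Biv n) (x : X) (y : Eu (2 * n)) :
    pf (dualB (bE n)) ((BK n X).loc π x y) =
      LinearMap.det (chB x y : Eu (2 * n) →ₗ[ℝ] Eu (2 * n)) *
        pf (dualB (bE n)) (π ((extChartAt (𝓡 (2 * n)) x).symm y)) := by
  rw [← det_precomp]
  exact pf_comp (dualB (bE n)) _ _

theorem pf_loc_form_eq_zero {σ : X → Form n} {x : X} {y : Eu (2 * n)}
    (hy : y ∈ (extChartAt (𝓡 (2 * n)) x).target) :
    pf (bE n) ((FK n X).loc σ x y) = 0 ↔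
      pf (bE n) (σ ((extChartAt (𝓡 (2 * n)) x).symm y)) = 0 := by
  rw [pf_loc_form, mul_eq_zero, or_iff_right (det_chA_ne_zero hy)]

theorem pf_loc_biv_eq_zero {π : X → Biv n} {x : X} {y : Eu (2 * n)}
    (hy : y ∈ (extChartAt (𝓡 (2 * n)) x).target) :
    pf (dualB (bE n)) ((BK n X).loc π x y) = 0 ↔
      pf (dualB (bE n)) (π ((extChartAt (𝓡 (2 * n)) x).symm y)) = 0 := by
  rw [pf_loc_biv, mul_eq_zero, or_iff_right (left_ne_zero_of_mul_eq_one (det_chB_mul_det_chA hy))]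

theorem C_add_smul_wed (x : X) (y : Eu (2 * n)) (a : Form n) (c : ℝ)
    (φ θ : Eu (2 * n) →L[ℝ] ℝ) :
    (FK n X).C x y (a + c • wed φ θ) =
      (FK n X).C x y a + c • wed (φ.comp (chA x y)) (θ.comp (chA x y)) := by
  refine form_ext fun v w => ?_
  simp only [formKind, form_comp_apply, ContinuousAlternatingMap.add_apply,
    ContinuousAlternatingMap.smul_apply, wed_apply, ContinuousLinearMap.comp_apply]
  rfl

theorem inv_loc {x : X} {y : Eu (2 * n)} (hy : y ∈ (extChartAt (𝓡 (2 * n)) x).target)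
    {a : Form n} {p : Biv n} (h : Inv a p) :
    Inv ((FK n X).C x y a) ((BK n X).C x y p) :=
  h.comp (chB x y) (chA x y) (chB_chA hy) (chA_chB hy)

theorem loc_invF {π : X → Biv n} {x : X} {y : Eu (2 * n)}
    (hy : y ∈ (extChartAt (𝓡 (2 * n)) x).target)
    (h : pf (dualB (bE n)) (π ((extChartAt (𝓡 (2 * n)) x).symm y)) ≠ 0) :
    (FK n X).loc (fun x => invF (bE n) (π x)) x y = invF (bE n) ((BK n X).loc π x y) :=
  (inv_loc hy (inv_invF (bE n) h)).form_eq (bE n)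

theorem loc_invB {σ : X → Form n} {x : X} {y : Eu (2 * n)}
    (hy : y ∈ (extChartAt (𝓡 (2 * n)) x).target)
    (h : pf (bE n) (σ ((extChartAt (𝓡 (2 * n)) x).symm y)) ≠ 0) :
    (BK n X).loc (fun x => invB (bE n) (σ x)) x y = invB (bE n) ((FK n X).loc σ x y) :=
  (inv_loc hy (inv_invB (bE n) h)).biv_eq (bE n)

theorem isSmooth_form_iff (σ : DiffForm (2 * n) X 2) :
    σ.IsSmooth ↔ (FK n X).Smooth σ := by
  constructor
  · intro h x
    have ht := mem_extChartAt_target (I := 𝓡 (2 * n)) x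
    filter_upwards [eventually_eventually_nhds.2 (target_mem_nhds ht)] with y hy
    exact (h x).contDiffAt hy
  · intro h x y hy
    exact (h.smoothNear x hy).contDiffAt.contDiffWithinAt

theorem isSmooth_biv_iff (π : BivectorField (2 * n) X) :
    π.IsSmooth ↔ (BK n X).Smooth π := by
  constructor
  · intro h x
    have ht := mem_extChartAt_target (I := 𝓡 (2 * n)) x
    filter_upwards [eventually_eventually_nhds.2 (target_mem_nhds ht)] with y hy
    exact (h x).contDiffAt hy
  · intro h x y hy
    exact (h.smoothNear x hy).contDiffAt.contDiffWithinAt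

theorem isClosed_iff (σ : DiffForm (2 * n) X 2) :
    σ.IsClosed ↔ ∀ x : X, ∀ y ∈ (extChartAt (𝓡 (2 * n)) x).target, ∀ a b c,
      d3 ((FK n X).loc σ x) y a b c = 0 :=
  forall_congr' fun _ => forall₂_congr fun _ _ => extDeriv_eq_zero_iff _ _

theorem contMDiff_of_smoothNearX {f : X → ℝ} (h : ∀ x, SmoothNearX (2 * n) f x) :
    ContMDiff (𝓡 (2 * n)) 𝓘(ℝ, ℝ) ∞ f := fun x => (h x).contMDiffAt

/-- The square of the Pfaffian of a two-form, normalized by a density, is a function. -/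
theorem exists_squareDefining_form [T2Space X] [CompactSpace X] {σ : X → Form n}
    (hσ : (FK n X).Smooth σ) : ∃ h : X → ℝ, ContMDiff (𝓡 (2 * n)) 𝓘(ℝ, ℝ) ∞ h ∧
      (∀ x, 0 ≤ h x) ∧ (∀ x, h x = 0 ↔ pf (bE n) (σ x) = 0) ∧
      ∀ x, pf (bE n) (σ x) = 0 →
        fderiv ℝ (fun y => pf (bE n) ((FK n X).loc σ x y)) (extChartAt (𝓡 (2 * n)) x x) ≠ 0 →
        ∃ u, SquareDefining (fun y => pf (bE n) ((FK n X).loc σ x y)) u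
          (fun y => h ((extChartAt (𝓡 (2 * n)) x).symm y)) (extChartAt (𝓡 (2 * n)) x x) := by
  obtain ⟨D, hD, hDs⟩ := exists_density (m := 2 * n) (X := X)
  have key : ∀ x, ∃ u, SmoothNear u (extChartAt (𝓡 (2 * n)) x x) ∧
      0 < u (extChartAt (𝓡 (2 * n)) x x) ∧ ∀ᶠ y in 𝓝 (extChartAt (𝓡 (2 * n)) x x),
        pf (bE n) (σ ((extChartAt (𝓡 (2 * n)) x).symm y)) ^ 2 /
          D ((extChartAt (𝓡 (2 * n)) x).symm y) =
        u y * pf (bE n) ((FK n X).loc σ x y) ^ 2 := by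
    intro x
    have ht := mem_extChartAt_target (I := 𝓡 (2 * n)) x
    have hp : ∀ y ∈ (extChartAt (𝓡 (2 * n)) x).target,
        0 < LinearMap.det (chA x y : Eu (2 * n) →ₗ[ℝ] Eu (2 * n)) ^ 2 *
          D ((extChartAt (𝓡 (2 * n)) x).symm y) := fun y hy =>
      mul_pos (by have := det_chA_ne_zero hy; positivity) (hD _)
    refine ⟨_, (hDs x _ ht).inv (hp _ ht).ne', inv_pos.2 (hp _ ht), ?_⟩
    filter_upwards [target_mem_nhds ht] with y hy
    rw [pf_loc_form]
    have h1 := det_chA_ne_zero hy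
    have h2 := (hD ((extChartAt (𝓡 (2 * n)) x).symm y)).ne'
    field_simp
  refine ⟨fun x => pf (bE n) (σ x) ^ 2 / D x, contMDiff_of_smoothNearX fun x => ?_,
    fun x => div_nonneg (sq_nonneg _) (hD x).le, fun x => ?_, fun x hx hd => ?_⟩
  · obtain ⟨u, hu, -, he⟩ := key x
    exact smoothNearX_of_chart (mem_extChartAt_source x)
      ((hu.mul (((hσ x).pfaffian (bE n)).pow 2)).congr he)
  · rw [div_eq_zero_iff, or_iff_left (hD x).ne', sq_eq_zero_iff]
  · obtain ⟨u, hu, hu0, he⟩ := key x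
    refine ⟨u, (hσ x).pfaffian (bE n), ?_, hd, hu, hu0, he⟩
    rw [pf_loc_form_eq_zero (mem_extChartAt_target x),
      (extChartAt (𝓡 (2 * n)) x).left_inv (mem_extChartAt_source x), hx]

/-- The square of the Pfaffian of a bivector field, normalized by a density, is a function. -/
theorem exists_squareDefining_biv [T2Space X] [CompactSpace X] {π : X → Biv n}
    (hπ : (BK n X).Smooth π) : ∃ h : X → ℝ, ContMDiff (𝓡 (2 * n)) 𝓘(ℝ, ℝ) ∞ h ∧
      (∀ x, 0 ≤ h x) ∧ (∀ x, h x = 0 ↔ pf (dualB (bE n)) (π x) = 0) ∧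
      ∀ x, pf (dualB (bE n)) (π x) = 0 →
        fderiv ℝ (fun y => pf (dualB (bE n)) ((BK n X).loc π x y))
          (extChartAt (𝓡 (2 * n)) x x) ≠ 0 →
        ∃ u, SquareDefining (fun y => pf (dualB (bE n)) ((BK n X).loc π x y)) u
          (fun y => h ((extChartAt (𝓡 (2 * n)) x).symm y)) (extChartAt (𝓡 (2 * n)) x x) := by
  obtain ⟨D, hD, hDs⟩ := exists_density (m := 2 * n) (X := X)
  have key : ∀ x, ∃ u, SmoothNear u (extChartAt (𝓡 (2 * n)) x x) ∧
      0 < u (extChartAt (𝓡 (2 * n)) x x) ∧ ∀ᶠ y in 𝓝 (extChartAt (𝓡 (2 * n)) x x),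
        pf (dualB (bE n)) (π ((extChartAt (𝓡 (2 * n)) x).symm y)) ^ 2 *
          D ((extChartAt (𝓡 (2 * n)) x).symm y) =
        u y * pf (dualB (bE n)) ((BK n X).loc π x y) ^ 2 := by
    intro x
    have ht := mem_extChartAt_target (I := 𝓡 (2 * n)) x
    refine ⟨_, hDs x _ ht, mul_pos (by have := det_chA_ne_zero ht; positivity) (hD _), ?_⟩
    filter_upwards [target_mem_nhds ht] with y hy
    rw [pf_loc_biv]
    have h1 := det_chB_mul_det_chA hy
    linear_combination (-pf (dualB (bE n)) (π ((extChartAt (𝓡 (2 * n)) x).symm y)) ^ 2 *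
      D ((extChartAt (𝓡 (2 * n)) x).symm y)) *
      (LinearMap.det (chB x y : Eu (2 * n) →ₗ[ℝ] Eu (2 * n)) *
      LinearMap.det (chA x y : Eu (2 * n) →ₗ[ℝ] Eu (2 * n)) + 1) * h1
  refine ⟨fun x => pf (dualB (bE n)) (π x) ^ 2 * D x, contMDiff_of_smoothNearX fun x => ?_,
    fun x => mul_nonneg (sq_nonneg _) (hD x).le, fun x => ?_, fun x hx hd => ?_⟩
  · obtain ⟨u, hu, -, he⟩ := key x
    exact smoothNearX_of_chart (mem_extChartAt_source x)
      ((hu.mul (((hπ x).pfaffian (dualB (bE n))).pow 2)).congr he)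
  · rw [mul_eq_zero, or_iff_left (hD x).ne', sq_eq_zero_iff]
  · obtain ⟨u, hu, hu0, he⟩ := key x
    refine ⟨u, (hπ x).pfaffian (dualB (bE n)), ?_, hd, hu, hu0, he⟩
    rw [pf_loc_biv_eq_zero (mem_extChartAt_target x),
      (extChartAt (𝓡 (2 * n)) x).left_inv (mem_extChartAt_source x), hx]

/-! ### The Jacobi identity in charts -/

theorem C_biv_apply {x : X} {y : Eu (2 * n)} (hy : y ∈ (extChartAt (𝓡 (2 * n)) x).target)
    (p : Biv n) (α β : Eu (2 * n) →L[ℝ] ℝ) :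
    (BK n X).C x y p ![α.comp (chA x y), β.comp (chA x y)] = p ![α, β] := by
  have h : (BK n X).C x y p ![α.comp (chA x y), β.comp (chA x y)] =
      p ![(α.comp (chA x y)).comp (chB x y), (β.comp (chA x y)).comp (chB x y)] :=
    form_comp_apply _ _ _ _
  rw [h, comp_chA_chB hy, comp_chA_chB hy]

/-- The bracket of functions, in a chart. -/
theorem bracket_symm (π : BivectorField (2 * n) X) {f g : X → ℝ} {x : X} {y : Eu (2 * n)}
    (hy : y ∈ (extChartAt (𝓡 (2 * n)) x).target)
    (hf : ContMDiffAt (𝓡 (2 * n)) 𝓘(ℝ, ℝ) ∞ f ((extChartAt (𝓡 (2 * n)) x).symm y))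
    (hg : ContMDiffAt (𝓡 (2 * n)) 𝓘(ℝ, ℝ) ∞ g ((extChartAt (𝓡 (2 * n)) x).symm y)) :
    π.bracket f g ((extChartAt (𝓡 (2 * n)) x).symm y) = (BK n X).loc π x y
      ![fderiv ℝ (fun z => f ((extChartAt (𝓡 (2 * n)) x).symm z)) y,
        fderiv ℝ (fun z => g ((extChartAt (𝓡 (2 * n)) x).symm z)) y] := by
  rw [← dX_comp_chA hy hf, ← dX_comp_chA hy hg]
  exact (C_biv_apply hy (π ((extChartAt (𝓡 (2 * n)) x).symm y)) _ _).symm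

/-- The iterated bracket of functions, in a chart. -/
theorem bracket_bracket_symm {π : BivectorField (2 * n) X} (hπ : (BK n X).Smooth π)
    {f g h : X → ℝ} {x : X} {y : Eu (2 * n)} (hy : y ∈ (extChartAt (𝓡 (2 * n)) x).target)
    (hf : SmoothNearX (2 * n) f ((extChartAt (𝓡 (2 * n)) x).symm y))
    (hg : SmoothNearX (2 * n) g ((extChartAt (𝓡 (2 * n)) x).symm y))
    (hh : SmoothNearX (2 * n) h ((extChartAt (𝓡 (2 * n)) x).symm y)) :
    π.bracket f (π.bracket g h) ((extChartAt (𝓡 (2 * n)) x).symm y) = (BK n X).loc π x y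
      ![fderiv ℝ (fun z => f ((extChartAt (𝓡 (2 * n)) x).symm z)) y,
        fderiv ℝ (fun z => (BK n X).loc π x z
          ![fderiv ℝ (fun z => g ((extChartAt (𝓡 (2 * n)) x).symm z)) z,
            fderiv ℝ (fun z => h ((extChartAt (𝓡 (2 * n)) x).symm z)) z]) y] := by
  have h1 : ∀ᶠ z in 𝓝 y, π.bracket g h ((extChartAt (𝓡 (2 * n)) x).symm z) = (BK n X).loc π x z
      ![fderiv ℝ (fun z => g ((extChartAt (𝓡 (2 * n)) x).symm z)) z,
        fderiv ℝ (fun z => h ((extChartAt (𝓡 (2 * n)) x).symm z)) z] := by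
    filter_upwards [target_mem_nhds hy, eventually_symm hy hg, eventually_symm hy hh]
      with z a1 a2 a3 using bracket_symm π a1 a2 a3
  have h2 : SmoothNear (fun z => π.bracket g h ((extChartAt (𝓡 (2 * n)) x).symm z)) y := by
    refine SmoothNear.congr ?_ h1
    filter_upwards [hπ.smoothNear x hy, (smoothNear_comp_symm hy hg).fderiv,
      (smoothNear_comp_symm hy hh).fderiv] with z a1 a2 a3
    exact ContDiffAt.form_apply a1 a2 a3
  rw [bracket_symm π hy hf.contMDiffAt]
  · congr 3
    exact Filter.EventuallyEq.fderiv_eq h1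
  · refine (smoothNearX_of_chart ((extChartAt (𝓡 (2 * n)) x).map_target hy) ?_).contMDiffAt
    rwa [(extChartAt (𝓡 (2 * n)) x).right_inv hy]

/-- The Jacobi identity for globally defined functions implies that for chart coordinates: linear
functions of the coordinates are extended to the manifold by cutting them off. -/
theorem BivectorField.IsPoisson.jacobiAt [T2Space X] [CompactSpace X]
    {π : BivectorField (2 * n) X} (h : π.IsPoisson) (x : X) {y : Eu (2 * n)}
    (hy : y ∈ (extChartAt (𝓡 (2 * n)) x).target) : JacobiAt ((BK n X).loc π x) y := by
  intro α β γ
  have hπ := (isSmooth_biv_iff π).1 h.smooth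
  have hs := (extChartAt (𝓡 (2 * n)) x).map_target hy
  have hF : ∀ α : Eu (2 * n) →L[ℝ] ℝ, ∃ F : X → ℝ, ContMDiff (𝓡 (2 * n)) 𝓘(ℝ, ℝ) ∞ F ∧
      ∀ᶠ z in 𝓝 y, fderiv ℝ (fun z => F ((extChartAt (𝓡 (2 * n)) x).symm z)) z = α := by
    intro α
    obtain ⟨F, hF, hFe⟩ := exists_contMDiff_eventually_eq (m := 2 * n)
      (f := fun x' => α (extChartAt (𝓡 (2 * n)) x x')) (isOpen_extChartAt_source x)
      (fun x' hx' => α.contDiff.contMDiff.contMDiffAt.comp x' (contMDiffAt_chart hx')) hs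
    refine ⟨F, hF, ?_⟩
    have h1 : ∀ᶠ z in 𝓝 y, F ((extChartAt (𝓡 (2 * n)) x).symm z) = α z := by
      filter_upwards [eventually_symm hy hFe, target_mem_nhds hy] with z h1 h2
      rw [h1, (extChartAt (𝓡 (2 * n)) x).right_inv h2]
    filter_upwards [eventually_eventually_nhds.2 h1] with z hz
    rw [Filter.EventuallyEq.fderiv_eq hz, α.fderiv]
  obtain ⟨f, hf, hf'⟩ := hF α
  obtain ⟨g, hg, hg'⟩ := hF β
  obtain ⟨k, hk, hk'⟩ := hF γ
  have hsm : ∀ {f : X → ℝ}, ContMDiff (𝓡 (2 * n)) 𝓘(ℝ, ℝ) ∞ f → ∀ x, SmoothNearX (2 * n) f x :=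
    fun hf x => Filter.Eventually.of_forall fun x' => hf x'
  have hJ := h.jacobi f g k hf hg hk ((extChartAt (𝓡 (2 * n)) x).symm y)
  rw [bracket_bracket_symm hπ hy (hsm hf _) (hsm hg _) (hsm hk _),
    bracket_bracket_symm hπ hy (hsm hg _) (hsm hk _) (hsm hf _),
    bracket_bracket_symm hπ hy (hsm hk _) (hsm hf _) (hsm hg _)] at hJ
  have e : ∀ {a b : X → ℝ} {α β : Eu (2 * n) →L[ℝ] ℝ},
      (∀ᶠ z in 𝓝 y, fderiv ℝ (fun z => a ((extChartAt (𝓡 (2 * n)) x).symm z)) z = α) →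
      (∀ᶠ z in 𝓝 y, fderiv ℝ (fun z => b ((extChartAt (𝓡 (2 * n)) x).symm z)) z = β) →
      fderiv ℝ (fun z => (BK n X).loc π x z
          ![fderiv ℝ (fun z => a ((extChartAt (𝓡 (2 * n)) x).symm z)) z,
            fderiv ℝ (fun z => b ((extChartAt (𝓡 (2 * n)) x).symm z)) z]) y =
        fderiv ℝ (fun z => (BK n X).loc π x z ![α, β]) y := by
    intro a b α β h1 h2
    refine Filter.EventuallyEq.fderiv_eq ?_
    filter_upwards [h1, h2] with z h1 h2
    rw [h1, h2]
  rw [e hg' hk', e hk' hf', e hf' hg', hf'.self_of_nhds, hg'.self_of_nhds, hk'.self_of_nhds] at hJ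
  exact hJ

theorem isPoisson_of_jacobiAt {π : BivectorField (2 * n) X} (hπ : (BK n X).Smooth π)
    (h : ∀ x, JacobiAt ((BK n X).loc π x) (extChartAt (𝓡 (2 * n)) x x)) : π.IsPoisson := by
  refine ⟨(isSmooth_biv_iff π).2 hπ, fun f g k hf hg hk x => ?_⟩
  have hy := mem_extChartAt_target (I := 𝓡 (2 * n)) x
  have e := (extChartAt (𝓡 (2 * n)) x).left_inv (mem_extChartAt_source (I := 𝓡 (2 * n)) x)
  have hsm : ∀ {f : X → ℝ}, ContMDiff (𝓡 (2 * n)) 𝓘(ℝ, ℝ) ∞ f → ∀ x, SmoothNearX (2 * n) f x :=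
    fun hf x => Filter.Eventually.of_forall fun x' => hf x'
  have hsm' : ∀ {f : X → ℝ}, ContMDiff (𝓡 (2 * n)) 𝓘(ℝ, ℝ) ∞ f → ContDiffAt ℝ ∞
      (fun z => f ((extChartAt (𝓡 (2 * n)) x).symm z)) (extChartAt (𝓡 (2 * n)) x x) :=
    fun hf => (smoothNear_comp_symm hy (hsm hf _)).contDiffAt
  have hJ := (h x).bracket (hπ x).differentiableAt (hsm' hf) (hsm' hg) (hsm' hk)
  rw [← bracket_bracket_symm hπ hy (hsm hf _) (hsm hg _) (hsm hk _),
    ← bracket_bracket_symm hπ hy (hsm hg _) (hsm hk _) (hsm hf _),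
    ← bracket_bracket_symm hπ hy (hsm hk _) (hsm hf _) (hsm hg _), e] at hJ
  exact hJ

/-! ### Closedness and the Jacobi identity at limit points -/

/-- A smooth two-form which is closed off a set with dense complement is closed. -/
theorem d3_eq_zero_of_dense {Z : Set X} (hZ : ∀ x ∈ Z, x ∈ closure Zᶜ) {σ : X → Form n}
    (hσ : (FK n X).Smooth σ) {x : X} {y : Eu (2 * n)}
    (hy : y ∈ (extChartAt (𝓡 (2 * n)) x).target)
    (h : ∀ᶠ z in 𝓝 y, (extChartAt (𝓡 (2 * n)) x).symm z ∉ Z → ∀ a b c,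
      d3 ((FK n X).loc σ x) z a b c = 0) (a b c : Eu (2 * n)) :
    d3 ((FK n X).loc σ x) y a b c = 0 := by
  by_cases hyZ : (extChartAt (𝓡 (2 * n)) x).symm y ∈ Z
  · have := FieldKind.mem_closure_symm hy (hZ _ hyZ)
    refine tendsto_nhds_unique_of_eventuallyEq
      (l := 𝓝[{z | (extChartAt (𝓡 (2 * n)) x).symm z ∉ Z}] y)
      ((continuousAt_d3 (hσ.smoothNear x hy) a b c).mono_left nhdsWithin_le_nhds)
      (tendsto_const_nhds) (eventually_nhdsWithin_iff.2 ?_)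
    filter_upwards [h] with z hz hz' using hz hz' a b c
  · exact h.self_of_nhds hyZ a b c

/-- A smooth bivector field which is Poisson off a set with dense complement is Poisson. -/
theorem jacobiAt_of_dense {Z : Set X} (hZ : ∀ x ∈ Z, x ∈ closure Zᶜ) {π : X → Biv n}
    (hπ : (BK n X).Smooth π) {x : X} {y : Eu (2 * n)}
    (hy : y ∈ (extChartAt (𝓡 (2 * n)) x).target)
    (h : ∀ᶠ z in 𝓝 y, (extChartAt (𝓡 (2 * n)) x).symm z ∉ Z →
      JacobiAt ((BK n X).loc π x) z) : JacobiAt ((BK n X).loc π x) y := by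
  by_cases hyZ : (extChartAt (𝓡 (2 * n)) x).symm y ∈ Z
  · intro α β γ
    have := FieldKind.mem_closure_symm hy (hZ _ hyZ)
    have hs := hπ.smoothNear x hy
    have hc : ∀ α β γ : Eu (2 * n) →L[ℝ] ℝ, ContinuousAt (fun z => (BK n X).loc π x z
        ![α, fderiv ℝ (fun z => (BK n X).loc π x z ![β, γ]) z]) y := fun α β γ =>
      (ContDiffAt.form_apply hs.contDiffAt contDiffAt_const
        (hs.form_apply β γ).fderiv.contDiffAt).continuousAt
    refine tendsto_nhds_unique_of_eventuallyEq
      (l := 𝓝[{z | (extChartAt (𝓡 (2 * n)) x).symm z ∉ Z}] y)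
      ((((hc α β γ).add (hc β γ α)).add (hc γ α β)).mono_left nhdsWithin_le_nhds)
      (tendsto_const_nhds) (eventually_nhdsWithin_iff.2 ?_)
    filter_upwards [h] with z hz hz' using hz hz' α β γ
  · exact h.self_of_nhds hyZ

end TwoForms

/-! ### Residues along a hypersurface -/

section Residues

set_option linter.unusedSectionVars false

/-- The converse of `SquareDefining.exists_regular_part`: if `dh ∧ dG / (2h)` is the singular part
of `s⁻¹ R`, then `R = ds ∧ dG + s β` with `β` smooth. -/
theorem SquareDefining.exists_residue_form {V : Type} [NormedAddCommGroup V] [NormedSpace ℝ V]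
    [FiniteDimensional ℝ V] {s u h : V → ℝ} {p : V} (H : SquareDefining s u h p)
    {R q : V → V [⋀^Fin 2]→L[ℝ] ℝ} {G : V → ℝ} (hR : SmoothNear R p) (hq : SmoothNear q p)
    (hG : SmoothNear G p) (hRq : ∀ᶠ y in 𝓝 p, s y ≠ 0 →
      (s y)⁻¹ • R y = q y + (2 * h y)⁻¹ • wed (fderiv ℝ h y) (fderiv ℝ G y)) :
    ∃ β : V → V [⋀^Fin 2]→L[ℝ] ℝ, SmoothNear β p ∧
      ∀ᶠ y in 𝓝 p, R y = wed (fderiv ℝ s y) (fderiv ℝ G y) + s y • β y := by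
  have h2u : SmoothNear (fun y => (2 * u y)⁻¹) p :=
    SmoothNear.inv ((smoothNear_const 2 p).mul H.smooth_factor) (by have := H.pos; positivity)
  have hβ : SmoothNear (fun y => q y + (2 * u y)⁻¹ • wed (fderiv ℝ u y) (fderiv ℝ G y)) p :=
    hq.add (h2u.smul (H.smooth_factor.fderiv.wedge hG.fderiv))
  refine ⟨_, hβ, eventually_eq_of_eq_off (H.smooth.eventually_fderiv_ne_zero H.regular)
    hR.eventually_continuousAt
    ((H.smooth.fderiv.wedge hG.fderiv).add (H.smooth.smul hβ)).eventually_continuousAt ?_⟩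
  filter_upwards [hRq, H.wed_fderiv_h] with y h1 h2 h0
  have h3 := congrArg (fun a => s y • a) (h1 h0)
  simp only [smul_inv_smul₀ h0] at h3
  rw [h3, h2 h0, smul_add, smul_inv_smul₀ h0, conormal, wed_add_left, wed_smul_left, smul_add,
    smul_smul, div_eq_mul_inv]
  abel

variable {n : ℕ} {X : Type*} [TopologicalSpace X] [ChartedSpace (Eu (2 * n)) X]
  [IsManifold (𝓡 (2 * n)) ∞ X]

/-- The expression in a chart of a form modified by a multiple of `dh ∧ Θ`, where `Θ` is locally
exact. -/
theorem loc_add_smul_wed (f : X → Form n) (c : X → ℝ) {h G : X → ℝ}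
    {Θ : X → Eu (2 * n) →L[ℝ] ℝ} {x : X} {y : Eu (2 * n)}
    (hy : y ∈ (extChartAt (𝓡 (2 * n)) x).target)
    (hh : SmoothNearX (2 * n) h ((extChartAt (𝓡 (2 * n)) x).symm y))
    (hG : SmoothNearX (2 * n) G ((extChartAt (𝓡 (2 * n)) x).symm y))
    (hΘ : ∀ᶠ x' in 𝓝 ((extChartAt (𝓡 (2 * n)) x).symm y), Θ x' = dX (2 * n) G x') :
    ∀ᶠ z in 𝓝 y, (FK n X).loc (fun x => f x + c x • wed (dX (2 * n) h x) (Θ x)) x z =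
      (FK n X).loc f x z + c ((extChartAt (𝓡 (2 * n)) x).symm z) •
        wed (fderiv ℝ (fun z => h ((extChartAt (𝓡 (2 * n)) x).symm z)) z)
          (fderiv ℝ (fun z => G ((extChartAt (𝓡 (2 * n)) x).symm z)) z) := by
  filter_upwards [target_mem_nhds hy, eventually_symm hy hh, eventually_symm hy hG,
    eventually_symm hy hΘ] with z h1 h2 h3 h4
  rw [FieldKind.loc, C_add_smul_wed, h4, dX_comp_chA h1 h2, dX_comp_chA h1 h3, FieldKind.loc]

/-- The function `G` is a primitive of the residue of the singular form `f` at `x`: subtracting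
`dh ∧ dG / (2h)` leaves a form which is smooth near `x`. -/
def ResiduePrimitive (Z : Set X) (f : X → Form n) (h G : X → ℝ) (x : X) : Prop :=
  SmoothNearX (2 * n) G x ∧
    (FK n X).Extends Z (fun x => f x + (-(2 * h x)⁻¹) • wed (dX (2 * n) h x) (dX (2 * n) G x)) x

theorem ResiduePrimitive.eventually {Z : Set X} {f : X → Form n} {h G : X → ℝ} {x : X}
    (H : ResiduePrimitive Z f h G x) : ∀ᶠ x' in 𝓝 x, ResiduePrimitive Z f h G x' := by
  filter_upwards [H.1.eventually, H.2.eventually] with x' h1 h2 using ⟨h1, h2⟩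

/-- Residue primitives in terms of the expression in the preferred chart. -/
theorem residuePrimitive_iff {Z : Set X} {f : X → Form n} {h G : X → ℝ} {x : X}
    (hh : SmoothNearX (2 * n) h x) (hG : SmoothNearX (2 * n) G x) :
    ResiduePrimitive Z f h G x ↔ ∃ q : Eu (2 * n) → Form n,
      SmoothNear q (extChartAt (𝓡 (2 * n)) x x) ∧ ∀ᶠ y in 𝓝 (extChartAt (𝓡 (2 * n)) x x),
        (extChartAt (𝓡 (2 * n)) x).symm y ∉ Z →
        (FK n X).loc f x y = q y + (2 * h ((extChartAt (𝓡 (2 * n)) x).symm y))⁻¹ •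
        wed (fderiv ℝ (fun z => h ((extChartAt (𝓡 (2 * n)) x).symm z)) y)
          (fderiv ℝ (fun z => G ((extChartAt (𝓡 (2 * n)) x).symm z)) y) := by
  have hy := mem_extChartAt_target (I := 𝓡 (2 * n)) x
  have e := (extChartAt (𝓡 (2 * n)) x).left_inv (mem_extChartAt_source (I := 𝓡 (2 * n)) x)
  have hl := loc_add_smul_wed f (fun x => -(2 * h x)⁻¹) (h := h) (G := G) (Θ := dX (2 * n) G) hy
    (by rwa [e]) (by rwa [e]) (Filter.Eventually.of_forall fun _ => rfl)
  refine (and_iff_right hG).trans (exists_congr fun q => and_congr_right fun hq =>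
    Filter.eventually_congr (hl.mono fun y hy => imp_congr_right fun _ => ?_))
  rw [hy]
  have key : ∀ (a b w : Form n) (t : ℝ), a + (-t) • w = b ↔ a = b + t • w := by
    intro a b w t
    constructor
    · rintro rfl
      refine form_ext fun v w => ?_
      simp
    · rintro rfl
      refine form_ext fun v w => ?_
      simp
  exact key _ _ _ _

end Residues

/-! ### Tangent spaces of a hypersurface -/

section Tangent

set_option linter.unusedSectionVars false

variable {m d : ℕ} {X : Type*} [TopologicalSpace X] [ChartedSpace (Eu m) X]
  [IsManifold (𝓡 m) ∞ X] {Z : Type*} [TopologicalSpace Z] [ChartedSpace (Eu d) Z]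
  [IsManifold (𝓡 d) ∞ Z]

/-- The differential of a map of manifolds. -/
def dMap (d m : ℕ) {X Z : Type*} [TopologicalSpace X] [ChartedSpace (Eu m) X]
    [TopologicalSpace Z] [ChartedSpace (Eu d) Z] (ι : Z → X) (z : Z) : Eu d →L[ℝ] Eu m :=
  mfderiv (𝓡 d) (𝓡 m) ι z

theorem dX_comp {ι : Z → X} {z : Z} (hι : ContMDiffAt (𝓡 d) (𝓡 m) ∞ ι z) {G : X → ℝ}
    (hG : ContMDiffAt (𝓡 m) 𝓘(ℝ, ℝ) ∞ G (ι z)) :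
    dX d (fun z => G (ι z)) z = (dX m G (ι z)).comp (dMap d m ι z) :=
  mfderiv_comp z (hG.mdifferentiableAt (by simp)) (hι.mdifferentiableAt (by simp))

/-- The differential of `ι`, expressed in the preferred chart at `ι z`. -/
def tangentMap (d m : ℕ) {X Z : Type*} [TopologicalSpace X] [ChartedSpace (Eu m) X]
    [TopologicalSpace Z] [ChartedSpace (Eu d) Z] (ι : Z → X) (z : Z) : Eu d →L[ℝ] Eu m :=
  (chB (ι z) (extChartAt (𝓡 m) (ι z) (ι z))).comp (dMap d m ι z)

theorem dX_comp_eq {ι : Z → X} {z : Z} (hι : ContMDiffAt (𝓡 d) (𝓡 m) ∞ ι z) {G : X → ℝ}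
    (hG : ContMDiffAt (𝓡 m) 𝓘(ℝ, ℝ) ∞ G (ι z)) :
    dX d (fun z => G (ι z)) z =
      (fderiv ℝ (fun y => G ((extChartAt (𝓡 m) (ι z)).symm y))
        (extChartAt (𝓡 m) (ι z) (ι z))).comp (tangentMap d m ι z) := by
  rw [dX_comp hι hG, dX_eq_fderiv_comp (mem_extChartAt_source (ι z)) hG]
  rfl

theorem injective_tangentMap {ι : Z → X} {z : Z}
    (h : Manifold.IsImmersionAt (𝓡 d) (𝓡 m) ∞ ι z) : Function.Injective (tangentMap d m ι z) := by
  obtain ⟨ρ, hρ, hρι⟩ := exists_local_retraction h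
  have h1 := mfderiv_comp z (hρ.self_of_nhds.mdifferentiableAt (by simp))
    (h.contMDiffAt.mdifferentiableAt (by simp))
  have e : (ρ ∘ ι) =ᶠ[𝓝 z] id := hρι
  rw [e.mfderiv_eq, mfderiv_id] at h1
  intro v w hvw
  have h2 : dMap d m ι z v = dMap d m ι z w := by
    have := congrArg (chA (ι z) (extChartAt (𝓡 m) (ι z) (ι z))) hvw
    rwa [tangentMap, ContinuousLinearMap.comp_apply, ContinuousLinearMap.comp_apply,
      chA_chB (mem_extChartAt_target (ι z)), chA_chB (mem_extChartAt_target (ι z))] at this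
  have h3 := congrArg (dMap m d ρ (ι z)) h2
  have h4 : ∀ v, dMap m d ρ (ι z) (dMap d m ι z v) = v := fun v =>
    (congrArg (fun L => L v) h1).symm
  rwa [h4, h4] at h3

/-- The differential of a function vanishing on the hypersurface kills its tangent vectors. -/
theorem fderiv_tangentMap_eq_zero {ι : Z → X} {z : Z}
    (h : Manifold.IsImmersionAt (𝓡 d) (𝓡 m) ∞ ι z) {s : Eu m → ℝ}
    (hs : SmoothNear s (extChartAt (𝓡 m) (ι z) (ι z)))
    (hs0 : ∀ᶠ z' in 𝓝 z, s (extChartAt (𝓡 m) (ι z) (ι z')) = 0) (v : Eu d) :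
    fderiv ℝ s (extChartAt (𝓡 m) (ι z) (ι z)) (tangentMap d m ι z v) = 0 := by
  have hsrc := mem_extChartAt_source (I := 𝓡 m) (ι z)
  have hG : SmoothNearX m (fun x => s (extChartAt (𝓡 m) (ι z) x)) (ι z) := by
    refine smoothNearX_of_chart hsrc (hs.congr ?_)
    filter_upwards [extChartAt_target_mem_nhds (I := 𝓡 m) (ι z)] with y hy
    rw [(extChartAt (𝓡 m) (ι z)).right_inv hy]
  have h1 := dX_comp_eq h.contMDiffAt hG.contMDiffAt
  rw [dX_congr (g := fun _ => 0) hs0] at h1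
  have h2 : dX d (fun _ : Z => (0 : ℝ)) z = 0 := mfderiv_const
  have h3 : fderiv ℝ (fun y => s (extChartAt (𝓡 m) (ι z) ((extChartAt (𝓡 m) (ι z)).symm y)))
      (extChartAt (𝓡 m) (ι z) (ι z)) = fderiv ℝ s (extChartAt (𝓡 m) (ι z) (ι z)) := by
    refine Filter.EventuallyEq.fderiv_eq ?_
    filter_upwards [extChartAt_target_mem_nhds (I := 𝓡 m) (ι z)] with y hy
    rw [(extChartAt (𝓡 m) (ι z)).right_inv hy]
  rw [h2, h3] at h1
  exact (congrArg (fun L => L v) h1).symm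

/-- The tangent space of a regular hypersurface is the kernel of the differential of its defining
function. -/
theorem exists_tangentMap_eq (hd : d + 1 = m) {ι : Z → X} {z : Z}
    (h : Manifold.IsImmersionAt (𝓡 d) (𝓡 m) ∞ ι z) {s : Eu m → ℝ}
    (hs : SmoothNear s (extChartAt (𝓡 m) (ι z) (ι z)))
    (hds : fderiv ℝ s (extChartAt (𝓡 m) (ι z) (ι z)) ≠ 0)
    (hs0 : ∀ᶠ z' in 𝓝 z, s (extChartAt (𝓡 m) (ι z) (ι z')) = 0) (w : Eu m)
    (hw : fderiv ℝ s (extChartAt (𝓡 m) (ι z) (ι z)) w = 0) : ∃ v, tangentMap d m ι z v = w := by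
  let α : Module.Dual ℝ (Eu m) := (fderiv ℝ s (extChartAt (𝓡 m) (ι z) (ι z)) : Eu m →ₗ[ℝ] ℝ)
  let J : Eu d →ₗ[ℝ] Eu m := tangentMap d m ι z
  have hα : α ≠ 0 := fun h0 => hds (ContinuousLinearMap.ext fun v => congrArg (fun L => L v) h0)
  have hle : LinearMap.range J ≤ LinearMap.ker α := by
    rintro _ ⟨v, rfl⟩
    exact fderiv_tangentMap_eq_zero h hs hs0 v
  have h1 : Module.finrank ℝ (LinearMap.range J) = d := by
    rw [LinearMap.finrank_range_of_inj (injective_tangentMap h), finrank_euclideanSpace_fin]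
  have h2 := Module.Dual.finrank_ker_add_one_of_ne_zero hα
  rw [finrank_euclideanSpace_fin] at h2
  have h3 := Submodule.eq_of_le_of_finrank_eq hle (by omega)
  have h4 : w ∈ LinearMap.range J := by rw [h3]; exact hw
  exact h4

end Tangent

/-! ### Neighbourhoods of a compact set -/

section Topology

variable {X : Type*} [TopologicalSpace X]

/-- A monotone family of conditions that holds locally on a compact set for some constant holds near
the whole set for one constant. -/
theorem exists_uniform_bound {K : Set X} (hK : IsCompact K) {P : ℝ → X → Prop}
    (hP : ∀ x C C', C ≤ C' → P C x → P C' x) (h : ∀ x ∈ K, ∃ C, ∀ᶠ x' in 𝓝 x, P C x') :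
    ∃ C, ∀ᶠ x in 𝓝ˢ K, P C x := by
  refine hK.induction_on (p := fun K => ∃ C, ∀ᶠ x in 𝓝ˢ K, P C x) ⟨0, by simp⟩ ?_ ?_ ?_
  · rintro s t hst ⟨C, hC⟩
    exact ⟨C, hC.filter_mono (nhdsSet_mono hst)⟩
  · rintro s t ⟨C, hC⟩ ⟨C', hC'⟩
    refine ⟨max C C', ?_⟩
    rw [nhdsSet_union, Filter.eventually_sup]
    exact ⟨hC.mono fun x => hP x _ _ (le_max_left _ _),
      hC'.mono fun x => hP x _ _ (le_max_right _ _)⟩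
  · intro x hx
    obtain ⟨C, hC⟩ := h x hx
    obtain ⟨t, ht, hto, hxt⟩ := eventually_nhds_iff.1 hC
    refine ⟨t, mem_nhdsWithin_of_mem_nhds (hto.mem_nhds hxt), C, ?_⟩
    rw [hto.nhdsSet_eq]
    exact ht

/-- The sublevel sets of `h ≥ 0` shrink to its zero set. -/
theorem exists_sublevel_subset [CompactSpace X] {h : X → ℝ} (hh : Continuous h)
    (h0 : ∀ x, 0 ≤ h x) {O : Set X} (hO : IsOpen O) (hZ : ∀ x, h x = 0 → x ∈ O) :
    ∃ δ, 0 < δ ∧ ∀ ε < δ, ∀ x ∉ O, ε < h x := by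
  by_cases hne : (Oᶜ).Nonempty
  · obtain ⟨x, hx, hmin⟩ := hO.isClosed_compl.isCompact.exists_isMinOn hne hh.continuousOn
    refine ⟨h x, (h0 x).lt_of_ne fun h => hx (hZ x h.symm), fun ε hε y hy => ?_⟩
    exact hε.trans_le (hmin hy)
  · exact ⟨1, one_pos, fun ε _ x hx => absurd ⟨x, hx⟩ hne⟩

end Topology

/-! ### Cutoff functions on the real line -/

section Cutoff

/-- A smooth function which vanishes on `(-∞, ε / 2]` and equals `1` on `[ε, ∞)`. -/
def step (ε t : ℝ) : ℝ := Real.smoothTransition (2 / ε * t - 1)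

theorem contDiff_step (ε : ℝ) : ContDiff ℝ ∞ (step ε) :=
  Real.smoothTransition.contDiff.comp ((contDiff_const.mul contDiff_id).sub contDiff_const)

theorem step_nonneg (ε t : ℝ) : 0 ≤ step ε t := Real.smoothTransition.nonneg _

theorem step_le_one (ε t : ℝ) : step ε t ≤ 1 := Real.smoothTransition.le_one _

theorem step_eq_zero {ε t : ℝ} (hε : 0 < ε) (ht : t ≤ ε / 2) : step ε t = 0 := by
  refine Real.smoothTransition.zero_of_nonpos ?_
  rw [div_mul_eq_mul_div, sub_nonpos, div_le_one hε]
  linarith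

theorem step_eq_one {ε t : ℝ} (hε : 0 < ε) (ht : ε ≤ t) : step ε t = 1 := by
  refine Real.smoothTransition.one_of_one_le ?_
  rw [div_mul_eq_mul_div, le_sub_iff_add_le, le_div_iff₀ hε]
  linarith

/-- A smooth function which equals `1 / (2 t)` for `t ≥ ε` and is constant near `0`. -/
def smoothInv (ε t : ℝ) : ℝ := (1 - step ε t) * (2 * ε)⁻¹ + step ε t * (2 * t)⁻¹

theorem smoothInv_eq_of_le {ε t : ℝ} (hε : 0 < ε) (ht : t ≤ ε / 2) : smoothInv ε t = (2 * ε)⁻¹ := by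
  rw [smoothInv, step_eq_zero hε ht]; ring

theorem smoothInv_eq_of_ge {ε t : ℝ} (hε : 0 < ε) (ht : ε ≤ t) : smoothInv ε t = (2 * t)⁻¹ := by
  rw [smoothInv, step_eq_one hε ht]; ring

theorem contDiffAt_smoothInv (ε : ℝ) {t : ℝ} (ht : 0 < t) : ContDiffAt ℝ ∞ (smoothInv ε) t := by
  refine ContDiffAt.add ?_ ?_
  · exact (contDiffAt_const.sub (contDiff_step ε).contDiffAt).mul contDiffAt_const
  · exact (contDiff_step ε).contDiffAt.mul
      ((contDiffAt_const.mul contDiffAt_id).inv (by simpa using ht.ne'))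

theorem le_smoothInv {ε t : ℝ} (h0 : 0 < t) (ht : t ≤ ε) :
    (2 * ε)⁻¹ ≤ smoothInv ε t := by
  have h1 : (2 * ε)⁻¹ ≤ (2 * t)⁻¹ := by gcongr
  have := step_nonneg ε t
  rw [smoothInv]
  nlinarith

theorem smoothInv_mul_le {ε t : ℝ} (h0 : 0 < t) (ht : t ≤ ε) : 2 * smoothInv ε t * t ≤ 1 := by
  have hε : 0 < ε := h0.trans_le ht
  have h1 : t / ε ≤ 1 := (div_le_one hε).2 ht
  have h2 := step_le_one ε t
  have h3 : 2 * smoothInv ε t * t = (1 - step ε t) * (t / ε) + step ε t := by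
    rw [smoothInv]; field_simp
  rw [h3]
  nlinarith [step_nonneg ε t]

end Cutoff

/-! ### The residue of a log-symplectic structure -/

section LogSymplectic

set_option linter.unusedSectionVars false

/-- The complement of a subset of a regular hypersurface accumulates at each point of the
hypersurface. -/
theorem mem_closure_compl {m : ℕ} {X : Type*} [TopologicalSpace X] [ChartedSpace (Eu m) X]
    {Z : Set X} {x : X} {s : Eu m → ℝ} (hs : fderiv ℝ s (extChartAt (𝓡 m) x x) ≠ 0)
    (h : ∀ᶠ y in 𝓝 (extChartAt (𝓡 m) x x), s y ≠ 0 → (extChartAt (𝓡 m) x).symm y ∉ Z) :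
    x ∈ closure Zᶜ := by
  rw [mem_closure_iff_frequently]
  intro hZ
  apply hs
  have h1 := eventually_symm (mem_extChartAt_target (I := 𝓡 m) x)
    (P := fun x' => ¬ x' ∈ Zᶜ) (by
      rwa [(extChartAt (𝓡 m) x).left_inv (mem_extChartAt_source x)])
  have h2 : s =ᶠ[𝓝 (extChartAt (𝓡 m) x x)] fun _ => 0 := by
    filter_upwards [h, h1] with y h3 h4
    by_contra h5
    exact h4 (h3 h5)
  rw [h2.fderiv_eq]
  simp

theorem SmoothNear.adjForm {V : Type} [NormedAddCommGroup V] [NormedSpace ℝ V]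
    [FiniteDimensional ℝ V] {n : ℕ} {W : Type*} [NormedAddCommGroup W] [NormedSpace ℝ W] {p : W}
    {a : W → (V →L[ℝ] ℝ) [⋀^Fin 2]→L[ℝ] ℝ} (b : Module.Basis (Fin (2 * n)) ℝ V)
    (ha : SmoothNear a p) : SmoothNear (fun y => adjF b (a y)) p := by
  filter_upwards [ha] with y hy using (contDiff_adjF b).contDiffAt.comp y hy

variable {n : ℕ} {X : Type*} [TopologicalSpace X] [ChartedSpace (Eu (2 * n)) X]
  [IsManifold (𝓡 (2 * n)) ∞ X]

/-- The Pfaffian of a bivector field in the chart at `x`. -/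
def pfLoc (π : X → Biv n) (x : X) (y : Eu (2 * n)) : ℝ := pf (dualB (bE n)) ((BK n X).loc π x y)

/-- A function on `X` in the chart at `x`. -/
def inCh (n : ℕ) {X : Type*} [TopologicalSpace X] [ChartedSpace (Eu (2 * n)) X] (h : X → ℝ) (x : X)
    (y : Eu (2 * n)) : ℝ := h ((extChartAt (𝓡 (2 * n)) x).symm y)

theorem SmoothNearX.inCh {h : X → ℝ} {x : X} (hh : SmoothNearX (2 * n) h x) :
    SmoothNear (inCh n h x) (extChartAt (𝓡 (2 * n)) x x) :=
  smoothNear_comp_symm (mem_extChartAt_target x)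
    (by rwa [(extChartAt (𝓡 (2 * n)) x).left_inv (mem_extChartAt_source x)])

theorem smoothNearX_of_inCh {h : X → ℝ} {x : X}
    (hh : SmoothNear (inCh n h x) (extChartAt (𝓡 (2 * n)) x x)) : SmoothNearX (2 * n) h x :=
  smoothNearX_of_chart (mem_extChartAt_source x) hh

theorem eventually_inCh {x : X} {P : X → Prop} (h : ∀ᶠ x' in 𝓝 x, P x') :
    ∀ᶠ y in 𝓝 (extChartAt (𝓡 (2 * n)) x x), P ((extChartAt (𝓡 (2 * n)) x).symm y) :=
  eventually_symm (mem_extChartAt_target x)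
    (by rwa [(extChartAt (𝓡 (2 * n)) x).left_inv (mem_extChartAt_source x)])

theorem eventually_of_inCh {x : X} {P : X → Prop}
    (h : ∀ᶠ y in 𝓝 (extChartAt (𝓡 (2 * n)) x x), P ((extChartAt (𝓡 (2 * n)) x).symm y)) :
    ∀ᶠ x' in 𝓝 x, P x' := by
  filter_upwards [eventually_chart (mem_extChartAt_source (I := 𝓡 (2 * n)) x) h,
    source_mem_nhds (mem_extChartAt_source (I := 𝓡 (2 * n)) x)] with x' h1 h2
  rwa [(extChartAt (𝓡 (2 * n)) x).left_inv h2] at h1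

/-- A log-symplectic structure `π` with degeneracy locus `Z`, and a function `h` which near `Z` is
a positive multiple of the square of a regular defining function. -/
structure LogData (π : X → Biv n) (Z : Set X) (h : X → ℝ) : Prop where
  smooth : (BK n X).Smooth π
  jacobi : ∀ x, ∀ y ∈ (extChartAt (𝓡 (2 * n)) x).target, JacobiAt ((BK n X).loc π x) y
  mem_iff : ∀ x, x ∈ Z ↔ pf (dualB (bE n)) (π x) = 0
  smooth_h : ContMDiff (𝓡 (2 * n)) 𝓘(ℝ, ℝ) ∞ h
  nonneg : ∀ x, 0 ≤ h x
  h_eq_zero : ∀ x, h x = 0 ↔ x ∈ Z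
  square : ∀ x ∈ Z, ∃ u, SquareDefining (pfLoc π x) u (inCh n h x) (extChartAt (𝓡 (2 * n)) x x)

/-- The inverse of a bivector field. -/
def invField (π : X → Biv n) (x : X) : Form n := invF (bE n) (π x)

namespace LogData

variable {π : X → Biv n} {Z : Set X} {h : X → ℝ} (H : LogData π Z h)
include H

theorem isClosed : IsClosed Z := by
  have : Z = h ⁻¹' {0} := Set.ext fun x => (H.h_eq_zero x).symm
  rw [this]
  exact isClosed_singleton.preimage H.smooth_h.continuous

theorem h_pos {x : X} (hx : x ∉ Z) : 0 < h x :=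
  (H.nonneg x).lt_of_ne fun e => hx ((H.h_eq_zero x).1 e.symm)

theorem smoothNearX (x : X) : SmoothNearX (2 * n) h x :=
  Filter.Eventually.of_forall fun x' => H.smooth_h x'

theorem pfLoc_ne_zero_iff {x : X} {y : Eu (2 * n)}
    (hy : y ∈ (extChartAt (𝓡 (2 * n)) x).target) :
    pfLoc π x y ≠ 0 ↔ (extChartAt (𝓡 (2 * n)) x).symm y ∉ Z := by
  rw [H.mem_iff, pfLoc, not_iff_not]
  exact pf_loc_biv_eq_zero hy

theorem eventually_pfLoc_ne_zero_iff (x : X) : ∀ᶠ y in 𝓝 (extChartAt (𝓡 (2 * n)) x x),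
    (pfLoc π x y ≠ 0 ↔ (extChartAt (𝓡 (2 * n)) x).symm y ∉ Z) := by
  filter_upwards [extChartAt_target_mem_nhds (I := 𝓡 (2 * n)) x] with y hy
    using H.pfLoc_ne_zero_iff hy

theorem dense {x : X} (hx : x ∈ Z) : x ∈ closure Zᶜ := by
  obtain ⟨u, hu⟩ := H.square x hx
  refine mem_closure_compl hu.regular ?_
  filter_upwards [H.eventually_pfLoc_ne_zero_iff x] with y hy using hy.1

/-- The inverse of `π` in a chart. -/
theorem loc_invField {x : X} {y : Eu (2 * n)} (hy : y ∈ (extChartAt (𝓡 (2 * n)) x).target)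
    (hyZ : (extChartAt (𝓡 (2 * n)) x).symm y ∉ Z) :
    (FK n X).loc (invField π) x y = (pfLoc π x y)⁻¹ • adjF (bE n) ((BK n X).loc π x y) :=
  loc_invF hy fun h0 => hyZ ((H.mem_iff _).2 h0)

theorem inv_loc {x : X} {y : Eu (2 * n)} (hy : y ∈ (extChartAt (𝓡 (2 * n)) x).target)
    (hyZ : (extChartAt (𝓡 (2 * n)) x).symm y ∉ Z) :
    Inv ((FK n X).loc (invField π) x y) ((BK n X).loc π x y) :=
  LogFolded.inv_loc hy (inv_invF (bE n) fun h0 => hyZ ((H.mem_iff _).2 h0))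

/-- The Pfaffian of the inverse has a simple pole along the hypersurface. -/
theorem pfLoc_mul_pf {x : X} {y : Eu (2 * n)} (hy : y ∈ (extChartAt (𝓡 (2 * n)) x).target)
    (hyZ : (extChartAt (𝓡 (2 * n)) x).symm y ∉ Z) :
    pfLoc π x y * pf (bE n) ((FK n X).loc (invField π) x y) = (-1) ^ n * stdPf n ^ 2 := by
  rw [mul_comm]
  exact (H.inv_loc hy hyZ).pf_mul_pf (bE n)

theorem smoothNear_loc {x : X} {y : Eu (2 * n)} (hy : y ∈ (extChartAt (𝓡 (2 * n)) x).target)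
    (hyZ : (extChartAt (𝓡 (2 * n)) x).symm y ∉ Z) :
    SmoothNear ((FK n X).loc (invField π) x) y := by
  have h1 := H.smooth.smoothNear x hy
  refine SmoothNear.congr (SmoothNear.smul
    (SmoothNear.inv (h1.pfaffian (dualB (bE n))) ((H.pfLoc_ne_zero_iff hy).2 hyZ))
    (h1.adjForm (bE n))) ?_
  filter_upwards [target_mem_nhds hy,
    eventually_symm hy (H.isClosed.isOpen_compl.mem_nhds hyZ)] with z h2 h3
    using H.loc_invField h2 h3

/-- The inverse is closed, by the Jacobi identity. -/
theorem d3_loc {x : X} {y : Eu (2 * n)} (hy : y ∈ (extChartAt (𝓡 (2 * n)) x).target)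
    (hyZ : (extChartAt (𝓡 (2 * n)) x).symm y ∉ Z) (a b c : Eu (2 * n)) :
    d3 ((FK n X).loc (invField π) x) y a b c = 0 := by
  refine (jacobiAt_iff_closed (H.smoothNear_loc hy hyZ).differentiableAt
    (H.smooth.smoothNear x hy).differentiableAt ?_).1 (H.jacobi x y hy) a b c
  filter_upwards [target_mem_nhds hy,
    eventually_symm hy (H.isClosed.isOpen_compl.mem_nhds hyZ)] with z h2 h3 using H.inv_loc h2 h3

theorem smoothNear_adj (x : X) : SmoothNear (fun y => adjF (bE n) ((BK n X).loc π x y))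
    (extChartAt (𝓡 (2 * n)) x x) := (H.smooth x).adjForm (bE n)

/-- Each point of the hypersurface has a local primitive of the residue. -/
theorem exists_residuePrimitive {x : X} (hx : x ∈ Z) :
    ∃ G, ResiduePrimitive Z (invField π) h G x := by
  obtain ⟨u, hu⟩ := H.square x hx
  have hcl : ∀ᶠ y in 𝓝 (extChartAt (𝓡 (2 * n)) x x), pfLoc π x y ≠ 0 → ∀ a b c,
      d3 (fun z => (pfLoc π x z)⁻¹ • adjF (bE n) ((BK n X).loc π x z)) y a b c = 0 := by
    filter_upwards [eventually_eventually_nhds.2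
      (extChartAt_target_mem_nhds (I := 𝓡 (2 * n)) x)] with y hy h0 a b c
    have hy' := mem_of_mem_nhds hy
    have hyZ := (H.pfLoc_ne_zero_iff hy').1 h0
    rw [← H.d3_loc hy' hyZ a b c]
    refine d3_congr ?_ a b c
    filter_upwards [hy, eventually_symm hy' (H.isClosed.isOpen_compl.mem_nhds hyZ)] with z h2 h3
      using (H.loc_invField h2 h3).symm
  obtain ⟨G, β, hG, hβ, hR⟩ := exists_residue_primitive (H.smoothNear_adj x) hu.smooth hu.zero
    hu.regular hcl
  obtain ⟨q, hq, hRq⟩ := hu.exists_regular_part hβ hG hR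
  have e : ∀ᶠ y in 𝓝 (extChartAt (𝓡 (2 * n)) x x),
      G (extChartAt (𝓡 (2 * n)) x ((extChartAt (𝓡 (2 * n)) x).symm y)) = G y := by
    filter_upwards [extChartAt_target_mem_nhds (I := 𝓡 (2 * n)) x] with y hy
    rw [(extChartAt (𝓡 (2 * n)) x).right_inv hy]
  have hGX : SmoothNearX (2 * n) (fun x' => G (extChartAt (𝓡 (2 * n)) x x')) x :=
    smoothNearX_of_inCh (hG.congr e)
  refine ⟨fun x' => G (extChartAt (𝓡 (2 * n)) x x'), (residuePrimitive_iff (H.smoothNearX x)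
    hGX).2 ⟨q, hq, ?_⟩⟩
  filter_upwards [hRq, extChartAt_target_mem_nhds (I := 𝓡 (2 * n)) x,
    eventually_eventually_nhds.2 e] with y h1 h2 h3 h4
  rw [H.loc_invField h2 h4, h1 ((H.pfLoc_ne_zero_iff h2).2 h4),
    Filter.EventuallyEq.fderiv_eq h3]
  rfl

/-- A primitive of the residue, in the form used for the uniqueness of residues. -/
theorem exists_residue_form {x : X} (hx : x ∈ Z) {G : X → ℝ}
    (hG : ResiduePrimitive Z (invField π) h G x) : ∃ β : Eu (2 * n) → Form n,
      SmoothNear β (extChartAt (𝓡 (2 * n)) x x) ∧ ∀ᶠ y in 𝓝 (extChartAt (𝓡 (2 * n)) x x),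
        adjF (bE n) ((BK n X).loc π x y) =
          wed (fderiv ℝ (pfLoc π x) y) (fderiv ℝ (inCh n G x) y) + pfLoc π x y • β y := by
  obtain ⟨u, hu⟩ := H.square x hx
  obtain ⟨q, hq, h1⟩ := (residuePrimitive_iff (H.smoothNearX x) hG.1).1 hG
  refine hu.exists_residue_form (H.smoothNear_adj x) hq hG.1.inCh ?_
  filter_upwards [h1, extChartAt_target_mem_nhds (I := 𝓡 (2 * n)) x] with y h2 h3 h4
  have h5 := (H.pfLoc_ne_zero_iff h3).1 h4
  rw [← H.loc_invField h3 h5, h2 h5]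
  rfl

/-- The residue only depends on the restriction of its primitive to the hypersurface. -/
theorem residuePrimitive_congr {x : X} (hx : x ∈ Z) {G G' : X → ℝ}
    (hG : ResiduePrimitive Z (invField π) h G x) (hG' : SmoothNearX (2 * n) G' x)
    (he : ∀ᶠ x' in 𝓝 x, x' ∈ Z → G' x' = G x') : ResiduePrimitive Z (invField π) h G' x := by
  obtain ⟨u, hu⟩ := H.square x hx
  obtain ⟨β, hβ, h1⟩ := H.exists_residue_form hx hG
  obtain ⟨β', hβ', h2⟩ := residue_primitive_congr (G' := inCh n G' x) (c := 0) hu.smooth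
    hu.regular hG.1.inCh hG'.inCh hβ h1 (by
      filter_upwards [eventually_inCh he, H.eventually_pfLoc_ne_zero_iff x] with y h2 h3 h4
      rw [add_zero]
      refine h2 ?_
      by_contra h5
      exact h3.2 h5 h4)
  obtain ⟨q, hq, h3⟩ := hu.exists_regular_part hβ' hG'.inCh h2
  refine (residuePrimitive_iff (H.smoothNearX x) hG').2 ⟨q, hq, ?_⟩
  filter_upwards [h3, extChartAt_target_mem_nhds (I := 𝓡 (2 * n)) x] with y h4 h5 h6
  rw [H.loc_invField h5 h6, h4 ((H.pfLoc_ne_zero_iff h5).2 h6)]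
  rfl

variable {Y : Type*} [TopologicalSpace Y] [ChartedSpace (Eu (2 * n - 1)) Y]
  [IsManifold (𝓡 (2 * n - 1)) ∞ Y] {ι : Y → X}

theorem eventually_pfLoc_eq_zero (hι : Manifold.IsSmoothEmbedding (𝓡 (2 * n - 1)) (𝓡 (2 * n)) ∞ ι)
    (hZ : Set.range ι = Z) (z : Y) :
    ∀ᶠ z' in 𝓝 z, pfLoc π (ι z) (extChartAt (𝓡 (2 * n)) (ι z) (ι z')) = 0 := by
  have h1 := hι.isEmbedding.continuous.continuousAt.eventually
    (source_mem_nhds (mem_extChartAt_source (I := 𝓡 (2 * n)) (ι z)))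
  filter_upwards [h1] with z' hz'
  by_contra h0
  have h2 := (H.pfLoc_ne_zero_iff ((extChartAt (𝓡 (2 * n)) (ι z)).map_source hz')).1 h0
  rw [(extChartAt (𝓡 (2 * n)) (ι z)).left_inv hz', ← hZ] at h2
  exact h2 ⟨z', rfl⟩

/-- The restrictions of all primitives of the residue have the same differential. -/
theorem dX_residuePrimitive_eq
    (hι : Manifold.IsSmoothEmbedding (𝓡 (2 * n - 1)) (𝓡 (2 * n)) ∞ ι)
    (hZ : Set.range ι = Z) {z : Y} {G G' : X → ℝ}
    (hG : ResiduePrimitive Z (invField π) h G (ι z))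
    (hG' : ResiduePrimitive Z (invField π) h G' (ι z)) :
    dX (2 * n - 1) (fun z => G (ι z)) z = dX (2 * n - 1) (fun z => G' (ι z)) z := by
  have hx : ι z ∈ Z := hZ ▸ ⟨z, rfl⟩
  obtain ⟨u, hu⟩ := H.square _ hx
  obtain ⟨β, -, h1⟩ := H.exists_residue_form hx hG
  obtain ⟨β', -, h2⟩ := H.exists_residue_form hx hG'
  have him := hι.isImmersion.isImmersionAt z
  have h3 := (residue_unique hu.smooth hu.regular h1 h2).self_of_nhds hu.zero
  rw [dX_comp_eq him.contMDiffAt hG.1.contMDiffAt, dX_comp_eq him.contMDiffAt hG'.1.contMDiffAt]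
  refine ContinuousLinearMap.ext fun v => h3 _ ?_
  exact fderiv_tangentMap_eq_zero him hu.smooth (H.eventually_pfLoc_eq_zero hι hZ z) v

/-- The residue is the restriction of a covector field which is locally exact near the
hypersurface. -/
theorem exists_residue [T2Space X] [CompactSpace X]
    (hι : Manifold.IsSmoothEmbedding (𝓡 (2 * n - 1)) (𝓡 (2 * n)) ∞ ι) (hZ : Set.range ι = Z) :
    ∃ Θ : X → Eu (2 * n) →L[ℝ] ℝ, ∀ x ∈ Z, ∃ G : X → ℝ,
      (∀ᶠ x' in 𝓝 x, Θ x' = dX (2 * n) G x') ∧ ResiduePrimitive Z (invField π) h G x := by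
  have hmem : ∀ z, ι z ∈ Z := fun z => hZ ▸ ⟨z, rfl⟩
  choose G hG using fun z => H.exists_residuePrimitive (hmem z)
  choose ρ hρ hρι using fun z => exists_local_retraction (hι.isImmersion.isImmersionAt z)
  have hcm : ContMDiff (𝓡 (2 * n - 1)) (𝓡 (2 * n)) ∞ ι := hι.isImmersion.contMDiff
  obtain ⟨Θ, hΘ⟩ := exists_extension_of_primitives hι.isEmbedding (hZ ▸ H.isClosed) ρ hρ hρι
    (fun z z' => G z (ι z')) (fun z => by
      filter_upwards [hcm.continuous.continuousAt.eventually (hG z).1] with z' hz'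
      exact hz'.comp z' (hcm z')) (fun z => by
      filter_upwards [hcm.continuous.continuousAt.eventually (hG z).eventually] with z' hz'
      exact H.dX_residuePrimitive_eq hι hZ hz' (hG z'))
  refine ⟨Θ, fun x hx => ?_⟩
  obtain ⟨z, rfl⟩ : x ∈ Set.range ι := hZ ▸ hx
  obtain ⟨G', hG', hΘG, he⟩ := hΘ z
  refine ⟨G', hΘG, H.residuePrimitive_congr (hmem z) (hG z) hG' ?_⟩
  rw [hι.isEmbedding.nhds_eq_comap, Filter.eventually_comap] at he
  filter_upwards [he] with x hx hxZ
  obtain ⟨z', rfl⟩ : x ∈ Set.range ι := hZ ▸ hxZ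
  exact hx z' rfl

end LogData

end LogSymplectic

/-! ### From log-symplectic structures to folded-symplectic forms -/

section Folded

set_option linter.unusedSectionVars false

variable {n : ℕ} {X : Type*} [TopologicalSpace X] [ChartedSpace (Eu (2 * n)) X]
  [IsManifold (𝓡 (2 * n)) ∞ X]

/-- The covector field `Θ` is exact near `x`. -/
def LocallyExactAt (Θ : X → Eu (2 * n) →L[ℝ] ℝ) (x : X) : Prop :=
  ∃ G : X → ℝ, SmoothNearX (2 * n) G x ∧ ∀ᶠ x' in 𝓝 x, Θ x' = dX (2 * n) G x'

theorem isOpen_locallyExactAt (Θ : X → Eu (2 * n) →L[ℝ] ℝ) : IsOpen {x | LocallyExactAt Θ x} := by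
  rw [isOpen_iff_eventually]
  rintro x ⟨G, hG, hΘ⟩
  filter_upwards [hG.eventually, eventually_eventually_nhds.2 hΘ] with x' h1 h2 using ⟨G, h1, h2⟩

/-- The form `f - dh ∧ Θ / (2h)`. -/
def regPart (f : X → Form n) (h : X → ℝ) (Θ : X → Eu (2 * n) →L[ℝ] ℝ) (x : X) : Form n :=
  f x + (-(2 * h x)⁻¹) • wed (dX (2 * n) h x) (Θ x)

theorem form_add_neg_smul_eq (a b w : Form n) {t : ℝ} (h : a = b + t • w) : a + (-t) • w = b := by
  rw [h]
  refine form_ext fun v w => ?_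
  simp

/-- Ratios of Pfaffians do not depend on the chart. -/
theorem pf_loc_div (a b : X → Form n) {x : X} {y : Eu (2 * n)}
    (hy : y ∈ (extChartAt (𝓡 (2 * n)) x).target) :
    pf (bE n) ((FK n X).loc a x y) / pf (bE n) ((FK n X).loc b x y) =
      pf (bE n) (a ((extChartAt (𝓡 (2 * n)) x).symm y)) /
        pf (bE n) (b ((extChartAt (𝓡 (2 * n)) x).symm y)) := by
  rw [pf_loc_form, pf_loc_form, mul_div_mul_left _ _ (det_chA_ne_zero hy)]

/-- Adding a multiple of `dh ∧ Θ`, with `Θ` locally exact and a coefficient which is a function of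
`h`, preserves smoothness and closedness. -/
theorem smoothNear_closed_add {f : X → Form n} {h : X → ℝ} {Θ : X → Eu (2 * n) →L[ℝ] ℝ} {x : X}
    {y : Eu (2 * n)} (hy : y ∈ (extChartAt (𝓡 (2 * n)) x).target)
    (hf : SmoothNear ((FK n X).loc f x) y) (hcl : ∀ a b c, d3 ((FK n X).loc f x) y a b c = 0)
    (hh : SmoothNearX (2 * n) h ((extChartAt (𝓡 (2 * n)) x).symm y))
    (hΘ : LocallyExactAt Θ ((extChartAt (𝓡 (2 * n)) x).symm y)) {F : ℝ → ℝ}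
    (hF : SmoothNear F (h ((extChartAt (𝓡 (2 * n)) x).symm y))) :
    SmoothNear ((FK n X).loc (fun x => f x + F (h x) • wed (dX (2 * n) h x) (Θ x)) x) y ∧
    ∀ a b c, d3 ((FK n X).loc
      (fun x => f x + F (h x) • wed (dX (2 * n) h x) (Θ x)) x) y a b c = 0 := by
  obtain ⟨G, hG, hΘG⟩ := hΘ
  have hl := loc_add_smul_wed f (fun x => F (h x)) hy hh hG hΘG
  have h1 := smoothNear_comp_symm hy hh
  have h2 := smoothNear_comp_symm hy hG
  have h3 : SmoothNear (fun z => F (h ((extChartAt (𝓡 (2 * n)) x).symm z))) y :=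
    SmoothNear.comp (g := F) hF h1
  refine ⟨(hf.add (h3.smul (h1.fderiv.wedge h2.fderiv))).congr hl, fun a b c => ?_⟩
  rw [d3_congr hl]
  refine (d3_add_smul_wed (t := deriv F (h ((extChartAt (𝓡 (2 * n)) x).symm y)))
    hf.differentiableAt h3.differentiableAt h1.contDiffAt h2.contDiffAt ?_ a b c).trans (hcl a b c)
  exact (hF.differentiableAt.hasDerivAt.comp_hasFDerivAt y
    h1.differentiableAt.hasFDerivAt).fderiv

namespace LogData

variable {π : X → Biv n} {Z : Set X} {h : X → ℝ} (H : LogData π Z h)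
  {Θ : X → Eu (2 * n) →L[ℝ] ℝ}
include H

/-- If the inverse `f` of `π` is `q + dh ∧ dG / (2h)`, then `q` is its regular part. -/
theorem loc_regPart {x : X} {G : X → ℝ} (hG : SmoothNearX (2 * n) G x)
    (hΘ : ∀ᶠ x' in 𝓝 x, Θ x' = dX (2 * n) G x') {q : Eu (2 * n) → Form n}
    (hq : ∀ᶠ y in 𝓝 (extChartAt (𝓡 (2 * n)) x x), pfLoc π x y ≠ 0 →
      (FK n X).loc (invField π) x y =
        q y + (2 * inCh n h x y)⁻¹ • wed (fderiv ℝ (inCh n h x) y) (fderiv ℝ (inCh n G x) y)) :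
    ∀ᶠ y in 𝓝 (extChartAt (𝓡 (2 * n)) x x), pfLoc π x y ≠ 0 →
      (FK n X).loc (regPart (invField π) h Θ) x y = q y := by
  have hy := mem_extChartAt_target (I := 𝓡 (2 * n)) x
  have e := (extChartAt (𝓡 (2 * n)) x).left_inv (mem_extChartAt_source (I := 𝓡 (2 * n)) x)
  have h1 := loc_add_smul_wed (invField π) (fun x => -(2 * h x)⁻¹) (h := h) (G := G) (Θ := Θ) hy
    (by rw [e]; exact H.smoothNearX x) (by rwa [e]) (by rwa [e])
  filter_upwards [h1, hq] with y h2 h3 h4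
  exact h2.trans (form_add_neg_smul_eq _ _ _ (h3 h4))

theorem pf_inv_ne_zero {x : X} (hx : x ∉ Z) : pf (bE n) (invField π x) ≠ 0 := by
  rw [pf_ne_zero_iff]
  exact (inv_invF (bE n) fun h0 => hx ((H.mem_iff x).2 h0)).nondeg_form

theorem pf_loc_inv_ne_zero {x : X} {y : Eu (2 * n)}
    (hy : y ∈ (extChartAt (𝓡 (2 * n)) x).target)
    (hyZ : (extChartAt (𝓡 (2 * n)) x).symm y ∉ Z) :
    pf (bE n) ((FK n X).loc (invField π) x y) ≠ 0 := fun h0 =>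
  H.pf_inv_ne_zero hyZ ((pf_loc_form_eq_zero hy).1 h0)

theorem smoothNear_loc_add {x : X} {y : Eu (2 * n)}
    (hy : y ∈ (extChartAt (𝓡 (2 * n)) x).target)
    (hyZ : (extChartAt (𝓡 (2 * n)) x).symm y ∉ Z)
    (hΘ : LocallyExactAt Θ ((extChartAt (𝓡 (2 * n)) x).symm y)) {F : ℝ → ℝ}
    (hF : SmoothNear F (h ((extChartAt (𝓡 (2 * n)) x).symm y))) :
    SmoothNear ((FK n X).loc (fun x => invField π x + F (h x) • wed (dX (2 * n) h x) (Θ x)) x) y ∧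
    ∀ a b c, d3 ((FK n X).loc
      (fun x => invField π x + F (h x) • wed (dX (2 * n) h x) (Θ x)) x) y a b c = 0 :=
  smoothNear_closed_add hy (H.smoothNear_loc hy hyZ) (H.d3_loc hy hyZ) (H.smoothNearX _) hΘ hF

end LogData

/-- A log-symplectic structure whose inverse is `β + dh ∧ Θ / (2h)`, with `Θ` exact near the
hypersurface, where the Pfaffian of the regular part `β` vanishes along the hypersurface, and is
even small of order `h` with respect to the singular Pfaffian. -/
structure NormalizedData (π : X → Biv n) (Z : Set X) (h : X → ℝ)
    (Θ : X → Eu (2 * n) →L[ℝ] ℝ) : Prop extends LogData π Z h where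
  normal : ∀ x ∈ Z, ∃ (G : X → ℝ) (β : Eu (2 * n) → Form n), SmoothNearX (2 * n) G x ∧
    (∀ᶠ x' in 𝓝 x, Θ x' = dX (2 * n) G x') ∧ SmoothNear β (extChartAt (𝓡 (2 * n)) x x) ∧
    (∀ᶠ y in 𝓝 (extChartAt (𝓡 (2 * n)) x x), pfLoc π x y ≠ 0 →
      (FK n X).loc (invField π) x y =
        β y + (2 * inCh n h x y)⁻¹ • wed (fderiv ℝ (inCh n h x) y) (fderiv ℝ (inCh n G x) y)) ∧
    pf (bE n) (β (extChartAt (𝓡 (2 * n)) x x)) = 0 ∧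
    pf (bE n) (β (extChartAt (𝓡 (2 * n)) x x) +
      wed (fderiv ℝ (pfLoc π x) (extChartAt (𝓡 (2 * n)) x x))
        (fderiv ℝ (inCh n G x) (extChartAt (𝓡 (2 * n)) x x))) -
      pf (bE n) (β (extChartAt (𝓡 (2 * n)) x x)) = (-1) ^ n * stdPf n ^ 2
  small : ∀ x ∈ Z, ∃ C, ∀ᶠ x' in 𝓝 x, x' ∉ Z →
    |pf (bE n) (regPart (invField π) h Θ x') / pf (bE n) (invField π x')| ≤ C * h x'

/-- Multiplication of `h` by `exp (2k)`, for a suitable function `k` which vanishes on the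
hypersurface, normalizes the regular part. The function `k` is the ratio of the Pfaffians of the
regular part and of the inverse, cut off away from the hypersurface. -/
theorem LogData.exists_normalizedData [T2Space X] [CompactSpace X] {π : X → Biv n} {Z : Set X}
    {h : X → ℝ} (H : LogData π Z h) {Θ : X → Eu (2 * n) →L[ℝ] ℝ}
    (hΘ : ∀ x ∈ Z, ∃ G : X → ℝ, (∀ᶠ x' in 𝓝 x, Θ x' = dX (2 * n) G x') ∧
      ResiduePrimitive Z (invField π) h G x) :
    ∃ h₁ : X → ℝ, NormalizedData π Z h₁ Θ := by
  classical
  have hc : (-1 : ℝ) ^ n * stdPf n ^ 2 ≠ 0 := by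
    have := stdPf_pos n
    exact mul_ne_zero (pow_ne_zero _ (by norm_num)) (by positivity)
  set N : Set X := {x | LocallyExactAt Θ x} with hN
  have hNo : IsOpen N := isOpen_locallyExactAt Θ
  have hZN : Z ⊆ N := fun x hx => by
    obtain ⟨G, h1, h2⟩ := hΘ x hx
    exact ⟨G, h2.1, h1⟩
  obtain ⟨η, h0, h1, -⟩ := exists_contMDiffMap_zero_one_nhds_of_isClosed (n := ⊤) (𝓡 (2 * n))
    hNo.isClosed_compl H.isClosed (Set.disjoint_left.2 fun x hx hx' => hx (hZN hx'))
  let κ : X → ℝ := fun x => pf (bE n) (regPart (invField π) h Θ x) / pf (bE n) (invField π x)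
  let k : X → ℝ := fun x => if x ∈ Z then 0 else η x * κ x
  -- near the hypersurface, `k` is `pfLoc π` times the smooth function `pf q / c`
  have hkZ : ∀ x ∈ Z, ∀ G : X → ℝ, SmoothNearX (2 * n) G x →
      (∀ᶠ x' in 𝓝 x, Θ x' = dX (2 * n) G x') → ∀ q : Eu (2 * n) → Form n,
      (∀ᶠ y in 𝓝 (extChartAt (𝓡 (2 * n)) x x), pfLoc π x y ≠ 0 →
        (FK n X).loc (invField π) x y =
        q y + (2 * inCh n h x y)⁻¹ • wed (fderiv ℝ (inCh n h x) y) (fderiv ℝ (inCh n G x) y)) →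
      ∀ᶠ y in 𝓝 (extChartAt (𝓡 (2 * n)) x x),
        inCh n k x y = pfLoc π x y * (pf (bE n) (q y) / ((-1) ^ n * stdPf n ^ 2)) := by
    intro x hx G hG hΘG q hq
    filter_upwards [H.loc_regPart hG hΘG hq, extChartAt_target_mem_nhds (I := 𝓡 (2 * n)) x,
      eventually_inCh (h1.filter_mono (nhds_le_nhdsSet hx))] with y a1 a2 a3
    by_cases hs : pfLoc π x y = 0
    · have hyZ : (extChartAt (𝓡 (2 * n)) x).symm y ∈ Z := by
        by_contra h5
        exact (H.pfLoc_ne_zero_iff a2).2 h5 hs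
      rw [hs, zero_mul, inCh]
      exact if_pos hyZ
    · have hyZ := (H.pfLoc_ne_zero_iff a2).1 hs
      rw [inCh, show k ((extChartAt (𝓡 (2 * n)) x).symm y) =
        η ((extChartAt (𝓡 (2 * n)) x).symm y) * κ ((extChartAt (𝓡 (2 * n)) x).symm y)
        from if_neg hyZ, a3, one_mul, ← H.pfLoc_mul_pf a2 hyZ, ← a1 hs]
      have h3 := H.pf_loc_inv_ne_zero a2 hyZ
      simp only [κ]
      rw [← pf_loc_div _ _ a2]
      field_simp
  have hks : ∀ x, SmoothNearX (2 * n) k x := by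
    intro x
    have hy := mem_extChartAt_target (I := 𝓡 (2 * n)) x
    have e := (extChartAt (𝓡 (2 * n)) x).left_inv (mem_extChartAt_source (I := 𝓡 (2 * n)) x)
    by_cases hxZ : x ∈ Z
    · obtain ⟨G, hG, hP⟩ := hΘ x hxZ
      obtain ⟨q, hq, hqf⟩ := (residuePrimitive_iff (H.smoothNearX x) hP.1).1 hP
      refine smoothNearX_of_inCh (SmoothNear.congr ?_ (hkZ x hxZ G hP.1 hG q ?_))
      · have h5 : SmoothNear (fun y => pf (bE n) (q y) * ((-1) ^ n * stdPf n ^ 2)⁻¹)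
            (extChartAt (𝓡 (2 * n)) x x) := (hq.pfaffian (bE n)).mul (smoothNear_const _ _)
        exact ((H.smooth x).pfaffian (dualB (bE n))).mul h5
      · filter_upwards [hqf, H.eventually_pfLoc_ne_zero_iff x] with y a1 a2 a3
          using a1 (a2.1 a3)
    by_cases hxN : x ∈ N
    · have hyZ : (extChartAt (𝓡 (2 * n)) x).symm (extChartAt (𝓡 (2 * n)) x x) ∉ Z := by rwa [e]
      have hr := (H.smoothNear_loc_add (F := fun t => -(2 * t)⁻¹) hy hyZ (Θ := Θ) (by rwa [e])
        (by
          rw [e]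
          filter_upwards [lt_mem_nhds (H.h_pos hxZ)] with t ht
          exact ((contDiffAt_const.mul contDiffAt_id).inv (by simpa using ht.ne')).neg)).1
      have hκ : SmoothNearX (2 * n) κ x := by
        refine smoothNearX_of_inCh (SmoothNear.congr ((hr.pfaffian (bE n)).mul
          (((H.smoothNear_loc hy hyZ).pfaffian (bE n)).inv (H.pf_loc_inv_ne_zero hy hyZ))) ?_)
        filter_upwards [target_mem_nhds hy] with y hy'
        exact (pf_loc_div _ _ hy').symm
      have hη : SmoothNearX (2 * n) η x :=
        Filter.Eventually.of_forall fun x' => η.contMDiff.contMDiffAt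
      refine (hη.mul hκ).congr ?_
      filter_upwards [H.isClosed.isOpen_compl.mem_nhds hxZ] with x' hx'
      exact if_neg hx'
    · refine (SmoothNearX.const 0 x).congr ?_
      filter_upwards [h0.filter_mono (nhds_le_nhdsSet hxN)] with x' hx'
      simp only [k, hx', zero_mul, ite_self]
  -- normalization of `h`, and its effect in charts
  let h₁ : X → ℝ := fun x => h x * Real.exp (2 * k x)
  have hexp : ContDiff ℝ ∞ fun t : ℝ => Real.exp (2 * t) :=
    Real.contDiff_exp.comp (contDiff_const.mul contDiff_id)
  have hh₁ : ∀ x, SmoothNearX (2 * n) h₁ x := fun x =>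
    (H.smoothNearX x).mul ((hks x).comp_real (F := fun t => Real.exp (2 * t)) hexp)
  have key : ∀ x ∈ Z, ∃ (G : X → ℝ) (u₁ : Eu (2 * n) → ℝ) (β : Eu (2 * n) → Form n),
      SmoothNearX (2 * n) G x ∧ (∀ᶠ x' in 𝓝 x, Θ x' = dX (2 * n) G x') ∧
      SquareDefining (pfLoc π x) u₁ (inCh n h₁ x) (extChartAt (𝓡 (2 * n)) x x) ∧
      SmoothNear β (extChartAt (𝓡 (2 * n)) x x) ∧
      (∀ᶠ y in 𝓝 (extChartAt (𝓡 (2 * n)) x x), pfLoc π x y ≠ 0 →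
        (FK n X).loc (invField π) x y =
        β y + (2 * inCh n h₁ x y)⁻¹ • wed (fderiv ℝ (inCh n h₁ x) y) (fderiv ℝ (inCh n G x) y)) ∧
      (∀ᶠ y in 𝓝 (extChartAt (𝓡 (2 * n)) x x), pfLoc π x y = 0 → pf (bE n) (β y) = 0) ∧
      (pf (bE n) (β (extChartAt (𝓡 (2 * n)) x x) +
        wed (fderiv ℝ (pfLoc π x) (extChartAt (𝓡 (2 * n)) x x))
        (fderiv ℝ (inCh n G x) (extChartAt (𝓡 (2 * n)) x x))) -
        pf (bE n) (β (extChartAt (𝓡 (2 * n)) x x)) = (-1) ^ n * stdPf n ^ 2) ∧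
      ∃ C, ∀ᶠ y in 𝓝 (extChartAt (𝓡 (2 * n)) x x), pfLoc π x y ≠ 0 →
        |pf (bE n) (β y) / pf (bE n) ((FK n X).loc (invField π) x y)| ≤ C * inCh n h₁ x y := by
    intro x hx
    obtain ⟨G, hG, hP⟩ := hΘ x hx
    obtain ⟨q, hq, hqf⟩ := (residuePrimitive_iff (H.smoothNearX x) hP.1).1 hP
    obtain ⟨u, hu⟩ := H.square x hx
    have hqf' : ∀ᶠ y in 𝓝 (extChartAt (𝓡 (2 * n)) x x), pfLoc π x y ≠ 0 →
        (FK n X).loc (invField π) x y = q y + (2 * inCh n h x y)⁻¹ •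
          wed (fderiv ℝ (inCh n h x) y) (fderiv ℝ (inCh n G x) y) := by
      filter_upwards [hqf, H.eventually_pfLoc_ne_zero_iff x] with y a1 a2 a3
        using a1 (a2.1 a3)
    obtain ⟨u₁, β, b1, b2, b3, b4, b5, b6⟩ := hu.exists_normalization (bE n) hc hq hP.1.inCh hqf'
      (by
        filter_upwards [extChartAt_target_mem_nhds (I := 𝓡 (2 * n)) x] with y a1 a2
        exact H.pfLoc_mul_pf a1 ((H.pfLoc_ne_zero_iff a1).1 a2))
      (hkZ x hx G hP.1 hG q hqf') (h₁ := inCh n h₁ x) (Filter.Eventually.of_forall fun _ => rfl)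
    exact ⟨G, u₁, β, hP.1, hG, b1, b2, b3, b4, b5, b6⟩
  have H₁ : LogData π Z h₁ :=
    { smooth := H.smooth
      jacobi := H.jacobi
      mem_iff := H.mem_iff
      smooth_h := contMDiff_of_smoothNearX hh₁
      nonneg := fun x => mul_nonneg (H.nonneg x) (Real.exp_pos _).le
      h_eq_zero := fun x => by
        rw [mul_eq_zero, or_iff_left (Real.exp_pos _).ne', H.h_eq_zero]
      square := fun x hx => by
        obtain ⟨G, u₁, β, -, -, b1, -⟩ := key x hx
        exact ⟨u₁, b1⟩ }
  refine ⟨h₁, { H₁ with normal := fun x hx => ?_, small := fun x hx => ?_ }⟩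
  · obtain ⟨G, u₁, β, a1, a2, b1, b2, b3, b4, b5, b6⟩ := key x hx
    exact ⟨G, β, a1, a2, b2, b3, b4.self_of_nhds b1.zero, b5⟩
  · obtain ⟨G, u₁, β, a1, a2, b1, b2, b3, b4, b5, C, b6⟩ := key x hx
    refine ⟨C, eventually_of_inCh (n := n) ?_⟩
    filter_upwards [H₁.loc_regPart a1 a2 b3, b6,
      extChartAt_target_mem_nhds (I := 𝓡 (2 * n)) x] with y c1 c2 c3 c4
    have c5 := (H₁.pfLoc_ne_zero_iff c3).2 c4
    rw [← pf_loc_div _ _ c3, c1 c5]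
    exact c2 c5

/-- The smoothing of the inverse of a log-symplectic structure: `1 / (2h)` is replaced by a
function of `h` which is constant near the hypersurface. -/
theorem NormalizedData.exists_folded [T2Space X] [CompactSpace X] {π : X → Biv n} {Z : Set X}
    {h : X → ℝ} {Θ : X → Eu (2 * n) →L[ℝ] ℝ} (H : NormalizedData π Z h Θ) {U : Set X}
    (hU : U ∈ 𝓝ˢ Z) :
    ∃ σ : X → Form n, (FK n X).Smooth σ ∧
      (∀ x, ∀ y ∈ (extChartAt (𝓡 (2 * n)) x).target, ∀ a b c,
        d3 ((FK n X).loc σ x) y a b c = 0) ∧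
      (∀ x, pf (bE n) (σ x) = 0 ↔ x ∈ Z) ∧
      (∀ x ∈ Z, fderiv ℝ (fun y => pf (bE n) ((FK n X).loc σ x y))
        (extChartAt (𝓡 (2 * n)) x x) ≠ 0) ∧
      (∀ x ∈ Z, ∃ θ : Eu (2 * n) →L[ℝ] ℝ,
        pf (bE n) ((FK n X).loc σ x (extChartAt (𝓡 (2 * n)) x x) +
          wed (fderiv ℝ (pfLoc π x) (extChartAt (𝓡 (2 * n)) x x)) θ) ≠
        pf (bE n) ((FK n X).loc σ x (extChartAt (𝓡 (2 * n)) x x))) ∧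
      ∀ x ∉ U, x ∉ Z ∧ σ x = invField π x := by
  have hc : (-1 : ℝ) ^ n * stdPf n ^ 2 ≠ 0 := by
    have := stdPf_pos n
    exact mul_ne_zero (pow_ne_zero _ (by norm_num)) (by positivity)
  obtain ⟨C, hC⟩ := exists_uniform_bound H.isClosed.isCompact (P := fun C x => x ∉ Z →
    |pf (bE n) (regPart (invField π) h Θ x) / pf (bE n) (invField π x)| ≤ C * h x)
    (fun x C C' hCC h1 hx => (h1 hx).trans (by
      have := H.nonneg x
      gcongr)) H.small
  have hN : {x | LocallyExactAt Θ x} ∈ 𝓝ˢ Z :=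
    (isOpen_locallyExactAt Θ).mem_nhdsSet.2 fun x hx => by
      obtain ⟨G, β, a1, a2, -⟩ := H.normal x hx
      exact ⟨G, a1, a2⟩
  obtain ⟨O, hOo, hZO, hO⟩ :=
    mem_nhdsSet_iff_exists.1 (Filter.inter_mem (Filter.inter_mem hC hN) hU)
  obtain ⟨δ, hδ, hδO⟩ := exists_sublevel_subset H.smooth_h.continuous H.nonneg hOo
    (fun x hx => hZO ((H.h_eq_zero x).1 hx))
  -- `ε` is so small that the modification takes place in `O` and `1 / (2ε)` exceeds `C`
  obtain ⟨ε, hε, hεδ, hεC⟩ : ∃ ε, 0 < ε ∧ ε < δ ∧ C ≤ (2 * ε)⁻¹ := by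
    refine ⟨min (δ / 2) (2 * (|C| + 1))⁻¹, by positivity,
      (min_le_left _ _).trans_lt (by linarith), ?_⟩
    have h1 : 2 * min (δ / 2) (2 * (|C| + 1))⁻¹ ≤ (|C| + 1)⁻¹ := by
      have := (min_le_right (δ / 2) (2 * (|C| + 1))⁻¹).trans_eq (mul_inv _ _)
      linarith
    have h2 : |C| + 1 ≤ (2 * min (δ / 2) (2 * (|C| + 1))⁻¹)⁻¹ :=
      (le_inv_comm₀ (by positivity) (by positivity)).2 h1
    linarith [le_abs_self C]
  have hout : ∀ x ∉ O, ε < h x := hδO ε hεδ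
  -- the correction which turns the coefficient `1 / (2h)` of `dh ∧ Θ` into `smoothInv ε h`
  let F : ℝ → ℝ := fun t => smoothInv ε t - (2 * t)⁻¹
  have hF : ∀ t, 0 < t → SmoothNear F t := fun t ht => by
    filter_upwards [lt_mem_nhds ht] with t ht
    exact (contDiffAt_smoothInv ε ht).sub ((contDiffAt_const.mul contDiffAt_id).inv
      (by simpa using ht.ne'))
  have hF0 : ∀ t, ε ≤ t → F t = 0 := fun t ht => by
    simp only [F]
    rw [smoothInv_eq_of_ge hε ht, sub_self]
  let σ₀ : X → Form n := fun x => invField π x + F (h x) • wed (dX (2 * n) h x) (Θ x)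
  have hσ₀out : ∀ x, ε ≤ h x → σ₀ x = invField π x := fun x hx => by
    simp only [σ₀]
    rw [hF0 _ hx, zero_smul, add_zero]
  -- off the hypersurface, `σ₀` is smooth and closed
  have hloc : ∀ x, ∀ y ∈ (extChartAt (𝓡 (2 * n)) x).target,
      (extChartAt (𝓡 (2 * n)) x).symm y ∉ Z → SmoothNear ((FK n X).loc σ₀ x) y ∧
        ∀ a b c, d3 ((FK n X).loc σ₀ x) y a b c = 0 := by
    intro x y hy hyZ
    by_cases hyO : (extChartAt (𝓡 (2 * n)) x).symm y ∈ O
    · exact H.smoothNear_loc_add hy hyZ (hO hyO).1.2 (hF _ (H.h_pos hyZ))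
    · have he : ∀ᶠ z in 𝓝 y, (FK n X).loc σ₀ x z = (FK n X).loc (invField π) x z := by
        have h1 : ∀ᶠ x' in 𝓝 ((extChartAt (𝓡 (2 * n)) x).symm y), ε < h x' :=
          H.smooth_h.continuous.continuousAt.eventually_const_lt (hout _ hyO)
        filter_upwards [eventually_symm hy h1] with z hz
        rw [FieldKind.loc, hσ₀out _ hz.le, FieldKind.loc]
      exact ⟨(H.smoothNear_loc hy hyZ).congr he, fun a b c => by
        rw [d3_congr he, H.d3_loc hy hyZ]⟩
  -- the local expression near the hypersurface
  have hZloc : ∀ x ∈ Z, ∀ (G : X → ℝ) (β : Eu (2 * n) → Form n), SmoothNearX (2 * n) G x →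
      (∀ᶠ x' in 𝓝 x, Θ x' = dX (2 * n) G x') →
      (∀ᶠ y in 𝓝 (extChartAt (𝓡 (2 * n)) x x), pfLoc π x y ≠ 0 →
        (FK n X).loc (invField π) x y =
        β y + (2 * inCh n h x y)⁻¹ • wed (fderiv ℝ (inCh n h x) y) (fderiv ℝ (inCh n G x) y)) →
      ∀ᶠ y in 𝓝 (extChartAt (𝓡 (2 * n)) x x), (extChartAt (𝓡 (2 * n)) x).symm y ∉ Z →
        (FK n X).loc σ₀ x y =
          β y + (2 * ε)⁻¹ • wed (fderiv ℝ (inCh n h x) y) (fderiv ℝ (inCh n G x) y) := by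
    intro x hx G β hG hΘG hβ
    have e := (extChartAt (𝓡 (2 * n)) x).left_inv (mem_extChartAt_source (I := 𝓡 (2 * n)) x)
    have h1 := loc_add_smul_wed (invField π) (fun x => F (h x)) (h := h) (G := G) (Θ := Θ)
      (mem_extChartAt_target (I := 𝓡 (2 * n)) x)
      (by rw [e]; exact H.smoothNearX x) (by rwa [e]) (by rwa [e])
    have h2 : ∀ᶠ x' in 𝓝 x, h x' < ε / 2 := H.smooth_h.continuous.continuousAt.eventually_lt_const
      (by rw [(H.h_eq_zero x).2 hx]; positivity)
    filter_upwards [h1, hβ, H.eventually_pfLoc_ne_zero_iff x, eventually_inCh h2]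
      with y a1 a2 a3 a4 a5
    have a6 : (FK n X).loc σ₀ x y = (FK n X).loc (invField π) x y + F (inCh n h x y) •
      wed (fderiv ℝ (inCh n h x) y) (fderiv ℝ (inCh n G x) y) := a1
    rw [a6, a2 (a3.2 a5)]
    change inCh n h x y < ε / 2 at a4
    simp only [F]
    rw [smoothInv_eq_of_le hε a4.le]
    refine form_ext fun v w => ?_
    simp only [ContinuousAlternatingMap.add_apply, ContinuousAlternatingMap.smul_apply, smul_eq_mul]
    ring
  -- near the hypersurface `F h + 1 / (2h)` is the constant `1 / (2ε)`, so `σ₀` extends smoothly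
  obtain ⟨σ, hσ, hσeq⟩ := (FK n X).exists_smooth_of_extends (fun x hx => H.dense hx) (f := σ₀) (by
    intro x
    by_cases hx : x ∈ Z
    · obtain ⟨G, β, a1, a2, a3, a4, -⟩ := H.normal x hx
      exact ⟨_, a3.add ((smoothNear_const _ _).smul
        ((H.smoothNearX x).inCh.fderiv.wedge a1.inCh.fderiv)), hZloc x hx G β a1 a2 a4⟩
    · have e := (extChartAt (𝓡 (2 * n)) x).left_inv (mem_extChartAt_source (I := 𝓡 (2 * n)) x)
      exact ⟨_, (hloc x _ (mem_extChartAt_target x) (by rwa [e])).1,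
        Filter.Eventually.of_forall fun _ _ => rfl⟩)
  have hlocσ : ∀ x ∈ Z, ∀ (G : X → ℝ) (β : Eu (2 * n) → Form n), SmoothNearX (2 * n) G x →
      (∀ᶠ x' in 𝓝 x, Θ x' = dX (2 * n) G x') → SmoothNear β (extChartAt (𝓡 (2 * n)) x x) →
      (∀ᶠ y in 𝓝 (extChartAt (𝓡 (2 * n)) x x), pfLoc π x y ≠ 0 →
        (FK n X).loc (invField π) x y =
        β y + (2 * inCh n h x y)⁻¹ • wed (fderiv ℝ (inCh n h x) y) (fderiv ℝ (inCh n G x) y)) →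
      ∀ᶠ y in 𝓝 (extChartAt (𝓡 (2 * n)) x x), (FK n X).loc σ x y =
          β y + (2 * ε)⁻¹ • wed (fderiv ℝ (inCh n h x) y) (fderiv ℝ (inCh n G x) y) :=
    fun x hx G β a1 a2 a3 a4 => hσ.eventually_loc_eq (fun x hx => H.dense hx) hσeq
      (a3.add ((smoothNear_const _ _).smul
        ((H.smoothNearX x).inCh.fderiv.wedge a1.inCh.fderiv))) (hZloc x hx G β a1 a2 a4)
  have hbd : ∀ x ∈ Z, ∀ (G : X → ℝ) (β : Eu (2 * n) → Form n), SmoothNearX (2 * n) G x →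
      (∀ᶠ x' in 𝓝 x, Θ x' = dX (2 * n) G x') →
      (∀ᶠ y in 𝓝 (extChartAt (𝓡 (2 * n)) x x), pfLoc π x y ≠ 0 →
        (FK n X).loc (invField π) x y =
        β y + (2 * inCh n h x y)⁻¹ • wed (fderiv ℝ (inCh n h x) y) (fderiv ℝ (inCh n G x) y)) →
      ∀ᶠ y in 𝓝 (extChartAt (𝓡 (2 * n)) x x), pfLoc π x y ≠ 0 →
        |pf (bE n) (β y) / pf (bE n) ((FK n X).loc (invField π) x y)| ≤ C * inCh n h x y := by
    intro x hx G β a1 a2 a4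
    filter_upwards [H.loc_regPart a1 a2 a4, extChartAt_target_mem_nhds (I := 𝓡 (2 * n)) x,
      eventually_inCh (hC.filter_mono (nhds_le_nhdsSet hx))] with y c1 c2 c3 c4
    rw [← c1 c4, pf_loc_div _ _ c2]
    exact c3 ((H.pfLoc_ne_zero_iff c2).1 c4)
  -- transversality and the fold condition along the hypersurface
  have htrans : ∀ x ∈ Z,
      fderiv ℝ (fun y => pf (bE n) ((FK n X).loc σ x y)) (extChartAt (𝓡 (2 * n)) x x) ≠ 0 ∧
      pf (bE n) ((FK n X).loc σ x (extChartAt (𝓡 (2 * n)) x x)) = 0 ∧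
      ∃ θ : Eu (2 * n) →L[ℝ] ℝ, pf (bE n) ((FK n X).loc σ x (extChartAt (𝓡 (2 * n)) x x) +
          wed (fderiv ℝ (pfLoc π x) (extChartAt (𝓡 (2 * n)) x x)) θ) ≠
        pf (bE n) ((FK n X).loc σ x (extChartAt (𝓡 (2 * n)) x x)) := by
    intro x hx
    obtain ⟨G, β, a1, a2, a3, a4, a5, a6⟩ := H.normal x hx
    obtain ⟨u, hu⟩ := H.square x hx
    have h1 := hlocσ x hx G β a1 a2 a3 a4
    obtain ⟨t1, t2, t3⟩ := hu.smoothing_transverse (bE n) hc a3 a1.inCh a4 (by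
        filter_upwards [extChartAt_target_mem_nhds (I := 𝓡 (2 * n)) x] with y a1 a2
        exact H.pfLoc_mul_pf a1 ((H.pfLoc_ne_zero_iff a1).1 a2)) a5 a6
      (hbd x hx G β a1 a2 a4) hεC (by positivity)
    have h2 : (FK n X).loc σ x (extChartAt (𝓡 (2 * n)) x x) = β (extChartAt (𝓡 (2 * n)) x x) :=
      h1.self_of_nhds.trans t2
    refine ⟨?_, by rw [h2, a5], _, by rw [h2]; exact t3⟩
    have h3 : (fun y => pf (bE n) ((FK n X).loc σ x y)) =ᶠ[𝓝 (extChartAt (𝓡 (2 * n)) x x)]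
        fun y => pf (bE n) (β y + (2 * ε)⁻¹ • wed (fderiv ℝ (inCh n h x) y)
          (fderiv ℝ (inCh n G x) y)) := by
      filter_upwards [h1] with y hy
      rw [hy]
    rw [h3.fderiv_eq]
    exact t1
  -- the ratio of the Pfaffians of `σ` and of the inverse of `π` is positive off the hypersurface
  have hpos : ∀ x ∉ Z, pf (bE n) (σ x) ≠ 0 := by
    intro x hx
    rw [hσeq x hx]
    rcases le_or_gt (h x) ε with hle | hlt
    · have hxO : x ∈ O := by
        by_contra hxO
        exact absurd hle (not_le.2 (hout x hxO))
      have h0 := H.h_pos hx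
      have hf := H.pf_inv_ne_zero hx
      have h1 : invField π x = regPart (invField π) h Θ x +
          (2 * h x)⁻¹ • wed (dX (2 * n) h x) (Θ x) := by
        refine form_ext fun v w => ?_
        simp [regPart]
      have h2 : σ₀ x = regPart (invField π) h Θ x +
          smoothInv ε (h x) • wed (dX (2 * n) h x) (Θ x) := by
        refine form_ext fun v w => ?_
        simp only [σ₀, F, regPart, ContinuousAlternatingMap.add_apply,
          ContinuousAlternatingMap.smul_apply, smul_eq_mul]
        ring
      have h3 := pf_smoothing (bE n) h0.ne' h1 (smoothInv ε (h x))
      have hg0 : 0 < smoothInv ε (h x) := lt_of_lt_of_le (by positivity) (le_smoothInv h0 hle)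
      have h4 := le_smoothing_ratio h0 ((hO hxO).1.1 hx) (hεC.trans (le_smoothInv h0 hle))
        (smoothInv_mul_le h0 hle) hg0.le
      rw [h2, h3]
      intro h5
      have h6 : pf (bE n) (regPart (invField π) h Θ x) / pf (bE n) (invField π x) *
          (1 - 2 * smoothInv ε (h x) * h x) + 2 * smoothInv ε (h x) * h x = 0 := by
        field_simp
        linarith
      have := mul_pos hg0 h0
      linarith
    · rw [hσ₀out x hlt.le]
      exact H.pf_inv_ne_zero hx
  refine ⟨σ, hσ, ?_, fun x => ⟨fun h0 => ?_, fun hx => ?_⟩, fun x hx => (htrans x hx).1,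
    fun x hx => (htrans x hx).2.2, fun x hx => ?_⟩
  · intro x y hy
    refine d3_eq_zero_of_dense (fun x hx => H.dense hx) hσ hy ?_
    filter_upwards [eventually_eventually_nhds.2 (target_mem_nhds hy)] with z hz hzZ a b c
    have hz' := mem_of_mem_nhds hz
    rw [← (hloc x z hz' hzZ).2 a b c]
    refine d3_congr ?_ a b c
    filter_upwards [eventually_symm hz' (H.isClosed.isOpen_compl.mem_nhds hzZ)] with w hw
    rw [FieldKind.loc, hσeq _ hw, FieldKind.loc]
  · by_contra hx
    exact hpos x hx h0
  · have h1 := (htrans x hx).2.1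
    rwa [pf_loc_form_eq_zero (mem_extChartAt_target x),
      (extChartAt (𝓡 (2 * n)) x).left_inv (mem_extChartAt_source x)] at h1
  · have hxO : x ∉ O := fun h1 => hx (hO h1).2
    have hxZ : x ∉ Z := fun h1 => hxO (hZO h1)
    exact ⟨hxZ, by rw [hσeq x hxZ, hσ₀out x (hout x hxO).le]⟩

end Folded

/-! ### From folded-symplectic forms to log-symplectic structures -/

section Logs

set_option linter.unusedSectionVars false

variable {n : ℕ} {X : Type*} [TopologicalSpace X] [ChartedSpace (Eu (2 * n)) X]
  [IsManifold (𝓡 (2 * n)) ∞ X]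

/-- A closed two-form `σ` with degeneracy locus `Z`, and a function `h` which near `Z` is a positive
multiple of the square of a regular defining function. -/
structure FoldData (σ : X → Form n) (Z : Set X) (h : X → ℝ) : Prop where
  smooth : (FK n X).Smooth σ
  closed : ∀ x, ∀ y ∈ (extChartAt (𝓡 (2 * n)) x).target, ∀ a b c,
    d3 ((FK n X).loc σ x) y a b c = 0
  mem_iff : ∀ x, x ∈ Z ↔ pf (bE n) (σ x) = 0
  smooth_h : ContMDiff (𝓡 (2 * n)) 𝓘(ℝ, ℝ) ∞ h
  nonneg : ∀ x, 0 ≤ h x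
  h_eq_zero : ∀ x, h x = 0 ↔ x ∈ Z
  square : ∀ x ∈ Z, ∃ u, SquareDefining (fun y => pf (bE n) ((FK n X).loc σ x y)) u (inCh n h x)
    (extChartAt (𝓡 (2 * n)) x x)

namespace FoldData

variable {σ : X → Form n} {Z : Set X} {h : X → ℝ} (H : FoldData σ Z h)
include H

theorem isClosed : IsClosed Z := by
  have : Z = h ⁻¹' {0} := Set.ext fun x => (H.h_eq_zero x).symm
  rw [this]
  exact isClosed_singleton.preimage H.smooth_h.continuous

theorem h_pos {x : X} (hx : x ∉ Z) : 0 < h x :=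
  (H.nonneg x).lt_of_ne fun e => hx ((H.h_eq_zero x).1 e.symm)

theorem smoothNearX (x : X) : SmoothNearX (2 * n) h x :=
  Filter.Eventually.of_forall fun x' => H.smooth_h x'

theorem pf_loc_ne_zero_iff {x : X} {y : Eu (2 * n)}
    (hy : y ∈ (extChartAt (𝓡 (2 * n)) x).target) :
    pf (bE n) ((FK n X).loc σ x y) ≠ 0 ↔ (extChartAt (𝓡 (2 * n)) x).symm y ∉ Z := by
  rw [H.mem_iff, not_iff_not]
  exact pf_loc_form_eq_zero hy

theorem dense {x : X} (hx : x ∈ Z) : x ∈ closure Zᶜ := by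
  obtain ⟨u, hu⟩ := H.square x hx
  refine mem_closure_compl hu.regular ?_
  filter_upwards [extChartAt_target_mem_nhds (I := 𝓡 (2 * n)) x] with y hy
    using (H.pf_loc_ne_zero_iff hy).1

/-- The inverse of `σ + dh ∧ Θ / (2h)`, cut off away from the hypersurface, extends to a
log-symplectic structure. The sign of the added term is chosen such that the Pfaffian does not
vanish off the hypersurface. -/
theorem exists_log [T2Space X] [CompactSpace X] {Θ : X → Eu (2 * n) →L[ℝ] ℝ}
    (hΘ : ∀ x ∈ Z, ∃ G : X → ℝ, SmoothNearX (2 * n) G x ∧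
      (∀ᶠ x' in 𝓝 x, Θ x' = dX (2 * n) G x') ∧
      pf (bE n) ((FK n X).loc σ x (extChartAt (𝓡 (2 * n)) x x) +
        wed (fderiv ℝ (fun y => pf (bE n) ((FK n X).loc σ x y)) (extChartAt (𝓡 (2 * n)) x x))
          (fderiv ℝ (inCh n G x) (extChartAt (𝓡 (2 * n)) x x))) ≠ 0) {U : Set X}
    (hU : U ∈ 𝓝ˢ Z) :
    ∃ π : X → Biv n, (BK n X).Smooth π ∧
      (∀ x, JacobiAt ((BK n X).loc π x) (extChartAt (𝓡 (2 * n)) x x)) ∧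
      (∀ x, pf (dualB (bE n)) (π x) = 0 ↔ x ∈ Z) ∧
      (∀ x ∈ Z, fderiv ℝ (pfLoc π x) (extChartAt (𝓡 (2 * n)) x x) ≠ 0) ∧
      ∀ x ∉ U, Inv (σ x) (π x) := by
  -- the relative change of the Pfaffian of `σ` when `dh ∧ Θ` is added
  let ρ : X → ℝ := fun x =>
    (pf (bE n) (σ x + wed (dX (2 * n) h x) (Θ x)) - pf (bE n) (σ x)) / pf (bE n) (σ x)
  -- the expression of `ρ` in charts
  have hρloc : ∀ x, ∀ y ∈ (extChartAt (𝓡 (2 * n)) x).target, ∀ G : X → ℝ,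
      SmoothNearX (2 * n) G ((extChartAt (𝓡 (2 * n)) x).symm y) →
      (∀ᶠ x' in 𝓝 ((extChartAt (𝓡 (2 * n)) x).symm y), Θ x' = dX (2 * n) G x') →
      ∀ᶠ z in 𝓝 y, ρ ((extChartAt (𝓡 (2 * n)) x).symm z) =
        (pf (bE n) ((FK n X).loc σ x z + wed (fderiv ℝ (inCh n h x) z) (fderiv ℝ (inCh n G x) z)) -
          pf (bE n) ((FK n X).loc σ x z)) / pf (bE n) ((FK n X).loc σ x z) := by
    intro x y hy G hG hΘG
    have h1 := loc_add_smul_wed σ (fun _ => 1) hy (H.smoothNearX _) hG hΘG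
    filter_upwards [h1, target_mem_nhds hy] with z h2 h3
    simp only [one_smul] at h2
    have h4 : (FK n X).loc (fun x => σ x + wed (dX (2 * n) h x) (Θ x)) x z =
      (FK n X).loc σ x z + wed (fderiv ℝ (inCh n h x) z) (fderiv ℝ (inCh n G x) z) := h2
    rw [← h4, sub_div, pf_loc_div _ _ h3, pf_loc_div _ _ h3, ← sub_div]
  -- near the hypersurface, `ρ` has locally constant sign `e`, and the inverse of
  -- `σ + e dh ∧ Θ / (2h)` extends to a smooth field `p` with transverse zero
  have hsign : ∀ x ∈ Z, ∃ G : X → ℝ, SmoothNearX (2 * n) G x ∧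
      (∀ᶠ x' in 𝓝 x, Θ x' = dX (2 * n) G x') ∧ ∃ e : ℝ, e ≠ 0 ∧
      (∀ᶠ x' in 𝓝 x, x' ∉ Z → (SignType.sign (ρ x') : ℝ) = e) ∧
      ∃ p : Eu (2 * n) → Biv n, SmoothNear p (extChartAt (𝓡 (2 * n)) x x) ∧
        (∀ᶠ y in 𝓝 (extChartAt (𝓡 (2 * n)) x x), pf (bE n) ((FK n X).loc σ x y) ≠ 0 →
          p y = invB (bE n) ((FK n X).loc σ x y + (e * (2 * inCh n h x y)⁻¹) •
            wed (fderiv ℝ (inCh n h x) y) (fderiv ℝ (inCh n G x) y))) ∧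
        pf (dualB (bE n)) (p (extChartAt (𝓡 (2 * n)) x x)) = 0 ∧
        fderiv ℝ (fun y => pf (dualB (bE n)) (p y)) (extChartAt (𝓡 (2 * n)) x x) ≠ 0 := by
    intro x hx
    have e' := (extChartAt (𝓡 (2 * n)) x).left_inv (mem_extChartAt_source (I := 𝓡 (2 * n)) x)
    obtain ⟨G, hG, hΘG, h0⟩ := hΘ x hx
    obtain ⟨u, hu⟩ := H.square x hx
    obtain ⟨e, he, hse, p, hp⟩ :=
      SquareDefining.exists_inverse_extension (bE n) hu (H.smooth x) hG.inCh h0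
    refine ⟨G, hG, hΘG, e, he, eventually_of_inCh (n := n) ?_, p, hp⟩
    filter_upwards [hse, hρloc x _ (mem_extChartAt_target x) G (by rwa [e']) (by rwa [e']),
      extChartAt_target_mem_nhds (I := 𝓡 (2 * n)) x] with y h1 h2 h3 h4
    rw [h2]
    exact h1 ((H.pf_loc_ne_zero_iff h3).2 h4)
  have hρ0 : ∀ᶠ x in 𝓝ˢ Z, x ∉ Z → ρ x ≠ 0 := by
    rw [eventually_nhdsSet_iff_forall]
    intro x hx
    obtain ⟨G, -, -, e, he, h1, -⟩ := hsign x hx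
    filter_upwards [h1] with x' h2 h3 h4
    rw [h4] at h2
    exact he (by simpa using (h2 h3).symm)
  have hN : {x | LocallyExactAt Θ x} ∈ 𝓝ˢ Z :=
    (isOpen_locallyExactAt Θ).mem_nhdsSet.2 fun x hx => by
      obtain ⟨G, a1, a2, -⟩ := hΘ x hx
      exact ⟨G, a1, a2⟩
  obtain ⟨O, hOo, hZO, hO⟩ :=
    mem_nhdsSet_iff_exists.1 (Filter.inter_mem (Filter.inter_mem hρ0 hN) hU)
  obtain ⟨δ, hδ, hδO⟩ := exists_sublevel_subset H.smooth_h.continuous H.nonneg hOo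
    (fun x hx => hZO ((H.h_eq_zero x).1 hx))
  obtain ⟨ε, hε, hout⟩ : ∃ ε, 0 < ε ∧ ∀ x ∉ O, ε < h x :=
    ⟨δ / 2, by positivity, hδO _ (by linarith)⟩
  let F : ℝ → ℝ := fun t => (1 - step ε t) * (2 * t)⁻¹
  have hF : ∀ e t, 0 < t → SmoothNear (fun t => e * F t) t := fun e t ht => by
    filter_upwards [lt_mem_nhds ht] with t ht
    exact contDiffAt_const.mul ((contDiffAt_const.sub (contDiff_step ε).contDiffAt).mul
      ((contDiffAt_const.mul contDiffAt_id).inv (by simpa using ht.ne')))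
  let τ : X → Form n := fun x =>
    σ x + ((SignType.sign (ρ x) : ℝ) * F (h x)) • wed (dX (2 * n) h x) (Θ x)
  have hτout : ∀ x, ε ≤ h x → τ x = σ x := fun x hx => by
    simp only [τ, F]
    rw [step_eq_one hε hx, sub_self, zero_mul, mul_zero, zero_smul, add_zero]
  -- the Pfaffian of `τ` is `1 + |ρ| F h ≥ 1` times the Pfaffian of `σ`
  have hτpf : ∀ x ∉ Z, pf (bE n) (τ x) ≠ 0 := by
    intro x hx
    have hσx : pf (bE n) (σ x) ≠ 0 := fun h0 => hx ((H.mem_iff x).2 h0)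
    have h1 : pf (bE n) (τ x) = pf (bE n) (σ x) * (1 + |ρ x| * F (h x)) := by
      simp only [τ]
      rw [pf_affine, ← sign_mul_self (ρ x)]
      simp only [ρ]
      field_simp
    have h2 : 0 ≤ F (h x) := mul_nonneg (by linarith [step_le_one ε (h x)])
      (by have := H.h_pos hx; positivity)
    rw [h1]
    exact mul_ne_zero hσx (by positivity)
  -- off the hypersurface, `τ` is smooth and closed
  have hloc : ∀ x, ∀ y ∈ (extChartAt (𝓡 (2 * n)) x).target,
      (extChartAt (𝓡 (2 * n)) x).symm y ∉ Z → SmoothNear ((FK n X).loc τ x) y ∧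
        ∀ a b c, d3 ((FK n X).loc τ x) y a b c = 0 := by
    intro x y hy hyZ
    by_cases hyO : (extChartAt (𝓡 (2 * n)) x).symm y ∈ O
    · obtain ⟨G, hG, hΘG⟩ := (hO hyO).1.2
      have hρs : ContinuousAt (fun z => ρ ((extChartAt (𝓡 (2 * n)) x).symm z)) y := by
        have h1 := H.smooth.smoothNear x hy
        have h2 : SmoothNear (fun z => (FK n X).loc σ x z +
            wed (fderiv ℝ (inCh n h x) z) (fderiv ℝ (inCh n G x) z)) y :=
          h1.add ((smoothNear_comp_symm hy (H.smoothNearX _)).fderiv.wedge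
            (smoothNear_comp_symm hy hG).fderiv)
        refine ContinuousAt.congr ?_ (Filter.EventuallyEq.symm (hρloc x y hy G hG hΘG))
        exact ((h2.pfaffian (bE n)).continuousAt.sub (h1.pfaffian (bE n)).continuousAt).div
          (h1.pfaffian (bE n)).continuousAt ((H.pf_loc_ne_zero_iff hy).2 hyZ)
      obtain ⟨e, he⟩ : ∃ e : ℝ, ∀ᶠ z in 𝓝 y,
          (SignType.sign (ρ ((extChartAt (𝓡 (2 * n)) x).symm z)) : ℝ) = e := by
        rcases lt_or_gt_of_ne ((hO hyO).1.1 hyZ) with hlt | hgt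
        · refine ⟨-1, ?_⟩
          filter_upwards [hρs.eventually_lt_const hlt] with z hz
          rw [sign_neg hz]; simp
        · refine ⟨1, ?_⟩
          filter_upwards [hρs.eventually_const_lt hgt] with z hz
          rw [sign_pos hz]; simp
      have h1 := smoothNear_closed_add hy (H.smooth.smoothNear x hy) (H.closed x y hy)
        (H.smoothNearX _) (hO hyO).1.2 (hF e _ (H.h_pos hyZ))
      have h2 : ∀ᶠ z in 𝓝 y, (FK n X).loc τ x z = (FK n X).loc
          (fun x => σ x + (e * F (h x)) • wed (dX (2 * n) h x) (Θ x)) x z := by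
        filter_upwards [he] with z hz
        simp only [FieldKind.loc, τ]
        rw [hz]
      exact ⟨h1.1.congr h2, fun a b c => by rw [d3_congr h2, h1.2]⟩
    · have he : ∀ᶠ z in 𝓝 y, (FK n X).loc τ x z = (FK n X).loc σ x z := by
        have h1 : ∀ᶠ x' in 𝓝 ((extChartAt (𝓡 (2 * n)) x).symm y), ε < h x' :=
          H.smooth_h.continuous.continuousAt.eventually_const_lt (hout _ hyO)
        filter_upwards [eventually_symm hy h1] with z hz
        rw [FieldKind.loc, hτout _ hz.le, FieldKind.loc]
      exact ⟨(H.smooth.smoothNear x hy).congr he, fun a b c => by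
        rw [d3_congr he, H.closed x y hy]⟩
  let π₀ : X → Biv n := fun x => invB (bE n) (τ x)
  have hinv : ∀ x ∉ Z, Inv (τ x) (π₀ x) := fun x hx => inv_invB (bE n) (hτpf x hx)
  -- so its inverse is smooth and Poisson there
  have hπloc : ∀ x, ∀ y ∈ (extChartAt (𝓡 (2 * n)) x).target,
      (extChartAt (𝓡 (2 * n)) x).symm y ∉ Z → SmoothNear ((BK n X).loc π₀ x) y ∧
        JacobiAt ((BK n X).loc π₀ x) y := by
    intro x y hy hyZ
    obtain ⟨h1, h2⟩ := hloc x y hy hyZ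
    have hev : ∀ᶠ z in 𝓝 y, z ∈ (extChartAt (𝓡 (2 * n)) x).target ∧
        (extChartAt (𝓡 (2 * n)) x).symm z ∉ Z := by
      filter_upwards [target_mem_nhds hy,
        eventually_symm hy (H.isClosed.isOpen_compl.mem_nhds hyZ)] with z h3 h4 using ⟨h3, h4⟩
    have h3 : SmoothNear ((BK n X).loc π₀ x) y := by
      refine SmoothNear.congr (SmoothNear.smul (SmoothNear.inv (h1.pfaffian (bE n)) ?_)
        (h1.adj (bE n))) ?_
      · exact fun h0 => hτpf _ hyZ ((pf_loc_form_eq_zero hy).1 h0)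
      · filter_upwards [hev] with z hz
        exact loc_invB hz.1 (hτpf _ hz.2)
    refine ⟨h3, (jacobiAt_iff_closed h1.differentiableAt h3.differentiableAt ?_).2 h2⟩
    filter_upwards [hev] with z hz using inv_loc hz.1 (hinv _ hz.2)
  -- across the hypersurface the inverse extends smoothly
  have hZloc : ∀ x ∈ Z, ∃ p : Eu (2 * n) → Biv n, SmoothNear p (extChartAt (𝓡 (2 * n)) x x) ∧
      (∀ᶠ y in 𝓝 (extChartAt (𝓡 (2 * n)) x x), (extChartAt (𝓡 (2 * n)) x).symm y ∉ Z →
        (BK n X).loc π₀ x y = p y) ∧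
      pf (dualB (bE n)) (p (extChartAt (𝓡 (2 * n)) x x)) = 0 ∧
      fderiv ℝ (fun y => pf (dualB (bE n)) (p y)) (extChartAt (𝓡 (2 * n)) x x) ≠ 0 := by
    intro x hx
    have e' := (extChartAt (𝓡 (2 * n)) x).left_inv (mem_extChartAt_source (I := 𝓡 (2 * n)) x)
    obtain ⟨G, hG, hΘG, e, he, hse, p, hp, hpe, hp0, hpd⟩ := hsign x hx
    refine ⟨p, hp, ?_, hp0, hpd⟩
    have h1 := loc_add_smul_wed σ (fun x => (SignType.sign (ρ x) : ℝ) * F (h x))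
      (mem_extChartAt_target (I := 𝓡 (2 * n)) x) (H.smoothNearX _) (G := G) (Θ := Θ) (by rwa [e'])
      (by rwa [e'])
    have h2 : ∀ᶠ x' in 𝓝 x, h x' < ε / 2 := H.smooth_h.continuous.continuousAt.eventually_lt_const
      (by rw [(H.h_eq_zero x).2 hx]; positivity)
    filter_upwards [h1, hpe, eventually_inCh hse, eventually_inCh h2,
      extChartAt_target_mem_nhds (I := 𝓡 (2 * n)) x] with y a1 a2 a3 a4 a5 a6
    have a7 : (FK n X).loc τ x y = (FK n X).loc σ x y + (e * (2 * inCh n h x y)⁻¹) •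
        wed (fderiv ℝ (inCh n h x) y) (fderiv ℝ (inCh n G x) y) := by
      refine Eq.trans a1 ?_
      simp only [F]
      rw [a3 a6, step_eq_zero hε a4.le, sub_zero, one_mul]
      rfl
    rw [a2 ((H.pf_loc_ne_zero_iff a5).2 a6), ← a7]
    exact loc_invB a5 (hτpf _ a6)
  obtain ⟨π, hπ, hπeq⟩ := (BK n X).exists_smooth_of_extends (fun x hx => H.dense hx) (f := π₀) (by
    intro x
    by_cases hx : x ∈ Z
    · obtain ⟨p, h1, h2, -⟩ := hZloc x hx
      exact ⟨p, h1, h2⟩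
    · have e := (extChartAt (𝓡 (2 * n)) x).left_inv (mem_extChartAt_source (I := 𝓡 (2 * n)) x)
      exact ⟨_, (hπloc x _ (mem_extChartAt_target x) (by rwa [e])).1,
        Filter.Eventually.of_forall fun _ _ => rfl⟩)
  have hπZ : ∀ x ∈ Z, pf (dualB (bE n)) (π x) = 0 ∧
      fderiv ℝ (pfLoc π x) (extChartAt (𝓡 (2 * n)) x x) ≠ 0 := by
    intro x hx
    obtain ⟨p, h1, h2, h3, h4⟩ := hZloc x hx
    have h5 := hπ.eventually_loc_eq (fun x hx => H.dense hx) hπeq h1 h2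
    constructor
    · have h6 : pf (dualB (bE n)) ((BK n X).loc π x (extChartAt (𝓡 (2 * n)) x x)) = 0 := by
        rw [h5.self_of_nhds, h3]
      rwa [pf_loc_biv_eq_zero (mem_extChartAt_target x),
        (extChartAt (𝓡 (2 * n)) x).left_inv (mem_extChartAt_source x)] at h6
    · have h6 : pfLoc π x =ᶠ[𝓝 (extChartAt (𝓡 (2 * n)) x x)]
          fun y => pf (dualB (bE n)) (p y) := by
        filter_upwards [h5] with y hy
        rw [pfLoc, hy]
      rw [h6.fderiv_eq]
      exact h4
  refine ⟨π, hπ, fun x => ?_, fun x => ⟨fun h0 => ?_, fun hx => (hπZ x hx).1⟩,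
    fun x hx => (hπZ x hx).2, fun x hx => ?_⟩
  · have hy := mem_extChartAt_target (I := 𝓡 (2 * n)) x
    refine jacobiAt_of_dense (fun x hx => H.dense hx) hπ hy ?_
    filter_upwards [eventually_eventually_nhds.2 (target_mem_nhds hy)] with z hz hzZ α β γ
    have hz' := mem_of_mem_nhds hz
    have he : ∀ᶠ w in 𝓝 z, (BK n X).loc π x w = (BK n X).loc π₀ x w := by
      filter_upwards [eventually_symm hz' (H.isClosed.isOpen_compl.mem_nhds hzZ)] with w hw
      rw [FieldKind.loc, hπeq _ hw, FieldKind.loc]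
    have he' : ∀ β γ : Eu (2 * n) →L[ℝ] ℝ, fderiv ℝ (fun w => (BK n X).loc π x w ![β, γ]) z =
        fderiv ℝ (fun w => (BK n X).loc π₀ x w ![β, γ]) z := fun β γ =>
      Filter.EventuallyEq.fderiv_eq (he.mono fun w hw => by simp only [hw])
    rw [he', he', he', he.self_of_nhds]
    exact (hπloc x z hz' hzZ).2 α β γ
  · by_contra hx
    have h1 := (hinv x hx).pf_mul_pf (bE n)
    have hs := stdPf_pos n
    rw [← hπeq x hx, h0, mul_zero] at h1
    exact (mul_ne_zero (pow_ne_zero n (by norm_num : (-1 : ℝ) ≠ 0))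
      (by positivity : stdPf n ^ 2 ≠ 0)) h1.symm
  · have hxO : x ∉ O := fun h1 => hx (hO h1).2
    have hxZ : x ∉ Z := fun h1 => hxO (hZO h1)
    rw [hπeq x hxZ, ← hτout x (hout x hxO).le]
    exact hinv x hxZ

end FoldData

end Logs

/-! ### Closed one-forms -/

section OneForms

set_option linter.unusedSectionVars false

variable {V : Type*} [NormedAddCommGroup V] [NormedSpace ℝ V]

/-- An alternating one-form as a covector. -/
def covec (a : V [⋀^Fin 1]→L[ℝ] ℝ) : V →L[ℝ] ℝ :=
  (ContinuousAlternatingMap.ofSubsingleton ℝ V ℝ (0 : Fin 1)).symm a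

theorem covec_apply (a : V [⋀^Fin 1]→L[ℝ] ℝ) (v : V) : covec a v = a ![v] := by
  change a (fun _ => v) = _
  congr 1
  funext i; fin_cases i; rfl

theorem SmoothNear.covec [FiniteDimensional ℝ V] {W : Type*} [NormedAddCommGroup W]
    [NormedSpace ℝ W] {a : W → V [⋀^Fin 1]→L[ℝ] ℝ} {p : W} (ha : SmoothNear a p) :
    SmoothNear (fun y => covec (a y)) p := by
  have h : ContDiff ℝ ∞ fun b : V [⋀^Fin 1]→L[ℝ] ℝ => LogFolded.covec b := by
    refine contDiff_clm_apply_iff.2 fun v => ?_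
    simp only [covec_apply]
    exact (ContinuousAlternatingMap.apply ℝ V ℝ ![v]).contDiff
  filter_upwards [ha] with y hy using h.contDiffAt.comp y hy

/-- The derivative of a closed one-form is symmetric. -/
theorem fderiv_covec_symm [FiniteDimensional ℝ V] {a : V → V [⋀^Fin 1]→L[ℝ] ℝ} {y : V}
    (ha : SmoothNear a y) (hd : extDeriv a y = 0) (v w : V) :
    fderiv ℝ (fun y => covec (a y)) y v w = fderiv ℝ (fun y => covec (a y)) y w v := by
  have hda : DifferentiableAt ℝ a y := ha.differentiableAt
  have h1 : ∀ v w, fderiv ℝ (fun y => covec (a y)) y v w = fderiv ℝ a y v ![w] := by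
    intro v w
    have h2 := fderiv_clm_apply (ha.covec.differentiableAt) (differentiableAt_const (x := y) w)
    have h3 : fderiv ℝ (fun y => a y ![w]) y v = fderiv ℝ a y v ![w] := by
      have := ((ContinuousAlternatingMap.apply ℝ V ℝ ![w]).hasFDerivAt.comp y
        hda.hasFDerivAt).fderiv
      exact congrArg (fun L => L v) this
    rw [← h3]
    simp only [← covec_apply, h2]
    simp
  have h4 : extDeriv a y ![v, w] = 0 := by rw [hd]; rfl
  rw [extDeriv, ContinuousAlternatingMap.alternatizeUncurryFin_apply, Fin.sum_univ_two] at h4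
  have e0 : (0 : Fin 2).removeNth ![v, w] = ![w] := by funext i; fin_cases i; rfl
  have e1 : (1 : Fin 2).removeNth ![v, w] = ![v] := by funext i; fin_cases i; rfl
  rw [e0, e1] at h4
  simp at h4
  rw [h1, h1]
  linarith

variable {d : ℕ} {Z : Type*} [TopologicalSpace Z] [ChartedSpace (Eu d) Z] [IsManifold (𝓡 d) ∞ Z]

/-- The Poincaré lemma for one-forms on a manifold. -/
theorem exists_primitive_near {θ : DiffForm d Z 1} (hs : θ.IsSmooth) (hc : θ.IsClosed) (z : Z) :
    ∃ g : Z → ℝ, SmoothNearX d g z ∧ ∀ᶠ z' in 𝓝 z, dX d g z' = covec (θ z') := by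
  have hz := mem_extChartAt_target (I := 𝓡 d) z
  have hsrc := mem_extChartAt_source (I := 𝓡 d) z
  have hev : ∀ᶠ y in 𝓝 (extChartAt (𝓡 d) z z), SmoothNear (θ.inChart z) y ∧
      extDeriv (θ.inChart z) y = 0 := by
    filter_upwards [eventually_eventually_nhds.2 (target_mem_nhds hz)] with y hy
    refine ⟨?_, hc z y (mem_of_mem_nhds hy)⟩
    filter_upwards [eventually_eventually_nhds.2 hy] with y' hy'
    exact (hs z).contDiffAt hy'
  obtain ⟨Γ, hΓ, hd⟩ := exists_primitive hev.self_of_nhds.1.covec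
    (hev.mono fun y hy => fderiv_covec_symm hy.1 hy.2)
  have e : ∀ᶠ y in 𝓝 (extChartAt (𝓡 d) z z),
      Γ (extChartAt (𝓡 d) z ((extChartAt (𝓡 d) z).symm y)) = Γ y := by
    filter_upwards [target_mem_nhds hz] with y hy
    rw [(extChartAt (𝓡 d) z).right_inv hy]
  have hg : SmoothNearX d (fun z' => Γ (extChartAt (𝓡 d) z z')) z :=
    smoothNearX_of_chart hsrc (hΓ.congr e)
  refine ⟨_, hg, ?_⟩
  filter_upwards [hg, eventually_chart hsrc (eventually_eventually_nhds.2 e),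
    eventually_chart hsrc hd, source_mem_nhds hsrc] with z' h1 h2 h3 h4
  have h5 : (fun y => Γ (extChartAt (𝓡 d) z ((extChartAt (𝓡 d) z).symm y)))
    =ᶠ[𝓝 (extChartAt (𝓡 d) z z')] Γ := h2
  rw [dX_eq_fderiv_comp h4 h1, h5.fderiv_eq, h3.fderiv]
  ext v
  have ht := (extChartAt (𝓡 d) z).map_source h4
  rw [ContinuousLinearMap.comp_apply, covec_apply]
  refine Eq.trans ?_ (covec_apply (V := Eu d) (θ z') v).symm
  have h6 : θ.inChart z (extChartAt (𝓡 d) z z') ![chB z (extChartAt (𝓡 d) z z') v] =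
      θ ((extChartAt (𝓡 d) z).symm (extChartAt (𝓡 d) z z'))
        ![chA z (extChartAt (𝓡 d) z z') (chB z (extChartAt (𝓡 d) z z') v)] := by
    change θ _ (chA z _ ∘ ![_]) = _
    congr 1
    funext i; fin_cases i; rfl
  rw [h6, chA_chB ht, (extChartAt (𝓡 d) z).left_inv h4]
  rfl

end OneForms

/-! ### Transversality -/

section Transversality

set_option linter.unusedSectionVars false

variable {n : ℕ} {X : Type*} [TopologicalSpace X] [ChartedSpace (Eu (2 * n)) X]
  [IsManifold (𝓡 (2 * n)) ∞ X]

/-- Transversality of the top power may be tested on a basis. -/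
theorem fderiv_wedgePow_apply_ne_zero {V : Type*} [NormedAddCommGroup V] [NormedSpace ℝ V]
    [FiniteDimensional ℝ V] {W : Type*} [NormedAddCommGroup W] [NormedSpace ℝ W]
    (b : Module.Basis (Fin (2 * n)) ℝ V) {a : W → V [⋀^Fin 2]→L[ℝ] ℝ} {p : W}
    {v : Fin (2 * n) → V}
    (h : fderiv ℝ (fun y => wedgePow (a y).toAlternatingMap n v) p ≠ 0) :
    fderiv ℝ (fun y => pf b (a y)) p ≠ 0 := by
  intro h0
  apply h
  have : (fun y => wedgePow (a y).toAlternatingMap n v) = fun y => b.det v * pf b (a y) := by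
    funext y
    conv_lhs => rw [(wedgePow (a y).toAlternatingMap n).eq_smul_basis_det b]
    rw [AlternatingMap.smul_apply, smul_eq_mul, mul_comm]
    rfl
  have h1 := fderiv_const_smul_field (𝕜 := ℝ) (b.det v) (f := fun y => pf b (a y))
  rw [this]
  refine Eq.trans (congrFun h1 p) ?_
  simp [h0]

theorem DiffForm.topPowerTransverse_iff (σ : DiffForm (2 * n) X 2) :
    σ.TopPowerTransverse ↔ ∀ x, pf (bE n) (σ x) = 0 →
      fderiv ℝ (fun y => pf (bE n) ((FK n X).loc σ x y)) (extChartAt (𝓡 (2 * n)) x x) ≠ 0 := by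
  refine ⟨fun h x hx => ?_, fun h x hx => ⟨bE n, h x ((pf_eq_zero_iff _ _).2 hx)⟩⟩
  obtain ⟨v, hv⟩ := h x ((pf_eq_zero_iff _ _).1 hx)
  exact fderiv_wedgePow_apply_ne_zero (bE n) hv

theorem BivectorField.topPowerTransverse_iff (π : BivectorField (2 * n) X) :
    π.TopPowerTransverse ↔ ∀ x, pf (dualB (bE n)) (π x) = 0 →
      fderiv ℝ (pfLoc π x) (extChartAt (𝓡 (2 * n)) x x) ≠ 0 := by
  refine ⟨fun h x hx => ?_, fun h x hx => ⟨dualB (bE n), h x ((pf_eq_zero_iff _ _).2 hx)⟩⟩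
  obtain ⟨v, hv⟩ := h x ((pf_eq_zero_iff _ _).1 hx)
  exact fderiv_wedgePow_apply_ne_zero (dualB (bE n)) hv

theorem DiffForm.degeneracyLocus_eq_iff (σ : DiffForm (2 * n) X 2) (Z : Set X) :
    σ.degeneracyLocus = Z ↔ ∀ x, x ∈ Z ↔ pf (bE n) (σ x) = 0 := by
  rw [eq_comm, Set.ext_iff]
  exact forall_congr' fun x => iff_congr Iff.rfl
    (pf_eq_zero_iff (V := Eu (2 * n)) (bE n) (σ x)).symm

theorem BivectorField.degeneracyLocus_eq_iff (π : BivectorField (2 * n) X) (Z : Set X) :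
    π.degeneracyLocus = Z ↔ ∀ x, x ∈ Z ↔ pf (dualB (bE n)) (π x) = 0 := by
  rw [eq_comm, Set.ext_iff]
  exact forall_congr' fun x => iff_congr Iff.rfl
    (pf_eq_zero_iff (V := Eu (2 * n) →L[ℝ] ℝ) (dualB (bE n)) (π x)).symm

/-- In dimension `0` the Pfaffian is the constant `1`, so a two-form can only be degenerate in
positive dimension. -/
theorem pos_of_pf_eq_zero {V : Type*} [NormedAddCommGroup V] [NormedSpace ℝ V]
    [FiniteDimensional ℝ V] {b : Module.Basis (Fin (2 * n)) ℝ V} {a : V [⋀^Fin 2]→L[ℝ] ℝ}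
    (h : pf b a = 0) : 0 < n := by
  rcases Nat.eq_zero_or_pos n with rfl | hn
  · exact absurd h one_ne_zero
  · exact hn

variable {Z : Type*} [TopologicalSpace Z] [ChartedSpace (Eu (2 * n - 1)) Z]

/-- The restriction of a two-form to a submanifold, in the chart of the ambient manifold. -/
theorem pullback_apply (σ : DiffForm (2 * n) X 2) (ι : Z → X) (z : Z) (v w : Eu (2 * n - 1)) :
    (σ.pullback ι : DiffForm (2 * n - 1) Z 2) z ![v, w] =
      (FK n X).loc σ (ι z) (extChartAt (𝓡 (2 * n)) (ι z) (ι z))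
        ![tangentMap (2 * n - 1) (2 * n) ι z v, tangentMap (2 * n - 1) (2 * n) ι z w] := by
  have ht := mem_extChartAt_target (I := 𝓡 (2 * n)) (ι z)
  have h1 : (FK n X).loc σ (ι z) (extChartAt (𝓡 (2 * n)) (ι z) (ι z))
        ![tangentMap (2 * n - 1) (2 * n) ι z v, tangentMap (2 * n - 1) (2 * n) ι z w] =
      σ ((extChartAt (𝓡 (2 * n)) (ι z)).symm (extChartAt (𝓡 (2 * n)) (ι z) (ι z)))
        ![chA (ι z) (extChartAt (𝓡 (2 * n)) (ι z) (ι z)) (tangentMap (2 * n - 1) (2 * n) ι z v),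
          chA (ι z) (extChartAt (𝓡 (2 * n)) (ι z) (ι z))
            (tangentMap (2 * n - 1) (2 * n) ι z w)] := by
    change σ _ (chA (ι z) _ ∘ ![_, _]) = _
    congr 1
    funext i; fin_cases i <;> rfl
  rw [h1, tangentMap, ContinuousLinearMap.comp_apply, ContinuousLinearMap.comp_apply, chA_chB ht,
    chA_chB ht, (extChartAt (𝓡 (2 * n)) (ι z)).left_inv (mem_extChartAt_source _)]
  change σ (ι z) (dMap (2 * n - 1) (2 * n) ι z ∘ ![v, w]) = _
  congr 1
  funext i; fin_cases i <;> rfl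

theorem FoldData.eventually_pf_loc_eq_zero {σ : X → Form n} {Y : Set X} {h : X → ℝ}
    (H : FoldData σ Y h) {ι : Z → X}
    (hι : Manifold.IsSmoothEmbedding (𝓡 (2 * n - 1)) (𝓡 (2 * n)) ∞ ι) (hY : Set.range ι = Y)
    (z : Z) : ∀ᶠ z' in 𝓝 z,
      pf (bE n) ((FK n X).loc σ (ι z) (extChartAt (𝓡 (2 * n)) (ι z) (ι z'))) = 0 := by
  have h1 := hι.isEmbedding.continuous.continuousAt.eventually
    (source_mem_nhds (mem_extChartAt_source (I := 𝓡 (2 * n)) (ι z)))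
  filter_upwards [h1] with z' hz'
  by_contra h0
  have h2 := (H.pf_loc_ne_zero_iff ((extChartAt (𝓡 (2 * n)) (ι z)).map_source hz')).1 h0
  rw [(extChartAt (𝓡 (2 * n)) (ι z)).left_inv hz', ← hY] at h2
  exact h2 ⟨z', rfl⟩

end Transversality

/-! ### Passing between log-symplectic and folded-symplectic structures -/

section Main

variable {n : ℕ} {X : Type*} [TopologicalSpace X] [T2Space X] [CompactSpace X]
  [ChartedSpace (EuclideanSpace ℝ (Fin (2 * n))) X] [IsManifold (𝓡 (2 * n)) ∞ X]
  {Z : Type*} [TopologicalSpace Z] [ChartedSpace (EuclideanSpace ℝ (Fin (2 * n - 1))) Z]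
  [IsManifold (𝓡 (2 * n - 1)) ∞ Z] {ι : Z → X}

/-- The inverse of a log-symplectic structure can be smoothed near the degeneracy locus to a
folded-symplectic form. -/
theorem IsLogSymplectic.exists_isFoldedSymplectic
    (hι : Manifold.IsSmoothEmbedding (𝓡 (2 * n - 1)) (𝓡 (2 * n)) ∞ ι)
    {π : BivectorField (2 * n) X} (hπ : IsLogSymplectic ι π) {U : Set X}
    (hU : U ∈ 𝓝ˢ (Set.range ι)) :
    ∃ σ : DiffForm (2 * n) X 2, IsFoldedSymplectic ι σ ∧ ∀ x ∉ U, IsInverseAt σ π x := by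
  have hsm := (isSmooth_biv_iff π).1 hπ.poisson.smooth
  have hmem := (π.degeneracyLocus_eq_iff _).1 hπ.locus
  have htr := π.topPowerTransverse_iff.1 hπ.transverse
  obtain ⟨h, hh, hnn, hh0, hsq⟩ := exists_squareDefining_biv hsm
  have H : LogData (n := n) (X := X) π (Set.range ι) h :=
    { smooth := hsm
      jacobi := fun x y hy => hπ.poisson.jacobiAt x hy
      mem_iff := hmem
      smooth_h := hh
      nonneg := hnn
      h_eq_zero := fun x => (hh0 x).trans (hmem x).symm
      square := fun x hx => hsq x ((hmem x).1 hx) (htr x ((hmem x).1 hx)) }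
  obtain ⟨Θ, hΘ⟩ := H.exists_residue hι rfl
  obtain ⟨h₁, H₁⟩ := H.exists_normalizedData hΘ
  obtain ⟨σ, hσ, hcl, hσ0, hσtr, hrk, hout⟩ := H₁.exists_folded hU
  refine ⟨σ, ⟨(isSmooth_form_iff σ).2 hσ, (isClosed_iff σ).2 hcl,
    (DiffForm.topPowerTransverse_iff σ).2 fun x hx => hσtr x ((hσ0 x).1 hx),
    (DiffForm.degeneracyLocus_eq_iff σ _).2 fun x => (hσ0 x).symm, fun z => ?_⟩, fun x hx => ?_⟩
  -- the restriction to `T Z = ker ds` has maximal rank, as adding `ds ∧ θ` changes the Pfaffian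
  · have hz : ι z ∈ Set.range ι := ⟨z, rfl⟩
    have hn := pos_of_pf_eq_zero ((hmem _).1 hz)
    obtain ⟨θ, hθ⟩ := hrk _ hz
    obtain ⟨u, hu⟩ := H.square _ hz
    refine wedgePow_hyperplane_ne_zero (bE n)
      ((FK n X).loc σ (ι z) (extChartAt (𝓡 (2 * n)) (ι z) (ι z))).toAlternatingMap
      (wed (fderiv ℝ (pfLoc π (ι z)) (extChartAt (𝓡 (2 * n)) (ι z) (ι z))) θ).toAlternatingMap
      (fderiv ℝ (pfLoc π (ι z)) (extChartAt (𝓡 (2 * n)) (ι z) (ι z)) : Eu (2 * n) →ₗ[ℝ] ℝ)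
      (θ : Eu (2 * n) →ₗ[ℝ] ℝ) (fun x y => wed_apply _ _ ![x, y])
      (tangentMap (2 * n - 1) (2 * n) ι z) ?_ _ (fun v w => pullback_apply σ ι z v w) hθ
    exact fun w hw => exists_tangentMap_eq (by omega) (hι.isImmersion.isImmersionAt z) hu.smooth
      hu.regular (H.eventually_pfLoc_eq_zero hι rfl z) w hw
  · obtain ⟨h1, h2⟩ := hout x hx
    have h3 : Inv (σ x) (π x) := by
      rw [h2]
      exact inv_invF (bE n) fun h0 => h1 ((hmem x).2 h0)
    exact h3

/-- A folded-symplectic form, together with a closed one-form on the fold which is non-zero on the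
kernel of the restriction, can be made singular near the fold such that its inverse is a
log-symplectic structure. -/
theorem IsFoldedSymplectic.exists_isLogSymplectic
    (hι : Manifold.IsSmoothEmbedding (𝓡 (2 * n - 1)) (𝓡 (2 * n)) ∞ ι)
    {σ : DiffForm (2 * n) X 2} (hσ : IsFoldedSymplectic ι σ) {θ : DiffForm (2 * n - 1) Z 1}
    (hθ : θ.IsSmooth) (hθc : θ.IsClosed)
    (hne : ∀ z : Z, wedge (θ z).toAlternatingMap
      (wedgePow ((σ.pullback ι : DiffForm (2 * n - 1) Z 2) z).toAlternatingMap (n - 1)) ≠ 0)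
    {U : Set X} (hU : U ∈ 𝓝ˢ (Set.range ι)) :
    ∃ π : BivectorField (2 * n) X, IsLogSymplectic ι π ∧ ∀ x ∉ U, IsInverseAt σ π x := by
  have hsm := (isSmooth_form_iff σ).1 hσ.smooth
  have hmem := (σ.degeneracyLocus_eq_iff _).1 hσ.locus
  have htr := σ.topPowerTransverse_iff.1 hσ.transverse
  obtain ⟨h, hh, hnn, hh0, hsq⟩ := exists_squareDefining_form hsm
  have H : FoldData (n := n) (X := X) σ (Set.range ι) h :=
    { smooth := hsm
      closed := (isClosed_iff σ).1 hσ.closed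
      mem_iff := hmem
      smooth_h := hh
      nonneg := hnn
      h_eq_zero := fun x => (hh0 x).trans (hmem x).symm
      square := fun x hx => hsq x ((hmem x).1 hx) (htr x ((hmem x).1 hx)) }
  -- extend `θ` to a covector field `Θ` which is locally exact near the hypersurface
  choose g hg hgθ using fun z => exists_primitive_near hθ hθc z
  choose ρ hρ hρι using fun z => exists_local_retraction (hι.isImmersion.isImmersionAt z)
  obtain ⟨Θ, hΘ⟩ := exists_extension_of_primitives hι.isEmbedding H.isClosed ρ hρ hρι g hg
    fun z => by
      filter_upwards [hgθ z] with z' hz'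
      rw [hz', (hgθ z').self_of_nhds]
  obtain ⟨π, hπ, hJ, hπ0, hπtr, hinv⟩ := H.exists_log (Θ := Θ) (by
    rintro _ ⟨z, rfl⟩
    obtain ⟨G, hG, hΘG, he⟩ := hΘ z
    refine ⟨G, hG, hΘG, ?_⟩
    have hz : ι z ∈ Set.range ι := ⟨z, rfl⟩
    have hn := pos_of_pf_eq_zero ((hmem _).1 hz)
    obtain ⟨u, hu⟩ := H.square _ hz
    have him := hι.isImmersion.isImmersionAt z
    have hs0 := H.eventually_pf_loc_eq_zero hι rfl z
    -- the differential of `G` restricts to `θ` on the hypersurface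
    have hGθ : ∀ w : Eu (2 * n - 1), fderiv ℝ (inCh n G (ι z))
        (extChartAt (𝓡 (2 * n)) (ι z) (ι z)) (tangentMap (2 * n - 1) (2 * n) ι z w) =
        (θ z).toAlternatingMap ![w] := fun w => by
      have h1 := dX_comp_eq him.contMDiffAt hG.contMDiffAt
      rw [dX_congr he, (hgθ z).self_of_nhds] at h1
      exact (congrArg (fun L => L w) h1).symm.trans (covec_apply (V := Eu (2 * n - 1)) (θ z) w)
    -- the hypothesis means that the restriction of `σ` is non-degenerate on `ker θ`, so that
    -- adding `ds ∧ dG` to `σ` makes it non-degenerate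
    have hne' : ∀ (θz : Eu (2 * n - 1) [⋀^Fin 1]→L[ℝ] ℝ) (a : Eu (2 * n - 1) [⋀^Fin 2]→L[ℝ] ℝ),
        wedge θz.toAlternatingMap (wedgePow a.toAlternatingMap (n - 1)) ≠ 0 →
        (∃ w, θz ![w] ≠ 0) ∧
          ∀ w, θz ![w] = 0 → (∀ w', θz ![w'] = 0 → a ![w, w'] = 0) → w = 0 := fun θz a =>
      wedge_one_wedgePow_ne_zero (by rw [finrank_euclideanSpace_fin]; omega) _ _
    obtain ⟨h1, h2⟩ := hne' (θ z) ((σ.pullback ι : DiffForm (2 * n - 1) Z 2) z) (hne z)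
    refine (pf_ne_zero_iff (bE n) _).2 (nondeg_add_of_hyperplane
      ((FK n X).loc σ (ι z) (extChartAt (𝓡 (2 * n)) (ι z) (ι z))).toAlternatingMap
      (wed _ _).toAlternatingMap (fderiv ℝ (fun y => pf (bE n) ((FK n X).loc σ (ι z) y))
        (extChartAt (𝓡 (2 * n)) (ι z) (ι z)) : Eu (2 * n) →ₗ[ℝ] ℝ)
      (fderiv ℝ (inCh n G (ι z)) (extChartAt (𝓡 (2 * n)) (ι z) (ι z)) : Eu (2 * n) →ₗ[ℝ] ℝ)
      (fun x y => wed_apply _ _ ![x, y]) (tangentMap (2 * n - 1) (2 * n) ι z)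
      (exists_apply_ne_zero hu.regular)
      (fun w hw => exists_tangentMap_eq (by omega) him hu.smooth hu.regular hs0 w hw)
      (map_zero _) (fun w => fderiv_tangentMap_eq_zero him hu.smooth hs0 w) ?_ ?_ ?_)
    · obtain ⟨w, hw⟩ := h1
      exact ⟨w, fun h0 => hw ((hGθ w).symm.trans h0)⟩
    · refine fun w hw hw' => h2 w ((hGθ w).symm.trans hw) fun w' h3 => ?_
      exact (pullback_apply σ ι z w w').trans (hw' w' ((hGθ w').trans h3))
    · rw [← pf_ne_zero_iff (bE n)]
      exact not_not.2 hu.zero) hU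
  exact ⟨π, ⟨isPoisson_of_jacobiAt hπ hJ,
    (BivectorField.topPowerTransverse_iff π).2 fun x hx => hπtr x ((hπ0 x).1 hx),
    (BivectorField.degeneracyLocus_eq_iff π _).2 fun x => (hπ0 x).symm⟩, hinv⟩

end Main

end LogFolded

end

theorem mainTheorem11 {n : ℕ}
    {X : Type*} [TopologicalSpace X] [T2Space X] [CompactSpace X]
    [ChartedSpace (EuclideanSpace ℝ (Fin (2 * n))) X] [IsManifold (𝓡 (2 * n)) ∞ X]
    {Z : Type*} [TopologicalSpace Z]
    [ChartedSpace (EuclideanSpace ℝ (Fin (2 * n - 1))) Z] [IsManifold (𝓡 (2 * n - 1)) ∞ Z]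
    (ι : Z → X) (hι : Manifold.IsSmoothEmbedding (𝓡 (2 * n - 1)) (𝓡 (2 * n)) ∞ ι) :
    (∀ π : LogFolded.BivectorField (2 * n) X, LogFolded.IsLogSymplectic ι π →
      ∀ U ∈ 𝓝ˢ (Set.range ι), ∃ σ : LogFolded.DiffForm (2 * n) X 2,
        LogFolded.IsFoldedSymplectic ι σ ∧ ∀ x ∉ U, LogFolded.IsInverseAt σ π x) ∧
    (∀ σ : LogFolded.DiffForm (2 * n) X 2, LogFolded.IsFoldedSymplectic ι σ →
      ∀ θ : LogFolded.DiffForm (2 * n - 1) Z 1, θ.IsSmooth → θ.IsClosed →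
      (∀ z : Z, LogFolded.wedge (θ z).toAlternatingMap
        (LogFolded.wedgePow ((σ.pullback ι : LogFolded.DiffForm (2 * n - 1) Z 2) z).toAlternatingMap
          (n - 1)) ≠ 0) →
      ∀ U ∈ 𝓝ˢ (Set.range ι), ∃ π : LogFolded.BivectorField (2 * n) X,
        LogFolded.IsLogSymplectic ι π ∧ ∀ x ∉ U, LogFolded.IsInverseAt σ π x) :=
  ⟨fun _ hπ _ hU => hπ.exists_isFoldedSymplectic hι hU,
    fun _ hσ _ hθ hθc hne _ hU => hσ.exists_isLogSymplectic hι hθ hθc hne hU⟩
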